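/- **Theorem.** Let $R>0$ and $L\ge 2R$. For $d\ge 1$ let $\mathcal G_{2,d}$ be the set of distributions $\Gamma=w_1\delta_{\mu_1}+w_2\delta_{\mu_2}$ on $\mathbb R^d$ with $w_1,w_2\ge 0$, $w_1+w_2=1$, $\|\mu_i\|_2\le R$; let $P_\Gamma=\Gamma*N(0,I_d)$, and let $H(P,Q)=\big(\int(\sqrt{p}-\sqrt{q})^2\big)^{1/2}$ be the Hellinger distance. Let $X_1,\dots,X_{2n}$ be i.i.d. from $P_\Gamma$, $n\ge 1$. *Estimator.* From the first half of the sample compute $\hat\mu=\frac1n\sum_{i\le n}X_i$ and $S=\frac1n\sum_{i\le n}(X_i-\hat\mu)(X_i-\hat\mu)^\top-I_d$, and let $\hat u$ be a unit top eigenvector of $S$ (any measurable choice). Put $x_i=\langle\hat u,X_{n+i}-\hat\mu\rangle$, $i\le n$, and apply to $x_1,\dots,x_n$ the one-dimensional denoised method of moments (DMM) on $[-L,L]$: estimate the moments of order $r=1,2,3$ by $\tilde m_r$, a median over $T$ disjoint consecutive batches of $\lfloor n/T\rfloor$ samples of the batch averages of $H_r(x_i)$, with $H_r$ the degree-$r$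 (probabilists') Hermite polynomial (so for $T=1$, $\tilde m_r=\frac1n\sum_i H_r(x_i)$); project $(\tilde m_1,\tilde m_2,\tilde m_3)$ in Euclidean norm onto the set of vectors of the first three moments of probability distributions on $[-L,L]$; and let $\hat\gamma=\hat w_1\delta_{\hat\theta_1}+\hat w_2\delta_{\hat\theta_2}$ be the 2-atomic distribution on $[-L,L]$ with the projected moments. Finally $\hat\Gamma=\sum_{j=1}^2\hat w_j\delta_{\hat\theta_j\hat u+\hat\mu}$. More generally, for $\tau\ge 0$ the steps may be executed up to tolerance $\tau$: $\hat u$ is a unit vector with $\|S\hat u-\ell\hat u\|_2\le\tau(\ell+1)$, where $\ell$ is the largest eigenvalue of $S$, and $\hat\gamma$ is a 2-atomic distribution on $[-L,L]$ whose vector of the first three moments has a distance to $\tilde m$ that exceeds the minimum by at most $\tau$; $\tau=0$ is the exact estimator. 1. *Existence.* For all $d,n,T\ge1$ the exact estimator exists. 2. *Rate.* There is a constant $C$ depending only on $R$ and $L$ such that for all $d,n\ge 1$, all $\delta\in(0,1)$, all $\tau\in[0,n^{-1/2}]$ and all $\Gamma\in\mathcal G_{2,d}$, every such estimator satisfies,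 with probability at least $1-\delta$, $$H(P_\Gamma,P_{\hat\Gamma})\le C\sqrt{\frac{d+\log(1/\delta)}{n}},$$ provided that either $T=\min(n,\lceil\log(1/\delta)\rceil)$, or $T=1$ (plain averages) and $\delta\ge e^{-\sqrt n}$. 3. *Optimality.* There is $c>0$ depending only on $R$ such that for all $d,n\ge 1$ and every estimator $\hat P$ of the distribution $P_\Gamma$ based on $X_1,\dots,X_{2n}$, some $\Gamma\in\mathcal G_{2,d}$ satisfies $H(P_\Gamma,\hat P)\ge c\,\min(\sqrt{d/n},1)$ with probability at least $1/4$. 4. *Polynomial time.* There are a program $p$, using the operations $+,-,\times,/,\sqrt{\cdot}$ and comparisons of real numbers and arithmetic on array indices at unit cost, and a constant $K$, both depending only on $R$ and $L$, such that for all $d,n\ge 1$ and $1\le T\le n$, on input $X_1,\dots,X_{2n}$ the program stops after at most $K(nd)^K$ steps and outputs the weights and atoms of $\hat\Gamma$ for an estimator as above with tolerance $\tau=n^{-1/2}$. -/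

import Mathlib

open MeasureTheory ProbabilityTheory
open scoped ENNReal

noncomputable section

namespace GaussianMixture

/-- `d`-dimensional Euclidean space. -/
abbrev E (d : ℕ) : Type := EuclideanSpace ℝ (Fin d)

/-! ### Gaussian mixtures and the Hellinger distance -/

/-- The discrete measure with weights `w j` and atoms `μ j`. -/
def atomic {k : ℕ} {α : Type*} [MeasurableSpace α] (w : Fin k → ℝ) (μ : Fin k → α) : Measure α :=
  ∑ j, ENNReal.ofReal (w j) • Measure.dirac (μ j)

/-- Mixing distributions with at most `k` atoms, all in the closed ball of radius `R` of `ℝ^d`. -/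
def mixingClass (k d : ℕ) (R : ℝ) : Set (Measure (E d)) :=
  {Γ | ∃ (w : Fin k → ℝ) (μ : Fin k → E d),
    (∀ j, 0 ≤ w j) ∧ ∑ j, w j = 1 ∧ (∀ j, ‖μ j‖ ≤ R) ∧ Γ = atomic w μ}

/-- The Gaussian mixture `Γ * N(0, I_d)`. -/
def mixture {d : ℕ} (Γ : Measure (E d)) : Measure (E d) :=
  Measure.conv Γ (stdGaussian (E d))

/-- The Hellinger distance `(∫ (√p - √q)²)^{1/2}`, with densities taken with respect to the
dominating measure `P + Q`. -/
def hellinger {α : Type*} [MeasurableSpace α] (P Q : Measure α) : ℝ :=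
  √(∫ x, (√(P.rnDeriv (P + Q) x).toReal - √(Q.rnDeriv (P + Q) x).toReal) ^ 2 ∂(P + Q))

/-- The law of `m` independent observations from `P_Γ`. -/
def sampleLaw {d : ℕ} (m : ℕ) (Γ : Measure (E d)) : Measure (Fin m → E d) :=
  Measure.pi fun _ => mixture Γ

/-! ### The one-dimensional denoised method of moments -/

/-- `v` is a median of the finite family `x`. -/
def IsMedian {T : ℕ} (x : Fin T → ℝ) (v : ℝ) : Prop :=
  T ≤ 2 * (Finset.univ.filter fun j => x j ≤ v).card ∧
    T ≤ 2 * (Finset.univ.filter fun j => v ≤ x j).card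

/-- The average over the `j`-th of `T` consecutive batches of `⌊n / T⌋` samples of the degree-`r`
(probabilists') Hermite polynomial. For `T = 1` this is the average over all `n` samples. -/
def batchMoment {n : ℕ} (T : ℕ) (y : Fin n → ℝ) (r : ℕ) (j : Fin T) : ℝ :=
  (∑ i ∈ Finset.univ.filter fun i : Fin n => (j : ℕ) * (n / T) ≤ (i : ℕ) ∧ (i : ℕ) < ((j : ℕ) + 1) * (n / T),
    Polynomial.aeval (y i) (Polynomial.hermite r)) / ((n / T : ℕ) : ℝ)

/-- The Euclidean distance between a vector `m = (m_1, …, m_p)` and the vector of the first `p`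
moments of `π`. -/
def momentDist {p : ℕ} (m : Fin p → ℝ) (π : Measure ℝ) : ℝ :=
  √(∑ r : Fin p, (m r - ∫ x, x ^ ((r : ℕ) + 1) ∂π) ^ 2)

/-- `∑ j, w j δ_{θ j}` is an output, up to the tolerance `τ`, of the `k`-component denoised method
of moments on the interval `[-L, L]` applied to `y`: the first `2k - 1` moments are estimated by
`m`, the median over `T` batches of the unbiased estimates (the plain average when `T = 1`), and
the output is a `k`-atomic distribution on `[-L, L]` whose moment vector is, up to `τ`, at minimal
distance from `m` among those of all probability distributions on `[-L, L]`. For `τ = 0` its moment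
vector is exactly the projection of `m` onto the moment space, as delivered by Gauss quadrature. -/
def IsDMM (k : ℕ) (L : ℝ) (T : ℕ) (τ : ℝ) {n : ℕ} (y : Fin n → ℝ) (w θ : Fin k → ℝ) : Prop :=
  (∀ j, 0 ≤ w j) ∧ ∑ j, w j = 1 ∧ (∀ j, θ j ∈ Set.Icc (-L) L) ∧
    ∃ m : Fin (2 * k - 1) → ℝ, (∀ r : Fin (2 * k - 1), IsMedian (batchMoment T y ((r : ℕ) + 1)) (m r)) ∧
      ∀ π : Measure ℝ, IsProbabilityMeasure π → π (Set.Icc (-L) L)ᶜ = 0 →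
        momentDist m (atomic w θ) ≤ momentDist m π + τ

/-! ### Centering, principal component, and the full estimator -/

def sampleMean {d n : ℕ} (X : Fin n → E d) : E d := (n : ℝ)⁻¹ • ∑ i, X i

/-- `S = (1/n) ∑ (X_i - μ̂)(X_i - μ̂)ᵀ - I_d`. -/
def sampleCov {d n : ℕ} (X : Fin n → E d) : Matrix (Fin d) (Fin d) ℝ :=
  (n : ℝ)⁻¹ • (∑ i, Matrix.vecMulVec (X i - sampleMean X).ofLp (X i - sampleMean X).ofLp) - 1

/-- `u` is a unit top eigenvector of `S` up to the tolerance `τ`, relative to the top eigenvalue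
`ℓ + 1` of `S + I`. For `τ = 0` this is an exact unit eigenvector for the largest eigenvalue. -/
def IsTopEigenvector {d : ℕ} (S : Matrix (Fin d) (Fin d) ℝ) (τ : ℝ) (u : E d) : Prop :=
  ‖u‖ = 1 ∧ ∃ ℓ : ℝ,
    IsGreatest {a : ℝ | Module.End.HasEigenvalue (Matrix.toEuclideanLin S) a} ℓ ∧
      ‖Matrix.toEuclideanLin S u - ℓ • u‖ ≤ τ * (ℓ + 1)

def firstHalf {n : ℕ} {α : Type*} (X : Fin (n + n) → α) : Fin n → α := fun i => X (Fin.castAdd n i)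

def secondHalf {n : ℕ} {α : Type*} (X : Fin (n + n) → α) : Fin n → α := fun i => X (Fin.natAdd n i)

/-- `Γhat`, a map from `2n` observations to distributions on `ℝ^d`, is the centered 2-component
estimator: a top eigenvector `u` of the sample covariance is chosen from the first half by a
measurable rule, the second half is centered by the sample mean `μ̂` of the first half and projected
onto `u`, the one-dimensional method is applied, and its output `∑ w_j δ_{θ_j}` is mapped back to
`∑ w_j δ_{θ_j u + μ̂}`. -/
def IsCenteredEstimator {d n : ℕ} (L : ℝ) (T : ℕ) (τ : ℝ)
    (Γhat : (Fin (n + n) → E d) → Measure (E d)) : Prop :=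
  ∃ u : (Fin n → E d) → E d, Measurable u ∧ (∀ x, IsTopEigenvector (sampleCov x) τ (u x)) ∧
    ∀ X, ∃ w θ : Fin 2 → ℝ,
      IsDMM 2 L T τ
        (fun i => inner ℝ (u (firstHalf X)) (secondHalf X i - sampleMean (firstHalf X))) w θ ∧
      Γhat X = atomic w fun j => θ j • u (firstHalf X) + sampleMean (firstHalf X)

/-! ### Running time: structured programs over the reals

Memory consists of arrays of real numbers. The basic operations are `+, -, *, /, √`, comparison of
two reals, and arithmetic on array indices, each at unit cost; loops have a number of iterations
fixed by the input sizes and the enclosing loop counters. -/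

/-- Index expressions; `var i` is the `i`-th input size or loop counter. -/
inductive IdxExpr : Type
  | const (c : ℕ)
  | var (i : ℕ)
  | add (a b : IdxExpr)
  | mul (a b : IdxExpr)
  | div (a b : IdxExpr)

def IdxExpr.eval (ρ : ℕ → ℕ) : IdxExpr → ℕ
  | .const c => c
  | .var i => ρ i
  | .add a b => a.eval ρ + b.eval ρ
  | .mul a b => a.eval ρ * b.eval ρ
  | .div a b => a.eval ρ / b.eval ρ

def IdxExpr.cost : IdxExpr → ℕ
  | .const _ => 1
  | .var _ => 1
  | .add a b => a.cost + b.cost + 1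
  | .mul a b => a.cost + b.cost + 1
  | .div a b => a.cost + b.cost + 1

/-- `M a i` is the entry of index `i` of the array `a`. -/
abbrev Memory : Type := ℕ → ℕ → ℝ

/-- Real expressions; `read a i` reads an array entry, `cast i` is an index as a real number. -/
inductive RealExpr : Type
  | const (c : ℝ)
  | read (a : ℕ) (i : IdxExpr)
  | cast (i : IdxExpr)
  | add (x y : RealExpr)
  | sub (x y : RealExpr)
  | mul (x y : RealExpr)
  | div (x y : RealExpr)
  | sqrt (x : RealExpr)

def RealExpr.eval (ρ : ℕ → ℕ) (M : Memory) : RealExpr → ℝ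
  | .const c => c
  | .read a i => M a (i.eval ρ)
  | .cast i => (i.eval ρ : ℝ)
  | .add x y => x.eval ρ M + y.eval ρ M
  | .sub x y => x.eval ρ M - y.eval ρ M
  | .mul x y => x.eval ρ M * y.eval ρ M
  | .div x y => x.eval ρ M / y.eval ρ M
  | .sqrt x => √(x.eval ρ M)

def RealExpr.cost : RealExpr → ℕ
  | .const _ => 1
  | .read _ i => i.cost + 1
  | .cast i => i.cost + 1
  | .add x y => x.cost + y.cost + 1
  | .sub x y => x.cost + y.cost + 1
  | .mul x y => x.cost + y.cost + 1
  | .div x y => x.cost + y.cost + 1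
  | .sqrt x => x.cost + 1

/-- Programs: assignment to an array entry, sequencing, branching on `x ≤ y`, and
`for v in 0, …, bound - 1`. -/
inductive Prog : Type
  | skip
  | assign (a : ℕ) (i : IdxExpr) (x : RealExpr)
  | seq (p q : Prog)
  | ifLe (x y : RealExpr) (p q : Prog)
  | loop (v : ℕ) (bound : IdxExpr) (body : Prog)

open Classical in
/-- The final memory and the number of steps of a run. -/
def Prog.run : Prog → (ℕ → ℕ) → Memory → Memory × ℕ
  | .skip, _, M => (M, 1)
  | .assign a i x, ρ, M =>
      (Function.update M a (Function.update (M a) (i.eval ρ) (x.eval ρ M)), i.cost + x.cost + 1)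
  | .seq p q, ρ, M =>
      ((q.run ρ (p.run ρ M).1).1, (p.run ρ M).2 + (q.run ρ (p.run ρ M).1).2)
  | .ifLe x y p q, ρ, M =>
      if x.eval ρ M ≤ y.eval ρ M then ((p.run ρ M).1, x.cost + y.cost + 1 + (p.run ρ M).2)
      else ((q.run ρ M).1, x.cost + y.cost + 1 + (q.run ρ M).2)
  | .loop v bound body, ρ, M =>
      (List.range (bound.eval ρ)).foldl
        (fun s j => ((body.run (Function.update ρ v j) s.1).1,
          s.2 + (body.run (Function.update ρ v j) s.1).2 + 1))
        (M, bound.cost + 1)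

/-- The input sizes: `var 0, var 1, var 2` are `d, n, T`. -/
def sizes (d n T : ℕ) : ℕ → ℕ
  | 0 => d
  | 1 => n
  | 2 => T
  | _ => 0

/-- The data in array `0`, row by row (`X i c` at index `i * d + c`); all else is zero. -/
def inputMemory {d m : ℕ} (X : Fin m → E d) : Memory := fun a l =>
  if h : a = 0 ∧ l < m * d then
    X ⟨l / d, Nat.div_lt_of_lt_mul (by rw [Nat.mul_comm]; exact h.2)⟩
      ⟨l % d, Nat.mod_lt _ (Nat.pos_of_ne_zero fun h0 => by simp [h0] at h)⟩
  else 0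

/-- The two-atomic distribution stored in a memory: weights in array `1`, atoms in array `2`. -/
def outputMeasure (d : ℕ) (M : Memory) : Measure (E d) :=
  atomic (fun j : Fin 2 => M 1 (j : ℕ)) fun j => WithLp.toLp 2 fun c : Fin d => M 2 ((j : ℕ) * d + (c : ℕ))

end GaussianMixture

end

noncomputable section

namespace GaussianMixture

/-! The upper bound rests on one Hilbert space computation. If a mixing distribution is centred at
the origin, Jensen's inequality bounds the density of its mixture relative to N(0, I) below by a
positive constant (`exp_le_sum_shiftDensity`). So, after a translation, the squared Hellinger
distance is at most a constant times the squared L²(N(0, I)) distance of the densities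
(`hellinger_sq_mixture_le`). Densities of shifted Gaussians have inner product exp⟨z, y⟩, so this
distance is an explicit quadratic form in the weights and atoms.

Write v = μ₀ - μ₁. Three errors enter the form (`hellinger_le_of_estimates`). Replacing the centred
atoms by their projections onto the line of û costs w₀w₁‖v‖‖v - ⟨û, v⟩û‖ (`direction_error`). An
error in the mean costs its norm (`perp_shift_error`). On the line, the difference of two two-atomic
distributions has power sums that satisfy a recurrence of order four, so the first three moments
control all moments and with them the form (`line_moment_error`). The errors are measured in the
mixture and not in its parameters: nothing degenerates when the atoms merge or a weight vanishes,
and no separation is needed.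

The sample covariance minus I is close to w₀w₁vvᵀ. The angle between û and v cannot be controlled
when w₀w₁‖v‖² is small, but the product above can: comparing the components of the approximate
eigenvalue equation along û and orthogonally to it bounds the product without dividing by an
eigengap (`residual_le_of_isTopEigenvector`).

Mean and covariance are controlled in exponentially many directions by a net and a Bernstein bound
for functions of quadratic growth; the union bound is the source of the summand d. Given the first
half, û is fixed and only three averages of the second half matter. The median of batches is handled
by Chebyshev's inequality and a union bound over sets of bad batches, the plain average by a
truncated Chernoff bound; for cubic growth the latter works as long as log(1/δ) is at most √n.

The lower bound uses point masses only: 2^d well separated means in a ball of radius of order √(d/n)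
have samples that a second moment argument cannot tell apart (`not_disjoint_likely`).

The first three moments of a distribution on [-L, L] are those of a two-atomic one
(`exists_two_atomic`). Hence the moment projection minimizes a continuous function over a
three-parameter box: it exists by compactness, and a grid with O(n) steps per coordinate attains it
up to n^{-1/2}. The direction comes from a power of the covariance matrix of order n d, by a
convergence bound that needs no spectral gap (`norm_power_residual_le`). The program is built from
guarded sums stored in tables (`tab`), whose effect and cost are analysed once. -/

/-! ### Product densities and shifted Gaussians -/

theorem lintegral_pi_prod {ι : Type*} [Fintype ι] {α : ι → Type*} [∀ i, MeasurableSpace (α i)]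
    (μ : ∀ i, Measure (α i)) [∀ i, IsProbabilityMeasure (μ i)] (f : ∀ i, α i → ℝ≥0∞)
    (hf : ∀ i, Measurable (f i)) :
    ∫⁻ x, ∏ i, f i (x i) ∂Measure.pi μ = ∏ i, ∫⁻ x, f i x ∂μ i := by
  have h := iIndepFun_pi (μ := μ) (X := f) fun i => (hf i).aemeasurable
  rw [lintegral_prod_eq_prod_lintegral_of_indepFun Finset.univ
    (fun i (x : ∀ i, α i) => f i (x i)) h fun i => (hf i).comp (measurable_pi_apply i)]
  refine Finset.prod_congr rfl fun i _ => ?_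
  exact (measurePreserving_eval μ i).lintegral_comp (hf i)

/-- A product measure is determined by its values on boxes, and the indicator of a box is the
product of the indicators of its sides, so the integral factorizes. -/
theorem pi_withDensity {ι : Type*} [Fintype ι] {α : ι → Type*} [∀ i, MeasurableSpace (α i)]
    (μ : ∀ i, Measure (α i)) [∀ i, IsProbabilityMeasure (μ i)] (f : ∀ i, α i → ℝ≥0∞)
    (hf : ∀ i, Measurable (f i)) [∀ i, IsProbabilityMeasure ((μ i).withDensity (f i))] :
    Measure.pi (fun i => (μ i).withDensity (f i)) =
      (Measure.pi μ).withDensity fun x => ∏ i, f i (x i) := by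
  refine Measure.pi_eq fun s hs => ?_
  rw [withDensity_apply _ (MeasurableSet.univ_pi hs), ← lintegral_indicator (MeasurableSet.univ_pi hs)]
  have : (Set.univ.pi s).indicator (fun x => ∏ i, f i (x i)) =
      fun x => ∏ i, (s i).indicator (f i) (x i) := by
    ext x
    by_cases hx : x ∈ Set.univ.pi s
    · rw [Set.indicator_of_mem hx]
      exact Finset.prod_congr rfl fun i _ =>
        (Set.indicator_of_mem (hx i (Set.mem_univ i)) _).symm
    · rw [Set.indicator_of_notMem hx]
      simp only [Set.mem_univ_pi, not_forall] at hx
      obtain ⟨i, hi⟩ := hx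
      exact (Finset.prod_eq_zero (Finset.mem_univ i) (Set.indicator_of_notMem hi _)).symm
  rw [this, lintegral_pi_prod μ _ fun i => (hf i).indicator (hs i)]
  refine Finset.prod_congr rfl fun i _ => ?_
  rw [lintegral_indicator (hs i), withDensity_apply _ (hs i)]

theorem gaussianReal_eq_withDensity (z : ℝ) :
    gaussianReal z 1 = (gaussianReal 0 1).withDensity
      fun x => ENNReal.ofReal (Real.exp (z * x - z ^ 2 / 2)) := by
  rw [gaussianReal_of_var_ne_zero _ one_ne_zero, gaussianReal_of_var_ne_zero _ one_ne_zero,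
    ← withDensity_mul _ (measurable_gaussianPDF _ _) (by fun_prop)]
  congr 1
  ext x
  simp only [Pi.mul_apply, gaussianPDF, gaussianPDFReal]
  rw [← ENNReal.ofReal_mul (by positivity), mul_assoc _ (Real.exp _), ← Real.exp_add]
  congr 3
  simp
  ring

/-- The density of `N(z, I)` with respect to `N(0, I)`. -/
def shiftDensity {d : ℕ} (z x : E d) : ℝ := Real.exp (inner ℝ z x - ‖z‖ ^ 2 / 2)

theorem measurable_shiftDensity {d : ℕ} (z : E d) : Measurable (shiftDensity z) := by
  unfold shiftDensity; fun_prop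

theorem shiftDensity_pos {d : ℕ} (z x : E d) : 0 < shiftDensity z x := Real.exp_pos _

theorem pi_gaussianReal_map_toLp {d : ℕ} (z : E d) :
    (Measure.pi fun i => gaussianReal (z i) 1).map (WithLp.toLp 2) =
      (stdGaussian (E d)).map (z + ·) := by
  rw [← map_pi_eq_stdGaussian, Measure.map_map (by fun_prop) (by fun_prop)]
  have : (fun i => gaussianReal (z i) 1) = fun i => (gaussianReal 0 1).map (z i + ·) := by
    ext1 i
    rw [gaussianReal_map_const_add]; simp
  have hp : ∀ i, IsProbabilityMeasure ((gaussianReal 0 1).map (z i + ·)) := fun i =>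
    Measure.isProbabilityMeasure_map (by fun_prop)
  rw [this, ← Measure.pi_map_pi (X := fun _ => ℝ) (f := fun i x => z i + x)
      (fun i => Measurable.aemeasurable (by fun_prop)),
    Measure.map_map (by fun_prop) (by fun_prop)]
  congr 1

/-- The Cameron–Martin formula. The shifted Gaussian is a product of one-dimensional shifted
Gaussians, and the product of the one-dimensional densities collects the inner product and the norm
in the exponent. -/
theorem map_add_stdGaussian {d : ℕ} (z : E d) :
    (stdGaussian (E d)).map (z + ·) =
      (stdGaussian (E d)).withDensity fun x => ENNReal.ofReal (shiftDensity z x) := by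
  rw [← pi_gaussianReal_map_toLp]
  have h1 : (fun i => gaussianReal (z i) 1) = fun i => (gaussianReal 0 1).withDensity
      fun x => ENNReal.ofReal (Real.exp (z i * x - z i ^ 2 / 2)) := by
    ext1 i
    exact gaussianReal_eq_withDensity _
  have : ∀ i, IsProbabilityMeasure ((gaussianReal 0 1).withDensity
      fun x => ENNReal.ofReal (Real.exp (z i * x - z i ^ 2 / 2))) := by
    intro i; rw [← gaussianReal_eq_withDensity]; infer_instance
  rw [h1, pi_withDensity _ _ (by intro i; fun_prop), ← map_pi_eq_stdGaussian]
  ext s hs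
  rw [Measure.map_apply (by fun_prop) hs,
    withDensity_apply _ (hs.preimage (by fun_prop)), withDensity_apply _ hs,
    setLIntegral_map hs (measurable_shiftDensity z).ennreal_ofReal (by fun_prop)]
  refine lintegral_congr fun x => ?_
  rw [← ENNReal.ofReal_prod_of_nonneg fun i _ => (Real.exp_pos _).le, ← Real.exp_sum, shiftDensity,
    EuclideanSpace.real_norm_sq_eq, PiLp.inner_apply]
  congr 2
  simp only [Finset.sum_sub_distrib, Finset.sum_div]
  congr 1
  exact Finset.sum_congr rfl fun i _ => by simp [mul_comm]

theorem lintegral_shiftDensity {d : ℕ} (z : E d) :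
    ∫⁻ x, ENNReal.ofReal (shiftDensity z x) ∂stdGaussian (E d) = 1 := by
  have h := congrArg (fun μ => μ Set.univ) (map_add_stdGaussian z)
  simp only [withDensity_apply _ MeasurableSet.univ, Measure.restrict_univ] at h
  rw [← h]
  have : IsProbabilityMeasure ((stdGaussian (E d)).map (z + ·)) :=
    Measure.isProbabilityMeasure_map (by fun_prop)
  exact measure_univ

theorem integrable_shiftDensity {d : ℕ} (z : E d) :
    Integrable (shiftDensity z) (stdGaussian (E d)) := by
  refine ⟨(measurable_shiftDensity z).aestronglyMeasurable, ?_⟩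
  rw [hasFiniteIntegral_iff_ofReal (Filter.Eventually.of_forall fun x => (shiftDensity_pos z x).le),
    lintegral_shiftDensity]
  exact ENNReal.one_lt_top

theorem integral_shiftDensity {d : ℕ} (z : E d) : ∫ x, shiftDensity z x ∂stdGaussian (E d) = 1 := by
  rw [integral_eq_lintegral_of_nonneg_ae
    (Filter.Eventually.of_forall fun x => (shiftDensity_pos z x).le)
    (measurable_shiftDensity z).aestronglyMeasurable, lintegral_shiftDensity, ENNReal.toReal_one]

/-- The cross term of ‖z + y‖² is what remains in front. This identity turns all L² computations
with mixtures into sums of exponentials of inner products. -/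
theorem shiftDensity_mul {d : ℕ} (z y x : E d) :
    shiftDensity z x * shiftDensity y x = Real.exp (inner ℝ z y) * shiftDensity (z + y) x := by
  simp only [shiftDensity, ← Real.exp_add]
  congr 1
  rw [inner_add_left, norm_add_sq_real]
  ring

theorem integrable_shiftDensity_mul {d : ℕ} (z y : E d) :
    Integrable (fun x => shiftDensity z x * shiftDensity y x) (stdGaussian (E d)) := by
  simp only [shiftDensity_mul]
  exact (integrable_shiftDensity _).const_mul _

theorem integral_shiftDensity_mul {d : ℕ} (z y : E d) :
    ∫ x, shiftDensity z x * shiftDensity y x ∂stdGaussian (E d) = Real.exp (inner ℝ z y) := by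
  simp only [shiftDensity_mul]
  rw [integral_const_mul, integral_shiftDensity, mul_one]

/-- The squared `L²(N(0, I))` norm of the linear combination `∑ c_a p_{z_a}` of densities. -/
theorem integral_sq_sum_shiftDensity {d : ℕ} {ι : Type*} [Fintype ι] (c : ι → ℝ) (z : ι → E d) :
    ∫ x, (∑ a, c a * shiftDensity (z a) x) ^ 2 ∂stdGaussian (E d) =
      ∑ a, ∑ b, c a * c b * Real.exp (inner ℝ (z a) (z b)) := by
  have : ∀ x, (∑ a, c a * shiftDensity (z a) x) ^ 2 =
      ∑ a, ∑ b, c a * c b * (shiftDensity (z a) x * shiftDensity (z b) x) := by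
    intro x
    rw [sq, Finset.sum_mul_sum]
    exact Finset.sum_congr rfl fun a _ => Finset.sum_congr rfl fun b _ => by ring
  simp only [this]
  rw [integral_finsetSum _ fun a _ => integrable_finsetSum _ fun b _ =>
    (integrable_shiftDensity_mul _ _).const_mul _]
  refine Finset.sum_congr rfl fun a _ => ?_
  rw [integral_finsetSum _ fun b _ => (integrable_shiftDensity_mul _ _).const_mul _]
  refine Finset.sum_congr rfl fun b _ => ?_
  rw [integral_const_mul, integral_shiftDensity_mul]

theorem integrable_sq_sum_shiftDensity {d : ℕ} {ι : Type*} [Fintype ι] (c : ι → ℝ) (z : ι → E d) :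
    Integrable (fun x => (∑ a, c a * shiftDensity (z a) x) ^ 2) (stdGaussian (E d)) := by
  have : ∀ x, (∑ a, c a * shiftDensity (z a) x) ^ 2 =
      ∑ a, ∑ b, c a * c b * (shiftDensity (z a) x * shiftDensity (z b) x) := by
    intro x
    rw [sq, Finset.sum_mul_sum]
    exact Finset.sum_congr rfl fun a _ => Finset.sum_congr rfl fun b _ => by ring
  simp only [this]
  exact integrable_finsetSum _ fun a _ => integrable_finsetSum _ fun b _ =>
    (integrable_shiftDensity_mul _ _).const_mul _

theorem conv_atomic {d k : ℕ} (w : Fin k → ℝ) (μ : Fin k → E d) :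
    mixture (atomic w μ) = ∑ j, ENNReal.ofReal (w j) • (stdGaussian (E d)).map (μ j + ·) := by
  unfold mixture atomic
  ext s hs
  rw [Measure.conv, Measure.map_apply (by fun_prop) hs, Measure.prod_apply (hs.preimage (by fun_prop)),
    lintegral_finsetSum_measure, Measure.finsetSum_apply]
  refine Finset.sum_congr rfl fun j _ => ?_
  rw [lintegral_smul_measure, lintegral_dirac, Measure.smul_apply, Measure.map_apply (by fun_prop) hs]
  rfl

/-- The density of `mixture (atomic w μ)` with respect to `N(0, I)`. -/
theorem mixture_atomic_eq_withDensity {d k : ℕ} (w : Fin k → ℝ) (hw : ∀ j, 0 ≤ w j)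
    (μ : Fin k → E d) :
    mixture (atomic w μ) = (stdGaussian (E d)).withDensity
      fun x => ENNReal.ofReal (∑ j, w j * shiftDensity (μ j) x) := by
  rw [conv_atomic]
  simp only [map_add_stdGaussian]
  ext s hs
  rw [withDensity_apply _ hs, Measure.finsetSum_apply]
  simp only [ENNReal.ofReal_sum_of_nonneg fun j _ => mul_nonneg (hw j) (shiftDensity_pos (μ j) _).le,
    ENNReal.ofReal_mul (hw _)]
  rw [lintegral_finsetSum _ fun j _ =>
    ((measurable_shiftDensity _).ennreal_ofReal.const_mul _)]
  refine Finset.sum_congr rfl fun j _ => ?_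
  rw [lintegral_const_mul _ (measurable_shiftDensity _).ennreal_ofReal, Measure.smul_apply,
    withDensity_apply _ hs, smul_eq_mul]

theorem isProbabilityMeasure_atomic {k : ℕ} {α : Type*} [MeasurableSpace α] {w : Fin k → ℝ}
    (hw : ∀ j, 0 ≤ w j) (h1 : ∑ j, w j = 1) (μ : Fin k → α) :
    IsProbabilityMeasure (atomic w μ) := by
  refine ⟨?_⟩
  simp [atomic, Measure.finsetSum_apply, ← ENNReal.ofReal_sum_of_nonneg fun j _ => hw j, h1]

instance isProbabilityMeasure_mixture {d : ℕ} (Γ : Measure (E d)) [IsProbabilityMeasure Γ] :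
    IsProbabilityMeasure (mixture Γ) := by
  unfold mixture; infer_instance

theorem mixture_map_add {d : ℕ} (Γ : Measure (E d)) [IsProbabilityMeasure Γ] (a : E d) :
    mixture (Γ.map (a + ·)) = (mixture Γ).map (a + ·) := by
  unfold mixture
  rw [← Measure.dirac_conv, ← Measure.dirac_conv, Measure.conv_assoc]

theorem atomic_map {k : ℕ} {α β : Type*} [MeasurableSpace α] [MeasurableSpace β] (w : Fin k → ℝ)
    (μ : Fin k → α) {f : α → β} (hf : Measurable f) :
    (atomic w μ).map f = atomic w fun j => f (μ j) := by
  unfold atomic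
  rw [← Measure.mapₗ_apply_of_measurable hf, map_sum]
  simp [Measure.mapₗ_apply_of_measurable hf, Measure.map_smul, Measure.map_dirac' hf]

/-! ### The Hellinger distance -/

theorem integrable_of_withDensity_isFinite {α : Type*} [MeasurableSpace α] {ν : Measure α}
    {p : α → ℝ} (hp : Measurable p) (hp0 : ∀ x, 0 ≤ p x)
    [IsFiniteMeasure (ν.withDensity fun x => ENNReal.ofReal (p x))] : Integrable p ν := by
  refine ⟨hp.aestronglyMeasurable, ?_⟩
  rw [hasFiniteIntegral_iff_ofReal (Filter.Eventually.of_forall hp0)]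
  have h := measure_lt_top (ν.withDensity fun x => ENNReal.ofReal (p x)) Set.univ
  rwa [withDensity_apply _ MeasurableSet.univ, Measure.restrict_univ] at h

/-- The Hellinger distance computed with densities with respect to any dominating measure. -/
theorem hellinger_withDensity {α : Type*} [MeasurableSpace α] {ν : Measure α}
    {p q : α → ℝ} (hp : Measurable p) (hq : Measurable q) (hp0 : ∀ x, 0 ≤ p x) (hq0 : ∀ x, 0 ≤ q x)
    [IsFiniteMeasure (ν.withDensity fun x => ENNReal.ofReal (p x))]
    [IsFiniteMeasure (ν.withDensity fun x => ENNReal.ofReal (q x))] :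
    hellinger (ν.withDensity fun x => ENNReal.ofReal (p x))
      (ν.withDensity fun x => ENNReal.ofReal (q x)) = √(∫ x, (√(p x) - √(q x)) ^ 2 ∂ν) := by
  have hsum : (ν.withDensity fun x => ENNReal.ofReal (p x)) +
      (ν.withDensity fun x => ENNReal.ofReal (q x)) =
      ν.withDensity fun x => ENNReal.ofReal (p x + q x) := by
    rw [← withDensity_add_left (by fun_prop)]
    congr 1
    ext x
    rw [Pi.add_apply, ENNReal.ofReal_add (hp0 x) (hq0 x)]
  have hfin : IsFiniteMeasure (ν.withDensity fun x => ENNReal.ofReal (p x + q x)) := by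
    rw [← hsum]; infer_instance
  -- Applied to r = p and r = q: relative to P + Q their densities are r / (p + q). Where p + q
  -- vanishes so does r, and the convention 0 / 0 = 0 does no harm.
  have key : ∀ r : α → ℝ, Measurable r → (∀ x, 0 ≤ r x) → (∀ x, r x ≤ p x + q x) →
      (ν.withDensity fun x => ENNReal.ofReal (r x)) =
        (ν.withDensity fun x => ENNReal.ofReal (p x + q x)).withDensity
          fun x => ENNReal.ofReal (r x / (p x + q x)) := by
    intro r hr hr0 hle
    rw [← withDensity_mul _ (by fun_prop) (by fun_prop)]
    congr 1
    ext x
    rw [Pi.mul_apply, ← ENNReal.ofReal_mul (add_nonneg (hp0 x) (hq0 x))]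
    congr 1
    rcases eq_or_lt_of_le (add_nonneg (hp0 x) (hq0 x)) with h | h
    · rw [← h, zero_mul]; linarith [hle x, hr0 x]
    · field_simp
  have hrn : ∀ r : α → ℝ, Measurable r → (∀ x, 0 ≤ r x) → (∀ x, r x ≤ p x + q x) →
      (fun x => (((ν.withDensity fun x => ENNReal.ofReal (r x)).rnDeriv
        (ν.withDensity fun x => ENNReal.ofReal (p x + q x))) x).toReal)
        =ᵐ[ν.withDensity fun x => ENNReal.ofReal (p x + q x)] fun x => r x / (p x + q x) := by
    intro r hr hr0 hle
    rw [key r hr hr0 hle]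
    filter_upwards [Measure.rnDeriv_withDensity
      (ν.withDensity fun x => ENNReal.ofReal (p x + q x))
      (f := fun x => ENNReal.ofReal (r x / (p x + q x))) (by fun_prop)] with x hx
    rw [hx, ENNReal.toReal_ofReal (div_nonneg (hr0 x) (add_nonneg (hp0 x) (hq0 x)))]
  unfold hellinger
  rw [hsum]
  congr 1
  have h1 := hrn p hp hp0 fun x => le_add_of_nonneg_right (hq0 x)
  have h2 := hrn q hq hq0 fun x => le_add_of_nonneg_left (hp0 x)
  rw [integral_congr_ae (g := fun x => (√(p x / (p x + q x)) - √(q x / (p x + q x))) ^ 2)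
    (by filter_upwards [h1, h2] with x hx1 hx2; rw [hx1, hx2])]
  rw [integral_withDensity_eq_integral_toReal_smul (by fun_prop)
    (Filter.Eventually.of_forall fun x => ENNReal.ofReal_lt_top)]
  refine integral_congr_ae (Filter.Eventually.of_forall fun x => ?_)
  simp only [smul_eq_mul]
  have h0 := add_nonneg (hp0 x) (hq0 x)
  rw [ENNReal.toReal_ofReal h0, Real.sqrt_div (hp0 x), Real.sqrt_div (hq0 x), ← sub_div, div_pow,
    Real.sq_sqrt h0]
  rcases eq_or_lt_of_le h0 with h | h
  · have hpx : p x = 0 := by linarith [hp0 x, hq0 x]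
    have hqx : q x = 0 := by linarith [hp0 x, hq0 x]
    simp [hpx, hqx]
  · field_simp

theorem integrable_sq_sub_sqrt {α : Type*} [MeasurableSpace α] {ν : Measure α}
    {p q : α → ℝ} (hp : Integrable p ν) (hq : Integrable q ν) (hpm : Measurable p)
    (hqm : Measurable q) (hp0 : ∀ x, 0 ≤ p x) (hq0 : ∀ x, 0 ≤ q x) :
    Integrable (fun x => (√(p x) - √(q x)) ^ 2) ν := by
  refine (hp.add hq).mono' (by fun_prop) (Filter.Eventually.of_forall fun x => ?_)
  rw [Real.norm_of_nonneg (sq_nonneg _), Pi.add_apply]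
  nlinarith [Real.sq_sqrt (hp0 x), Real.sq_sqrt (hq0 x), Real.sqrt_nonneg (p x),
    Real.sqrt_nonneg (q x), mul_nonneg (Real.sqrt_nonneg (p x)) (Real.sqrt_nonneg (q x))]

theorem withDensity_toReal_rnDeriv {α : Type*} [MeasurableSpace α] {P ν : Measure α}
    [IsFiniteMeasure P] [SigmaFinite ν] (h : P ≪ ν) :
    P = ν.withDensity fun x => ENNReal.ofReal (P.rnDeriv ν x).toReal := by
  conv_lhs => rw [← Measure.withDensity_rnDeriv_eq P ν h]
  refine withDensity_congr_ae ?_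
  filter_upwards [Measure.rnDeriv_lt_top P ν] with x hx
  rw [ENNReal.ofReal_toReal hx.ne]

theorem hellinger_sq_le_two {α : Type*} [MeasurableSpace α] (P Q : Measure α)
    [IsProbabilityMeasure P] [IsProbabilityMeasure Q] : hellinger P Q ^ 2 ≤ 2 := by
  unfold hellinger
  rw [Real.sq_sqrt (integral_nonneg fun x => sq_nonneg _)]
  have hP : Integrable (fun x => (P.rnDeriv (P + Q) x).toReal) (P + Q) :=
    Measure.integrable_toReal_rnDeriv
  have hQ : Integrable (fun x => (Q.rnDeriv (P + Q) x).toReal) (P + Q) :=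
    Measure.integrable_toReal_rnDeriv
  calc _ ≤ ∫ x, ((P.rnDeriv (P + Q) x).toReal + (Q.rnDeriv (P + Q) x).toReal) ∂(P + Q) := by
        refine integral_mono (integrable_sq_sub_sqrt hP hQ (by fun_prop) (by fun_prop)
          (fun x => ENNReal.toReal_nonneg) fun x => ENNReal.toReal_nonneg) (hP.add hQ) fun x => ?_
        simp only []
        nlinarith [Real.sq_sqrt (ENNReal.toReal_nonneg (a := P.rnDeriv (P + Q) x)),
          Real.sq_sqrt (ENNReal.toReal_nonneg (a := Q.rnDeriv (P + Q) x)),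
          mul_nonneg (Real.sqrt_nonneg (P.rnDeriv (P + Q) x).toReal)
            (Real.sqrt_nonneg (Q.rnDeriv (P + Q) x).toReal)]
    _ = 2 := by
        rw [integral_add hP hQ,
          Measure.integral_toReal_rnDeriv (Measure.AbsolutelyContinuous.rfl.add_right Q),
          Measure.integral_toReal_rnDeriv
            (by rw [add_comm]; exact Measure.AbsolutelyContinuous.rfl.add_right P)]
        simp; norm_num

theorem hellinger_nonneg {α : Type*} [MeasurableSpace α] (P Q : Measure α) : 0 ≤ hellinger P Q :=
  Real.sqrt_nonneg _

theorem hellinger_le_two {α : Type*} [MeasurableSpace α] (P Q : Measure α)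
    [IsProbabilityMeasure P] [IsProbabilityMeasure Q] : hellinger P Q ≤ 2 := by
  nlinarith [hellinger_sq_le_two P Q, hellinger_nonneg P Q]

theorem hellinger_sq_withDensity {α : Type*} [MeasurableSpace α] {ν : Measure α}
    {p q : α → ℝ} (hp : Measurable p) (hq : Measurable q) (hp0 : ∀ x, 0 ≤ p x) (hq0 : ∀ x, 0 ≤ q x)
    [IsFiniteMeasure (ν.withDensity fun x => ENNReal.ofReal (p x))]
    [IsFiniteMeasure (ν.withDensity fun x => ENNReal.ofReal (q x))] :
    hellinger (ν.withDensity fun x => ENNReal.ofReal (p x))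
      (ν.withDensity fun x => ENNReal.ofReal (q x)) ^ 2 = ∫ x, (√(p x) - √(q x)) ^ 2 ∂ν := by
  rw [hellinger_withDensity hp hq hp0 hq0, Real.sq_sqrt (integral_nonneg fun x => sq_nonneg _)]

/-- A weak triangle inequality for the squared Hellinger distance. -/
theorem hellinger_sq_le_add {α : Type*} [MeasurableSpace α] (P Q S : Measure α)
    [IsFiniteMeasure P] [IsFiniteMeasure Q] [IsFiniteMeasure S] :
    hellinger P S ^ 2 ≤ 2 * hellinger P Q ^ 2 + 2 * hellinger S Q ^ 2 := by
  set ν := P + Q + S with hν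
  have hP : P ≪ ν := (Measure.AbsolutelyContinuous.rfl.add_right Q).add_right S
  have hQ : Q ≪ ν := by
    rw [hν, add_comm P Q]; exact (Measure.AbsolutelyContinuous.rfl.add_right P).add_right S
  have hS : S ≪ ν := by
    rw [hν, add_comm (P + Q) S]; exact Measure.AbsolutelyContinuous.rfl.add_right _
  set p := fun x => (P.rnDeriv ν x).toReal
  set q := fun x => (Q.rnDeriv ν x).toReal
  set s := fun x => (S.rnDeriv ν x).toReal
  have eP : P = ν.withDensity fun x => ENNReal.ofReal (p x) := withDensity_toReal_rnDeriv hP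
  have eQ : Q = ν.withDensity fun x => ENNReal.ofReal (q x) := withDensity_toReal_rnDeriv hQ
  have eS : S = ν.withDensity fun x => ENNReal.ofReal (s x) := withDensity_toReal_rnDeriv hS
  have mp : Measurable p := by fun_prop
  have mq : Measurable q := by fun_prop
  have ms : Measurable s := by fun_prop
  have fP : IsFiniteMeasure (ν.withDensity fun x => ENNReal.ofReal (p x)) := by
    rw [← eP]; infer_instance
  have fQ : IsFiniteMeasure (ν.withDensity fun x => ENNReal.ofReal (q x)) := by
    rw [← eQ]; infer_instance
  have fS : IsFiniteMeasure (ν.withDensity fun x => ENNReal.ofReal (s x)) := by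
    rw [← eS]; infer_instance
  have p0 : ∀ x, 0 ≤ p x := fun x => ENNReal.toReal_nonneg
  have q0 : ∀ x, 0 ≤ q x := fun x => ENNReal.toReal_nonneg
  have s0 : ∀ x, 0 ≤ s x := fun x => ENNReal.toReal_nonneg
  have ip := integrable_of_withDensity_isFinite (ν := ν) mp p0
  have iq := integrable_of_withDensity_isFinite (ν := ν) mq q0
  have is := integrable_of_withDensity_isFinite (ν := ν) ms s0
  have h1 := hellinger_sq_withDensity (ν := ν) mp ms p0 s0
  have h2 := hellinger_sq_withDensity (ν := ν) mp mq p0 q0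
  have h3 := hellinger_sq_withDensity (ν := ν) ms mq s0 q0
  rw [← eP, ← eS] at h1
  rw [← eP, ← eQ] at h2
  rw [← eS, ← eQ] at h3
  rw [h1, h2, h3, ← integral_const_mul, ← integral_const_mul, ← integral_add
    ((integrable_sq_sub_sqrt ip iq mp mq p0 q0).const_mul 2)
    ((integrable_sq_sub_sqrt is iq ms mq s0 q0).const_mul 2)]
  refine integral_mono (integrable_sq_sub_sqrt ip is mp ms p0 s0)
    (((integrable_sq_sub_sqrt ip iq mp mq p0 q0).const_mul 2).add
      ((integrable_sq_sub_sqrt is iq ms mq s0 q0).const_mul 2)) fun x => ?_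
  simp only []
  nlinarith [sq_nonneg (√(p x) + √(s x) - 2 * √(q x))]

theorem map_withDensity_equiv {α β : Type*} [MeasurableSpace α] [MeasurableSpace β] (e : α ≃ᵐ β)
    (ν : Measure α) (f : α → ℝ≥0∞) (hf : Measurable f) :
    (ν.withDensity f).map e = (ν.map e).withDensity fun y => f (e.symm y) := by
  ext s hs
  rw [Measure.map_apply e.measurable hs, withDensity_apply _ (hs.preimage e.measurable),
    withDensity_apply _ hs, setLIntegral_map hs (f := fun y => f (e.symm y)) (hf.comp e.symm.measurable) e.measurable]
  simp

/-- Needed for translations: they move the mean of the true mixture to the origin, where its density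
relative to N(0, I) is bounded below. -/
theorem hellinger_sq_map {α β : Type*} [MeasurableSpace α] [MeasurableSpace β] (e : α ≃ᵐ β)
    {ν : Measure α} {p q : α → ℝ} (hp : Measurable p) (hq : Measurable q) (hp0 : ∀ x, 0 ≤ p x)
    (hq0 : ∀ x, 0 ≤ q x) [IsFiniteMeasure (ν.withDensity fun x => ENNReal.ofReal (p x))]
    [IsFiniteMeasure (ν.withDensity fun x => ENNReal.ofReal (q x))] :
    hellinger ((ν.withDensity fun x => ENNReal.ofReal (p x)).map e)
      ((ν.withDensity fun x => ENNReal.ofReal (q x)).map e) ^ 2 =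
      ∫ x, (√(p x) - √(q x)) ^ 2 ∂ν := by
  have h1 := map_withDensity_equiv e ν (fun x => ENNReal.ofReal (p x)) (by fun_prop)
  have h2 := map_withDensity_equiv e ν (fun x => ENNReal.ofReal (q x)) (by fun_prop)
  have f1 : IsFiniteMeasure ((ν.map e).withDensity fun y => ENNReal.ofReal (p (e.symm y))) := by
    rw [← h1]; infer_instance
  have f2 : IsFiniteMeasure ((ν.map e).withDensity fun y => ENNReal.ofReal (q (e.symm y))) := by
    rw [← h2]; infer_instance
  rw [h1, h2, hellinger_sq_withDensity (p := fun y => p (e.symm y)) (q := fun y => q (e.symm y))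
    (hp.comp e.symm.measurable) (hq.comp e.symm.measurable) (fun y => hp0 _) fun y => hq0 _,
    MeasureTheory.integral_map_equiv]
  simp

/-! ### From the Hellinger distance to an L² distance -/

/-- The quotient of (p - q)² and (√p - √q)² is (√p + √q)², which is at least p. A lower bound on one
of the two densities is enough. -/
theorem sq_sub_sqrt_le {c p q : ℝ} (hc : 0 < c) (hp : c ≤ p) (hq : 0 ≤ q) :
    (√p - √q) ^ 2 ≤ c⁻¹ * (p - q) ^ 2 := by
  have hp0 : 0 ≤ p := hc.le.trans hp
  have h : (p - q) ^ 2 = (√p - √q) ^ 2 * (√p + √q) ^ 2 := by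
    rw [← mul_pow]; congr 1
    nlinarith [Real.sq_sqrt hp0, Real.sq_sqrt hq]
  rw [h, ← mul_assoc, mul_comm c⁻¹, mul_assoc]
  refine le_mul_of_one_le_right (sq_nonneg _) ?_
  rw [inv_mul_eq_div, one_le_div hc]
  nlinarith [Real.sq_sqrt hp0, Real.sqrt_nonneg p, Real.sqrt_nonneg q,
    mul_nonneg (Real.sqrt_nonneg p) (Real.sqrt_nonneg q), sq_nonneg √q]

/-- If the atoms of a centered `Γ` lie in a ball of radius `ρ`, the density of the mixture with
respect to `N(0, I)` is bounded below. -/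
theorem exp_le_sum_shiftDensity {d k : ℕ} {ρ : ℝ} {w : Fin k → ℝ} {μ : Fin k → E d}
    (hw : ∀ j, 0 ≤ w j) (h1 : ∑ j, w j = 1) (hμ : ∀ j, ‖μ j‖ ≤ ρ) (h0 : ∑ j, w j • μ j = 0)
    (x : E d) : Real.exp (-(ρ ^ 2 / 2)) ≤ ∑ j, w j * shiftDensity (μ j) x := by
  -- Jensen's inequality for the exponential. Centring cancels the terms linear in x, so the bound
  -- is uniform in x.
  have hj := convexOn_exp.map_sum_le (t := Finset.univ) (w := w)
    (p := fun j => inner ℝ (μ j) x - ‖μ j‖ ^ 2 / 2) (fun j _ => hw j) h1 fun _ _ => Set.mem_univ _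
  simp only [smul_eq_mul] at hj
  refine le_trans (Real.exp_le_exp.2 ?_) hj
  have hin : ∑ j, w j * inner ℝ (μ j) x = 0 := by
    have : ∑ j, w j * inner ℝ (μ j) x = inner ℝ (∑ j, w j • μ j) x := by
      rw [sum_inner]; simp [real_inner_smul_left]
    rw [this, h0, inner_zero_left]
  have : ∑ j, w j * (‖μ j‖ ^ 2 / 2) ≤ ∑ j, w j * (ρ ^ 2 / 2) :=
    Finset.sum_le_sum fun j _ => mul_le_mul_of_nonneg_left
      (by have := hμ j; have := norm_nonneg (μ j); gcongr) (hw j)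
  rw [← Finset.sum_mul, h1, one_mul] at this
  simp only [mul_sub, Finset.sum_sub_distrib, hin]
  linarith

/-- The Hellinger distance between two Gaussian mixtures, the first of which is centered at `a`,
is bounded by the kernel norm of the difference of the (translated) mixing distributions. -/
theorem hellinger_sq_mixture_le {d k l : ℕ} {ρ : ℝ} {w : Fin k → ℝ} {μ : Fin k → E d}
    (hw : ∀ j, 0 ≤ w j) (h1 : ∑ j, w j = 1) (hμ : ∀ j, ‖μ j‖ ≤ ρ) (h0 : ∑ j, w j • μ j = 0)
    {w' : Fin l → ℝ} {μ' : Fin l → E d} (hw' : ∀ j, 0 ≤ w' j) (h1' : ∑ j, w' j = 1) (a : E d) :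
    hellinger (mixture (atomic w fun j => a + μ j)) (mixture (atomic w' fun j => a + μ' j)) ^ 2 ≤
      Real.exp (ρ ^ 2 / 2) * ∫ x, ((∑ j, w j * shiftDensity (μ j) x) -
        ∑ j, w' j * shiftDensity (μ' j) x) ^ 2 ∂stdGaussian (E d) := by
  have i1 := isProbabilityMeasure_atomic hw h1 μ
  have i2 := isProbabilityMeasure_atomic hw' h1' μ'
  rw [← atomic_map w μ (f := (a + ·)) (by fun_prop), ← atomic_map w' μ' (f := (a + ·)) (by fun_prop),
    mixture_map_add, mixture_map_add]
  have e1 := mixture_atomic_eq_withDensity w hw μ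
  have e2 := mixture_atomic_eq_withDensity w' hw' μ'
  have m1 : Measurable fun x => ∑ j, w j * shiftDensity (μ j) x :=
    Finset.measurable_sum _ fun j _ => (measurable_shiftDensity _).const_mul _
  have m2 : Measurable fun x => ∑ j, w' j * shiftDensity (μ' j) x :=
    Finset.measurable_sum _ fun j _ => (measurable_shiftDensity _).const_mul _
  have p1 : ∀ x, 0 ≤ ∑ j, w j * shiftDensity (μ j) x := fun x =>
    Finset.sum_nonneg fun j _ => mul_nonneg (hw j) (shiftDensity_pos _ _).le
  have p2 : ∀ x, 0 ≤ ∑ j, w' j * shiftDensity (μ' j) x := fun x =>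
    Finset.sum_nonneg fun j _ => mul_nonneg (hw' j) (shiftDensity_pos _ _).le
  have f1 : IsFiniteMeasure ((stdGaussian (E d)).withDensity fun x =>
      ENNReal.ofReal (∑ j, w j * shiftDensity (μ j) x)) := by rw [← e1]; infer_instance
  have f2 : IsFiniteMeasure ((stdGaussian (E d)).withDensity fun x =>
      ENNReal.ofReal (∑ j, w' j * shiftDensity (μ' j) x)) := by rw [← e2]; infer_instance
  have hmap := hellinger_sq_map (MeasurableEquiv.addLeft a) m1 m2 p1 p2 (ν := stdGaussian (E d))
  rw [← e1, ← e2] at hmap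
  have hint : Integrable (fun x => ((∑ j, w j * shiftDensity (μ j) x) -
        ∑ j, w' j * shiftDensity (μ' j) x) ^ 2) (stdGaussian (E d)) := by
    have := integrable_sq_sum_shiftDensity (ι := Fin k ⊕ Fin l)
      (Sum.elim w fun j => - w' j) (Sum.elim μ μ')
    simpa [← sub_eq_add_neg] using this
  refine (le_of_eq hmap).trans ?_
  rw [← integral_const_mul]
  refine integral_mono (integrable_sq_sub_sqrt (integrable_of_withDensity_isFinite m1 p1)
    (integrable_of_withDensity_isFinite m2 p2) m1 m2 p1 p2) (hint.const_mul _) fun x => ?_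
  have := sq_sub_sqrt_le (Real.exp_pos _) (exp_le_sum_shiftDensity hw h1 hμ h0 x) (p2 x)
  rwa [← Real.exp_neg, neg_neg] at this

/-! ### The minimax lower bound -/

theorem mixture_dirac {d : ℕ} (z : E d) : mixture (Measure.dirac z) =
    (stdGaussian (E d)).withDensity fun x => ENNReal.ofReal (shiftDensity z x) := by
  rw [mixture, Measure.dirac_conv, map_add_stdGaussian]

/-- The root of a Gaussian density is a multiple of the density at half the shift, so the Hellinger
affinity of two Gaussians is again an exponential of an inner product. -/
theorem sqrt_shiftDensity {d : ℕ} (z x : E d) :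
    √(shiftDensity z x) = Real.exp (-(‖z‖ ^ 2 / 8)) * shiftDensity ((2 : ℝ)⁻¹ • z) x := by
  rw [shiftDensity, shiftDensity, ← Real.exp_half, ← Real.exp_add, real_inner_smul_left, norm_smul]
  congr 1
  rw [Real.norm_of_nonneg (by norm_num : (0:ℝ) ≤ 2⁻¹)]
  ring

theorem hellinger_sq_gaussian {d : ℕ} (z y : E d) :
    hellinger (mixture (Measure.dirac z)) (mixture (Measure.dirac y)) ^ 2 =
      2 - 2 * Real.exp (-(‖z - y‖ ^ 2 / 8)) := by
  have f : ∀ z : E d, IsFiniteMeasure ((stdGaussian (E d)).withDensity fun x =>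
      ENNReal.ofReal (shiftDensity z x)) := fun z => by rw [← mixture_dirac]; infer_instance
  rw [mixture_dirac, mixture_dirac, hellinger_sq_withDensity (measurable_shiftDensity z)
    (measurable_shiftDensity y) (fun x => (shiftDensity_pos _ _).le)
    fun x => (shiftDensity_pos _ _).le]
  have : ∀ x, (√(shiftDensity z x) - √(shiftDensity y x)) ^ 2 =
      (shiftDensity z x + shiftDensity y x) - 2 * Real.exp (-(‖z‖ ^ 2 / 8)) *
        Real.exp (-(‖y‖ ^ 2 / 8)) *
        (shiftDensity ((2 : ℝ)⁻¹ • z) x * shiftDensity ((2 : ℝ)⁻¹ • y) x) := by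
    intro x
    rw [sub_sq, Real.sq_sqrt (shiftDensity_pos _ _).le, Real.sq_sqrt (shiftDensity_pos _ _).le,
      sqrt_shiftDensity, sqrt_shiftDensity]
    ring
  simp only [this]
  have hadd : Integrable (fun x => shiftDensity z x + shiftDensity y x) (stdGaussian (E d)) :=
    (integrable_shiftDensity z).add (integrable_shiftDensity y)
  rw [integral_sub hadd ((integrable_shiftDensity_mul _ _).const_mul _), integral_add (integrable_shiftDensity z)
    (integrable_shiftDensity y), integral_shiftDensity, integral_shiftDensity, integral_const_mul,
    integral_shiftDensity_mul, mul_assoc, mul_assoc, ← Real.exp_add, ← Real.exp_add,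
    real_inner_smul_left, real_inner_smul_right, norm_sub_sq_real]
  norm_num
  ring_nf

theorem le_hellinger_sq_gaussian {d : ℕ} (z y : E d) (h : ‖z - y‖ ^ 2 ≤ 8) :
    ‖z - y‖ ^ 2 / 8 ≤ hellinger (mixture (Measure.dirac z)) (mixture (Measure.dirac y)) ^ 2 := by
  rw [hellinger_sq_gaussian]
  set t := ‖z - y‖ ^ 2 / 8 with ht
  have ht0 : 0 ≤ t := by positivity
  have ht1 : t ≤ 1 := by linarith
  -- From e^{-t} ≤ 1 / (1 + t) one gets 2 - 2e^{-t} ≥ 2t / (1 + t), which is at least t because t ≤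
  -- 1.
  have h1 : Real.exp (-t) * (1 + t) ≤ 1 := by
    have := Real.add_one_le_exp t
    calc Real.exp (-t) * (1 + t) ≤ Real.exp (-t) * Real.exp t := by gcongr; linarith
      _ = 1 := by rw [← Real.exp_add]; simp
  have h2 : 0 ≤ Real.exp (-t) := (Real.exp_pos _).le
  nlinarith

/-- A greedy choice and a comparison of volumes: fewer than 2^d balls of radius 1/2 cannot cover the
unit ball, so a further point at distance at least 1/2 from all chosen ones exists. -/
theorem exists_separated_finset (d : ℕ) : ∀ m : ℕ, m ≤ 2 ^ d → ∃ s : Finset (E d),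
    s.card = m ∧ (∀ x ∈ s, ‖x‖ ≤ 1) ∧ ∀ x ∈ s, ∀ y ∈ s, x ≠ y → 1 / 2 ≤ ‖x - y‖ := by
  intro m
  induction m with
  | zero => exact fun _ => ⟨∅, by simp⟩
  | succ m ih =>
    intro hm
    obtain ⟨s, hs, hn, hsep⟩ := ih (by omega)
    have hex : ∃ y : E d, ‖y‖ ≤ 1 ∧ ∀ x ∈ s, 1 / 2 ≤ ‖y - x‖ := by
      by_contra hcon
      push Not at hcon
      have hsub : Metric.closedBall (0 : E d) 1 ⊆ ⋃ x ∈ s, Metric.closedBall x (1 / 2) := by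
        intro y hy
        obtain ⟨x, hx, hxy⟩ := hcon y (by simpa using hy)
        simp only [Set.mem_iUnion]
        exact ⟨x, hx, by rw [mem_closedBall_iff_norm]; exact hxy.le⟩
      have hv := (measure_mono (μ := (volume : Measure (E d))) hsub).trans
        (measure_biUnion_finset_le _ _)
      simp only [Measure.addHaar_closedBall' volume _ (by norm_num : (0 : ℝ) ≤ 1 / 2)] at hv
      rw [Finset.sum_const, hs, nsmul_eq_mul, finrank_euclideanSpace_fin, ← mul_assoc] at hv
      set V := (volume : Measure (E d)) (Metric.closedBall (0 : E d) 1) with hV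
      have hV0 : V ≠ 0 := (Metric.measure_closedBall_pos volume _ one_pos).ne'
      have hVt : V ≠ ∞ := measure_closedBall_lt_top.ne
      have hlt : (m : ℝ≥0∞) * ENNReal.ofReal ((1 / 2) ^ d) < 1 := by
        rw [← ENNReal.ofReal_natCast, ← ENNReal.ofReal_mul (by positivity), ← ENNReal.ofReal_one]
        refine (ENNReal.ofReal_lt_ofReal_iff one_pos).2 ?_
        have : (m : ℝ) < 2 ^ d := by exact_mod_cast (by omega : m < 2 ^ d)
        rw [one_div, inv_pow, ← div_eq_mul_inv, div_lt_one (by positivity)]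
        exact this
      have := ENNReal.mul_lt_mul_left hV0 hVt hlt
      rw [one_mul] at this
      exact absurd hv (not_le.2 this)
    obtain ⟨y, hy, hys⟩ := hex
    classical
    have hnot : y ∉ s := fun h => by
      have := hys y h
      simp at this
      norm_num at this
    refine ⟨insert y s, by rw [Finset.card_insert_of_notMem hnot, hs], ?_, ?_⟩
    · intro x hx
      rcases Finset.mem_insert.1 hx with rfl | h
      exacts [hy, hn x h]
    · intro x hx z hz hxz
      rcases Finset.mem_insert.1 hx with rfl | h <;> rcases Finset.mem_insert.1 hz with rfl | h'
      · exact absurd rfl hxz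
      · exact hys z h'
      · rw [norm_sub_rev]; exact hys x h
      · exact hsep x h z h' hxz

theorem dirac_mem_mixingClass {d : ℕ} {R : ℝ} {z : E d} (hz : ‖z‖ ≤ R) :
    Measure.dirac z ∈ mixingClass 2 d R := by
  refine ⟨![1, 0], fun _ => z, ?_, ?_, fun _ => hz, ?_⟩
  · intro j; fin_cases j <;> simp
  · simp
  · simp [atomic]

theorem sampleLaw_dirac {d : ℕ} (m : ℕ) (z : E d) : sampleLaw m (Measure.dirac z) =
    (Measure.pi fun _ : Fin m => stdGaussian (E d)).withDensity
      fun x => ∏ i, ENNReal.ofReal (shiftDensity z (x i)) := by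
  have hz : IsProbabilityMeasure ((stdGaussian (E d)).withDensity fun x =>
      ENNReal.ofReal (shiftDensity z x)) := by rw [← mixture_dirac]; infer_instance
  rw [sampleLaw, mixture_dirac]
  exact pi_withDensity (ι := Fin m) (fun _ => stdGaussian (E d))
    (fun _ x => ENNReal.ofReal (shiftDensity z x))
    (fun _ => (measurable_shiftDensity z).ennreal_ofReal)

instance isProbabilityMeasure_sampleLaw {d m : ℕ} (Γ : Measure (E d)) [IsProbabilityMeasure Γ] :
    IsProbabilityMeasure (sampleLaw m Γ) := by
  unfold sampleLaw; infer_instance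

/-- The second moment of the likelihood ratio of a sample against N(0, I); it tensorizes over
independent observations. -/
theorem lintegral_sq_prod_shiftDensity {d : ℕ} (m : ℕ) (z : E d) :
    ∫⁻ x, (∏ i, ENNReal.ofReal (shiftDensity z (x i))) ^ 2
      ∂(Measure.pi fun _ : Fin m => stdGaussian (E d)) = ENNReal.ofReal (Real.exp (m * ‖z‖ ^ 2)) := by
  simp only [← Finset.prod_pow]
  rw [lintegral_pi_prod _ (fun _ x => ENNReal.ofReal (shiftDensity z x) ^ 2)
    fun _ => (measurable_shiftDensity z).ennreal_ofReal.pow_const 2]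
  have : ∫⁻ x, ENNReal.ofReal (shiftDensity z x) ^ 2 ∂stdGaussian (E d) =
      ENNReal.ofReal (Real.exp (‖z‖ ^ 2)) := by
    have h := integral_shiftDensity_mul z z
    rw [integral_eq_lintegral_of_nonneg_ae (Filter.Eventually.of_forall fun x =>
      (mul_pos (shiftDensity_pos z x) (shiftDensity_pos z x)).le)
      ((measurable_shiftDensity z).mul (measurable_shiftDensity z)).aestronglyMeasurable,
      real_inner_self_eq_norm_sq] at h
    rw [← h, ENNReal.ofReal_toReal]
    · exact lintegral_congr fun x => by rw [sq, ← ENNReal.ofReal_mul (shiftDensity_pos z x).le]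
    · intro htop
      rw [htop] at h
      exact (Real.exp_pos _).ne h
  simp only [this, Finset.prod_const, Finset.card_univ, Fintype.card_fin]
  rw [← ENNReal.ofReal_pow (Real.exp_pos _).le, ← Real.exp_nat_mul]

/-- The inequality (L - t)² ≥ 0, divided by 2t. It replaces Cauchy–Schwarz: a probability under the
alternative is bounded linearly by the probability under N(0, I) and the second moment of the
likelihood ratio. -/
theorem ennreal_le_half_add_sq (L : ℝ≥0∞) {t : ℝ} (ht : 0 < t) :
    L ≤ ENNReal.ofReal (t / 2) + ENNReal.ofReal (1 / (2 * t)) * L ^ 2 := by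
  rcases eq_or_ne L ∞ with rfl | hL
  · rw [ENNReal.top_pow two_ne_zero, ENNReal.mul_top (by simpa using ht), add_top]
  · lift L to NNReal using hL
    have : (L : ℝ) ≤ t / 2 + 1 / (2 * t) * (L : ℝ) ^ 2 := by
      have h : t / 2 + 1 / (2 * t) * (L : ℝ) ^ 2 - L = (L - t) ^ 2 / (2 * t) := by
        field_simp; ring
      have : 0 ≤ (L - t) ^ 2 / (2 * t) := by positivity
      linarith
    have h2 : ((L : NNReal) : ℝ≥0∞) = ENNReal.ofReal L := by simp
    rw [h2, ← ENNReal.ofReal_pow (NNReal.coe_nonneg L), ← ENNReal.ofReal_mul (by positivity),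
      ← ENNReal.ofReal_add (by positivity) (by positivity)]
    exact ENNReal.ofReal_le_ofReal this

/-- Many Gaussian location models whose samples are hard to tell apart admit no family of
disjoint events of probability more than `3/4`. -/
theorem not_disjoint_likely {d m : ℕ} (s : Finset (E d)) (G : E d → Set (Fin m → E d)) {a : ℝ}
    (hs : s.Nonempty) (hG : ∀ z ∈ s, MeasurableSet (G z))
    (hdis : ∀ z ∈ s, ∀ y ∈ s, z ≠ y → Disjoint (G z) (G y)) (ha : ∀ z ∈ s, m * ‖z‖ ^ 2 ≤ a)
    (hcard : Real.exp a ≤ 9 / 16 * s.card)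
    (hP : ∀ z ∈ s, ENNReal.ofReal (3 / 4) < sampleLaw m (Measure.dirac z) (G z)) : False := by
  set N : ℝ := (s.card : ℝ) with hN
  have hN0 : 0 < N := by rw [hN]; exact_mod_cast hs.card_pos
  set P₀ : Measure (Fin m → E d) := Measure.pi fun _ => stdGaussian (E d)
  -- The parameter of the linearization is t = 3N/4. Summed over the N models, the first terms give
  -- at most 3N/8 because the events are disjoint, and the second ones N · (2/(3N)) · (9N/16) =
  -- 3N/8. The total 3N/4 contradicts `hP`.
  have h1 : ∀ z ∈ s, sampleLaw m (Measure.dirac z) (G z) ≤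
      ENNReal.ofReal (3 / 4 * N / 2) * P₀ (G z) +
        ENNReal.ofReal (1 / (2 * (3 / 4 * N))) * ENNReal.ofReal (Real.exp a) := by
    intro z hz
    rw [sampleLaw_dirac, withDensity_apply _ (hG z hz)]
    have hm : Measurable fun x : Fin m → E d => ∏ i, ENNReal.ofReal (shiftDensity z (x i)) :=
      Finset.measurable_prod _ fun i _ =>
        ((measurable_shiftDensity z).comp (measurable_pi_apply i)).ennreal_ofReal
    calc _ ≤ ∫⁻ x in G z, (ENNReal.ofReal (3 / 4 * N / 2) + ENNReal.ofReal (1 / (2 * (3 / 4 * N))) *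
            (∏ i, ENNReal.ofReal (shiftDensity z (x i))) ^ 2) ∂P₀ :=
          lintegral_mono fun x => ennreal_le_half_add_sq _ (by positivity)
      _ = ENNReal.ofReal (3 / 4 * N / 2) * P₀ (G z) + ENNReal.ofReal (1 / (2 * (3 / 4 * N))) *
            ∫⁻ x in G z, (∏ i, ENNReal.ofReal (shiftDensity z (x i))) ^ 2 ∂P₀ := by
          rw [lintegral_add_left measurable_const, setLIntegral_const,
            lintegral_const_mul _ (hm.pow_const 2)]
      _ ≤ _ := by
          gcongr
          refine (setLIntegral_le_lintegral _ _).trans ?_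
          rw [lintegral_sq_prod_shiftDensity]
          exact ENNReal.ofReal_le_ofReal (Real.exp_le_exp.2 (ha z hz))
  have h2 : ∑ z ∈ s, P₀ (G z) ≤ 1 := by
    rw [← measure_biUnion_finset (fun z hz y hy hzy => hdis z hz y hy hzy) hG]
    exact prob_le_one
  have h3 : ∑ z ∈ s, sampleLaw m (Measure.dirac z) (G z) ≤ ENNReal.ofReal (3 / 4 * N) := by
    calc _ ≤ ∑ z ∈ s, (ENNReal.ofReal (3 / 4 * N / 2) * P₀ (G z) +
        ENNReal.ofReal (1 / (2 * (3 / 4 * N))) * ENNReal.ofReal (Real.exp a)) :=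
          Finset.sum_le_sum h1
      _ = ENNReal.ofReal (3 / 4 * N / 2) * ∑ z ∈ s, P₀ (G z) +
          s.card * (ENNReal.ofReal (1 / (2 * (3 / 4 * N))) * ENNReal.ofReal (Real.exp a)) := by
          rw [Finset.sum_add_distrib, Finset.mul_sum, Finset.sum_const, nsmul_eq_mul]
      _ ≤ ENNReal.ofReal (3 / 4 * N / 2) * 1 +
          s.card * (ENNReal.ofReal (1 / (2 * (3 / 4 * N))) * ENNReal.ofReal (9 / 16 * N)) := by
          gcongr
      _ = ENNReal.ofReal (3 / 4 * N) := by
          rw [mul_one, ← ENNReal.ofReal_natCast, ← hN, ← ENNReal.ofReal_mul (by positivity),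
            ← ENNReal.ofReal_mul (by positivity), ← ENNReal.ofReal_add (by positivity)
            (by positivity)]
          congr 1
          field_simp
          norm_num
  have h4 : ∑ z ∈ s, ENNReal.ofReal (3 / 4) < ∑ z ∈ s, sampleLaw m (Measure.dirac z) (G z) :=
    ENNReal.sum_lt_sum_of_nonempty hs hP
  rw [Finset.sum_const, nsmul_eq_mul, ← ENNReal.ofReal_natCast, ← hN,
    ← ENNReal.ofReal_mul hN0.le, mul_comm] at h4
  exact absurd h3 (not_le.2 h4)

/-- An estimator that is accurate with probability more than 3/4 for every point mass of a packing
would identify the point mass: the events of accuracy are disjoint by the triangle inequality, which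
`not_disjoint_likely` excludes. -/
theorem minimax_lower_bound (R : ℝ) (hR : 0 < R) : ∃ c : ℝ, 0 < c ∧
    ∀ d n : ℕ, 1 ≤ d → 1 ≤ n → ∀ Phat : (Fin (n + n) → E d) → Measure (E d),
      (∀ X, IsProbabilityMeasure (Phat X)) → ∃ Γ ∈ mixingClass 2 d R,
        ENNReal.ofReal (1 / 4) ≤ sampleLaw (n + n) Γ
          {X | c * min (√((d : ℝ) / n)) 1 ≤ hellinger (mixture Γ) (Phat X)} := by
  set c₀ : ℝ := min R (1 / 5) with hc₀
  have hc0 : 0 < c₀ := lt_min hR (by norm_num)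
  have hc1 : c₀ ≤ 1 / 5 := min_le_right _ _
  refine ⟨c₀ / 12, by positivity, fun d n hd hn Phat hPhat => ?_⟩
  by_contra hcon
  push Not at hcon
  have hn0 : (0 : ℝ) < n := by exact_mod_cast hn
  have hd0 : (0 : ℝ) < d := by exact_mod_cast hd
  -- The radius of the packing. The minimum with 1 and c₀ ≤ R keep the means in the admissible ball,
  -- and c₀ ≤ 1/5 makes the exponent 2n‖z‖² ≤ 2d/25 smaller than d/9.
  set r : ℝ := c₀ * min (√((d : ℝ) / n)) 1 with hr
  have hr0 : 0 < r := mul_pos hc0 (lt_min (Real.sqrt_pos.2 (by positivity)) one_pos)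
  have hr1 : r ≤ c₀ := mul_le_of_le_one_right hc0.le (min_le_right _ _)
  have hrn : n * r ^ 2 ≤ c₀ ^ 2 * d := by
    have : (min (√((d : ℝ) / n)) 1) ^ 2 ≤ (d : ℝ) / n := by
      calc _ ≤ (√((d : ℝ) / n)) ^ 2 :=
            pow_le_pow_left₀ (le_min (Real.sqrt_nonneg _) zero_le_one) (min_le_left _ _) 2
        _ = _ := Real.sq_sqrt (by positivity)
    rw [hr, mul_pow]
    calc n * (c₀ ^ 2 * (min (√((d : ℝ) / n)) 1) ^ 2) ≤ n * (c₀ ^ 2 * ((d : ℝ) / n)) := by gcongr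
      _ = _ := by field_simp
  obtain ⟨s, hs, hball, hsep⟩ := exists_separated_finset d (2 ^ d) le_rfl
  classical
  set s' : Finset (E d) := s.image (r • ·) with hs'
  have hinj : Function.Injective (fun x : E d => r • x) := smul_right_injective _ hr0.ne'
  have hcard : s'.card = 2 ^ d := by rw [hs', Finset.card_image_of_injective _ hinj, hs]
  have hnorm : ∀ z ∈ s', ‖z‖ ≤ r := by
    intro z hz
    obtain ⟨x, hx, rfl⟩ := Finset.mem_image.1 hz
    rw [norm_smul, Real.norm_of_nonneg hr0.le]
    exact mul_le_of_le_one_right hr0.le (hball x hx)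
  have hdist : ∀ z ∈ s', ∀ y ∈ s', z ≠ y → r / 2 ≤ ‖z - y‖ := by
    intro z hz y hy hzy
    obtain ⟨x, hx, rfl⟩ := Finset.mem_image.1 hz
    obtain ⟨x', hx', rfl⟩ := Finset.mem_image.1 hy
    rw [← smul_sub, norm_smul, Real.norm_of_nonneg hr0.le]
    have := hsep x hx x' hx' fun h => hzy (by rw [h])
    nlinarith
  set A : E d → Set (Fin (n + n) → E d) := fun z =>
    {X | c₀ / 12 * min (√((d : ℝ) / n)) 1 ≤ hellinger (mixture (Measure.dirac z)) (Phat X)} with hA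
  have hlt : ∀ z ∈ s', sampleLaw (n + n) (Measure.dirac z) (A z) < ENNReal.ofReal (1 / 4) :=
    fun z hz => hcon _ (dirac_mem_mixingClass
      ((hnorm z hz).trans (hr1.trans (min_le_left _ _))))
  -- The estimator is an arbitrary map, so the events of failure are replaced by measurable hulls,
  -- which have the same outer measure; their complements are still disjoint.
  refine not_disjoint_likely (m := n + n) (a := 1 / 9 * d) s'
    (fun z => (toMeasurable (sampleLaw (n + n) (Measure.dirac z)) (A z))ᶜ) ?_ ?_ ?_ ?_ ?_ ?_
  · rw [← Finset.card_pos, hcard]; positivity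
  · exact fun z _ => (measurableSet_toMeasurable _ _).compl
  · intro z hz y hy hzy
    rw [Set.disjoint_left]
    intro X hX hX'
    have h1 : X ∉ A z := fun h => hX (subset_toMeasurable _ _ h)
    have h2 : X ∉ A y := fun h => hX' (subset_toMeasurable _ _ h)
    simp only [hA, Set.mem_ofPred_eq, not_le] at h1 h2
    have hPX := hPhat X
    have e : c₀ / 12 * min (√((d : ℝ) / n)) 1 = r / 12 := by rw [hr]; ring
    rw [e] at h1 h2
    have hzn := hnorm z hz
    have hyn := hnorm y hy
    have hup : ‖z - y‖ ≤ 2 / 5 := (norm_sub_le _ _).trans (by linarith)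
    have h3 := le_hellinger_sq_gaussian z y (by nlinarith [norm_nonneg (z - y)])
    have h4 := hellinger_sq_le_add (mixture (Measure.dirac z)) (Phat X) (mixture (Measure.dirac y))
    have h5 := hdist z hz y hy hzy
    have h6 : hellinger (mixture (Measure.dirac z)) (Phat X) ^ 2 ≤ (r / 12) ^ 2 :=
      pow_le_pow_left₀ (hellinger_nonneg _ _) h1.le 2
    have h7 : hellinger (mixture (Measure.dirac y)) (Phat X) ^ 2 ≤ (r / 12) ^ 2 :=
      pow_le_pow_left₀ (hellinger_nonneg _ _) h2.le 2
    have h8 : (r / 2) ^ 2 ≤ ‖z - y‖ ^ 2 := pow_le_pow_left₀ (by positivity) h5 2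
    -- Separation r/2 forces squared Hellinger distance at least r²/32, whereas two errors below
    -- r/12 allow at most 4(r/12)² = r²/36.
    nlinarith [pow_pos hr0 2]
  · intro z hz
    have := pow_le_pow_left₀ (norm_nonneg z) (hnorm z hz) 2
    push_cast
    have h1 : (n : ℝ) * ‖z‖ ^ 2 ≤ c₀ ^ 2 * d := le_trans (by gcongr) hrn
    have h2 : c₀ ^ 2 ≤ 1 / 25 := by nlinarith
    nlinarith
  · rw [hcard]
    have hexp : Real.exp (1 / 9) ≤ 9 / 8 := by
      have := Real.add_one_le_exp (-(1 / 9 : ℝ))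
      rw [Real.exp_neg] at this
      have h9 := Real.exp_pos (1 / 9)
      have h10 : (8 / 9 : ℝ) * Real.exp (1 / 9) ≤ 1 := by
        calc _ ≤ (Real.exp (1 / 9))⁻¹ * Real.exp (1 / 9) := by gcongr; linarith
          _ = 1 := inv_mul_cancel₀ h9.ne'
      linarith
    -- Since e^{1/9} ≤ 9/8 = (9/16) · 2, the exponential is at most (9/16)^d · 2^d, and the packing
    -- has 2^d points.
    have h1 : Real.exp (1 / 9 * d) ≤ (9 / 8) ^ d := by
      rw [mul_comm, Real.exp_nat_mul]
      exact pow_le_pow_left₀ (Real.exp_pos _).le hexp d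
    have h2 : ((9 : ℝ) / 8) ^ d = (9 / 16) ^ d * 2 ^ d := by rw [← mul_pow]; norm_num
    have h3 : ((9 : ℝ) / 16) ^ d ≤ 9 / 16 := pow_le_of_le_one (by norm_num) (by norm_num) (by omega)
    push_cast
    calc _ ≤ _ := h1
      _ = _ := h2
      _ ≤ _ := by gcongr
  · intro z hz
    have h1 := hlt z hz
    rw [← measure_toMeasurable] at h1
    by_contra h2
    have h3 := prob_add_prob_compl (μ := sampleLaw (n + n) (Measure.dirac z))
      (measurableSet_toMeasurable (sampleLaw (n + n) (Measure.dirac z)) (A z))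
    have h4 := ENNReal.add_lt_add_of_lt_of_le (measure_ne_top _ _) h1 (not_lt.1 h2)
    rw [h3, ← ENNReal.ofReal_add (by norm_num) (by norm_num)] at h4
    norm_num at h4

/-! ### Moments and the exponential kernel -/

/-- The four nodes are roots of a monic quartic, so the weighted power sums satisfy a linear
recurrence of order four with elementary symmetric functions as coefficients. These consist of 4, 6,
4 and 1 monomials, each at most M⁴ because M ≥ 1; their sum 15M⁴ is the growth factor per step. The
nodes may coincide. -/
theorem abs_moment_diff_le {M ε : ℝ} (hM : 1 ≤ M) (c₁ c₂ c₃ c₄ p q r s : ℝ) (hp : |p| ≤ M)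
    (hq : |q| ≤ M) (hr : |r| ≤ M) (hs : |s| ≤ M)
    (h : ∀ l < 4, |c₁ * p ^ l + c₂ * q ^ l + c₃ * r ^ l + c₄ * s ^ l| ≤ ε) (l : ℕ) :
    |c₁ * p ^ l + c₂ * q ^ l + c₃ * r ^ l + c₄ * s ^ l| ≤ ε * (15 * M ^ 4) ^ l := by
  set D : ℕ → ℝ := fun l => c₁ * p ^ l + c₂ * q ^ l + c₃ * r ^ l + c₄ * s ^ l with hD
  have hε : 0 ≤ ε := (abs_nonneg _).trans (h 0 (by norm_num))
  have hM0 : 0 ≤ M := by linarith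
  have hM4 : 1 ≤ M ^ 4 := one_le_pow₀ hM
  have hB : 1 ≤ 15 * M ^ 4 := by linarith
  have m1 : M ≤ M ^ 4 := le_self_pow₀ hM (by norm_num)
  have m2 : M ^ 2 ≤ M ^ 4 := pow_le_pow_right₀ hM (by norm_num)
  have m3 : M ^ 3 ≤ M ^ 4 := pow_le_pow_right₀ hM (by norm_num)
  have b2 : ∀ x y : ℝ, |x| ≤ M → |y| ≤ M → |x * y| ≤ M ^ 2 := fun x y hx hy => by
    rw [abs_mul, sq]; exact mul_le_mul hx hy (abs_nonneg _) hM0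
  have b3 : ∀ x y z : ℝ, |x| ≤ M → |y| ≤ M → |z| ≤ M → |x * y * z| ≤ M ^ 3 :=
    fun x y z hx hy hz => by
      rw [abs_mul, pow_succ]; exact mul_le_mul (b2 x y hx hy) hz (abs_nonneg _) (by positivity)
  have b4 : |p * q * r * s| ≤ M ^ 4 := by
    rw [abs_mul, pow_succ]; exact mul_le_mul (b3 p q r hp hq hr) hs (abs_nonneg _) (by positivity)
  have e1 : |p + q + r + s| ≤ 4 * M ^ 4 := by
    rw [abs_le] at *; constructor <;> linarith
  have e2 : |p * q + p * r + p * s + q * r + q * s + r * s| ≤ 6 * M ^ 4 := by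
    have h1 := b2 p q hp hq; have h2 := b2 p r hp hr; have h3 := b2 p s hp hs
    have h4 := b2 q r hq hr; have h5 := b2 q s hq hs; have h6 := b2 r s hr hs
    rw [abs_le] at *; constructor <;> linarith
  have e3 : |p * q * r + p * q * s + p * r * s + q * r * s| ≤ 4 * M ^ 4 := by
    have h1 := b3 p q r hp hq hr; have h2 := b3 p q s hp hq hs
    have h3 := b3 p r s hp hr hs; have h4 := b3 q r s hq hr hs
    rw [abs_le] at *; constructor <;> linarith
  have hrec : ∀ l, D (l + 4) = (p + q + r + s) * D (l + 3) -
      (p * q + p * r + p * s + q * r + q * s + r * s) * D (l + 2) +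
      (p * q * r + p * q * s + p * r * s + q * r * s) * D (l + 1) - p * q * r * s * D l := by
    intro l; simp only [hD]; ring
  suffices ∀ l, |D l| ≤ ε * (15 * M ^ 4) ^ l from this l
  intro l
  induction l using Nat.strong_induction_on with
  | _ l ih =>
    by_cases hl : l < 4
    · exact (h l hl).trans (le_mul_of_one_le_right hε (one_le_pow₀ hB))
    · obtain ⟨k, rfl⟩ := Nat.exists_eq_add_of_le (not_lt.1 hl)
      rw [add_comm 4 k, hrec]
      set X := ε * (15 * M ^ 4) ^ (k + 3) with hX
      have hX0 : 0 ≤ X := by positivity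
      have hd : ∀ i ≤ 3, |D (k + i)| ≤ X := fun i hi =>
        (ih (k + i) (by omega)).trans (by rw [hX]; gcongr)
      have t1 := mul_le_mul e1 (hd 3 le_rfl) (abs_nonneg _) (by positivity)
      have t2 := mul_le_mul e2 (hd 2 (by norm_num)) (abs_nonneg _) (by positivity)
      have t3 := mul_le_mul e3 (hd 1 (by norm_num)) (abs_nonneg _) (by positivity)
      have t4 := mul_le_mul b4 (hd 0 (by norm_num)) (abs_nonneg _) (by positivity)
      rw [← abs_mul] at t1 t2 t3 t4
      have hgoal : ε * (15 * M ^ 4) ^ (k + 4) = 15 * M ^ 4 * X := by rw [hX]; ring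
      rw [hgoal]
      rw [add_zero] at t4
      rw [abs_le] at *
      constructor <;> linarith

/-- The kernel norm on a line is controlled by the moments. -/
theorem sum_exp_mul_le {ι : Type*} [Fintype ι] (c x : ι → ℝ) {ε B : ℝ}
    (h : ∀ l : ℕ, |∑ a, c a * x a ^ l| ≤ ε * B ^ l) :
    ∑ a, ∑ b, c a * c b * Real.exp (x a * x b) ≤ ε ^ 2 * Real.exp (B ^ 2) := by
  -- Expanding the exponential turns the form into the sum over l of the squared l-th moment divided
  -- by l!, to which the moment bounds apply term by term.
  have h1 : HasSum (fun l : ℕ => ∑ a, ∑ b, c a * c b * ((x a * x b) ^ l / l.factorial))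
      (∑ a, ∑ b, c a * c b * Real.exp (x a * x b)) := by
    refine hasSum_sum fun a _ => hasSum_sum fun b _ => HasSum.mul_left _ ?_
    rw [Real.exp_eq_exp_ℝ]
    exact NormedSpace.expSeries_div_hasSum_exp (x a * x b)
  have h2 : HasSum (fun l : ℕ => ε ^ 2 * ((B ^ 2) ^ l / l.factorial))
      (ε ^ 2 * Real.exp (B ^ 2)) := by
    refine HasSum.mul_left _ ?_
    rw [Real.exp_eq_exp_ℝ]
    exact NormedSpace.expSeries_div_hasSum_exp (B ^ 2)
  refine hasSum_le (fun l => ?_) h1 h2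
  have : ∑ a, ∑ b, c a * c b * ((x a * x b) ^ l / l.factorial) =
      (∑ a, c a * x a ^ l) ^ 2 / l.factorial := by
    rw [sq, Finset.sum_mul_sum, Finset.sum_div]
    refine Finset.sum_congr rfl fun a _ => ?_
    rw [Finset.sum_div]
    exact Finset.sum_congr rfl fun b _ => by rw [mul_pow]; ring
  rw [this, ← mul_div_assoc]
  gcongr
  rw [← sq_abs, ← pow_mul, mul_comm 2 l, pow_mul, ← mul_pow]
  exact pow_le_pow_left₀ (abs_nonneg _) (h l) 2

/-- The squared kernel distance of two discrete distributions. -/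
theorem integral_sq_sub_shiftDensity {d k l : ℕ} (w : Fin k → ℝ) (z : Fin k → E d)
    (w' : Fin l → ℝ) (z' : Fin l → E d) :
    Integrable (fun x => ((∑ j, w j * shiftDensity (z j) x) -
        ∑ j, w' j * shiftDensity (z' j) x) ^ 2) (stdGaussian (E d)) ∧
    ∫ x, ((∑ j, w j * shiftDensity (z j) x) -
        ∑ j, w' j * shiftDensity (z' j) x) ^ 2 ∂stdGaussian (E d) =
      ∑ a, ∑ b, (Sum.elim w fun j => -w' j) a * (Sum.elim w fun j => -w' j) b *
        Real.exp (inner ℝ (Sum.elim z z' a) (Sum.elim z z' b)) := by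
  have h1 := integrable_sq_sum_shiftDensity (ι := Fin k ⊕ Fin l)
    (Sum.elim w fun j => -w' j) (Sum.elim z z')
  have h2 := integral_sq_sum_shiftDensity (ι := Fin k ⊕ Fin l)
    (Sum.elim w fun j => -w' j) (Sum.elim z z')
  have e : ∀ x, ∑ a : Fin k ⊕ Fin l, (Sum.elim w fun j => -w' j) a *
      shiftDensity (Sum.elim z z' a) x =
      (∑ j, w j * shiftDensity (z j) x) - ∑ j, w' j * shiftDensity (z' j) x := by
    intro x; simp [sub_eq_add_neg]
  simp only [e] at h1 h2
  exact ⟨h1, h2⟩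

theorem exp_sub_exp_le (x y : ℝ) : Real.exp x - Real.exp y ≤ (x - y) * Real.exp x := by
  have h := Real.add_one_le_exp (y - x)
  have h2 : Real.exp y = Real.exp x * Real.exp (y - x) := by rw [← Real.exp_add]; ring_nf
  rw [h2]
  nlinarith [Real.exp_pos x]

/-- Here a = ‖v‖² and b = ⟨u, v⟩². The tangent bound for each exponential produces the common factor
(w₀w₁)²(a - b), with the mixed term entering with the opposite sign. The remaining differences of
exponentials are of order a, and this extra factor makes the bound quadratic in w₀w₁‖v‖ times the
residual. -/
theorem line_direction_bound {w₀ w₁ a b : ℝ} (h0 : 0 ≤ w₀) (h1 : 0 ≤ w₁) (hs : w₀ + w₁ = 1)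
    (hb : 0 ≤ b) (hab : b ≤ a) :
    w₀ * w₀ * (Real.exp (w₁ * w₁ * a) - Real.exp (w₁ * w₁ * b)) +
      2 * (w₀ * w₁) * (Real.exp (-(w₀ * w₁ * a)) - Real.exp (-(w₀ * w₁ * b))) +
      w₁ * w₁ * (Real.exp (w₀ * w₀ * a) - Real.exp (w₀ * w₀ * b)) ≤
    2 * Real.exp a * ((w₀ * w₁) ^ 2 * a * (a - b)) := by
  have ha : 0 ≤ a := hb.trans hab
  have t1 := mul_le_mul_of_nonneg_left (exp_sub_exp_le (w₁ * w₁ * a) (w₁ * w₁ * b))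
    (mul_nonneg h0 h0)
  have t3 := mul_le_mul_of_nonneg_left (exp_sub_exp_le (w₀ * w₀ * a) (w₀ * w₀ * b))
    (mul_nonneg h1 h1)
  have t2 := mul_le_mul_of_nonneg_left (exp_sub_exp_le (-(w₀ * w₁ * a)) (-(w₀ * w₁ * b)))
    (mul_nonneg zero_le_two (mul_nonneg h0 h1))
  have key : ∀ u v : ℝ, 0 ≤ u → 0 ≤ v → u + v = 1 →
      Real.exp (u * u * a) - Real.exp (-(u * v * a)) ≤ a * Real.exp a := by
    intro u v hu hv huv
    refine (exp_sub_exp_le _ _).trans ?_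
    have e : u * u * a - -(u * v * a) = u * a := by
      have : v = 1 - u := by linarith
      rw [this]; ring
    rw [e]
    have hu1 : u ≤ 1 := by linarith
    have : u * u * a ≤ a := mul_le_of_le_one_left ha (by nlinarith)
    exact mul_le_mul (mul_le_of_le_one_left ha hu1) (Real.exp_le_exp.2 this) (Real.exp_pos _).le ha
  have k1 := key w₁ w₀ h1 h0 (by linarith)
  have k2 := key w₀ w₁ h0 h1 hs
  rw [mul_comm w₁ w₀] at k1
  have hq : 0 ≤ (w₀ * w₁) ^ 2 * (a - b) := mul_nonneg (sq_nonneg _) (by linarith)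
  have k3 := mul_le_mul_of_nonneg_left (add_le_add k1 k2) hq
  nlinarith

/-! ### Errors in direction, centre and moments -/

section Comparison

variable {d : ℕ} {w : Fin 2 → ℝ} {μ : Fin 2 → E d} {u : E d}

/-- Projecting onto u does not change inner products with vectors on the line of u. So the mixed
terms of the quadratic form equal those of the projected measure, and the form is the difference of
the energies before and after projection, which `line_direction_bound` estimates. -/
theorem direction_error (hw : ∀ j, 0 ≤ w j) (h1 : ∑ j, w j = 1) (hu : ‖u‖ = 1) :
    ∫ x, ((∑ j, w j * shiftDensity (μ j - ∑ i, w i • μ i) x) -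
        ∑ j, w j * shiftDensity (inner ℝ u (μ j - ∑ i, w i • μ i) • u) x) ^ 2 ∂stdGaussian (E d) ≤
      2 * Real.exp (‖μ 0 - μ 1‖ ^ 2) * (w 0 * w 1 * ‖μ 0 - μ 1‖ *
        ‖(μ 0 - μ 1) - (inner ℝ u (μ 0 - μ 1) : ℝ) • u‖) ^ 2 := by
  rw [(integral_sq_sub_shiftDensity _ _ _ _).2]
  set v := μ 0 - μ 1 with hv
  rw [Fin.sum_univ_two] at h1
  have e0 : μ 0 - ∑ i, w i • μ i = w 1 • v := by
    have : w 1 = 1 - w 0 := by linarith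
    rw [Fin.sum_univ_two, hv, this]; module
  have e1 : μ 1 - ∑ i, w i • μ i = (-w 0) • v := by
    have : w 1 = 1 - w 0 := by linarith
    rw [Fin.sum_univ_two, hv, this]; module
  have huu : (inner ℝ u u : ℝ) = 1 := by rw [real_inner_self_eq_norm_sq, hu]; norm_num
  have hperp : ‖v - (inner ℝ u v : ℝ) • u‖ ^ 2 = ‖v‖ ^ 2 - inner ℝ u v ^ 2 := by
    rw [norm_sub_sq_real, real_inner_smul_right, norm_smul, hu, mul_one, Real.norm_eq_abs, sq_abs,
      real_inner_comm]
    ring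
  have hb : inner ℝ u v ^ 2 ≤ ‖v‖ ^ 2 := by
    have := sq_nonneg ‖v - (inner ℝ u v : ℝ) • u‖
    linarith
  have main := line_direction_bound (hw 0) (hw 1) h1 (sq_nonneg (inner ℝ u v)) hb
  rw [Fin.sum_univ_two] at e0 e1
  simp only [Fintype.sum_sum_type, Fin.sum_univ_two, Sum.elim_inl, Sum.elim_inr]
  have hvv := real_inner_self_eq_norm_sq v
  simp only [e0, e1, real_inner_smul_left, real_inner_smul_right, huu, hvv, real_inner_comm u v]
  refine le_trans (le_of_eq ?_) (main.trans (le_of_eq ?_))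
  · ring_nf
  · rw [mul_pow (w 0 * w 1 * ‖v‖), hperp]; ring

/-- Only the part of h orthogonal to u distinguishes the two measures. It adds η, the square of its
norm, to the inner products among the shifted atoms and nothing to the mixed ones. Hence the form is
e^η - 1 times the energy of the measure on the line. -/
theorem perp_shift_error {ŵ θ : Fin 2 → ℝ} {h : E d} {M : ℝ} (hw : ∀ j, 0 ≤ ŵ j)
    (h1 : ∑ j, ŵ j = 1) (hu : ‖u‖ = 1) (hM : ∀ j, |θ j + inner ℝ u h| ≤ M) (hh : ‖h‖ ≤ 1) :
    ∫ x, ((∑ j, ŵ j * shiftDensity ((θ j + inner ℝ u h) • u) x) -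
        ∑ j, ŵ j * shiftDensity (θ j • u + h) x) ^ 2 ∂stdGaussian (E d) ≤
      Real.exp (M ^ 2 + 1) * ‖h‖ ^ 2 := by
  rw [(integral_sq_sub_shiftDensity _ _ _ _).2]
  have huu : (inner ℝ u u : ℝ) = 1 := by rw [real_inner_self_eq_norm_sq, hu]; norm_num
  set β : ℝ := inner ℝ u h with hβ
  set η : ℝ := ‖h‖ ^ 2 - β ^ 2 with hη
  have hM0 : 0 ≤ M := (abs_nonneg _).trans (hM 0)
  have hβh : β ^ 2 ≤ ‖h‖ ^ 2 := by
    have := abs_real_inner_le_norm u h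
    rw [hu, one_mul] at this
    rw [← sq_abs β]
    exact pow_le_pow_left₀ (abs_nonneg _) this 2
  have hη0 : 0 ≤ η := by linarith
  have hη1 : η ≤ ‖h‖ ^ 2 := by have := sq_nonneg β; linarith
  have hη2 : η ≤ 1 := hη1.trans (by nlinarith [norm_nonneg h])
  have expand : ∀ i j, inner ℝ (θ i • u + h) (θ j • u + h) =
      (θ i + β) * (θ j + β) + η := by
    intro i j
    simp only [inner_add_left, inner_add_right, real_inner_smul_left, real_inner_smul_right, huu,
      real_inner_self_eq_norm_sq, real_inner_comm u h, ← hβ, hη]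
    ring
  have expand2 : ∀ i j, inner ℝ ((θ i + β) • u) (θ j • u + h) = (θ i + β) * (θ j + β) := by
    intro i j
    simp only [inner_add_right, real_inner_smul_left, real_inner_smul_right, huu, ← hβ]
    ring
  have expand3 : ∀ i j, inner ℝ (θ j • u + h) ((θ i + β) • u) = (θ i + β) * (θ j + β) := by
    intro i j; rw [real_inner_comm, expand2]
  have expand4 : ∀ i j, inner ℝ ((θ i + β) • u) ((θ j + β) • u) = (θ i + β) * (θ j + β) := by
    intro i j
    simp only [real_inner_smul_left, real_inner_smul_right, huu]
    ring
  have hbound : ∑ i, ∑ j, ŵ i * ŵ j * Real.exp ((θ i + β) * (θ j + β)) ≤ Real.exp (M ^ 2) := by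
    calc _ ≤ ∑ i, ∑ j, ŵ i * ŵ j * Real.exp (M ^ 2) := by
          refine Finset.sum_le_sum fun i _ => Finset.sum_le_sum fun j _ => ?_
          refine mul_le_mul_of_nonneg_left (Real.exp_le_exp.2 ?_) (mul_nonneg (hw i) (hw j))
          refine (le_abs_self _).trans ?_
          rw [abs_mul, sq]
          exact mul_le_mul (hM i) (hM j) (abs_nonneg _) hM0
      _ = Real.exp (M ^ 2) := by
          simp only [← Finset.sum_mul, ← Finset.mul_sum, h1, mul_one, one_mul]
  have heq : ∑ a, ∑ b, (Sum.elim ŵ fun j => -ŵ j) a * (Sum.elim ŵ fun j => -ŵ j) b *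
        Real.exp (inner ℝ (Sum.elim (fun j => (θ j + β) • u) (fun j => θ j • u + h) a)
          (Sum.elim (fun j => (θ j + β) • u) (fun j => θ j • u + h) b)) =
      (Real.exp η - 1) * ∑ i, ∑ j, ŵ i * ŵ j * Real.exp ((θ i + β) * (θ j + β)) := by
    simp only [Fintype.sum_sum_type, Sum.elim_inl, Sum.elim_inr, expand, expand2, expand3, expand4,
      Real.exp_add _ η, Fin.sum_univ_two]
    ring_nf
  rw [heq]
  have h3 : Real.exp η - 1 ≤ ‖h‖ ^ 2 * Real.exp 1 := by
    have := exp_sub_exp_le η 0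
    rw [Real.exp_zero, sub_zero] at this
    exact this.trans (mul_le_mul hη1 (Real.exp_le_exp.2 hη2) (Real.exp_pos _).le (sq_nonneg _))
  have h4 : 0 ≤ Real.exp η - 1 := by have := Real.add_one_le_exp η; linarith
  calc _ ≤ (Real.exp η - 1) * Real.exp (M ^ 2) := mul_le_mul_of_nonneg_left hbound h4
    _ ≤ ‖h‖ ^ 2 * Real.exp 1 * Real.exp (M ^ 2) := by gcongr
    _ = _ := by rw [Real.exp_add]; ring

/-- On a line the kernel is exp(xy), a power series in moments, and the difference of two two-atomic
measures has four nodes. The constraint l < 4 includes the total mass. -/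
theorem line_moment_error {w' x x' : Fin 2 → ℝ} {M ε : ℝ} (hM1 : 1 ≤ M) (hu : ‖u‖ = 1)
    (hx : ∀ j, |x j| ≤ M) (hx' : ∀ j, |x' j| ≤ M)
    (hm : ∀ l < 4, |∑ j, w j * x j ^ l - ∑ j, w' j * x' j ^ l| ≤ ε) :
    ∫ y, ((∑ j, w j * shiftDensity (x j • u) y) -
        ∑ j, w' j * shiftDensity (x' j • u) y) ^ 2 ∂stdGaussian (E d) ≤
      ε ^ 2 * Real.exp ((15 * M ^ 4) ^ 2) := by
  rw [(integral_sq_sub_shiftDensity _ _ _ _).2]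
  have huu : (inner ℝ u u : ℝ) = 1 := by rw [real_inner_self_eq_norm_sq, hu]; norm_num
  have hinner : ∀ a b, inner ℝ (Sum.elim (fun j => x j • u) (fun j => x' j • u) a)
      (Sum.elim (fun j => x j • u) (fun j => x' j • u) b) =
      Sum.elim x x' a * Sum.elim x x' b := by
    rintro (a | a) (b | b) <;>
      simp only [Sum.elim_inl, Sum.elim_inr, real_inner_smul_left, real_inner_smul_right, huu,
        mul_one, mul_comm]
  simp only [hinner]
  refine sum_exp_mul_le _ _ fun l => ?_
  have := abs_moment_diff_le hM1 (w 0) (w 1) (-w' 0) (-w' 1) (x 0) (x 1) (x' 0) (x' 1) (hx 0)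
    (hx 1) (hx' 0) (hx' 1) (ε := ε) (fun l hl => by
      have := hm l hl
      simp only [Fin.sum_univ_two] at this
      convert this using 2; ring) l
  convert this using 2
  simp [Fintype.sum_sum_type, Fin.sum_univ_two]
  ring

end Comparison

theorem abs_pow_sub_pow_le {M ε t s : ℝ} (hM1 : 1 ≤ M) (hε : 0 ≤ ε) (ht : |t| ≤ M) (hs : |s| ≤ M)
    (hts : |t - s| ≤ ε) {l : ℕ} (hl : l < 4) : |t ^ l - s ^ l| ≤ 3 * M ^ 2 * ε := by
  have hMM : M ≤ M ^ 2 := le_self_pow₀ hM1 two_ne_zero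
  have hMM2 : 1 ≤ M ^ 2 := one_le_pow₀ hM1
  interval_cases l
  · simp only [pow_zero, sub_self, abs_zero]; positivity
  · rw [pow_one, pow_one]
    exact hts.trans (le_mul_of_one_le_left hε (by linarith))
  · have : t ^ 2 - s ^ 2 = (t - s) * (t + s) := by ring
    rw [this, abs_mul, mul_comm]
    have h5 : |t + s| ≤ 3 * M ^ 2 := (abs_add_le _ _).trans (by linarith)
    exact mul_le_mul h5 hts (abs_nonneg _) (by positivity)
  · have : t ^ 3 - s ^ 3 = (t - s) * (t ^ 2 + t * s + s ^ 2) := by ring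
    rw [this, abs_mul, mul_comm]
    have b1 : |t ^ 2| ≤ M ^ 2 := by
      rw [abs_pow]; exact pow_le_pow_left₀ (abs_nonneg _) ht 2
    have b2 : |s ^ 2| ≤ M ^ 2 := by
      rw [abs_pow]; exact pow_le_pow_left₀ (abs_nonneg _) hs 2
    have b3 : |t * s| ≤ M ^ 2 := by
      rw [abs_mul, sq]; exact mul_le_mul ht hs (abs_nonneg _) (by linarith)
    have h5 : |t ^ 2 + t * s + s ^ 2| ≤ 3 * M ^ 2 := by
      refine (abs_add_le _ _).trans ?_
      linarith [abs_add_le (t ^ 2) (t * s)]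
    exact mul_le_mul h5 hts (abs_nonneg _) (by positivity)

theorem moment_shift_le {ŵ θ : Fin 2 → ℝ} {M ε β : ℝ} (hM1 : 1 ≤ M) (hε : 0 ≤ ε)
    (hw : ∀ j, 0 ≤ ŵ j) (h1 : ∑ j, ŵ j = 1) (hθ : ∀ j, |θ j| ≤ M) (hθβ : ∀ j, |θ j + β| ≤ M)
    (hβ : |β| ≤ ε) : ∀ l < 4,
      |∑ j, ŵ j * θ j ^ l - ∑ j, ŵ j * (θ j + β) ^ l| ≤ 3 * M ^ 2 * ε := by
  intro l hl
  rw [← Finset.sum_sub_distrib]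
  calc _ ≤ ∑ j, |ŵ j * θ j ^ l - ŵ j * (θ j + β) ^ l| := Finset.abs_sum_le_sum_abs _ _
    _ ≤ ∑ j, ŵ j * (3 * M ^ 2 * ε) := Finset.sum_le_sum fun j _ => by
        rw [← mul_sub, abs_mul, abs_of_nonneg (hw j)]
        refine mul_le_mul_of_nonneg_left (abs_pow_sub_pow_le hM1 hε (hθ j) (hθβ j) ?_ hl) (hw j)
        rwa [sub_add_cancel_left, abs_neg]
    _ = _ := by rw [← Finset.sum_mul, h1, one_mul]

theorem integral_sq_sub_le_three {α : Type*} [MeasurableSpace α] {ν : Measure α} {p q r s : α → ℝ}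
    (h0 : Integrable (fun x => (p x - s x) ^ 2) ν) (h1 : Integrable (fun x => (p x - q x) ^ 2) ν)
    (h2 : Integrable (fun x => (q x - r x) ^ 2) ν) (h3 : Integrable (fun x => (r x - s x) ^ 2) ν) :
    ∫ x, (p x - s x) ^ 2 ∂ν ≤ 3 * (∫ x, (p x - q x) ^ 2 ∂ν + ∫ x, (q x - r x) ^ 2 ∂ν +
      ∫ x, (r x - s x) ^ 2 ∂ν) := by
  have h12 : Integrable (fun x => (p x - q x) ^ 2 + (q x - r x) ^ 2) ν := h1.add h2
  rw [← integral_add h1 h2, ← integral_add h12 h3, ← integral_const_mul]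
  refine integral_mono h0 ((h12.add h3).const_mul 3) fun x => ?_
  beta_reduce
  nlinarith [sq_nonneg (p x - q x - (q x - r x)), sq_nonneg (q x - r x - (r x - s x)),
    sq_nonneg (p x - q x - (r x - s x))]

set_option maxHeartbeats 1000000 in
/-- Deterministic error bound: the mean, the direction and the one-dimensional moments determine the
mixture up to a constant factor. -/
theorem hellinger_le_of_estimates (R L : ℝ) (hR : 0 < R) (hL : 2 * R ≤ L) : ∃ C : ℝ, 0 < C ∧
    ∀ (d : ℕ) (ε : ℝ) (w : Fin 2 → ℝ) (μ : Fin 2 → E d) (u m : E d) (ŵ θ : Fin 2 → ℝ), 0 ≤ ε →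
      (∀ j, 0 ≤ w j) → ∑ j, w j = 1 → (∀ j, ‖μ j‖ ≤ R) → (∀ j, 0 ≤ ŵ j) → ∑ j, ŵ j = 1 →
      (∀ j, θ j ∈ Set.Icc (-L) L) → ‖u‖ = 1 → ‖m - ∑ j, w j • μ j‖ ≤ ε →
      ‖m - ∑ j, w j • μ j‖ ≤ 1 →
      w 0 * w 1 * ‖μ 0 - μ 1‖ * ‖(μ 0 - μ 1) - (inner ℝ u (μ 0 - μ 1) : ℝ) • u‖ ≤ ε →
      (∀ r : Fin 3, |∑ j, w j * (inner ℝ u (μ j - ∑ i, w i • μ i)) ^ ((r : ℕ) + 1) -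
        ∑ j, ŵ j * θ j ^ ((r : ℕ) + 1)| ≤ ε) →
      hellinger (mixture (atomic w μ)) (mixture (atomic ŵ fun j => θ j • u + m)) ≤ C * ε := by
  set M := L + 1 with hM
  set K₁ := 2 * Real.exp ((2 * R) ^ 2) with hK₁
  set K₂ := (1 + 3 * M ^ 2) ^ 2 * Real.exp ((15 * M ^ 4) ^ 2) with hK₂
  set K₃ := Real.exp (M ^ 2 + 1) with hK₃
  have hC0 : 0 < Real.exp ((2 * R) ^ 2 / 2) * (3 * (K₁ + K₂ + K₃)) := by positivity
  refine ⟨√(Real.exp ((2 * R) ^ 2 / 2) * (3 * (K₁ + K₂ + K₃))), Real.sqrt_pos.2 hC0, ?_⟩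
  intro d ε w μ u m ŵ θ hε hw h1 hμ hŵ h1' hθ hu hmε hm1 hdir hmom
  set a : E d := ∑ j, w j • μ j with ha
  set h : E d := m - a with hh
  have hanorm : ‖a‖ ≤ R := by
    calc ‖a‖ ≤ ∑ j, ‖w j • μ j‖ := norm_sum_le _ _
      _ ≤ ∑ j, w j * R := Finset.sum_le_sum fun j _ => by
          rw [norm_smul, Real.norm_of_nonneg (hw j)]
          exact mul_le_mul_of_nonneg_left (hμ j) (hw j)
      _ = R := by rw [← Finset.sum_mul, h1, one_mul]
  have hy : ∀ j, ‖μ j - a‖ ≤ 2 * R := fun j => (norm_sub_le _ _).trans (by linarith [hμ j])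
  have hy0 : ∑ j, w j • (μ j - a) = 0 := by
    simp only [smul_sub, Finset.sum_sub_distrib, ← Finset.sum_smul, h1, one_smul, ← ha, sub_self]
  have hβ : |(inner ℝ u h : ℝ)| ≤ ‖h‖ := by
    have := abs_real_inner_le_norm u h
    rwa [hu, one_mul] at this
  have hβ1 : |(inner ℝ u h : ℝ)| ≤ 1 := hβ.trans hm1
  have hβε : |(inner ℝ u h : ℝ)| ≤ ε := hβ.trans hmε
  have hL0 : 0 < L := by linarith
  have hθa : ∀ j, |θ j| ≤ L := fun j => abs_le.2 (hθ j)
  have hθβ : ∀ j, |θ j + inner ℝ u h| ≤ M := fun j =>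
    (abs_add_le _ _).trans (by rw [hM]; linarith [hθa j])
  have hx : ∀ j, |(inner ℝ u (μ j - a) : ℝ)| ≤ M := fun j => by
    have := abs_real_inner_le_norm u (μ j - a)
    rw [hu, one_mul] at this
    linarith [hy j]
  have hM1 : 1 ≤ M := by linarith
  -- Both mixtures are translated by the true mean a, the centring that makes the true density
  -- bounded below; the estimated atoms become θ_j u + h.
  have H := hellinger_sq_mixture_le hw h1 hy hy0 hŵ h1' (μ' := fun j => θ j • u + h) a
  have e1 : (fun j => a + (μ j - a)) = μ := by ext1 j; abel
  have e2 : (fun j => a + (θ j • u + h)) = fun j => θ j • u + m := by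
    ext1 j; rw [hh]; abel
  rw [e1, e2] at H
  have A := direction_error (μ := μ) hw h1 hu
  have C := perp_shift_error (h := h) hŵ h1' hu hθβ hm1
  have hmom' : ∀ l < 4, |∑ j, w j * (inner ℝ u (μ j - a) : ℝ) ^ l -
      ∑ j, ŵ j * (θ j + inner ℝ u h) ^ l| ≤ (1 + 3 * M ^ 2) * ε := by
    have shift := moment_shift_le (β := inner ℝ u h) hM1 hε hŵ h1'
      (fun j => (hθa j).trans (by linarith)) hθβ hβε
    intro l hl
    have hfirst : |∑ j, w j * (inner ℝ u (μ j - a) : ℝ) ^ l - ∑ j, ŵ j * θ j ^ l| ≤ ε := by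
      rcases Nat.eq_zero_or_pos l with rfl | hl0
      · simp only [pow_zero, mul_one, h1, h1', sub_self, abs_zero]; exact hε
      · have := hmom ⟨l - 1, by omega⟩
        simpa only [Nat.sub_add_cancel hl0] using this
    refine (abs_sub_le _ (∑ j, ŵ j * θ j ^ l) _).trans ?_
    linarith [shift l hl]
  have B := line_moment_error (w := w) (w' := ŵ) hM1 hu hx hθβ hmom'
  -- The chain of comparisons: the centred true atoms, their projections onto the line of u, the
  -- estimated atoms shifted along u by ⟨u, h⟩, and finally the estimated atoms shifted by all of h.
  have I1 := (integral_sq_sub_shiftDensity w (fun j => μ j - a) w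
    (fun j => (inner ℝ u (μ j - a) : ℝ) • u)).1
  have I2 := (integral_sq_sub_shiftDensity w (fun j => (inner ℝ u (μ j - a) : ℝ) • u) ŵ
    (fun j => (θ j + inner ℝ u h) • u)).1
  have I3 := (integral_sq_sub_shiftDensity ŵ (fun j => (θ j + inner ℝ u h) • u) ŵ
    (fun j => θ j • u + h)).1
  have I0 := (integral_sq_sub_shiftDensity w (fun j => μ j - a) ŵ (fun j => θ j • u + h)).1
  have hsplit : ∫ x, ((∑ j, w j * shiftDensity (μ j - a) x) -
      ∑ j, ŵ j * shiftDensity (θ j • u + h) x) ^ 2 ∂stdGaussian (E d) ≤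
      3 * (K₁ + K₂ + K₃) * ε ^ 2 := by
    have hA : 2 * Real.exp (‖μ 0 - μ 1‖ ^ 2) * (w 0 * w 1 * ‖μ 0 - μ 1‖ *
        ‖(μ 0 - μ 1) - (inner ℝ u (μ 0 - μ 1) : ℝ) • u‖) ^ 2 ≤ K₁ * ε ^ 2 := by
      have hv : ‖μ 0 - μ 1‖ ≤ 2 * R := (norm_sub_le _ _).trans (by linarith [hμ 0, hμ 1])
      have h00 := hw 0
      have h01 := hw 1
      rw [hK₁]
      gcongr
    have hB : ((1 + 3 * M ^ 2) * ε) ^ 2 * Real.exp ((15 * M ^ 4) ^ 2) = K₂ * ε ^ 2 := by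
      rw [hK₂]; ring
    have hCC : Real.exp (M ^ 2 + 1) * ‖h‖ ^ 2 ≤ K₃ * ε ^ 2 := by rw [hK₃]; gcongr
    refine (integral_sq_sub_le_three I0 I1 I2 I3).trans ?_
    linarith
  refine abs_le_of_sq_le_sq' ?_ (by positivity) |>.2
  refine H.trans ?_
  rw [mul_pow (√_), Real.sq_sqrt hC0.le, mul_assoc]
  gcongr

/-! ### Chernoff bounds with truncation -/

theorem exp_le_quadratic (t : ℝ) : Real.exp t ≤ 1 + t + t ^ 2 * Real.exp |t| := by
  have h1 : Real.exp t - 1 ≤ t * Real.exp t := by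
    have := exp_sub_exp_le t 0
    simpa using this
  rcases le_total 0 t with h | h
  · rw [abs_of_nonneg h]
    have : t * (Real.exp t - 1) ≤ t * (t * Real.exp t) := mul_le_mul_of_nonneg_left h1 h
    nlinarith
  · have h2 := Real.add_one_le_exp t
    have h3 : (1 : ℝ) ≤ Real.exp |t| := Real.one_le_exp (abs_nonneg t)
    have h4 : t * (Real.exp t - 1) ≤ t ^ 2 := by nlinarith
    nlinarith [sq_nonneg t]

/-- A second-order bound for the moment generating function on G. There λ|f| ≤ ψ, so the quadratic
term is dominated by an integrable multiple of e^{2ψ}. Truncation may destroy the vanishing of the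
mean; η bounds what is left of it. -/
theorem lintegral_exp_mul_le {α : Type*} [MeasurableSpace α] {ν : Measure α}
    [IsProbabilityMeasure ν] {f ψ : α → ℝ} {G : Set α} {lam A K η : ℝ}
    (hG : MeasurableSet G) (hlam : 0 ≤ lam) (hA : 0 ≤ A)
    (hfi : Integrable f ν) (hfA : ∀ x, f x ^ 2 ≤ A * Real.exp (ψ x))
    (hψi : Integrable (fun x => Real.exp (2 * ψ x)) ν) (hK : ∫ x, Real.exp (2 * ψ x) ∂ν ≤ K)
    (hGψ : ∀ x ∈ G, lam * |f x| ≤ ψ x) (hη : ∫ x in G, f x ∂ν ≤ η) :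
    ∫⁻ x in G, ENNReal.ofReal (Real.exp (lam * f x)) ∂ν ≤
      ENNReal.ofReal (Real.exp (lam * η + lam ^ 2 * (A * K))) := by
  have hpt : ∀ x ∈ G, Real.exp (lam * f x) ≤
      1 + lam * f x + lam ^ 2 * A * Real.exp (2 * ψ x) := by
    intro x hx
    refine (exp_le_quadratic _).trans ?_
    have h1 : Real.exp |lam * f x| ≤ Real.exp (ψ x) := by
      rw [abs_mul, abs_of_nonneg hlam]; exact Real.exp_le_exp.2 (hGψ x hx)
    have h2 : (lam * f x) ^ 2 * Real.exp |lam * f x| ≤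
        lam ^ 2 * (A * Real.exp (ψ x)) * Real.exp (ψ x) := by
      rw [mul_pow]
      exact mul_le_mul (mul_le_mul_of_nonneg_left (hfA x) (sq_nonneg _)) h1 (Real.exp_pos _).le
        (by positivity)
    have h3 : Real.exp (2 * ψ x) = Real.exp (ψ x) * Real.exp (ψ x) := by
      rw [← Real.exp_add]; ring_nf
    rw [h3]
    linarith
  have hi1 : Integrable (fun x => 1 + lam * f x) (ν.restrict G) :=
    (integrable_const _).add (hfi.restrict.const_mul lam)
  have hi2 : Integrable (fun x => lam ^ 2 * A * Real.exp (2 * ψ x)) (ν.restrict G) :=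
    hψi.restrict.const_mul _
  have hint : Integrable (fun x => 1 + lam * f x + lam ^ 2 * A * Real.exp (2 * ψ x))
      (ν.restrict G) := hi1.add hi2
  calc _ ≤ ∫⁻ x in G, ENNReal.ofReal (1 + lam * f x + lam ^ 2 * A * Real.exp (2 * ψ x)) ∂ν :=
        setLIntegral_mono' hG fun x hx => ENNReal.ofReal_le_ofReal (hpt x hx)
    _ = ENNReal.ofReal (∫ x in G, (1 + lam * f x + lam ^ 2 * A * Real.exp (2 * ψ x)) ∂ν) := by
        rw [ofReal_integral_eq_lintegral_ofReal hint]
        filter_upwards [ae_restrict_mem hG] with x hx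
        exact (Real.exp_pos _).le.trans (hpt x hx)
    _ ≤ _ := by
        refine ENNReal.ofReal_le_ofReal ?_
        rw [integral_add hi1 hi2, integral_add (integrable_const _) (hfi.restrict.const_mul lam),
          integral_const_mul, integral_const_mul, integral_const]
        have h1 : (ν.restrict G).real Set.univ • (1 : ℝ) ≤ 1 := by
          rw [smul_eq_mul, mul_one, measureReal_restrict_apply_univ]; exact measureReal_le_one
        have h2 : ∫ x in G, Real.exp (2 * ψ x) ∂ν ≤ K :=
          (setIntegral_le_integral hψi (Filter.Eventually.of_forall fun x => (Real.exp_pos _).le)).trans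
            hK
        have h3 := Real.add_one_le_exp (lam * η + lam ^ 2 * (A * K))
        have h4 := mul_le_mul_of_nonneg_left hη hlam
        have h5 := mul_le_mul_of_nonneg_left h2 (mul_nonneg (sq_nonneg lam) hA)
        linarith

/-- Markov's inequality for the product of the variables e^{λf} set to zero outside G. The
truncation stays in the event, so nothing is assumed about the integrability of e^{λf} outside G. -/
theorem chernoff_truncated {α : Type*} [MeasurableSpace α] {ν : Measure α}
    [IsProbabilityMeasure ν] {f : α → ℝ} {G : Set α} {lam b t : ℝ} (hf : Measurable f)
    (hG : MeasurableSet G) (hlam : 0 ≤ lam)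
    (hb : ∫⁻ x in G, ENNReal.ofReal (Real.exp (lam * f x)) ∂ν ≤ ENNReal.ofReal (Real.exp b))
    (n : ℕ) :
    Measure.pi (fun _ : Fin n => ν) {x | (∀ i, x i ∈ G) ∧ n * t ≤ ∑ i, f (x i)} ≤
      ENNReal.ofReal (Real.exp (n * (b - lam * t))) := by
  set g : α → ℝ≥0∞ := G.indicator fun x => ENNReal.ofReal (Real.exp (lam * f x)) with hg
  have hgm : Measurable g := Measurable.indicator (by fun_prop) hG
  have h1 := lintegral_pi_prod (fun _ : Fin n => ν) (fun _ => g) fun _ => hgm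
  rw [Finset.prod_const, Finset.card_univ, Fintype.card_fin, hg, lintegral_indicator hG, ← hg] at h1
  have h2 : ∫⁻ x, ∏ i, g (x i) ∂Measure.pi (fun _ : Fin n => ν) ≤
      ENNReal.ofReal (Real.exp (n * b)) := by
    rw [h1, Real.exp_nat_mul, ENNReal.ofReal_pow (Real.exp_pos _).le]
    gcongr
  have hm : Measurable fun x : Fin n → α => ∏ i, g (x i) :=
    Finset.measurable_prod _ fun i _ => hgm.comp (measurable_pi_apply i)
  have hsub : {x : Fin n → α | (∀ i, x i ∈ G) ∧ n * t ≤ ∑ i, f (x i)} ⊆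
      {x | ENNReal.ofReal (Real.exp (n * (lam * t))) ≤ ∏ i, g (x i)} := by
    rintro x ⟨hx, hxt⟩
    have : ∏ i, g (x i) = ENNReal.ofReal (Real.exp (lam * ∑ i, f (x i))) := by
      rw [Finset.mul_sum, Real.exp_sum, ENNReal.ofReal_prod_of_nonneg fun i _ => (Real.exp_pos _).le]
      exact Finset.prod_congr rfl fun i _ => Set.indicator_of_mem (hx i) _
    change ENNReal.ofReal (Real.exp (n * (lam * t))) ≤ ∏ i, g (x i)
    rw [this]
    refine ENNReal.ofReal_le_ofReal (Real.exp_le_exp.2 ?_)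
    have := mul_le_mul_of_nonneg_left hxt hlam
    linarith
  refine (measure_mono hsub).trans ?_
  refine (meas_ge_le_lintegral_div hm.aemeasurable
    (by simp [Real.exp_pos]) ENNReal.ofReal_ne_top).trans ?_
  refine (ENNReal.div_le_div_right h2 _).trans ?_
  rw [← ENNReal.ofReal_div_of_pos (Real.exp_pos _), ← Real.exp_sub]
  refine ENNReal.ofReal_le_ofReal (Real.exp_le_exp.2 (by linarith))

/-! ### One-dimensional mixtures -/

/-- The mixture of the normal distributions `N(z j, 1)` with weights `w j`. -/
def lineMix {k : ℕ} (w z : Fin k → ℝ) : Measure ℝ :=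
  ∑ j, ENNReal.ofReal (w j) • gaussianReal (z j) 1

theorem isProbabilityMeasure_lineMix {k : ℕ} {w : Fin k → ℝ} (hw : ∀ j, 0 ≤ w j)
    (h1 : ∑ j, w j = 1) (z : Fin k → ℝ) : IsProbabilityMeasure (lineMix w z) := by
  refine ⟨?_⟩
  simp [lineMix, Measure.finsetSum_apply, ← ENNReal.ofReal_sum_of_nonneg fun j _ => hw j, h1]

theorem map_stdGaussian_inner {d : ℕ} {u : E d} (hu : ‖u‖ = 1) :
    (stdGaussian (E d)).map (fun x => inner ℝ u x) = gaussianReal 0 1 := by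
  have h := IsGaussian.map_eq_gaussianReal (μ := stdGaussian (E d)) (innerSL ℝ u)
  rw [integral_strongDual_stdGaussian, variance_dual_stdGaussian, innerSL_apply_norm, hu] at h
  have e : (fun x => inner ℝ u x) = ⇑(innerSL ℝ u : StrongDual ℝ (E d)) := by
    ext x; simp
  rw [e, h]
  simp

theorem map_mixture_inner {d k : ℕ} (w : Fin k → ℝ) (μ : Fin k → E d) {u : E d} (hu : ‖u‖ = 1)
    (a : E d) : (mixture (atomic w μ)).map (fun x => inner ℝ u (x - a)) =
      lineMix w fun j => inner ℝ u (μ j - a) := by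
  have hm : Measurable fun x : E d => (inner ℝ u (x - a) : ℝ) := by fun_prop
  rw [conv_atomic, lineMix, ← Measure.mapₗ_apply_of_measurable hm, map_sum]
  refine Finset.sum_congr rfl fun j _ => ?_
  rw [map_smul, Measure.mapₗ_apply_of_measurable hm, Measure.map_map hm (by fun_prop)]
  congr 1
  have e : (fun x : E d => (inner ℝ u (x - a) : ℝ)) ∘ (fun x => μ j + x) =
      (fun y => inner ℝ u (μ j - a) + y) ∘ fun x => inner ℝ u x := by
    ext x
    simp only [Function.comp, ← inner_add_right]
    congr 1; abel
  rw [e, ← Measure.map_map (by fun_prop) (by fun_prop), map_stdGaussian_inner hu,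
    gaussianReal_map_const_add, zero_add]

theorem integrable_lineMix {k : ℕ} {w z : Fin k → ℝ} {f : ℝ → ℝ}
    (hf : ∀ j, Integrable f (gaussianReal (z j) 1)) : Integrable f (lineMix w z) := by
  unfold lineMix
  exact integrable_finsetSum_measure.2 fun j _ => (hf j).smul_measure ENNReal.ofReal_ne_top

theorem integral_lineMix {k : ℕ} {w z : Fin k → ℝ} (hw : ∀ j, 0 ≤ w j) {f : ℝ → ℝ}
    (hf : ∀ j, Integrable f (gaussianReal (z j) 1)) :
    ∫ y, f y ∂lineMix w z = ∑ j, w j * ∫ y, f y ∂gaussianReal (z j) 1 := by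
  unfold lineMix
  rw [integral_finsetSum_measure fun j _ => (hf j).smul_measure ENNReal.ofReal_ne_top]
  refine Finset.sum_congr rfl fun j _ => ?_
  rw [integral_smul_measure, ENNReal.toReal_ofReal (hw j), smul_eq_mul]

theorem integrable_exp_sq_gaussian :
    Integrable (fun g : ℝ => Real.exp (g ^ 2 / 4)) (gaussianReal 0 1) := by
  rw [gaussianReal_of_var_ne_zero _ one_ne_zero, integrable_withDensity_iff
    (measurable_gaussianPDF _ _) (Filter.Eventually.of_forall fun x => gaussianPDF_lt_top)]
  simp only [toReal_gaussianPDF, gaussianPDFReal]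
  have : (fun x : ℝ => Real.exp (x ^ 2 / 4) * ((√(2 * Real.pi * ((1 : NNReal) : ℝ)))⁻¹ *
      Real.exp (-(x - 0) ^ 2 / (2 * ((1 : NNReal) : ℝ))))) =
      fun x => (√(2 * Real.pi * ((1 : NNReal) : ℝ)))⁻¹ * Real.exp (-(1 / 4) * x ^ 2) := by
    ext x
    rw [mul_left_comm, ← Real.exp_add]
    congr 2
    simp
    ring
  rw [this]
  exact (integrable_exp_neg_mul_sq (by norm_num)).const_mul _

theorem exp_sq_gaussian_bound (B : ℝ) : ∃ K : ℝ, 0 < K ∧ ∀ z : ℝ, |z| ≤ B →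
    Integrable (fun y => Real.exp (2 * ((1 + y ^ 2) / 16))) (gaussianReal z 1) ∧
      ∫ y, Real.exp (2 * ((1 + y ^ 2) / 16)) ∂gaussianReal z 1 ≤ K := by
  refine ⟨Real.exp (1 / 8 + B ^ 2 / 4) * ∫ g, Real.exp (g ^ 2 / 4) ∂gaussianReal 0 1,
    mul_pos (Real.exp_pos _) (integral_exp_pos integrable_exp_sq_gaussian), fun z hz => ?_⟩
  have hmap : gaussianReal z 1 = (gaussianReal 0 1).map (z + ·) := by
    rw [gaussianReal_map_const_add, zero_add]
  have hpt : ∀ g : ℝ, Real.exp (2 * ((1 + (z + g) ^ 2) / 16)) ≤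
      Real.exp (1 / 8 + B ^ 2 / 4) * Real.exp (g ^ 2 / 4) := by
    intro g
    rw [← Real.exp_add]
    refine Real.exp_le_exp.2 ?_
    have h1 : z ^ 2 ≤ B ^ 2 := by
      rw [← sq_abs z]; exact pow_le_pow_left₀ (abs_nonneg z) hz 2
    -- By (z + g)² ≤ 2z² + 2g² the exponent is at most 1/8 + z²/4 + g²/4; the coefficient of g²
    -- stays below the 1/2 of the Gaussian density.
    nlinarith [sq_nonneg (z - g)]
  have hi : Integrable (fun g : ℝ => Real.exp (2 * ((1 + (z + g) ^ 2) / 16))) (gaussianReal 0 1) := by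
    refine (integrable_exp_sq_gaussian.const_mul (Real.exp (1 / 8 + B ^ 2 / 4))).mono'
      (by fun_prop) (Filter.Eventually.of_forall fun g => ?_)
    rw [Real.norm_of_nonneg (Real.exp_pos _).le]
    exact hpt g
  rw [hmap]
  constructor
  · rw [integrable_map_measure (by fun_prop) (by fun_prop)]
    exact hi
  · rw [integral_map (by fun_prop) (by fun_prop), ← integral_const_mul]
    exact integral_mono hi (integrable_exp_sq_gaussian.const_mul _) hpt

/-- The cubic term of the exponential series at (1 + y²)/16; the constant is 3! · 16³. -/
theorem cube_le_exp (y : ℝ) : (1 + y ^ 2) ^ 3 ≤ 24576 * Real.exp ((1 + y ^ 2) / 16) := by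
  have h := Real.pow_div_factorial_le_exp ((1 + y ^ 2) / 16) (by positivity) 3
  have : Nat.factorial 3 = 6 := rfl
  rw [this, div_pow] at h
  push_cast at h
  linarith

theorem sq_le_exp_of_growth {f : ℝ → ℝ} {A : ℝ} (hfA : ∀ y, f y ^ 2 ≤ A ^ 2 * (1 + y ^ 2) ^ 3)
    (y : ℝ) : f y ^ 2 ≤ A ^ 2 * 24576 * Real.exp ((1 + y ^ 2) / 16) := by
  have := mul_le_mul_of_nonneg_left (cube_le_exp y) (sq_nonneg A)
  linarith [hfA y]

theorem integrable_of_growth {f : ℝ → ℝ} (hf : Measurable f) {A : ℝ}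
    (hfA : ∀ y, f y ^ 2 ≤ A ^ 2 * (1 + y ^ 2) ^ 3) (z : ℝ) :
    MemLp f 2 (gaussianReal z 1) := by
  rw [memLp_two_iff_integrable_sq hf.aestronglyMeasurable]
  obtain ⟨K, -, hK⟩ := exp_sq_gaussian_bound |z|
  refine ((hK z le_rfl).1.const_mul (A ^ 2 * 24576)).mono' (by fun_prop)
    (Filter.Eventually.of_forall fun y => ?_)
  rw [Real.norm_of_nonneg (sq_nonneg _)]
  refine (sq_le_exp_of_growth hfA y).trans ?_
  gcongr
  have : 0 ≤ (1 + y ^ 2) / 16 := by positivity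
  linarith

theorem lineMix_exp_bound {k : ℕ} {w z : Fin k → ℝ} {B K : ℝ} (hw : ∀ j, 0 ≤ w j)
    (h1 : ∑ j, w j = 1) (hz : ∀ j, |z j| ≤ B)
    (hK : ∀ z : ℝ, |z| ≤ B →
      Integrable (fun y => Real.exp (2 * ((1 + y ^ 2) / 16))) (gaussianReal z 1) ∧
      ∫ y, Real.exp (2 * ((1 + y ^ 2) / 16)) ∂gaussianReal z 1 ≤ K) :
    Integrable (fun y => Real.exp (2 * ((1 + y ^ 2) / 16))) (lineMix w z) ∧
      ∫ y, Real.exp (2 * ((1 + y ^ 2) / 16)) ∂lineMix w z ≤ K := by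
  refine ⟨integrable_lineMix fun j => (hK _ (hz j)).1, ?_⟩
  rw [integral_lineMix hw fun j => (hK _ (hz j)).1]
  calc _ ≤ ∑ j, w j * K := Finset.sum_le_sum fun j _ =>
        mul_le_mul_of_nonneg_left (hK _ (hz j)).2 (hw j)
    _ = K := by rw [← Finset.sum_mul, h1, one_mul]

/-- Bernstein-type deviation bound for functions of quadratic growth. -/
theorem deviation_quadratic (B A κ : ℝ) (hA : 0 ≤ A) (hκ : 0 ≤ κ) : ∃ C : ℝ, 0 < C ∧
    ∀ (w z : Fin 2 → ℝ), (∀ j, 0 ≤ w j) → ∑ j, w j = 1 → (∀ j, |z j| ≤ B) →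
    ∀ (n : ℕ) (S : ℝ), 1 ≤ n → 0 < S → S ≤ n →
    ∀ f : ℝ → ℝ, Measurable f → (∀ y, |f y| ≤ A * (1 + y ^ 2)) → ∫ y, f y ∂lineMix w z = 0 →
      Measure.pi (fun _ : Fin n => lineMix w z) {y | n * (C * √(S / n)) ≤ ∑ i, f (y i)} ≤
        ENNReal.ofReal (Real.exp (-(κ * S))) := by
  obtain ⟨K, hK0, hK⟩ := exp_sq_gaussian_bound B
  -- For quadratic growth the choice λ = c₀s with s ≤ 1 gives λ|f| ≤ (1 + y²)/16 everywhere, so no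
  -- truncation is needed. The constant in the deviation makes the final exponent -(κ + c₀)S.
  set c₀ : ℝ := 1 / (16 * (A + 1)) with hc₀
  have hc0 : 0 < c₀ := by positivity
  set A' : ℝ := A ^ 2 * 24576 with hA'
  have hA'0 : 0 ≤ A' := by positivity
  refine ⟨c₀ * (A' * K) + κ / c₀ + 1, by positivity, ?_⟩
  intro w z hw h1 hz n S hn hS hSn f hf hfA hmean
  have hn0 : (0 : ℝ) < n := by exact_mod_cast hn
  have hP := isProbabilityMeasure_lineMix hw h1 z
  have hgrow : ∀ y, f y ^ 2 ≤ A ^ 2 * (1 + y ^ 2) ^ 3 := by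
    intro y
    rw [← sq_abs]
    have h2 : 1 ≤ 1 + y ^ 2 := by nlinarith
    calc |f y| ^ 2 ≤ (A * (1 + y ^ 2)) ^ 2 := pow_le_pow_left₀ (abs_nonneg _) (hfA y) 2
      _ = A ^ 2 * (1 + y ^ 2) ^ 2 := by ring
      _ ≤ _ := by gcongr; norm_num
  have hfi : Integrable f (lineMix w z) := integrable_lineMix fun j =>
    (integrable_of_growth hf hgrow (z j)).integrable (by norm_num)
  obtain ⟨hψi, hψK⟩ := lineMix_exp_bound hw h1 hz hK
  set s : ℝ := √(S / n) with hs
  have hs0 : 0 ≤ s := Real.sqrt_nonneg _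
  have hs2 : n * s ^ 2 = S := by rw [hs, Real.sq_sqrt (by positivity)]; field_simp
  have hs1 : s ≤ 1 := Real.sqrt_le_one.2 (by rw [div_le_one hn0]; exact hSn)
  have hb := lintegral_exp_mul_le (ν := lineMix w z) (f := f) (ψ := fun y => (1 + y ^ 2) / 16)
    (G := Set.univ) (lam := c₀ * s) (η := 0) MeasurableSet.univ (by positivity) hA'0 hfi
    (sq_le_exp_of_growth hgrow) hψi hψK (fun y _ => by
      have h2 : 0 ≤ 1 + y ^ 2 := by positivity
      have h3 : c₀ * A ≤ 1 / 16 := by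
        rw [hc₀, div_mul_eq_mul_div, div_le_div_iff₀ (by positivity) (by norm_num)]; linarith
      calc c₀ * s * |f y| ≤ c₀ * 1 * (A * (1 + y ^ 2)) := by
            gcongr; exact hfA y
        _ = (c₀ * A) * (1 + y ^ 2) := by ring
        _ ≤ 1 / 16 * (1 + y ^ 2) := by gcongr
        _ = _ := by ring) (by rw [setIntegral_univ, hmean])
  have hch := chernoff_truncated (t := (c₀ * (A' * K) + κ / c₀ + 1) * s) hf MeasurableSet.univ
    (by positivity) hb n
  simp only [Set.mem_univ, implies_true, true_and] at hch
  refine hch.trans (ENNReal.ofReal_le_ofReal (Real.exp_le_exp.2 ?_))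
  have e : (n : ℝ) * (c₀ * s * 0 + (c₀ * s) ^ 2 * (A' * K) -
      c₀ * s * ((c₀ * (A' * K) + κ / c₀ + 1) * s)) = (n * s ^ 2) * (-κ - c₀) := by
    field_simp; ring
  rw [e, hs2]
  nlinarith

theorem log_le_two_sqrt {n : ℕ} (hn : 1 ≤ n) : Real.log n ≤ 2 * √(n : ℝ) := by
  have hn0 : (0 : ℝ) < n := by exact_mod_cast hn
  have h := Real.log_le_sub_one_of_pos (Real.sqrt_pos.2 hn0)
  rw [Real.log_sqrt hn0.le] at h
  linarith

set_option maxHeartbeats 1000000 in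
/-- Deviation bound for functions of cubic growth, in the range of deviations where the
tail of a single variable does not matter. -/
theorem deviation_cubic (B A κ : ℝ) (hA : 0 ≤ A) (hκ : 0 ≤ κ) : ∃ C : ℝ, 0 < C ∧
    ∀ (w z : Fin 2 → ℝ), (∀ j, 0 ≤ w j) → ∑ j, w j = 1 → (∀ j, |z j| ≤ B) →
    ∀ (n : ℕ) (S : ℝ), 1 ≤ n → 1 ≤ S → S ≤ 2 * √(n : ℝ) →
    ∀ f : ℝ → ℝ, Measurable f → (∀ y, f y ^ 2 ≤ A ^ 2 * (1 + y ^ 2) ^ 3) →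
      ∫ y, f y ∂lineMix w z = 0 →
      Measure.pi (fun _ : Fin n => lineMix w z) {y | n * (C * √(S / n)) ≤ ∑ i, f (y i)} ≤
        ENNReal.ofReal (2 * Real.exp (-(κ * S))) := by
  obtain ⟨K, hK0, hK⟩ := exp_sq_gaussian_bound B
  -- The truncation level is y² ≤ k(S + log n). With this k, the probability that one of n variables
  -- exceeds it is at most nK e^{-k(S + log n)/8} ≤ e^{-κS}.
  set k : ℝ := 8 * (κ + 2 + K) with hk
  have hk0 : 0 < k := by positivity
  have hk16 : 16 ≤ k := by rw [hk]; linarith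
  set c₀ : ℝ := 1 / (16 * (A + 1) * √(2 + 8 * k)) with hc₀
  have hc0 : 0 < c₀ := by positivity
  have hc0sq : c₀ ^ 2 * A ^ 2 * (2 + 8 * k) ≤ 1 / 256 := by
    rw [hc₀, div_pow, mul_pow, Real.sq_sqrt (by positivity)]
    have : A ^ 2 ≤ (A + 1) ^ 2 := by gcongr; linarith
    calc _ = A ^ 2 / (256 * (A + 1) ^ 2) := by field_simp; ring
      _ ≤ _ := by rw [div_le_div_iff₀ (by positivity) (by norm_num)]; linarith
  set A' : ℝ := A ^ 2 * 24576 with hA'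
  have hA'0 : 0 ≤ A' := by positivity
  refine ⟨(A' + 1) * K + c₀ * (A' * K) + κ / c₀, by positivity, ?_⟩
  intro w z hw h1 hz n S hn hS1 hSn f hf hgrow hmean
  have hn1 : (1 : ℝ) ≤ n := by exact_mod_cast hn
  have hn0 : (0 : ℝ) < n := by linarith
  have hP := isProbabilityMeasure_lineMix hw h1 z
  have hfi : Integrable f (lineMix w z) := integrable_lineMix fun j =>
    (integrable_of_growth hf hgrow (z j)).integrable (by norm_num)
  obtain ⟨hψi, hψK⟩ := lineMix_exp_bound hw h1 hz hK
  set s : ℝ := √(S / n) with hs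
  have hs0 : 0 ≤ s := Real.sqrt_nonneg _
  have hs2 : n * s ^ 2 = S := by rw [hs, Real.sq_sqrt (by positivity)]; field_simp
  set q : ℝ := √(n : ℝ) with hq
  have hq2 : q ^ 2 = n := Real.sq_sqrt hn0.le
  have hq1 : 1 ≤ q := Real.one_le_sqrt.2 hn1
  set l : ℝ := Real.log n with hl
  have hl0 : 0 ≤ l := Real.log_nonneg hn1
  have hlq : l ≤ 2 * q := log_le_two_sqrt hn
  set b2 : ℝ := k * (S + l) with hb2
  set G : Set ℝ := {y | y ^ 2 ≤ b2} with hG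
  have hGm : MeasurableSet G := measurableSet_le (by fun_prop) (by fun_prop)
  -- The only place where S ≤ 2√n matters: it bounds S²/n and S log(n)/n. On G one factor 1 + y² of
  -- the cubic growth is then absorbed by s², and c₀ is chosen to give λ|f| ≤ (1 + y²)/16.
  have hsl : s ^ 2 * (1 + b2) ≤ 2 + 8 * k := by
    have h2 : s ^ 2 = S / n := Real.sq_sqrt (by positivity)
    rw [h2, div_mul_eq_mul_div, div_le_iff₀ hn0, ← hq2, hb2]
    have a1 : S ≤ 2 * q ^ 2 := by nlinarith
    have a2 : S * S ≤ 4 * q ^ 2 := by nlinarith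
    have a3 : S * l ≤ 4 * q ^ 2 := by nlinarith
    nlinarith
  have hψ0 : ∀ y : ℝ, 0 ≤ (1 + y ^ 2) / 16 := fun y => by positivity
  have hlamf : ∀ y ∈ G, c₀ * s * |f y| ≤ (1 + y ^ 2) / 16 := by
    intro y hy
    refine abs_le_of_sq_le_sq' ?_ (hψ0 y) |>.2
    have hy' : y ^ 2 ≤ b2 := hy
    calc (c₀ * s * |f y|) ^ 2 = c₀ ^ 2 * s ^ 2 * f y ^ 2 := by rw [mul_pow, mul_pow, sq_abs]
      _ ≤ c₀ ^ 2 * s ^ 2 * (A ^ 2 * (1 + y ^ 2) ^ 3) := by gcongr; exact hgrow y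
      _ = c₀ ^ 2 * A ^ 2 * (s ^ 2 * (1 + y ^ 2)) * (1 + y ^ 2) ^ 2 := by ring
      _ ≤ c₀ ^ 2 * A ^ 2 * (2 + 8 * k) * (1 + y ^ 2) ^ 2 := by
          gcongr
          exact le_trans (by gcongr) hsl
      _ ≤ 1 / 256 * (1 + y ^ 2) ^ 2 := by gcongr
      _ = _ := by ring
  have hout : ∀ y ∉ G, Real.exp (b2 / 16) ≤ Real.exp ((1 + y ^ 2) / 16) := by
    intro y hy
    have hy' : b2 < y ^ 2 := not_le.1 hy
    exact Real.exp_le_exp.2 (by linarith)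
  have hb2l : n ≤ Real.exp (b2 / 16) := by
    rw [← Real.log_le_iff_le_exp hn0, ← hl, hb2]; nlinarith
  -- The mean of f over G is minus the mean over the complement, where e^{ψ} ≥ n. So truncation
  -- shifts the mean by O(1/n) only.
  have hη : ∫ y in G, f y ∂lineMix w z ≤ (A' + 1) * K / n := by
    have hsplit := integral_add_compl hGm hfi
    rw [hmean] at hsplit
    have : ∫ y in G, f y ∂lineMix w z = -∫ y in Gᶜ, f y ∂lineMix w z := by linarith
    rw [this]
    refine (neg_le_abs _).trans ((abs_integral_le_integral_abs).trans ?_)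
    calc ∫ y in Gᶜ, |f y| ∂lineMix w z ≤
          ∫ y in Gᶜ, (A' + 1) / n * Real.exp (2 * ((1 + y ^ 2) / 16)) ∂lineMix w z := by
          refine setIntegral_mono_on hfi.abs.integrableOn (hψi.const_mul _).integrableOn
            hGm.compl fun y hy => ?_
          have h2 : |f y| ≤ (A' + 1) * Real.exp ((1 + y ^ 2) / 16) := by
            refine abs_le_of_sq_le_sq ?_ (by positivity)
            have h3 := sq_le_exp_of_growth hgrow y
            have h4 : 1 ≤ Real.exp ((1 + y ^ 2) / 16) := Real.one_le_exp (hψ0 y)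
            have h5 : A' ≤ (A' + 1) ^ 2 := by nlinarith
            calc f y ^ 2 ≤ A' * Real.exp ((1 + y ^ 2) / 16) := h3
              _ ≤ (A' + 1) ^ 2 * (Real.exp ((1 + y ^ 2) / 16) * Real.exp ((1 + y ^ 2) / 16)) := by
                  gcongr
                  exact le_mul_of_one_le_left (by positivity) h4
              _ = _ := by ring
          have h6 : n * Real.exp ((1 + y ^ 2) / 16) ≤ Real.exp (2 * ((1 + y ^ 2) / 16)) := by
            rw [two_mul, Real.exp_add]
            gcongr
            exact hb2l.trans (hout y hy)
          calc |f y| ≤ (A' + 1) * Real.exp ((1 + y ^ 2) / 16) := h2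
            _ = (A' + 1) / n * (n * Real.exp ((1 + y ^ 2) / 16)) := by field_simp
            _ ≤ _ := by gcongr
      _ ≤ (A' + 1) / n * K := by
          rw [integral_const_mul]
          gcongr
          exact (setIntegral_le_integral hψi
            (Filter.Eventually.of_forall fun x => (Real.exp_pos _).le)).trans hψK
      _ = _ := by ring
  have hb := lintegral_exp_mul_le (ν := lineMix w z) (f := f) (ψ := fun y => (1 + y ^ 2) / 16)
    (lam := c₀ * s) hGm (by positivity) hA'0 hfi (sq_le_exp_of_growth hgrow) hψi hψK hlamf hη
  have hch := chernoff_truncated (t := ((A' + 1) * K + c₀ * (A' * K) + κ / c₀) * s) hf hGm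
    (by positivity) hb n
  have hsS : s ≤ S := by
    have h2 : s ^ 2 ≤ S := by
      rw [← hs2]; exact le_mul_of_one_le_left (sq_nonneg s) hn1
    rcases le_total s 1 with h | h
    · exact h.trans hS1
    · exact (le_self_pow₀ h two_ne_zero).trans h2
  have hexp : (n : ℝ) * (c₀ * s * ((A' + 1) * K / n) + (c₀ * s) ^ 2 * (A' * K) -
      c₀ * s * (((A' + 1) * K + c₀ * (A' * K) + κ / c₀) * s)) ≤ -(κ * S) := by
    have e : (n : ℝ) * (c₀ * s * ((A' + 1) * K / n) + (c₀ * s) ^ 2 * (A' * K) -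
        c₀ * s * (((A' + 1) * K + c₀ * (A' * K) + κ / c₀) * s)) =
        c₀ * ((A' + 1) * K) * s - (n * s ^ 2) * (c₀ * ((A' + 1) * K) + κ) := by
      field_simp; ring
    rw [e, hs2]
    have : c₀ * ((A' + 1) * K) * s ≤ c₀ * ((A' + 1) * K) * S := by gcongr
    linarith
  have hGc : lineMix w z Gᶜ ≤ ENNReal.ofReal (K * Real.exp (-(b2 / 8))) := by
    have hsub : Gᶜ ⊆ {y | ENNReal.ofReal (Real.exp (b2 / 8)) ≤
        ENNReal.ofReal (Real.exp (2 * ((1 + y ^ 2) / 16)))} := by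
      intro y hy
      refine ENNReal.ofReal_le_ofReal ?_
      have := Real.exp_le_exp.1 (hout y hy)
      exact Real.exp_le_exp.2 (by linarith)
    refine (measure_mono hsub).trans ((meas_ge_le_lintegral_div (by fun_prop)
      (by simp [Real.exp_pos]) ENNReal.ofReal_ne_top).trans ?_)
    rw [← ofReal_integral_eq_lintegral_ofReal hψi (Filter.Eventually.of_forall fun x =>
      (Real.exp_pos _).le), ← ENNReal.ofReal_div_of_pos (Real.exp_pos _), div_eq_mul_inv,
      ← Real.exp_neg]
    refine ENNReal.ofReal_le_ofReal ?_
    gcongr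
  have hbad : Measure.pi (fun _ : Fin n => lineMix w z) {y | ∃ i, y i ∉ G} ≤
      ENNReal.ofReal (Real.exp (-(κ * S))) := by
    have e : {y : Fin n → ℝ | ∃ i, y i ∉ G} = ⋃ i, (fun y => y i) ⁻¹' Gᶜ := by
      ext y; simp
    rw [e]
    refine (measure_iUnion_le _).trans ?_
    rw [tsum_fintype]
    have : ∀ i : Fin n, Measure.pi (fun _ : Fin n => lineMix w z) ((fun y => y i) ⁻¹' Gᶜ) =
        lineMix w z Gᶜ := fun i =>
      (measurePreserving_eval (fun _ : Fin n => lineMix w z) i).measure_preimage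
        hGm.compl.nullMeasurableSet
    simp only [this, Finset.sum_const, Finset.card_univ, Fintype.card_fin, nsmul_eq_mul]
    calc (n : ℝ≥0∞) * lineMix w z Gᶜ ≤ n * ENNReal.ofReal (K * Real.exp (-(b2 / 8))) := by gcongr
      _ = ENNReal.ofReal (n * (K * Real.exp (-(b2 / 8)))) := by
          rw [← ENNReal.ofReal_natCast, ← ENNReal.ofReal_mul hn0.le]
      _ ≤ _ := by
          refine ENNReal.ofReal_le_ofReal ?_
          have h2 : (n : ℝ) = Real.exp l := (Real.exp_log hn0).symm
          have h3 : K ≤ Real.exp K := by linarith [Real.add_one_le_exp K]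
          calc (n : ℝ) * (K * Real.exp (-(b2 / 8))) ≤
                Real.exp l * (Real.exp K * Real.exp (-(b2 / 8))) := by
                rw [← h2]; gcongr
            _ = Real.exp (l + (K + -(b2 / 8))) := by rw [Real.exp_add, Real.exp_add]
            _ ≤ _ := by
                refine Real.exp_le_exp.2 ?_
                rw [hb2, hk]
                nlinarith [mul_nonneg hκ hl0, mul_nonneg hK0.le hl0,
                  mul_nonneg hK0.le (sub_nonneg.2 hS1)]
  calc Measure.pi (fun _ : Fin n => lineMix w z)
        {y | n * (((A' + 1) * K + c₀ * (A' * K) + κ / c₀) * s) ≤ ∑ i, f (y i)} ≤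
      Measure.pi (fun _ : Fin n => lineMix w z) ({y | (∀ i, y i ∈ G) ∧
        n * (((A' + 1) * K + c₀ * (A' * K) + κ / c₀) * s) ≤ ∑ i, f (y i)} ∪
        {y | ∃ i, y i ∉ G}) := by
        refine measure_mono fun y hy => ?_
        by_cases h : ∀ i, y i ∈ G
        · exact Or.inl ⟨h, hy⟩
        · exact Or.inr (not_forall.1 h)
    _ ≤ ENNReal.ofReal (Real.exp (-(κ * S))) + ENNReal.ofReal (Real.exp (-(κ * S))) :=
        (measure_union_le _ _).trans (add_le_add
          (hch.trans (ENNReal.ofReal_le_ofReal (Real.exp_le_exp.2 hexp))) hbad)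
    _ = _ := by
        rw [← ENNReal.ofReal_add (Real.exp_pos _).le (Real.exp_pos _).le, two_mul]

/-! ### Medians of batch averages -/

/-- A median off by more than t has at least half of the entries on its far side, and all of them
are off by more than t. -/
theorem IsMedian.abs_sub_le {T : ℕ} {x : Fin T → ℝ} {v m t : ℝ} (h : IsMedian x v)
    (hb : 2 * (Finset.univ.filter fun j => t < |x j - m|).card < T) : |v - m| ≤ t := by
  obtain ⟨h1, h2⟩ := h
  rw [abs_le]
  constructor
  · by_contra hcon
    push Not at hcon
    have : (Finset.univ.filter fun j => x j ≤ v).card ≤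
        (Finset.univ.filter fun j => t < |x j - m|).card := by
      refine Finset.card_le_card fun j hj => ?_
      simp only [Finset.mem_filter, Finset.mem_univ, true_and] at hj ⊢
      have := neg_le_abs (x j - m)
      linarith
    omega
  · by_contra hcon
    push Not at hcon
    have : (Finset.univ.filter fun j => v ≤ x j).card ≤
        (Finset.univ.filter fun j => t < |x j - m|).card := by
      refine Finset.card_le_card fun j hj => ?_
      simp only [Finset.mem_filter, Finset.mem_univ, true_and] at hj ⊢
      have := le_abs_self (x j - m)
      linarith
    omega

theorem batch_index_lt {n T : ℕ} (p : Fin T × Fin (n / T)) :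
    (p.1 : ℕ) * (n / T) + p.2 < n := by
  have h1 : ((p.1 : ℕ) + 1) * (n / T) ≤ T * (n / T) := Nat.mul_le_mul_right _ p.1.2
  have h2 : T * (n / T) ≤ n := Nat.mul_div_le n T
  have h3 := p.2.2
  rw [add_mul, one_mul] at h1
  omega

/-- The position of the `p.2`-th sample of batch `p.1`. -/
def batchIndex (n T : ℕ) (p : Fin T × Fin (n / T)) : Fin n :=
  ⟨(p.1 : ℕ) * (n / T) + p.2, batch_index_lt p⟩

theorem batchIndex_injective (n T : ℕ) : Function.Injective (batchIndex n T) := by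
  rintro ⟨a, b⟩ ⟨a', b'⟩ h
  have h' : (a : ℕ) * (n / T) + b = (a' : ℕ) * (n / T) + b' := congrArg Fin.val h
  have hb := b.2
  have hb' := b'.2
  have hpos : 0 < n / T := by omega
  have h1 : (a : ℕ) = a' := by
    have := congrArg (· / (n / T)) h'
    simpa [Nat.add_comm, Nat.add_mul_div_right _ _ hpos, Nat.div_eq_of_lt hb,
      Nat.div_eq_of_lt hb'] using this
  have h2 : (b : ℕ) = b' := by rw [h1] at h'; omega
  exact Prod.ext (Fin.ext h1) (Fin.ext h2)

theorem sum_batch {n T : ℕ} (g : Fin n → ℝ) (j : Fin T) :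
    ∑ i ∈ Finset.univ.filter fun i : Fin n => (j : ℕ) * (n / T) ≤ (i : ℕ) ∧
      (i : ℕ) < ((j : ℕ) + 1) * (n / T), g i = ∑ q : Fin (n / T), g (batchIndex n T (j, q)) := by
  symm
  refine Finset.sum_bij (fun q _ => batchIndex n T (j, q)) ?_ ?_ ?_ fun _ _ => rfl
  · intro q _
    simp only [Finset.mem_filter, Finset.mem_univ, true_and, batchIndex, add_mul, one_mul]
    have := q.2
    omega
  · intro q _ q' _ h
    exact (Prod.ext_iff.1 (batchIndex_injective n T h)).2
  · intro i hi
    simp only [Finset.mem_filter, Finset.mem_univ, true_and, add_mul, one_mul] at hi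
    exact ⟨⟨i - j * (n / T), by omega⟩, Finset.mem_univ _, Fin.ext (by simp [batchIndex]; omega)⟩

/-- Distinct positions give independent coordinates, and the injective family of positions is
curried by batch. The leftover samples at the end are simply not read. -/
theorem map_batches {α : Type*} [MeasurableSpace α] (ν : Measure α) [IsProbabilityMeasure ν]
    (n T : ℕ) :
    (Measure.pi fun _ : Fin n => ν).map (fun y (j : Fin T) (q : Fin (n / T)) =>
      y (batchIndex n T (j, q))) = Measure.pi fun _ : Fin T => Measure.pi fun _ : Fin (n / T) => ν := by
  have hind : iIndepFun (fun (i : Fin n) (y : Fin n → α) => y i) (Measure.pi fun _ : Fin n => ν) :=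
    iIndepFun_pi (μ := fun _ : Fin n => ν) (X := fun _ y => y) fun _ => aemeasurable_id
  have h1 := (hind.precomp (batchIndex_injective n T)).map_fun_eq_pi_map
    (fun p => (measurable_pi_apply _).aemeasurable)
  have h2 : ∀ p, (Measure.pi fun _ : Fin n => ν).map (fun y => y (batchIndex n T p)) = ν :=
    fun p => (measurePreserving_eval (fun _ : Fin n => ν) _).map_eq
  have h1' : (Measure.pi fun _ : Fin n => ν).map (fun y (p : Fin T × Fin (n / T)) =>
      y (batchIndex n T p)) = Measure.pi fun _ : Fin T × Fin (n / T) => ν := by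
    refine h1.trans ?_
    congr 1
    ext1 p
    exact h2 p
  have h3 := Measure.infinitePi_map_curry (fun (_ : Fin T) (_ : Fin (n / T)) => ν)
  simp only [Measure.infinitePi_eq_pi] at h3
  rw [← h3, ← h1', Measure.map_map (MeasurableEquiv.measurable _) (by fun_prop)]
  rfl

theorem chebyshev_average {ν : Measure ℝ} [IsProbabilityMeasure ν] {f : ℝ → ℝ}
    (hf2 : MemLp f 2 ν) (hf0 : ∫ y, f y ∂ν = 0) {V t : ℝ}
    (hV : ∫ y, f y ^ 2 ∂ν ≤ V) (ht : 0 < t) {b : ℕ} (hb : 1 ≤ b) :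
    Measure.pi (fun _ : Fin b => ν) {x | t < |(∑ q, f (x q)) / b|} ≤
      ENNReal.ofReal (V / (b * t ^ 2)) := by
  have hb0 : (0 : ℝ) < b := by exact_mod_cast hb
  set X : (Fin b → ℝ) → ℝ := ∑ q, fun x => f (x q) with hX
  have hXe : ∀ x, X x = ∑ q, f (x q) := fun x => by rw [hX, Finset.sum_apply]
  have hmem : ∀ q : Fin b, MemLp (fun x : Fin b → ℝ => f (x q)) 2 (Measure.pi fun _ => ν) :=
    fun q => hf2.comp_measurePreserving (measurePreserving_eval (fun _ : Fin b => ν) q)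
  have hvar : Var[X; Measure.pi fun _ : Fin b => ν] = b * Var[f; ν] := by
    rw [hX, variance_sum_pi (μ := fun _ : Fin b => ν) (X := fun _ => f) fun _ => hf2]
    simp
  have hmean : ∫ x, X x ∂(Measure.pi fun _ : Fin b => ν) = 0 := by
    simp only [hXe]
    rw [integral_finsetSum _ fun q _ => (hmem q).integrable (by norm_num)]
    refine Finset.sum_eq_zero fun q _ => ?_
    rw [integral_comp_eval (μ := fun _ : Fin b => ν) (f := f) hf2.aestronglyMeasurable, hf0]
  have hVar : Var[f; ν] ≤ V := by
    rw [variance_eq_sub hf2, hf0]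
    simpa using hV
  have hXm : MemLp X 2 (Measure.pi fun _ : Fin b => ν) := memLp_finsetSum' _ fun q _ => hmem q
  have hch := meas_ge_le_variance_div_sq hXm (c := t * b) (by positivity)
  rw [hmean, hvar] at hch
  refine (measure_mono fun x hx => ?_).trans (hch.trans (ENNReal.ofReal_le_ofReal ?_))
  · change t * b ≤ |X x - 0|
    have hx' : t < |(∑ q, f (x q)) / b| := hx
    rw [abs_div, abs_of_pos hb0, lt_div_iff₀ hb0] at hx'
    rw [sub_zero, hXe]
    exact hx'.le
  · calc b * Var[f; ν] / (t * b) ^ 2 = Var[f; ν] / (b * t ^ 2) := by field_simp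
      _ ≤ _ := by gcongr

/-- If at least half of the batches fail, all batches in some set J with T ≤ 2|J| fail. By Chebyshev
and independence this has probability at most (1/(4q²))^{|J|} ≤ (1/(2q))^T, and there are at most
2^T sets J. Only second moments of f are used. -/
theorem median_deviation {ν : Measure ℝ} [IsProbabilityMeasure ν] {f : ℝ → ℝ} (hf : Measurable f)
    (hf2 : MemLp f 2 ν) (hf0 : ∫ y, f y ∂ν = 0) {V t q : ℝ}
    (hV : ∫ y, f y ^ 2 ∂ν ≤ V) (ht : 0 < t) (hq : 1 ≤ q) {n T : ℕ} (hT : 1 ≤ T) (hTn : T ≤ n)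
    (hp : V / ((n / T : ℕ) * t ^ 2) ≤ 1 / (4 * q ^ 2)) :
    Measure.pi (fun _ : Fin n => ν) {y | T ≤ 2 * (Finset.univ.filter fun j : Fin T =>
      t < |(∑ p : Fin (n / T), f (y (batchIndex n T (j, p)))) / (n / T : ℕ)|).card} ≤
      ENNReal.ofReal ((1 / q) ^ T) := by
  have hb : 1 ≤ n / T := (Nat.one_le_div_iff (by omega)).2 hTn
  set b := n / T with hbdef
  set Bad : Set (Fin b → ℝ) := {x | t < |(∑ p, f (x p)) / b|} with hBad
  have hBadm : MeasurableSet Bad := measurableSet_lt (by fun_prop) (by fun_prop)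
  have hBadp : Measure.pi (fun _ : Fin b => ν) Bad ≤ ENNReal.ofReal (1 / (4 * q ^ 2)) :=
    (chebyshev_average hf2 hf0 hV ht hb).trans (ENNReal.ofReal_le_ofReal hp)
  set Φ : (Fin n → ℝ) → Fin T → Fin b → ℝ := fun y j p => y (batchIndex n T (j, p)) with hΦ
  have hΦm : Measurable Φ := by fun_prop
  have hsub : {y : Fin n → ℝ | T ≤ 2 * (Finset.univ.filter fun j : Fin T =>
      t < |(∑ p : Fin b, f (y (batchIndex n T (j, p)))) / (b : ℕ)|).card} ⊆
      ⋃ J ∈ (Finset.univ.filter fun J : Finset (Fin T) => T ≤ 2 * J.card),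
        Φ ⁻¹' ((J : Set (Fin T)).pi fun _ => Bad) := by
    intro y hy
    simp only [Set.mem_iUnion]
    refine ⟨Finset.univ.filter fun j : Fin T =>
      t < |(∑ p : Fin b, f (y (batchIndex n T (j, p)))) / (b : ℕ)|, by simpa using hy, ?_⟩
    intro j hj
    have hj' : t < |(∑ p : Fin b, f (y (batchIndex n T (j, p)))) / (b : ℕ)| := by simpa using hj
    exact hj'
  have hprob : ∀ J : Finset (Fin T), T ≤ 2 * J.card →
      Measure.pi (fun _ : Fin n => ν) (Φ ⁻¹' ((J : Set (Fin T)).pi fun _ => Bad)) ≤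
        ENNReal.ofReal ((1 / (2 * q)) ^ T) := by
    intro J hJ
    rw [← Measure.map_apply hΦm (MeasurableSet.pi (Finset.countable_toSet J) fun _ _ => hBadm),
      hΦ, map_batches, Measure.pi_pi_finset (μ := fun _ : Fin T => Measure.pi fun _ : Fin b => ν)
        (fun _ => Bad), Finset.prod_const]
    calc _ ≤ ENNReal.ofReal (1 / (4 * q ^ 2)) ^ J.card := by gcongr
      _ = ENNReal.ofReal ((1 / (2 * q)) ^ (2 * J.card)) := by
          rw [← ENNReal.ofReal_pow (by positivity), pow_mul]
          congr 2
          field_simp; norm_num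
      _ ≤ _ := by
          refine ENNReal.ofReal_le_ofReal (pow_le_pow_of_le_one (by positivity) ?_ hJ)
          rw [div_le_one (by positivity)]; linarith
  refine (measure_mono hsub).trans ((measure_biUnion_finset_le _ _).trans ?_)
  calc _ ≤ ∑ J ∈ (Finset.univ.filter fun J : Finset (Fin T) => T ≤ 2 * J.card),
        ENNReal.ofReal ((1 / (2 * q)) ^ T) := Finset.sum_le_sum fun J hJ =>
          hprob J (by simpa using hJ)
    _ ≤ (2 ^ T : ℕ) * ENNReal.ofReal ((1 / (2 * q)) ^ T) := by
        rw [Finset.sum_const, nsmul_eq_mul]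
        gcongr
        refine (Finset.card_filter_le _ _).trans ?_
        rw [Finset.card_univ, Fintype.card_finset, Fintype.card_fin]
    _ = _ := by
        rw [← ENNReal.ofReal_natCast, ← ENNReal.ofReal_mul (by positivity)]
        congr 1
        push_cast
        rw [← mul_pow]
        congr 1
        field_simp

/-! ### Hermite moments -/

theorem aeval_hermite_one (y : ℝ) : Polynomial.aeval y (Polynomial.hermite 1) = y := by simp

theorem aeval_hermite_two (y : ℝ) : Polynomial.aeval y (Polynomial.hermite 2) = y ^ 2 - 1 := by
  rw [Polynomial.hermite_succ]; simp; ring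

theorem aeval_hermite_three (y : ℝ) :
    Polynomial.aeval y (Polynomial.hermite 3) = y ^ 3 - 3 * y := by
  rw [Polynomial.hermite_succ, Polynomial.hermite_succ]; simp; ring

theorem hermite_growth {r : ℕ} (hr : r < 3) (m y : ℝ) :
    (Polynomial.aeval y (Polynomial.hermite (r + 1)) - m) ^ 2 ≤
      (6 + |m|) ^ 2 * (1 + y ^ 2) ^ 3 := by
  have h1 : (1 : ℝ) ≤ 1 + y ^ 2 := by nlinarith
  have hpow : (1 : ℝ) ≤ (1 + y ^ 2) ^ 3 := one_le_pow₀ h1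
  have key : ∀ p : ℝ, p ^ 2 ≤ 36 * (1 + y ^ 2) ^ 3 → (p - m) ^ 2 ≤
      (6 + |m|) ^ 2 * (1 + y ^ 2) ^ 3 := by
    intro p hp
    set s := √((1 + y ^ 2) ^ 3) with hs
    have hs2 : s ^ 2 = (1 + y ^ 2) ^ 3 := Real.sq_sqrt (by positivity)
    have hs1 : 1 ≤ s := Real.one_le_sqrt.2 hpow
    have hpa : |p| ≤ 6 * s := by
      refine abs_le_of_sq_le_sq ?_ (by positivity)
      rw [mul_pow, hs2]; linarith
    have : |p - m| ≤ (6 + |m|) * s := by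
      calc |p - m| ≤ |p| + |m| := abs_sub _ _
        _ ≤ 6 * s + |m| * s := by
          gcongr
          exact le_mul_of_one_le_right (abs_nonneg m) hs1
        _ = _ := by ring
    calc (p - m) ^ 2 = |p - m| ^ 2 := (sq_abs _).symm
      _ ≤ ((6 + |m|) * s) ^ 2 := pow_le_pow_left₀ (abs_nonneg _) this 2
      _ = _ := by rw [mul_pow, hs2]
  refine key _ ?_
  have e : (1 + y ^ 2) ^ 3 = 1 + 3 * y ^ 2 + 3 * y ^ 4 + y ^ 6 := by ring
  have h2 : 0 ≤ y ^ 2 := by positivity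
  have h4 : 0 ≤ y ^ 4 := by positivity
  have h6 : 0 ≤ y ^ 6 := by positivity
  interval_cases r
  · rw [zero_add, aeval_hermite_one, e]; linarith
  · rw [aeval_hermite_two, e]; nlinarith
  · rw [aeval_hermite_three, e]; nlinarith

theorem measurable_aeval_hermite (r : ℕ) :
    Measurable fun y : ℝ => (Polynomial.aeval y (Polynomial.hermite r) : ℝ) :=
  (Polynomial.hermite r).continuous_aeval.measurable

theorem integrable_pow_gaussian (k : ℕ) :
    Integrable (fun y : ℝ => y ^ k) (gaussianReal 0 1) := by
  rcases Nat.eq_zero_or_pos k with rfl | hk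
  · simp
  · have h := (memLp_id_gaussianReal' (μ := 0) (v := 1) (k : ℝ≥0∞) (by simp)).integrable_norm_pow hk.ne'
    exact h.mono' (by fun_prop) (Filter.Eventually.of_forall fun y => by simp)

theorem integral_hermite_gaussian {r : ℕ} (hr : r < 3) (z : ℝ) :
    ∫ y, (Polynomial.aeval y (Polynomial.hermite (r + 1)) : ℝ) ∂gaussianReal z 1 = z ^ (r + 1) := by
  have hmap : gaussianReal z 1 = (gaussianReal 0 1).map (z + ·) := by
    rw [gaussianReal_map_const_add, zero_add]
  have m1 : ∫ y : ℝ, y ∂gaussianReal 0 1 = 0 := integral_id_gaussianReal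
  have m2 : ∫ y : ℝ, y ^ 2 ∂gaussianReal 0 1 = 1 := by
    have h := variance_fun_id_gaussianReal (μ := 0) (v := 1)
    have h2 : MemLp (fun x : ℝ => x) 2 (gaussianReal 0 1) :=
      memLp_id_gaussianReal' 2 (by norm_num)
    rw [variance_eq_sub h2] at h
    simpa [m1] using h
  have m3 : ∫ y : ℝ, y ^ 3 ∂gaussianReal 0 1 = 0 := by
    have h : ∫ y : ℝ, y ^ 3 ∂((gaussianReal 0 1).map fun x => -x) = ∫ y : ℝ, y ^ 3 ∂gaussianReal 0 1 := by
      rw [gaussianReal_map_neg, neg_zero]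
    rw [integral_map (by fun_prop) (by fun_prop)] at h
    have e : ∀ x : ℝ, (-x) ^ 3 = -(x ^ 3) := fun x => by ring
    simp only [e, integral_neg] at h
    linarith
  have i1 : Integrable (fun y : ℝ => y) (gaussianReal 0 1) := by
    simpa using integrable_pow_gaussian 1
  have i2 := integrable_pow_gaussian 2
  have i3 := integrable_pow_gaussian 3
  rw [hmap, integral_map (by fun_prop) (measurable_aeval_hermite _).aestronglyMeasurable]
  interval_cases r
  · simp only [zero_add, aeval_hermite_one]
    rw [integral_add (integrable_const _) i1, m1]; simp
  · simp only [Nat.reduceAdd, aeval_hermite_two]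
    have e : ∀ x : ℝ, (z + x) ^ 2 - 1 = (z ^ 2 - 1) + 2 * z * x + x ^ 2 := fun x => by ring
    have j1 : Integrable (fun x : ℝ => (z ^ 2 - 1) + 2 * z * x) (gaussianReal 0 1) :=
      (integrable_const _).add (i1.const_mul _)
    simp only [e]
    rw [integral_add j1 i2, integral_add (integrable_const _) (i1.const_mul _),
      integral_const_mul, m1, m2]
    simp
  · simp only [Nat.reduceAdd, aeval_hermite_three]
    have e : ∀ x : ℝ, (z + x) ^ 3 - 3 * (z + x) =
        (z ^ 3 - 3 * z) + (3 * z ^ 2 - 3) * x + 3 * z * x ^ 2 + x ^ 3 := fun x => by ring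
    have j1 : Integrable (fun x : ℝ => (z ^ 3 - 3 * z) + (3 * z ^ 2 - 3) * x) (gaussianReal 0 1) :=
      (integrable_const _).add (i1.const_mul _)
    have j2 : Integrable (fun x : ℝ => (z ^ 3 - 3 * z) + (3 * z ^ 2 - 3) * x + 3 * z * x ^ 2)
      (gaussianReal 0 1) := j1.add (i2.const_mul _)
    simp only [e]
    rw [integral_add j2 i3, integral_add j1 (i2.const_mul _),
      integral_add (integrable_const _) (i1.const_mul _), integral_const_mul, integral_const_mul,
      m1, m2, m3]
    simp

/-- The event that for some `r < 3` at least half of the batches estimate the moment of order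
`r + 1` with an error of more than `t`. -/
def momentBadSet (n T : ℕ) (m : ℕ → ℝ) (t : ℝ) : Set (Fin n → ℝ) :=
  {y | ∃ r < 3, T ≤ 2 * (Finset.univ.filter fun j : Fin T =>
    t < |batchMoment T y (r + 1) j - m r|).card}

theorem batchMoment_eq {n T : ℕ} (y : Fin n → ℝ) (r : ℕ) (j : Fin T) :
    batchMoment T y r j = (∑ p : Fin (n / T),
      (Polynomial.aeval (y (batchIndex n T (j, p))) (Polynomial.hermite r) : ℝ)) / (n / T : ℕ) := by
  rw [batchMoment, sum_batch]

theorem batchMoment_sub_eq {n T : ℕ} (hb : 1 ≤ n / T) (y : Fin n → ℝ) (r : ℕ) (j : Fin T) (m : ℝ) :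
    batchMoment T y r j - m = (∑ p : Fin (n / T),
      ((Polynomial.aeval (y (batchIndex n T (j, p))) (Polynomial.hermite r) : ℝ) - m)) /
        (n / T : ℕ) := by
  have hb0 : ((n / T : ℕ) : ℝ) ≠ 0 := by positivity
  rw [batchMoment_eq, Finset.sum_sub_distrib, sub_div]
  simp [hb0]

theorem abs_sum_pow_le {w z : Fin 2 → ℝ} {B : ℝ} (hB : 1 ≤ B) (hw : ∀ j, 0 ≤ w j)
    (h1 : ∑ j, w j = 1) (hz : ∀ j, |z j| ≤ B) {r : ℕ} (hr : r < 3) :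
    |∑ j, w j * z j ^ (r + 1)| ≤ B ^ 3 := by
  calc _ ≤ ∑ j, |w j * z j ^ (r + 1)| := Finset.abs_sum_le_sum_abs _ _
    _ ≤ ∑ j, w j * B ^ 3 := Finset.sum_le_sum fun j _ => by
        rw [abs_mul, abs_of_nonneg (hw j), abs_pow]
        refine mul_le_mul_of_nonneg_left ?_ (hw j)
        calc |z j| ^ (r + 1) ≤ B ^ (r + 1) := pow_le_pow_left₀ (abs_nonneg _) (hz j) _
          _ ≤ B ^ 3 := pow_le_pow_right₀ hB (by omega)
    _ = _ := by rw [← Finset.sum_mul, h1, one_mul]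

section

variable {w z : Fin 2 → ℝ} {B K : ℝ}

theorem centered_hermite_growth (hB : 1 ≤ B) (hw : ∀ j, 0 ≤ w j) (h1 : ∑ j, w j = 1)
    (hz : ∀ j, |z j| ≤ B) {r : ℕ} (hr : r < 3) (y : ℝ) :
    ((Polynomial.aeval y (Polynomial.hermite (r + 1)) : ℝ) - ∑ j, w j * z j ^ (r + 1)) ^ 2 ≤
      (6 + B ^ 3) ^ 2 * (1 + y ^ 2) ^ 3 := by
  refine (hermite_growth hr _ y).trans ?_
  gcongr
  exact abs_sum_pow_le hB hw h1 hz hr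

theorem integral_centered_hermite (hw : ∀ j, 0 ≤ w j) (h1 : ∑ j, w j = 1) {r : ℕ} (hr : r < 3) :
    ∫ y, ((Polynomial.aeval y (Polynomial.hermite (r + 1)) : ℝ) - ∑ j, w j * z j ^ (r + 1))
      ∂lineMix w z = 0 := by
  have hP := isProbabilityMeasure_lineMix hw h1 z
  have hi : ∀ j, Integrable (fun y : ℝ => (Polynomial.aeval y (Polynomial.hermite (r + 1)) : ℝ))
      (gaussianReal (z j) 1) := fun j =>
    (integrable_of_growth (A := 6 + |(0 : ℝ)|) (measurable_aeval_hermite _) (fun y => by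
      have := hermite_growth hr 0 y
      rwa [sub_zero] at this) (z j)).integrable (by norm_num)
  rw [integral_sub (integrable_lineMix hi) (integrable_const _), integral_lineMix hw hi]
  simp only [integral_hermite_gaussian hr]
  simp

end

/-- The estimated moments of a one-dimensional mixture are accurate up to a constant times
`√((d + log (1 / δ)) / n)` for the majority of the batches. -/
theorem moment_deviation (B : ℝ) (hB : 1 ≤ B) : ∃ C : ℝ, 0 < C ∧
    ∀ (w z : Fin 2 → ℝ), (∀ j, 0 ≤ w j) → ∑ j, w j = 1 → (∀ j, |z j| ≤ B) →
    ∀ (d n T : ℕ) (δ : ℝ), 1 ≤ d → 1 ≤ n → 0 < δ → δ < 1 → d + Real.log (1 / δ) < n →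
      (T = min n ⌈Real.log (1 / δ)⌉₊ ∨ (T = 1 ∧ Real.exp (-√(n : ℝ)) ≤ δ)) →
      Measure.pi (fun _ : Fin n => lineMix w z) (momentBadSet n T
        (fun r => ∑ j, w j * z j ^ (r + 1)) (C * √((d + Real.log (1 / δ)) / n))) ≤
        ENNReal.ofReal (δ / 2) := by
  obtain ⟨K, hK0, hK⟩ := exp_sq_gaussian_bound B
  set A : ℝ := 6 + B ^ 3 with hA
  have hA0 : 0 ≤ A := by positivity
  obtain ⟨C₁, hC₁, hdev⟩ := deviation_cubic B A 4 hA0 (by norm_num)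
  set V : ℝ := A ^ 2 * 24576 * K with hV
  have hV0 : 0 ≤ V := by positivity
  -- A median fails with probability at most q^{-T} ≤ e^{-T}/6 ≤ δ/6, and there are three of them.
  set q : ℝ := 6 * Real.exp 1 with hq
  have he1 : 1 ≤ Real.exp 1 := Real.one_le_exp zero_le_one
  have hq1 : 1 ≤ q := by linarith
  -- Batches have at least n/(2T) samples and T is at most d + log(1/δ), so Chebyshev gives failure
  -- probability at most 2V/(C₁ + C₂)² per batch. This is at most 1/(4q²), as C₂ ≥ 1 implies C₂ ≤
  -- (C₁ + C₂)².
  set C₂ : ℝ := 8 * V * q ^ 2 + 1 with hC₂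
  have hC₂1 : 1 ≤ C₂ := by rw [hC₂]; nlinarith [mul_nonneg hV0 (sq_nonneg q)]
  refine ⟨C₁ + C₂, by positivity, ?_⟩
  intro w z hw h1 hz d n T δ hd hn hδ hδ1 hSn hT
  set l : ℝ := Real.log (1 / δ) with hl
  have hl0 : 0 < l := Real.log_pos (by rw [lt_div_iff₀ hδ]; linarith)
  have hexpl : Real.exp (-l) = δ := by
    rw [hl, Real.log_div one_ne_zero hδ.ne', Real.log_one, zero_sub, neg_neg, Real.exp_log hδ]
  have hd1 : (1 : ℝ) ≤ d := by exact_mod_cast hd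
  have hn1 : (1 : ℝ) ≤ n := by exact_mod_cast hn
  have hn0 : (0 : ℝ) < n := by linarith
  set S : ℝ := d + l with hS
  have hS1 : 1 ≤ S := by linarith
  set t : ℝ := (C₁ + C₂) * √(S / n) with ht
  have ht0 : 0 < t := by positivity
  have hP := isProbabilityMeasure_lineMix hw h1 z
  set f : ℕ → ℝ → ℝ := fun r y =>
    (Polynomial.aeval y (Polynomial.hermite (r + 1)) : ℝ) - ∑ j, w j * z j ^ (r + 1) with hf
  have hfm : ∀ r, Measurable (f r) := fun r => (measurable_aeval_hermite _).sub_const _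
  have hfA : ∀ r < 3, ∀ y, f r y ^ 2 ≤ A ^ 2 * (1 + y ^ 2) ^ 3 := fun r hr y =>
    centered_hermite_growth hB hw h1 hz hr y
  have hf0 : ∀ r < 3, ∫ y, f r y ∂lineMix w z = 0 := fun r hr => integral_centered_hermite hw h1 hr
  have hunion : ∀ {p : ℝ≥0∞}, 1 ≤ n / T → (∀ r < 3, Measure.pi (fun _ : Fin n => lineMix w z)
      {y | T ≤ 2 * (Finset.univ.filter fun j : Fin T =>
        t < |(∑ p : Fin (n / T), f r (y (batchIndex n T (j, p)))) / (n / T : ℕ)|).card} ≤ p) →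
      Measure.pi (fun _ : Fin n => lineMix w z) (momentBadSet n T
        (fun r => ∑ j, w j * z j ^ (r + 1)) t) ≤ 3 * p := by
    intro p hb hp
    have hsub : momentBadSet n T (fun r => ∑ j, w j * z j ^ (r + 1)) t ⊆
        ⋃ r ∈ Finset.range 3, {y | T ≤ 2 * (Finset.univ.filter fun j : Fin T =>
        t < |(∑ p : Fin (n / T), f r (y (batchIndex n T (j, p)))) / (n / T : ℕ)|).card} := by
      rintro y ⟨r, hr, hy⟩
      simp only [Set.mem_iUnion]
      refine ⟨r, Finset.mem_range.2 hr, ?_⟩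
      simp only [batchMoment_sub_eq hb] at hy
      exact hy
    refine (measure_mono hsub).trans ((measure_biUnion_finset_le _ _).trans ?_)
    refine (Finset.sum_le_sum fun r hr => hp r (Finset.mem_range.1 hr)).trans ?_
    simp
  rcases hT with hT | ⟨hT, hδn⟩
  · have hceil : (⌈l⌉₊ : ℝ) < l + 1 := Nat.ceil_lt_add_one hl0.le
    have hceiln : ⌈l⌉₊ ≤ n := by
      have : (⌈l⌉₊ : ℝ) ≤ n := by linarith
      exact_mod_cast this
    rw [min_eq_right hceiln] at hT
    have hT1 : 1 ≤ T := by rw [hT]; exact Nat.one_le_iff_ne_zero.2 (Nat.ceil_pos.2 hl0).ne'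
    have hTn : T ≤ n := by rw [hT]; exact hceiln
    have hlT : l ≤ T := by rw [hT]; exact Nat.le_ceil l
    have hTS : (T : ℝ) ≤ S := by rw [hT]; linarith
    have hT0 : (0 : ℝ) < T := by exact_mod_cast hT1
    have hb : 1 ≤ n / T := (Nat.one_le_div_iff (by omega)).2 hTn
    have hb2 : (n : ℝ) / (2 * T) ≤ (n / T : ℕ) := by
      have h2 : n < T * (n / T) + T := by
        have := Nat.div_add_mod n T
        have := Nat.mod_lt n (by omega : T > 0)
        omega
      have h3 : (n : ℝ) < T * (n / T : ℕ) + T := by exact_mod_cast h2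
      have h4 : (1 : ℝ) ≤ (n / T : ℕ) := by exact_mod_cast hb
      rw [div_le_iff₀ (by positivity)]
      nlinarith
    have hpq : V / ((n / T : ℕ) * t ^ 2) ≤ 1 / (4 * q ^ 2) := by
      have hC : C₂ ≤ (C₁ + C₂) ^ 2 := by nlinarith
      have hb0 : (0 : ℝ) < (n / T : ℕ) := by exact_mod_cast hb
      rw [div_le_div_iff₀ (by positivity) (by positivity)]
      have h5 : t ^ 2 = (C₁ + C₂) ^ 2 * (S / n) := by
        rw [ht, mul_pow, Real.sq_sqrt (by positivity)]
      calc V * (4 * q ^ 2) ≤ C₂ / 2 := by rw [hC₂]; linarith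
        _ ≤ (C₁ + C₂) ^ 2 / 2 := by linarith
        _ = n / (2 * T) * ((C₁ + C₂) ^ 2 * (T / n)) := by field_simp
        _ ≤ (n / T : ℕ) * ((C₁ + C₂) ^ 2 * (S / n)) := by gcongr
        _ = 1 * ((n / T : ℕ) * t ^ 2) := by rw [h5]; ring
    have hint : ∀ r < 3, MemLp (f r) 2 (lineMix w z) := by
      intro r hr
      rw [memLp_two_iff_integrable_sq (hfm r).aestronglyMeasurable]
      exact integrable_lineMix fun j => (integrable_of_growth (hfm r) (hfA r hr) (z j)).integrable_sq
    obtain ⟨hψi, hψK⟩ := lineMix_exp_bound hw h1 hz hK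
    have hfV : ∀ r < 3, ∫ y, f r y ^ 2 ∂lineMix w z ≤ V := by
      intro r hr
      calc _ ≤ ∫ y, A ^ 2 * 24576 * Real.exp (2 * ((1 + y ^ 2) / 16)) ∂lineMix w z := by
            refine integral_mono (hint r hr).integrable_sq (hψi.const_mul _) fun y => ?_
            refine (sq_le_exp_of_growth (hfA r hr) y).trans ?_
            have : 0 ≤ (1 + y ^ 2) / 16 := by positivity
            gcongr
            linarith
        _ ≤ _ := by rw [integral_const_mul]; exact mul_le_mul_of_nonneg_left hψK (by positivity)
    refine (hunion hb fun r hr => median_deviation (hfm r) (hint r hr) (hf0 r hr) (hfV r hr) ht0 hq1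
      hT1 hTn hpq).trans ?_
    have h3 : (3 : ℝ≥0∞) = ENNReal.ofReal 3 := by simp
    rw [h3, ← ENNReal.ofReal_mul (by norm_num)]
    refine ENNReal.ofReal_le_ofReal ?_
    have h6 : (1 / q) ^ T ≤ 1 / 6 * Real.exp (-(T : ℝ)) := by
      have : 1 / q = 1 / 6 * Real.exp (-1) := by rw [hq, Real.exp_neg]; field_simp
      rw [this, mul_pow, ← Real.exp_nat_mul, mul_neg, mul_one]
      gcongr
      exact pow_le_of_le_one (by norm_num) (by norm_num) (by omega)
    have h7 : Real.exp (-(T : ℝ)) ≤ δ := by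
      rw [← hexpl]; exact Real.exp_le_exp.2 (by linarith)
    linarith
  · subst hT
    have hlq : l ≤ √(n : ℝ) := by
      rw [← hexpl] at hδn
      linarith [Real.exp_le_exp.1 hδn]
    have hq1' : 1 ≤ √(n : ℝ) := Real.one_le_sqrt.2 hn1
    -- The deviation bound is used at level 1 + log(1/δ) and not d + log(1/δ): the former is at most
    -- 2√n, whereas d may be of larger order. The second half is one-dimensional, so d is not needed
    -- here.
    have hdd : ∀ r < 3, Measure.pi (fun _ : Fin n => lineMix w z)
        {y | (1 : ℕ) ≤ 2 * (Finset.univ.filter fun j : Fin 1 =>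
        t < |(∑ p : Fin (n / 1), f r (y (batchIndex n 1 (j, p)))) / (n / 1 : ℕ)|).card} ≤
        ENNReal.ofReal (4 * Real.exp (-(4 * (1 + l)))) := by
      intro r hr
      have hp := hdev w z hw h1 hz n (1 + l) hn (by linarith) (by linarith) (f r) (hfm r)
        (hfA r hr) (hf0 r hr)
      have hm := hdev w z hw h1 hz n (1 + l) hn (by linarith) (by linarith) (fun y => -f r y)
        (hfm r).neg (fun y => by rw [neg_sq]; exact hfA r hr y)
        (by rw [integral_neg, hf0 r hr, neg_zero])
      have hsub : {y : Fin n → ℝ | (1 : ℕ) ≤ 2 * (Finset.univ.filter fun j : Fin 1 =>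
          t < |(∑ p : Fin (n / 1), f r (y (batchIndex n 1 (j, p)))) / (n / 1 : ℕ)|).card} ⊆
          {y | n * (C₁ * √((1 + l) / n)) ≤ ∑ i, f r (y i)} ∪
          {y | n * (C₁ * √((1 + l) / n)) ≤ ∑ i, -f r (y i)} := by
        intro y hy
        have hy' : (1 : ℕ) ≤ 2 * (Finset.univ.filter fun j : Fin 1 =>
          t < |(∑ p : Fin (n / 1), f r (y (batchIndex n 1 (j, p)))) / (n / 1 : ℕ)|).card := hy
        have hne : (Finset.univ.filter fun j : Fin 1 => t <
            |(∑ p : Fin (n / 1), f r (y (batchIndex n 1 (j, p)))) / (n / 1 : ℕ)|).Nonempty := by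
          rw [← Finset.card_pos]; omega
        obtain ⟨j, hj⟩ := hne
        have hj' := (Finset.mem_filter.1 hj).2
        have hsum : ∑ p : Fin (n / 1), f r (y (batchIndex n 1 (j, p))) = ∑ i, f r (y i) := by
          refine Fintype.sum_equiv (finCongr (Nat.div_one n)) _ _ fun p => ?_
          exact congrArg (fun i => f r (y i)) (Fin.ext (by simp [batchIndex]))
        rw [hsum, Nat.div_one, abs_div, abs_of_pos hn0, lt_div_iff₀ hn0] at hj'
        have hle : n * (C₁ * √((1 + l) / n)) ≤ t * n := by
          rw [mul_comm, ht]
          have : √((1 + l) / n) ≤ √(S / n) := by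
            refine Real.sqrt_le_sqrt ?_
            gcongr
            linarith
          have h8 : 0 ≤ √(S / n) := Real.sqrt_nonneg _
          gcongr
          linarith
        simp only [Finset.sum_neg_distrib]
        rcases abs_cases (∑ i, f r (y i)) with ⟨h, _⟩ | ⟨h, _⟩
        · exact Or.inl (by rw [h] at hj'; exact hle.trans hj'.le)
        · exact Or.inr (by rw [h] at hj'; exact hle.trans hj'.le)
      refine (measure_mono hsub).trans ((measure_union_le _ _).trans
        ((add_le_add hp hm).trans ?_))
      rw [← ENNReal.ofReal_add (by positivity) (by positivity)]
      exact ENNReal.ofReal_le_ofReal (by linarith)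
    refine (hunion (by simpa using hn) hdd).trans ?_
    have h3 : (3 : ℝ≥0∞) = ENNReal.ofReal 3 := by simp
    rw [h3, ← ENNReal.ofReal_mul (by norm_num)]
    refine ENNReal.ofReal_le_ofReal ?_
    have e1 : Real.exp (-(4 * (1 + l))) = Real.exp (-4) * δ ^ 4 := by
      rw [← hexpl, ← Real.exp_nat_mul, ← Real.exp_add]; push_cast; ring_nf
    have e2 : Real.exp (-4) ≤ 1 / 24 := by
      rw [Real.exp_neg, one_div]
      refine inv_anti₀ (by norm_num) ?_
      have h8 := Real.exp_one_gt_d9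
      have h9 : Real.exp 4 = Real.exp 1 ^ 4 := by rw [← Real.exp_nat_mul]; norm_num
      rw [h9]
      calc (24 : ℝ) ≤ 2.7 ^ 4 := by norm_num
        _ ≤ _ := pow_le_pow_left₀ (by norm_num) (by linarith) 4
    have e3 : δ ^ 4 ≤ δ := pow_le_of_le_one hδ.le hδ1.le (by norm_num)
    rw [e1]
    calc 3 * (4 * (Real.exp (-4) * δ ^ 4)) ≤ 3 * (4 * (1 / 24 * δ)) := by gcongr
      _ = _ := by ring

/-! ### Nets of the sphere -/

/-- A maximal `1/2`-separated subset of the unit sphere. -/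
theorem exists_sphere_net (d : ℕ) : ∃ N : Finset (E d), N.card ≤ 5 ^ d ∧ (∀ x ∈ N, ‖x‖ = 1) ∧
    ∀ x : E d, ‖x‖ = 1 → ∃ y ∈ N, ‖x - y‖ ≤ 1 / 2 := by
  classical
  set P : ℕ → Prop := fun k => ∃ s : Finset (E d), s.card = k ∧ (∀ x ∈ s, ‖x‖ = 1) ∧
    ∀ x ∈ s, ∀ y ∈ s, x ≠ y → 1 / 2 ≤ ‖x - y‖ with hP
  have hbound : ∀ k, P k → k ≤ 5 ^ d := by
    rintro k ⟨s, rfl, hs, hsep⟩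
    have hinj : Function.Injective (fun x : E d => (2 : ℝ) • x) :=
      smul_right_injective _ two_ne_zero
    -- Doubling turns the points into 1-separated points in the ball of radius 2, of which there are
    -- at most 5^d.
    have h := Besicovitch.card_le_of_separated (s.image fun x : E d => (2 : ℝ) • x) ?_ ?_
    · rwa [Finset.card_image_of_injective _ hinj, finrank_euclideanSpace_fin] at h
    · intro c hc
      obtain ⟨x, hx, rfl⟩ := Finset.mem_image.1 hc
      simp [norm_smul, hs x hx]
    · intro c hc e he hce
      obtain ⟨x, hx, rfl⟩ := Finset.mem_image.1 hc
      obtain ⟨y, hy, rfl⟩ := Finset.mem_image.1 he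
      have := hsep x hx y hy fun h => hce (by rw [h])
      rw [← smul_sub, norm_smul, Real.norm_two]
      linarith
  have h0 : P 0 := ⟨∅, by simp⟩
  obtain ⟨s, hsc, hs, hsep⟩ := Nat.findGreatest_spec (P := P) (Nat.zero_le (5 ^ d)) h0
  refine ⟨s, hsc ▸ Nat.findGreatest_le _, hs, fun x hx => ?_⟩
  by_contra hcon
  push Not at hcon
  have hnot : x ∉ s := fun h => by
    have := hcon x h
    simp at this
    linarith
  have hP1 : P (s.card + 1) := by
    refine ⟨insert x s, Finset.card_insert_of_notMem hnot, ?_, ?_⟩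
    · intro y hy
      rcases Finset.mem_insert.1 hy with rfl | h
      · exact hx
      · exact hs y h
    · intro y hy z hz hyz
      rcases Finset.mem_insert.1 hy with h | h <;> rcases Finset.mem_insert.1 hz with h' | h'
      · exact absurd (h.trans h'.symm) hyz
      · rw [h]; exact (hcon z h').le
      · rw [h', norm_sub_rev]; exact (hcon y h).le
      · exact hsep y h z h' hyz
  have := Nat.le_findGreatest (hbound _ hP1) hP1
  omega

/-- The net point nearest to h/‖h‖ misses at most half of ‖h‖ in the inner product with h, and this
half is absorbed on the left. -/
theorem norm_le_of_net {d : ℕ} {N : Finset (E d)}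
    (hN : ∀ x : E d, ‖x‖ = 1 → ∃ y ∈ N, ‖x - y‖ ≤ 1 / 2) (h : E d) {t : ℝ}
    (ht : 0 ≤ t) (hu : ∀ u ∈ N, |inner ℝ u h| ≤ t) : ‖h‖ ≤ 2 * t := by
  by_cases h0 : h = 0
  · simp [h0, ht]
  have hn : 0 < ‖h‖ := norm_pos_iff.2 h0
  obtain ⟨y, hy, hxy⟩ := hN (‖h‖⁻¹ • h) (by simp [norm_smul, hn.ne'])
  have e : ‖h‖ = inner ℝ y h + inner ℝ (‖h‖⁻¹ • h - y) h := by
    rw [inner_sub_left, inner_smul_left, real_inner_self_eq_norm_sq]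
    simp only [conj_trivial]
    field_simp
    ring
  have h1 := (le_abs_self _).trans (hu y hy)
  have h2 := (real_inner_le_norm (‖h‖⁻¹ • h - y) h).trans
    (mul_le_mul_of_nonneg_right hxy hn.le)
  linarith

/-- Finitely many unit vectors that control the norms of vectors and of symmetric operators. -/
theorem exists_directions (d : ℕ) : ∃ U : Finset (E d), U.card ≤ 3 * 25 ^ d ∧ (∀ u ∈ U, ‖u‖ = 1) ∧
    (∀ (h : E d) (t : ℝ), 0 ≤ t → (∀ u ∈ U, |inner ℝ u h| ≤ t) → ‖h‖ ≤ 2 * t) ∧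
    ∀ (D : E d →ₗ[ℝ] E d) (t : ℝ), D.IsSymmetric → 0 ≤ t → (∀ u ∈ U, |inner ℝ u (D u)| ≤ t) →
      ∀ y, ‖D y‖ ≤ 4 * t * ‖y‖ := by
  classical
  obtain ⟨N, hcard, h1, hnet⟩ := exists_sphere_net d
  -- Sums and differences of net points are included, normalized, so that bounds on the quadratic
  -- form of D give bounds on its bilinear form by polarization. Zero sums and differences are
  -- discarded by the filter below.
  set P : Finset (E d) := (N ×ˢ N).image fun p => ‖p.1 + p.2‖⁻¹ • (p.1 + p.2) with hP
  set Q : Finset (E d) := (N ×ˢ N).image fun p => ‖p.1 - p.2‖⁻¹ • (p.1 - p.2) with hQ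
  have hNN : (N ×ˢ N).card ≤ 25 ^ d := by
    rw [Finset.card_product]
    calc _ ≤ 5 ^ d * 5 ^ d := Nat.mul_le_mul hcard hcard
      _ = _ := by rw [← mul_pow]; norm_num
  have hN25 : N.card ≤ 25 ^ d := hcard.trans (Nat.pow_le_pow_left (by norm_num) _)
  refine ⟨(N ∪ P ∪ Q).filter fun u => ‖u‖ = 1, ?_, fun u hu => (Finset.mem_filter.1 hu).2, ?_, ?_⟩
  · have e1 := Finset.card_filter_le (N ∪ P ∪ Q) fun u => ‖u‖ = 1
    have e2 := Finset.card_union_le (N ∪ P) Q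
    have e3 := Finset.card_union_le N P
    have e4 : P.card ≤ _ := Finset.card_image_le
    have e5 : Q.card ≤ _ := Finset.card_image_le
    omega
  · intro h t ht hu
    refine norm_le_of_net hnet h ht fun u huN => hu u ?_
    simp [huN, h1 u huN]
  · intro D t hD ht hu
    have hq : ∀ z : E d, (‖z‖⁻¹ • z) ∈ N ∪ P ∪ Q → |inner ℝ z (D z)| ≤ t * ‖z‖ ^ 2 := by
      intro z hz
      by_cases h0 : z = 0
      · simp [h0]
      have hn : 0 < ‖z‖ := norm_pos_iff.2 h0
      have := hu (‖z‖⁻¹ • z) (Finset.mem_filter.2 ⟨hz, by simp [norm_smul, hn.ne']⟩)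
      have e : (inner ℝ z (D z) : ℝ) =
          inner ℝ (‖z‖⁻¹ • z) (D (‖z‖⁻¹ • z)) * ‖z‖ ^ 2 := by
        rw [map_smul, inner_smul_left, inner_smul_right]
        simp only [conj_trivial]
        field_simp
      rw [e, abs_mul, abs_of_nonneg (sq_nonneg ‖z‖)]
      gcongr
    have hxy : ∀ x ∈ N, ∀ y ∈ N, |inner ℝ x (D y)| ≤ t := by
      intro x hx y hy
      have hp := hq (x + y) (by
        refine Finset.mem_union_left _ (Finset.mem_union_right _ ?_)
        exact Finset.mem_image.2 ⟨(x, y), Finset.mk_mem_product hx hy, rfl⟩)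
      have hm := hq (x - y) (by
        refine Finset.mem_union_right _ ?_
        exact Finset.mem_image.2 ⟨(x, y), Finset.mk_mem_product hx hy, rfl⟩)
      have e : (inner ℝ x (D y) : ℝ) =
          (inner ℝ (x + y) (D (x + y)) - inner ℝ (x - y) (D (x - y))) / 4 := by
        have hs : (inner ℝ y (D x) : ℝ) = inner ℝ x (D y) := by
          rw [← hD y x, real_inner_comm]
        simp only [map_add, map_sub, inner_add_left, inner_sub_left, inner_add_right,
          inner_sub_right, hs]
        ring
      -- For unit vectors ‖x + y‖² + ‖x - y‖² = 4, which cancels the 4 of the polarization identity: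
      -- the bilinear form is bounded by t itself.
      have hpar := parallelogram_law_with_norm ℝ x y
      rw [h1 x hx, h1 y hy] at hpar
      rw [e, abs_le]
      rw [abs_le] at hp hm
      constructor <;> nlinarith
    have hx : ∀ x ∈ N, ‖D x‖ ≤ 2 * t := fun x hx =>
      norm_le_of_net hnet _ ht fun y hy => hxy y hy x hx
    intro y
    have := norm_le_of_net hnet (D y) (t := 2 * t * ‖y‖) (by positivity) fun x hxN => by
      rw [← hD x y]
      exact (abs_real_inner_le_norm _ _).trans
        (mul_le_mul_of_nonneg_right (hx x hxN) (norm_nonneg _))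
    linarith

/-! ### Deviations of the sample mean and of the sample covariance -/

theorem toEuclideanLin_sampleCov {d n : ℕ} (X : Fin n → E d) (y : E d) :
    Matrix.toEuclideanLin (sampleCov X) y =
      (n : ℝ)⁻¹ • (∑ i, (inner ℝ (X i - sampleMean X) y : ℝ) • (X i - sampleMean X)) - y := by
  ext c
  simp only [sampleCov, Matrix.toLpLin_apply, Matrix.sub_mulVec, Matrix.one_mulVec,
    Matrix.smul_mulVec, Matrix.sum_mulVec, Matrix.vecMulVec_mulVec]
  simp [Finset.sum_apply, PiLp.inner_apply, dotProduct, mul_comm]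

theorem inner_toEuclideanLin_sampleCov {d n : ℕ} (X : Fin n → E d) (x y : E d) :
    inner ℝ x (Matrix.toEuclideanLin (sampleCov X) y) =
      (n : ℝ)⁻¹ * (∑ i, (inner ℝ (X i - sampleMean X) x : ℝ) * inner ℝ (X i - sampleMean X) y) -
        inner ℝ x y := by
  rw [toEuclideanLin_sampleCov, inner_sub_right, inner_smul_right, inner_sum]
  simp only [inner_smul_right]
  congr 2
  refine Finset.sum_congr rfl fun i _ => ?_
  rw [mul_comm, real_inner_comm]

theorem isSymmetric_sampleCov {d n : ℕ} (X : Fin n → E d) :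
    (Matrix.toEuclideanLin (sampleCov X)).IsSymmetric := by
  intro x y
  rw [real_inner_comm, inner_toEuclideanLin_sampleCov, inner_toEuclideanLin_sampleCov,
    real_inner_comm y x]
  congr 2
  exact Finset.sum_congr rfl fun i _ => mul_comm _ _

/-- The covariance operator of the two-atomic distribution with weights `a`, `1 - a` and atoms at
difference `v`, with `c = a (1 - a)`. -/
def rankOne {d : ℕ} (c : ℝ) (v : E d) : E d →ₗ[ℝ] E d :=
  c • ((innerSL ℝ v).toLinearMap.smulRight v)

theorem rankOne_apply {d : ℕ} (c : ℝ) (v y : E d) :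
    rankOne c v y = (c * inner ℝ v y) • v := by
  simp [rankOne, smul_smul]

theorem isSymmetric_rankOne {d : ℕ} (c : ℝ) (v : E d) : (rankOne c v).IsSymmetric := by
  intro x y
  rw [rankOne_apply, rankOne_apply, inner_smul_left, inner_smul_right, real_inner_comm x v]
  simp only [conj_trivial]
  ring

theorem sum_inner_sub_sampleMean {d n : ℕ} (hn : 1 ≤ n) (X : Fin n → E d) (m u : E d) :
    ∑ i, (inner ℝ u (X i - m) : ℝ) = n * inner ℝ u (sampleMean X - m) := by
  have hn0 : (n : ℝ) ≠ 0 := by positivity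
  rw [← inner_sum, Finset.sum_sub_distrib, sampleMean, inner_sub_right, inner_sub_right,
    inner_smul_right, mul_sub, ← mul_assoc, mul_inv_cancel₀ hn0, one_mul]
  simp [inner_smul_right, Finset.sum_const, ← Nat.cast_smul_eq_nsmul ℝ]

/-- Centring at any fixed m instead of the sample mean costs only the square of the error of the
mean, so the covariance reduces to an average of independent variables and a second-order term. -/
theorem inner_sampleCov_self {d n : ℕ} (hn : 1 ≤ n) (X : Fin n → E d) (m u : E d) (hu : ‖u‖ = 1) :
    inner ℝ u (Matrix.toEuclideanLin (sampleCov X) u) =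
      (n : ℝ)⁻¹ * (∑ i, ((inner ℝ u (X i - m) : ℝ) ^ 2 - 1)) - (inner ℝ u (sampleMean X - m)) ^ 2 := by
  have hn0 : (n : ℝ) ≠ 0 := by positivity
  rw [inner_toEuclideanLin_sampleCov, real_inner_self_eq_norm_sq, hu]
  set h : ℝ := inner ℝ u (sampleMean X - m) with hh
  have e : ∀ i, (inner ℝ (X i - sampleMean X) u : ℝ) = inner ℝ u (X i - m) - h := by
    intro i
    rw [hh, ← inner_sub_right, real_inner_comm]
    congr 1; abel
  have e2 : ∀ i, (inner ℝ (X i - sampleMean X) u : ℝ) * inner ℝ (X i - sampleMean X) u =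
      (inner ℝ u (X i - m) ^ 2 - 1) - 2 * h * inner ℝ u (X i - m) + (h ^ 2 + 1) := by
    intro i; rw [e]; ring
  simp only [e2]
  rw [Finset.sum_add_distrib, Finset.sum_sub_distrib, ← Finset.mul_sum,
    sum_inner_sub_sampleMean hn X m u, ← hh]
  simp only [Finset.sum_const, Finset.card_univ, Fintype.card_fin, nsmul_eq_mul]
  field_simp
  ring

section

variable {d : ℕ} {w : Fin 2 → ℝ} {μ : Fin 2 → E d}

theorem sub_mean_two (h1 : ∑ j, w j = 1) :
    μ 0 - ∑ i, w i • μ i = w 1 • (μ 0 - μ 1) ∧ μ 1 - ∑ i, w i • μ i = -(w 0 • (μ 0 - μ 1)) := by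
  rw [Fin.sum_univ_two] at h1
  rw [Fin.sum_univ_two]
  have e0 : w 0 = 1 - w 1 := by linarith
  rw [e0]
  constructor <;> module

theorem inner_sub_mean_two (h1 : ∑ j, w j = 1) (u : E d) :
    ∑ j, w j * inner ℝ u (μ j - ∑ i, w i • μ i) ^ 1 = 0 ∧
    ∑ j, w j * inner ℝ u (μ j - ∑ i, w i • μ i) ^ 2 =
      w 0 * w 1 * (inner ℝ (μ 0 - μ 1) u) ^ 2 := by
  obtain ⟨e0, e1⟩ := sub_mean_two (μ := μ) h1
  generalize ∑ i, w i • μ i = m at *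
  rw [Fin.sum_univ_two] at h1
  rw [Fin.sum_univ_two, Fin.sum_univ_two, e0, e1, inner_neg_right, inner_smul_right,
    inner_smul_right, real_inner_comm u]
  constructor
  · ring
  · linear_combination (w 0 * w 1 * inner ℝ u (μ 0 - μ 1) ^ 2) * h1

theorem norm_mean_le {R : ℝ} (hw : ∀ j, 0 ≤ w j) (h1 : ∑ j, w j = 1) (hμ : ∀ j, ‖μ j‖ ≤ R) :
    ‖∑ i, w i • μ i‖ ≤ R := by
  refine (norm_sum_le _ _).trans ?_
  calc ∑ i, ‖w i • μ i‖ ≤ ∑ i, w i * R := Finset.sum_le_sum fun i _ => by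
        rw [norm_smul, Real.norm_of_nonneg (hw i)]
        exact mul_le_mul_of_nonneg_left (hμ i) (hw i)
    _ = R := by rw [← Finset.sum_mul, h1, one_mul]

theorem abs_inner_sub_mean_le {R : ℝ} (hw : ∀ j, 0 ≤ w j) (h1 : ∑ j, w j = 1)
    (hμ : ∀ j, ‖μ j‖ ≤ R) {u : E d} (hu : ‖u‖ = 1) (j : Fin 2) :
    |inner ℝ u (μ j - ∑ i, w i • μ i)| ≤ 2 * R := by
  refine (abs_real_inner_le_norm _ _).trans ?_
  rw [hu, one_mul]
  exact (norm_sub_le _ _).trans (by linarith [hμ j, norm_mean_le hw h1 hμ])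

theorem map_sampleLaw_inner (hw : ∀ j, 0 ≤ w j) (h1 : ∑ j, w j = 1) (n : ℕ) {u : E d}
    (hu : ‖u‖ = 1) (a : E d) :
    (sampleLaw n (atomic w μ)).map (fun x i => inner ℝ u (x i - a)) =
      Measure.pi fun _ : Fin n => lineMix w fun j => inner ℝ u (μ j - a) := by
  have := isProbabilityMeasure_atomic hw h1 μ
  have hP := isProbabilityMeasure_lineMix hw h1 fun j => inner ℝ u (μ j - a)
  rw [← map_mixture_inner w μ hu a] at hP ⊢
  exact (Measure.pi_map_pi (μ := fun _ : Fin n => mixture (atomic w μ))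
    (f := fun _ x => (inner ℝ u (x - a) : ℝ)) fun _ => by fun_prop)

end

theorem centered_hermite_quadratic {w z : Fin 2 → ℝ} {B : ℝ} (hw : ∀ j, 0 ≤ w j)
    (h1 : ∑ j, w j = 1) (hB : 0 ≤ B) (hz : ∀ j, |z j| ≤ B) {r : ℕ} (hr : r < 2) (y : ℝ) :
    |(Polynomial.aeval y (Polynomial.hermite (r + 1)) : ℝ) - ∑ j, w j * z j ^ (r + 1)| ≤
      (2 + B + B ^ 2) * (1 + y ^ 2) := by
  have hs : |∑ j, w j * z j ^ (r + 1)| ≤ B ^ (r + 1) := by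
    calc _ ≤ ∑ j, |w j * z j ^ (r + 1)| := Finset.abs_sum_le_sum_abs _ _
      _ ≤ ∑ j, w j * B ^ (r + 1) := Finset.sum_le_sum fun j _ => by
          rw [abs_mul, abs_of_nonneg (hw j), abs_pow]
          exact mul_le_mul_of_nonneg_left (pow_le_pow_left₀ (abs_nonneg _) (hz j) _) (hw j)
      _ = _ := by rw [← Finset.sum_mul, h1, one_mul]
  set s := ∑ j, w j * z j ^ (r + 1)
  have hy := sq_nonneg y
  have hB2 := sq_nonneg B
  rw [abs_le] at hs
  interval_cases r
  · rw [aeval_hermite_one, abs_le]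
    rw [zero_add, pow_one] at hs
    constructor <;> nlinarith [sq_nonneg (y - 1), sq_nonneg (y + 1), mul_nonneg hB hy, mul_nonneg hB2 hy]
  · rw [aeval_hermite_two, abs_le]
    norm_num at hs
    constructor <;> nlinarith [mul_nonneg hB hy, mul_nonneg hB2 hy]

/-- The sample mean and the sample covariance are accurate up to a constant times
`√((d + log (1 / δ)) / n)`. -/
theorem first_half_deviation (R : ℝ) (hR : 0 < R) : ∃ C : ℝ, 0 < C ∧
    ∀ (d n : ℕ) (w : Fin 2 → ℝ) (μ : Fin 2 → E d) (δ : ℝ), (∀ j, 0 ≤ w j) → ∑ j, w j = 1 →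
      (∀ j, ‖μ j‖ ≤ R) → 1 ≤ d → 1 ≤ n → 0 < δ → δ < 1 → d + Real.log (1 / δ) < n →
      sampleLaw n (atomic w μ) {x | ¬ (
        ‖sampleMean x - ∑ j, w j • μ j‖ ≤ C * √((d + Real.log (1 / δ)) / n) ∧
        ∀ y, ‖Matrix.toEuclideanLin (sampleCov x) y - rankOne (w 0 * w 1) (μ 0 - μ 1) y‖ ≤
          C * √((d + Real.log (1 / δ)) / n) * ‖y‖)} ≤ ENNReal.ofReal (δ / 2) := by
  -- The exponent κ = 9 pays for the union bound: at most 3 · 25^d directions, two moments and two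
  -- signs, with 25 ≤ e⁴, give at most 12e^{-5d - 9 log(1/δ)} ≤ δ/2.
  obtain ⟨C, hC, hdev⟩ := deviation_quadratic (2 * R) (2 + 2 * R + (2 * R) ^ 2) 9 (by positivity)
    (by norm_num)
  -- In each direction the form of the covariance error is at most t for the averages plus t · C for
  -- the squared error of the mean; the factor 4 is the loss of the net.
  refine ⟨4 * (1 + C) * C, by positivity, ?_⟩
  intro d n w μ δ hw h1 hμ hd hn hδ hδ1 hSn
  obtain ⟨U, hUc, hU1, hUn, hUD⟩ := exists_directions d
  set l : ℝ := Real.log (1 / δ) with hl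
  have hl0 : 0 < l := Real.log_pos (by rw [lt_div_iff₀ hδ]; linarith)
  have hexpl : Real.exp (-l) = δ := by
    rw [hl, Real.log_div one_ne_zero hδ.ne', Real.log_one, zero_sub, neg_neg, Real.exp_log hδ]
  have hd1 : (1 : ℝ) ≤ d := by exact_mod_cast hd
  have hn0 : (0 : ℝ) < n := by exact_mod_cast hn
  set S : ℝ := d + l with hS
  set m : E d := ∑ j, w j • μ j with hm
  set t : ℝ := C * √(S / n) with ht
  have ht0 : 0 ≤ t := by positivity
  have htC : t ≤ C := by
    have : √(S / n) ≤ 1 := Real.sqrt_le_one.2 (by rw [div_le_one hn0]; exact hSn.le)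
    nlinarith
  set f : E d → ℕ → ℝ → ℝ := fun u r y => (Polynomial.aeval y (Polynomial.hermite (r + 1)) : ℝ) -
    ∑ j, w j * inner ℝ u (μ j - m) ^ (r + 1) with hf
  have hfm : ∀ u r, Measurable (f u r) := fun u r => (measurable_aeval_hermite _).sub_const _
  have hdir : ∀ u ∈ U, ∀ r < 2, sampleLaw n (atomic w μ)
      {x | n * t < |∑ i, f u r (inner ℝ u (x i - m))|} ≤ ENNReal.ofReal (2 * Real.exp (-(9 * S))) := by
    intro u hu r hr
    have hz := fun j => abs_inner_sub_mean_le hw h1 hμ (hU1 u hu) j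
    have hA : ∀ y, |f u r y| ≤ (2 + 2 * R + (2 * R) ^ 2) * (1 + y ^ 2) := fun y =>
      centered_hermite_quadratic hw h1 (by positivity) hz hr y
    have h0 : ∫ y, f u r y ∂lineMix w (fun j => inner ℝ u (μ j - m)) = 0 :=
      integral_centered_hermite hw h1 (by omega)
    have hp := hdev w _ hw h1 hz n S hn (by positivity) hSn.le (f u r) (hfm u r) hA h0
    have hq := hdev w _ hw h1 hz n S hn (by positivity) hSn.le (fun y => -f u r y) (hfm u r).neg
      (fun y => by rw [abs_neg]; exact hA y) (by rw [integral_neg, h0, neg_zero])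
    rw [← map_sampleLaw_inner hw h1 n (hU1 u hu) m] at hp hq
    have hmeas : Measurable fun (x : Fin n → E d) i => (inner ℝ u (x i - m) : ℝ) := by fun_prop
    -- `Measure.le_map_apply` needs no measurability of the event, only of the map.
    have hp' := (Measure.le_map_apply hmeas.aemeasurable _).trans hp
    have hq' := (Measure.le_map_apply hmeas.aemeasurable _).trans hq
    refine (measure_mono ?_).trans ((measure_union_le _ _).trans ((add_le_add hp' hq').trans ?_))
    · intro x hx
      have hx' : n * t < |∑ i, f u r (inner ℝ u (x i - m))| := hx
      simp only [Set.mem_union, Set.mem_preimage, Set.mem_ofPred_eq, Finset.sum_neg_distrib]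
      rcases lt_abs.1 hx' with h | h
      · exact Or.inl h.le
      · exact Or.inr h.le
    · rw [← ENNReal.ofReal_add (by positivity) (by positivity)]
      exact ENNReal.ofReal_le_ofReal (by linarith)
  refine (measure_mono (t := ⋃ p ∈ U ×ˢ Finset.range 2,
    {x | n * t < |∑ i, f p.1 p.2 (inner ℝ p.1 (x i - m))|}) ?_).trans
    ((measure_biUnion_finset_le _ _).trans ((Finset.sum_le_sum fun p hp => hdir p.1
      (Finset.mem_product.1 hp).1 p.2 (Finset.mem_range.1 (Finset.mem_product.1 hp).2)).trans ?_))
  · intro x hx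
    by_contra hcon
    simp only [Set.mem_iUnion, not_exists, Set.mem_ofPred_eq, not_lt] at hcon
    have hg : ∀ u ∈ U, ∀ r < 2, |∑ i, f u r (inner ℝ u (x i - m))| ≤ n * t := fun u hu r hr =>
      hcon (u, r) (Finset.mk_mem_product hu (Finset.mem_range.2 hr))
    have hmean : ∀ u ∈ U, |inner ℝ u (sampleMean x - m)| ≤ t := by
      intro u hu
      have := hg u hu 0 (by norm_num)
      simp only [hf, zero_add, aeval_hermite_one] at this
      rw [(inner_sub_mean_two h1 u).1] at this
      simp only [sub_zero] at this
      rw [sum_inner_sub_sampleMean hn, abs_mul, abs_of_pos hn0] at this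
      exact le_of_mul_le_mul_left this hn0
    refine hx ⟨?_, ?_⟩
    · have := hUn _ t ht0 hmean
      refine this.trans ?_
      rw [mul_assoc]
      nlinarith
    · intro y
      set D : E d →ₗ[ℝ] E d := Matrix.toEuclideanLin (sampleCov x) - rankOne (w 0 * w 1) (μ 0 - μ 1)
        with hD
      have hsym : D.IsSymmetric := (isSymmetric_sampleCov x).sub (isSymmetric_rankOne _ _)
      have := hUD D ((1 + C) * t) hsym (by positivity) ?_ y
      · refine this.trans (le_of_eq ?_)
        rw [ht]; ring
      · intro u hu
        have h2 := hg u hu 1 (by norm_num)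
        have h3 := hmean u hu
        simp only [hf, aeval_hermite_two, Nat.reduceAdd] at h2
        rw [(inner_sub_mean_two h1 u).2, Finset.sum_sub_distrib] at h2
        simp only [Finset.sum_const, Finset.card_univ, Fintype.card_fin, nsmul_eq_mul] at h2
        have e : (inner ℝ u (D u) : ℝ) = (n : ℝ)⁻¹ * (∑ i, ((inner ℝ u (x i - m) : ℝ) ^ 2 - 1) -
            n * (w 0 * w 1 * inner ℝ (μ 0 - μ 1) u ^ 2)) - (inner ℝ u (sampleMean x - m)) ^ 2 := by
          rw [hD, LinearMap.sub_apply, inner_sub_right, inner_sampleCov_self hn x m u (hU1 u hu),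
            rankOne_apply, inner_smul_right, real_inner_comm (μ 0 - μ 1) u]
          field_simp
          ring
        rw [e]
        have h4 : |(n : ℝ)⁻¹ * (∑ i, ((inner ℝ u (x i - m) : ℝ) ^ 2 - 1) -
            n * (w 0 * w 1 * inner ℝ (μ 0 - μ 1) u ^ 2))| ≤ t := by
          rw [abs_mul, abs_of_pos (inv_pos.2 hn0), inv_mul_le_iff₀ hn0]
          exact h2
        have h5 : (inner ℝ u (sampleMean x - m) : ℝ) ^ 2 ≤ t * C := by
          rw [← sq_abs]
          nlinarith [abs_nonneg (inner ℝ u (sampleMean x - m) : ℝ)]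
        rw [abs_le] at h4 ⊢
        constructor <;> nlinarith [sq_nonneg (inner ℝ u (sampleMean x - m) : ℝ)]
  · rw [Finset.sum_const, nsmul_eq_mul, Finset.card_product, Finset.card_range,
      ← ENNReal.ofReal_natCast, ← ENNReal.ofReal_mul (by positivity)]
    refine ENNReal.ofReal_le_ofReal ?_
    have hc : ((U.card * 2 : ℕ) : ℝ) ≤ 6 * 25 ^ d := by
      exact_mod_cast (by omega : U.card * 2 ≤ 6 * 25 ^ d)
    have he : (2.7 : ℝ) ≤ Real.exp 1 := by have := Real.exp_one_gt_d9; linarith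
    have he4 : (25 : ℝ) ≤ Real.exp 4 := by
      have h9 : Real.exp 4 = Real.exp 1 ^ 4 := by rw [← Real.exp_nat_mul]; norm_num
      rw [h9]
      calc (25 : ℝ) ≤ 2.7 ^ 4 := by norm_num
        _ ≤ _ := pow_le_pow_left₀ (by norm_num) he 4
    have h25 : (25 : ℝ) ^ d ≤ Real.exp (4 * d) := by
      rw [mul_comm, Real.exp_nat_mul]
      exact pow_le_pow_left₀ (by norm_num) he4 d
    calc ((U.card * 2 : ℕ) : ℝ) * (2 * Real.exp (-(9 * S)))
        ≤ (6 * Real.exp (4 * d)) * (2 * Real.exp (-(9 * S))) := by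
          gcongr
          exact hc.trans (by gcongr)
      _ = 12 * Real.exp (-5 * d + -9 * l) := by
          rw [show (-5 * d + -9 * l : ℝ) = 4 * d + -(9 * S) by rw [hS]; ring, Real.exp_add]
          ring
      _ ≤ 12 * Real.exp (-4 + -l) := by gcongr <;> linarith
      _ = 12 * Real.exp (-4) * δ := by rw [Real.exp_add, hexpl]; ring
      _ ≤ 12 * (1 / 25) * δ := by
          gcongr
          rw [Real.exp_neg, ← one_div]
          exact one_div_le_one_div_of_le (by norm_num) he4
      _ ≤ δ / 2 := by linarith

/-! ### Approximate top eigenvectors -/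

theorem inner_le_of_eigenvalues_le {d : ℕ} {A : E d →ₗ[ℝ] E d} (hA : A.IsSymmetric) {ℓ : ℝ}
    (hℓ : ∀ i, hA.eigenvalues finrank_euclideanSpace_fin i ≤ ℓ) (x : E d) :
    inner ℝ x (A x) ≤ ℓ * ‖x‖ ^ 2 := by
  set b := hA.eigenvectorBasis finrank_euclideanSpace_fin with hb
  rw [← b.sum_inner_mul_inner x (A x), ← real_inner_self_eq_norm_sq, ← b.sum_inner_mul_inner x x,
    Finset.mul_sum]
  refine Finset.sum_le_sum fun i _ => ?_
  have e : inner ℝ (b i) (A x) =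
      hA.eigenvalues finrank_euclideanSpace_fin i * inner ℝ (b i) x := by
    rw [← hA (b i) x, hb, hA.apply_eigenvectorBasis, inner_smul_left]
    simp
  rw [e, real_inner_comm (b i) x]
  nlinarith [mul_nonneg (sub_nonneg.2 (hℓ i)) (mul_self_nonneg (inner ℝ (b i) x : ℝ))]

theorem inner_le_of_isGreatest_eigenvalue {d : ℕ} {A : E d →ₗ[ℝ] E d} (hA : A.IsSymmetric) {ℓ : ℝ}
    (hℓ : ℓ ∈ upperBounds {a : ℝ | Module.End.HasEigenvalue A a}) (x : E d) :
    inner ℝ x (A x) ≤ ℓ * ‖x‖ ^ 2 :=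
  inner_le_of_eigenvalues_le hA (fun i => hℓ (hA.hasEigenvalue_eigenvalues _ i)) x

theorem exists_isGreatest_eigenvalue {d : ℕ} (hd : 1 ≤ d) {A : E d →ₗ[ℝ] E d}
    (hA : A.IsSymmetric) :
    ∃ ℓ : ℝ, IsGreatest {a : ℝ | Module.End.HasEigenvalue A a} ℓ := by
  refine ⟨hA.eigenvalues finrank_euclideanSpace_fin ⟨0, hd⟩, hA.hasEigenvalue_eigenvalues _ _,
    fun a ha => ?_⟩
  obtain ⟨x, hx⟩ := Module.End.HasEigenvalue.exists_hasEigenvector ha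
  have hx0 : 0 < ‖x‖ ^ 2 := by
    have := norm_pos_iff.2 hx.2
    positivity
  have hle := inner_le_of_eigenvalues_le hA (fun i => hA.eigenvalues_antitone _
    (show (⟨0, hd⟩ : Fin d) ≤ i from Nat.zero_le _)) x
  rw [hx.apply_eq_smul, inner_smul_right, real_inner_self_eq_norm_sq] at hle
  exact le_of_mul_le_mul_right hle hx0

/-- An approximate top eigenvector of a perturbation of a rank-one operator is nearly aligned with
the direction of the operator. -/
theorem residual_le_of_isTopEigenvector {d : ℕ} {S : Matrix (Fin d) (Fin d) ℝ} {τ ε c : ℝ}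
    {u v : E d} (hS : (Matrix.toEuclideanLin S).IsSymmetric) (hu : IsTopEigenvector S τ u)
    (hc : 0 ≤ c) (hτ : 0 ≤ τ)
    (hε : ∀ y, ‖Matrix.toEuclideanLin S y - rankOne c v y‖ ≤ ε * ‖y‖) :
    c * ‖v‖ * ‖v - (inner ℝ u v : ℝ) • u‖ ≤ 3 * ε + 2 * (τ * (c * ‖v‖ ^ 2 + ε + 1)) := by
  obtain ⟨hu1, ℓ, ⟨hev, hub⟩, hres⟩ := hu
  set A := Matrix.toEuclideanLin S with hA
  set s : ℝ := inner ℝ u v with hs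
  set q : E d := v - s • u with hq
  have hε0 : 0 ≤ ε := by
    have := (norm_nonneg _).trans (hε u)
    rwa [hu1, mul_one] at this
  have huq : inner ℝ u q = (0 : ℝ) := by
    rw [hq, inner_sub_right, inner_smul_right, real_inner_self_eq_norm_sq, hu1, ← hs]
    ring
  have hv2 : ‖v‖ ^ 2 = s ^ 2 + ‖q‖ ^ 2 := by
    have e : v = s • u + q := by rw [hq]; abel
    rw [← real_inner_self_eq_norm_sq, e, inner_add_left, inner_add_right, inner_add_right,
      inner_smul_left, inner_smul_right, inner_smul_left, inner_smul_right, real_inner_comm u q, huq,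
      real_inner_self_eq_norm_sq, real_inner_self_eq_norm_sq, hu1]
    simp only [conj_trivial]
    ring
  have hvq : ‖v‖ ≤ |s| + ‖q‖ := by
    refine abs_le_of_sq_le_sq' ?_ (by positivity) |>.2
    rw [hv2, add_sq, sq_abs]
    have : 0 ≤ 2 * |s| * ‖q‖ := by positivity
    linarith
  have hbil : ∀ y, |inner ℝ y (A y) - c * (inner ℝ v y) ^ 2| ≤ ε * ‖y‖ ^ 2 := by
    intro y
    have h := (abs_real_inner_le_norm y (A y - rankOne c v y)).trans
      (mul_le_mul_of_nonneg_left (hε y) (norm_nonneg _))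
    rw [inner_sub_right, rankOne_apply, inner_smul_right, real_inner_comm v y] at h
    calc _ = |inner ℝ y (A y) - c * inner ℝ v y * inner ℝ v y| := by ring_nf
      _ ≤ ‖y‖ * (ε * ‖y‖) := h
      _ = _ := by ring
  -- Weyl's inequality by hand: the largest eigenvalue differs from c‖v‖² by at most ε. Testing with
  -- v gives this side, testing with an eigenvector the other.
  have hlow : c * ‖v‖ ^ 2 - ε ≤ ℓ := by
    by_cases hv0 : v = 0
    · rw [hv0, norm_zero]
      have h1 := (abs_le.1 (hbil u)).1
      have h2 := inner_le_of_isGreatest_eigenvalue hS hub u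
      rw [hv0, hu1, inner_zero_left] at *
      nlinarith
    · have hv : 0 < ‖v‖ ^ 2 := by
        have := norm_pos_iff.2 hv0
        positivity
      have h1 := (abs_le.1 (hbil v)).1
      have h2 := inner_le_of_isGreatest_eigenvalue hS hub v
      rw [real_inner_self_eq_norm_sq] at h1
      have h3 : (c * ‖v‖ ^ 2 - ε) * ‖v‖ ^ 2 ≤ ℓ * ‖v‖ ^ 2 := by linarith
      exact le_of_mul_le_mul_right h3 hv
  have hupp : ℓ ≤ c * ‖v‖ ^ 2 + ε := by
    obtain ⟨x, hx⟩ := Module.End.HasEigenvalue.exists_hasEigenvector hev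
    have hx1 : A x = ℓ • x := hx.apply_eq_smul
    have hx0 : 0 < ‖x‖ ^ 2 := by
      have := norm_pos_iff.2 hx.2
      positivity
    have h1 := (abs_le.1 (hbil x)).2
    rw [hx1, inner_smul_right, real_inner_self_eq_norm_sq] at h1
    have h2 : (inner ℝ v x : ℝ) ^ 2 ≤ ‖v‖ ^ 2 * ‖x‖ ^ 2 := by
      rw [← mul_pow]
      exact sq_le_sq' (by linarith [neg_le_of_abs_le (abs_real_inner_le_norm v x)])
        (real_inner_le_norm v x)
    have h3 : ℓ * ‖x‖ ^ 2 ≤ (c * ‖v‖ ^ 2 + ε) * ‖x‖ ^ 2 := by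
      have := mul_le_mul_of_nonneg_left h2 hc
      linarith
    exact le_of_mul_le_mul_right h3 hx0
  -- The vector c s v - ℓu has norm at most η. Its component along u gives ℓ ≤ c s² + η, its
  -- component along q gives c|s|‖q‖ ≤ η. With the lower bound on ℓ the former yields c‖q‖² ≤ ε + η,
  -- and the two add up to a bound on c‖v‖‖q‖ because ‖v‖ ≤ |s| + ‖q‖.
  set η : ℝ := ε + τ * (c * ‖v‖ ^ 2 + ε + 1) with hη
  have hr : ‖(c * s) • v - ℓ • u‖ ≤ η := by
    have h1 := hε u
    rw [rankOne_apply, real_inner_comm, ← hs, hu1, mul_one, norm_sub_rev] at h1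
    have h2 : (c * s) • v - ℓ • u = ((c * s) • v - A u) + (A u - ℓ • u) := by abel
    rw [h2]
    refine (norm_add_le _ _).trans (add_le_add h1 (hres.trans ?_))
    gcongr
  have hru : c * s ^ 2 - ℓ ≥ -η := by
    have h1 := (abs_real_inner_le_norm u ((c * s) • v - ℓ • u)).trans
      (mul_le_mul_of_nonneg_left hr (norm_nonneg _))
    rw [inner_sub_right, inner_smul_right, inner_smul_right, real_inner_self_eq_norm_sq, hu1, ← hs]
      at h1
    have := (abs_le.1 h1).1
    nlinarith
  have hrq : c * |s| * ‖q‖ ≤ η := by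
    by_cases hq0 : q = 0
    · rw [hq0, norm_zero, mul_zero]
      exact (norm_nonneg _).trans hr
    · have hqp : 0 < ‖q‖ := norm_pos_iff.2 hq0
      have h1 := (abs_real_inner_le_norm q ((c * s) • v - ℓ • u)).trans
        (mul_le_mul_of_nonneg_left hr (norm_nonneg _))
      have hqv : inner ℝ q v = ‖q‖ ^ 2 := by
        have e : v = s • u + q := by rw [hq]; abel
        rw [e, inner_add_right, inner_smul_right, real_inner_comm u q, huq,
          real_inner_self_eq_norm_sq]
        ring
      rw [inner_sub_right, inner_smul_right, inner_smul_right, hqv, real_inner_comm u q, huq,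
        mul_zero, sub_zero, abs_mul, abs_mul, abs_of_nonneg hc, abs_of_nonneg (sq_nonneg ‖q‖)] at h1
      refine le_of_mul_le_mul_left (a := ‖q‖) ?_ hqp
      linarith
  have hcq : c * ‖q‖ ^ 2 ≤ ε + η := by
    rw [hv2] at hlow
    linarith
  calc c * ‖v‖ * ‖q‖ ≤ c * (|s| + ‖q‖) * ‖q‖ := by gcongr
    _ = c * |s| * ‖q‖ + c * ‖q‖ ^ 2 := by ring
    _ ≤ η + (ε + η) := add_le_add hrq hcq
    _ = _ := by rw [hη]; ring

/-! ### The rate -/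

theorem integral_atomic {k : ℕ} {w : Fin k → ℝ} (hw : ∀ j, 0 ≤ w j) (θ : Fin k → ℝ) (f : ℝ → ℝ) :
    ∫ x, f x ∂atomic w θ = ∑ j, w j * f (θ j) := by
  unfold atomic
  rw [integral_finsetSum_measure fun j _ => (integrable_dirac (by simp)).smul_measure
    ENNReal.ofReal_ne_top]
  refine Finset.sum_congr rfl fun j _ => ?_
  rw [integral_smul_measure, ENNReal.toReal_ofReal (hw j), smul_eq_mul, integral_dirac]

theorem atomic_compl_eq_zero {k : ℕ} {w θ : Fin k → ℝ} {s : Set ℝ} (hs : MeasurableSet s)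
    (hθ : ∀ j, θ j ∈ s) : atomic w θ sᶜ = 0 := by
  simp [atomic, Measure.finsetSum_apply, hs.compl, hθ]

theorem momentDist_eq_norm {p : ℕ} (m : Fin p → ℝ) (π : Measure ℝ) :
    momentDist m π = ‖(WithLp.toLp 2 m : E p) -
      WithLp.toLp 2 fun r : Fin p => ∫ x, x ^ ((r : ℕ) + 1) ∂π‖ := by
  rw [momentDist, EuclideanSpace.norm_eq]
  simp

theorem abs_le_momentDist {p : ℕ} (m : Fin p → ℝ) (π : Measure ℝ) (r : Fin p) :
    |m r - ∫ x, x ^ ((r : ℕ) + 1) ∂π| ≤ momentDist m π := by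
  rw [momentDist_eq_norm]
  exact PiLp.norm_apply_le (WithLp.toLp 2 m - WithLp.toLp 2 fun r : Fin p =>
    ∫ x, x ^ ((r : ℕ) + 1) ∂π : E p) r

theorem momentDist_le_three {m : Fin 3 → ℝ} {π : Measure ℝ} {t : ℝ}
    (h : ∀ r, |m r - ∫ x, x ^ ((r : ℕ) + 1) ∂π| ≤ t) : momentDist m π ≤ 2 * t := by
  have ht : 0 ≤ t := (abs_nonneg _).trans (h 0)
  refine Real.sqrt_le_iff.2 ⟨by positivity, ?_⟩
  calc _ ≤ ∑ _r : Fin 3, t ^ 2 := Finset.sum_le_sum fun r _ => by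
        rw [← sq_abs]; exact pow_le_pow_left₀ (abs_nonneg _) (h r) 2
    _ ≤ _ := by simp; nlinarith

theorem map_halves {d n : ℕ} (Γ : Measure (E d)) [IsProbabilityMeasure Γ] :
    (sampleLaw (n + n) Γ).map (fun X => (firstHalf X, secondHalf X)) =
      (sampleLaw n Γ).prod (sampleLaw n Γ) := by
  have h1 := (measurePreserving_piCongrLeft (fun _ : Fin (n + n) => mixture Γ)
    (finSumFinEquiv (m := n) (n := n))).symm
  have h2 := measurePreserving_sumPiEquivProdPi fun _ : Fin n ⊕ Fin n => mixture Γ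
  have h3 := (h2.comp h1).map_eq
  unfold sampleLaw
  rw [← h3]
  congr 1

theorem measurable_sampleMean {d n : ℕ} : Measurable (sampleMean : (Fin n → E d) → E d) := by
  unfold sampleMean; fun_prop

theorem measurable_batchMoment {n T : ℕ} (r : ℕ) (j : Fin T) :
    Measurable fun y : Fin n → ℝ => batchMoment T y r j := by
  unfold batchMoment
  exact (Finset.measurable_sum _ fun i _ =>
    (measurable_aeval_hermite r).comp (measurable_pi_apply i)).div_const _

theorem measurableSet_momentBadSet {α : Type*} [MeasurableSpace α] {n : ℕ} (T : ℕ)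
    {y : α → Fin n → ℝ} (hy : Measurable y) {m : ℕ → α → ℝ} (hm : ∀ r, Measurable (m r)) (t : ℝ) :
    MeasurableSet {a | y a ∈ momentBadSet n T (fun r => m r a) t} := by
  have e : {a | y a ∈ momentBadSet n T (fun r => m r a) t} = ⋃ r ∈ Finset.range 3,
      {a | T ≤ 2 * (Finset.univ.filter fun j : Fin T =>
        t < |batchMoment T (y a) (r + 1) j - m r a|).card} := by
    ext a
    simp [momentBadSet]
  rw [e]
  refine Finset.measurableSet_biUnion _ fun r _ => ?_
  refine measurableSet_le measurable_const (Measurable.const_mul ?_ 2)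
  simp only [Finset.card_filter]
  refine Finset.measurable_sum _ fun j _ => Measurable.ite ?_ measurable_const measurable_const
  exact measurableSet_lt measurable_const
    (((measurable_batchMoment (r + 1) j).comp hy).sub (hm r)).abs

theorem IsDMM.isProbabilityMeasure_mixture {d n T : ℕ} {L τ : ℝ} {y : Fin n → ℝ} {w θ : Fin 2 → ℝ}
    (h : IsDMM 2 L T τ y w θ) (μ : Fin 2 → E d) :
    IsProbabilityMeasure (mixture (atomic w μ)) := by
  have := isProbabilityMeasure_atomic h.1 h.2.1 μ
  infer_instance

/-- The accuracy of the one-dimensional method, given that for each of the three moments the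
majority of the batches is accurate. -/
theorem IsDMM.abs_sub_le {n T : ℕ} {L τ t t' : ℝ} {y : Fin n → ℝ} {w θ w' θ' : Fin 2 → ℝ}
    {m : ℕ → ℝ} (h : IsDMM 2 L T τ y w θ) (hy : y ∉ momentBadSet n T m t)
    (hw' : ∀ j, 0 ≤ w' j) (h1' : ∑ j, w' j = 1) (hθ' : ∀ j, θ' j ∈ Set.Icc (-L) L)
    (hm : ∀ r < 3, |m r - ∑ j, w' j * θ' j ^ (r + 1)| ≤ t') (r : Fin 3) :
    |∑ j, w' j * θ' j ^ ((r : ℕ) + 1) - ∑ j, w j * θ j ^ ((r : ℕ) + 1)| ≤ 3 * (t + t') + τ := by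
  obtain ⟨hw, h1, hθ, m', hmed, hopt⟩ := h
  have hmm : ∀ r : Fin 3, |m' r - m r| ≤ t := by
    intro r
    refine (hmed r).abs_sub_le ?_
    by_contra hcon
    exact hy ⟨r, r.2, not_lt.1 hcon⟩
  have h2 : ∀ r : Fin 3, |m' r - ∑ j, w' j * θ' j ^ ((r : ℕ) + 1)| ≤ t + t' := fun r => by
    have := _root_.abs_sub_le (m' r) (m r) (∑ j, w' j * θ' j ^ ((r : ℕ) + 1))
    linarith [hmm r, hm r r.2]
  have h3 : momentDist m' (atomic w' θ') ≤ 2 * (t + t') := momentDist_le_three fun r => by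
    rw [integral_atomic hw' θ' fun x => x ^ ((r : ℕ) + 1)]
    exact h2 r
  have h4 := hopt (atomic w' θ') (isProbabilityMeasure_atomic hw' h1' θ')
    (atomic_compl_eq_zero measurableSet_Icc hθ')
  have h5 := abs_le_momentDist m' (atomic w θ) r
  rw [integral_atomic hw θ fun x => x ^ ((r : ℕ) + 1)] at h5
  have h6 := _root_.abs_sub_le (∑ j, w' j * θ' j ^ ((r : ℕ) + 1)) (m' r) (∑ j, w j * θ j ^ ((r : ℕ) + 1))
  rw [abs_sub_comm _ (m' r)] at h6
  linarith [h2 r]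

/-- The accuracy of the estimator when the estimates of the first half and the batch averages of
the second half are accurate. -/
theorem hellinger_le_of_good_sample (R L C₁ C₂ : ℝ) (hR : 0 < R) (hL : 2 * R ≤ L) (hC₁ : 0 < C₁)
    (hC₂ : 0 < C₂) : ∃ C : ℝ, 0 < C ∧ ∀ (d n T : ℕ) (ε τ : ℝ) (w : Fin 2 → ℝ) (μ : Fin 2 → E d)
      (x : Fin n → E d) (u : E d) (y : Fin n → ℝ) (ŵ θ : Fin 2 → ℝ),
      0 ≤ ε → ε ≤ 1 → C₂ * ε ≤ 1 → 0 ≤ τ → τ ≤ ε →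
      (∀ j, 0 ≤ w j) → ∑ j, w j = 1 → (∀ j, ‖μ j‖ ≤ R) →
      IsTopEigenvector (sampleCov x) τ u → IsDMM 2 L T τ y ŵ θ →
      ‖sampleMean x - ∑ j, w j • μ j‖ ≤ C₂ * ε →
      (∀ z, ‖Matrix.toEuclideanLin (sampleCov x) z - rankOne (w 0 * w 1) (μ 0 - μ 1) z‖ ≤
        C₂ * ε * ‖z‖) →
      y ∉ momentBadSet n T (fun r => ∑ j, w j * inner ℝ u (μ j - sampleMean x) ^ (r + 1)) (C₁ * ε) →
      hellinger (mixture (atomic w μ)) (mixture (atomic ŵ fun j => θ j • u + sampleMean x)) ≤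
        C * ε := by
  obtain ⟨C₃, hC₃, hell⟩ := hellinger_le_of_estimates R L hR hL
  set M : ℝ := 2 * R + 1 with hM
  set K : ℝ := C₂ + (3 * C₂ + 2 * ((2 * R) ^ 2 + 2)) + (3 * (C₁ + 3 * M ^ 2 * C₂) + 1) with hK
  refine ⟨C₃ * K, by positivity, ?_⟩
  intro d n T ε τ w μ x u y ŵ θ hε hε1 hCε hτ hτε hw h1 hμ hu hD hmean hcov hy
  set m := sampleMean x with hm
  set a := ∑ j, w j • μ j with ha
  have hKε : ∀ b, 0 ≤ K - b → b * ε ≤ K * ε := fun b hb =>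
    mul_le_mul_of_nonneg_right (sub_nonneg.1 hb) hε
  have hu1 := hu.1
  rw [mul_assoc]
  refine hell d (K * ε) w μ u m ŵ θ (by positivity) hw h1 hμ hD.1 hD.2.1 hD.2.2.1 hu1
    (hmean.trans (hKε _ (by rw [hK]; ring_nf; positivity))) (hmean.trans hCε) ?_ fun r => ?_
  · have hc : 0 ≤ w 0 * w 1 := mul_nonneg (hw 0) (hw 1)
    have hc1 : w 0 * w 1 ≤ 1 := by
      rw [Fin.sum_univ_two] at h1
      nlinarith [hw 0, hw 1]
    have hv : ‖μ 0 - μ 1‖ ≤ 2 * R := (norm_sub_le _ _).trans (by linarith [hμ 0, hμ 1])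
    refine (residual_le_of_isTopEigenvector (isSymmetric_sampleCov x) hu hc hτ hcov).trans ?_
    have h2 : w 0 * w 1 * ‖μ 0 - μ 1‖ ^ 2 ≤ (2 * R) ^ 2 := by
      calc _ ≤ 1 * (2 * R) ^ 2 := by gcongr
        _ = _ := one_mul _
    calc 3 * (C₂ * ε) + 2 * (τ * (w 0 * w 1 * ‖μ 0 - μ 1‖ ^ 2 + C₂ * ε + 1))
        ≤ 3 * (C₂ * ε) + 2 * (ε * ((2 * R) ^ 2 + 1 + 1)) := by gcongr
      _ = (3 * C₂ + 2 * ((2 * R) ^ 2 + 2)) * ε := by ring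
      _ ≤ _ := hKε _ (by rw [hK]; ring_nf; positivity)
  · have hz : ∀ j, |inner ℝ u (μ j - a)| ≤ 2 * R := fun j => abs_inner_sub_mean_le hw h1 hμ hu1 j
    -- The sample is centred at the sample mean, but the competitor in the minimization is centred
    -- at the true mean: its atoms lie in [-2R, 2R], hence in [-L, L], which the sample mean would
    -- not guarantee. The change of centre costs O(ε) in the moments.
    set β : ℝ := inner ℝ u (a - m) with hβ
    have hβε : |β| ≤ C₂ * ε := by
      refine (abs_real_inner_le_norm _ _).trans ?_
      rw [hu1, one_mul, norm_sub_rev]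
      exact hmean
    have hsum : ∀ j, inner ℝ u (μ j - m) = inner ℝ u (μ j - a) + β := fun j => by
      rw [hβ, ← inner_add_right]; congr 1; abel
    have hshift : ∀ r < 3, |∑ j, w j * inner ℝ u (μ j - m) ^ (r + 1) -
        ∑ j, w j * inner ℝ u (μ j - a) ^ (r + 1)| ≤ 3 * M ^ 2 * (C₂ * ε) := by
      intro r hr
      rw [abs_sub_comm]
      simp only [hsum]
      refine moment_shift_le (by linarith) (by positivity) hw h1 (fun j => ?_) (fun j => ?_) hβε
        (r + 1) (by omega)
      · linarith [hz j]
      · linarith [hz j, abs_add_le (inner ℝ u (μ j - a)) β]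
    have := hD.abs_sub_le hy hw h1 (θ' := fun j => inner ℝ u (μ j - a)) (fun j => by
      have := abs_le.1 (hz j)
      exact ⟨by linarith, by linarith⟩) hshift r
    refine this.trans ?_
    calc 3 * (C₁ * ε + 3 * M ^ 2 * (C₂ * ε)) + τ ≤ 3 * (C₁ * ε + 3 * M ^ 2 * (C₂ * ε)) + ε := by
          gcongr
      _ = (3 * (C₁ + 3 * M ^ 2 * C₂) + 1) * ε := by ring
      _ ≤ _ := hKε _ (by rw [hK]; ring_nf; positivity)

/-- The rate of the centered estimator. -/
theorem centered_estimator_rate (R L : ℝ) (hR : 0 < R) (hL : 2 * R ≤ L) : ∃ C : ℝ, 0 < C ∧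
    ∀ (d n T : ℕ) (δ τ : ℝ), 1 ≤ d → 1 ≤ n → 0 < δ → δ < 1 → 0 ≤ τ → τ ≤ 1 / √(n : ℝ) →
      (T = min n ⌈Real.log (1 / δ)⌉₊ ∨ (T = 1 ∧ Real.exp (-√(n : ℝ)) ≤ δ)) →
      ∀ Γhat : (Fin (n + n) → E d) → Measure (E d), IsCenteredEstimator L T τ Γhat →
      ∀ Γ ∈ mixingClass 2 d R,
        sampleLaw (n + n) Γ {X | ¬ hellinger (mixture Γ) (mixture (Γhat X)) ≤
          C * √((d + Real.log (1 / δ)) / n)} ≤ ENNReal.ofReal δ := by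
  obtain ⟨C₁, hC₁, hmom⟩ := moment_deviation (2 * R + 1) (by linarith)
  obtain ⟨C₂, hC₂, hfirst⟩ := first_half_deviation R hR
  obtain ⟨C₃, hC₃, hell⟩ := hellinger_le_of_good_sample R L C₁ C₂ hR hL hC₁ hC₂
  refine ⟨C₃ + 2 * (1 + C₂), by positivity, ?_⟩
  rintro d n T δ τ hd hn hδ hδ1 hτ hτn hT Γhat ⟨u, hum, hu, hΓ⟩ Γ ⟨w, μ, hw, h1, hμ, rfl⟩
  have hprob := isProbabilityMeasure_atomic hw h1 μ
  set l : ℝ := Real.log (1 / δ) with hl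
  have hl0 : 0 < l := Real.log_pos (by rw [lt_div_iff₀ hδ]; linarith)
  have hd1 : (1 : ℝ) ≤ d := by exact_mod_cast hd
  have hn0 : (0 : ℝ) < n := by exact_mod_cast hn
  set ε : ℝ := √((d + l) / n) with hε
  have hε0 : 0 ≤ ε := Real.sqrt_nonneg _
  -- Since d ≥ 1, the target rate is never below n^{-1/2}, so the tolerance is of the order of the
  -- statistical error.
  have hτε : τ ≤ ε := by
    refine hτn.trans ?_
    rw [hε, ← Real.sqrt_one, ← Real.sqrt_div zero_le_one]
    refine Real.sqrt_le_sqrt ?_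
    gcongr
    linarith
  -- If the rate is not small the claim holds surely, because the Hellinger distance is at most 2.
  -- Otherwise the rate is less than 1 and the deviation bounds apply.
  by_cases hbig : 1 ≤ (1 + C₂) * ε
  · have hemp : {X | ¬ hellinger (mixture (atomic w μ)) (mixture (Γhat X)) ≤
        (C₃ + 2 * (1 + C₂)) * ε} = ∅ := by
      refine Set.eq_empty_of_forall_notMem fun X hX => hX ?_
      obtain ⟨ŵ, θ, hD, he⟩ := hΓ X
      rw [he]
      have := hD.isProbabilityMeasure_mixture fun j => θ j • u (firstHalf X) + sampleMean (firstHalf X)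
      refine (hellinger_le_two _ _).trans ?_
      nlinarith [mul_nonneg hC₃.le hε0]
    rw [hemp, measure_empty]
    exact zero_le
  have hbig' := not_le.1 hbig
  have hε1 : ε ≤ 1 := by nlinarith [mul_nonneg hC₂.le hε0]
  have hCε : C₂ * ε ≤ 1 := by nlinarith
  have hSn : d + l < n := by
    by_contra hcon
    have : 1 ≤ ε := Real.one_le_sqrt.2 (by rw [one_le_div hn0]; exact not_lt.1 hcon)
    nlinarith
  set a : E d := ∑ j, w j • μ j with ha
  set z : (Fin n → E d) → Fin 2 → ℝ := fun x j => inner ℝ (u x) (μ j - sampleMean x) with hz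
  set y : (Fin n → E d) × (Fin n → E d) → Fin n → ℝ :=
    fun p i => inner ℝ (u p.1) (p.2 i - sampleMean p.1) with hy
  set G : Set (Fin n → E d) := {x | ‖sampleMean x - a‖ ≤ C₂ * ε} with hG
  -- Membership in G is part of the event, so that after fixing the first half the projected means
  -- are bounded by 2R + 1. The error of the covariance is left to B: only W, which is integrated
  -- over sections, must be measurable.
  set W : Set ((Fin n → E d) × (Fin n → E d)) := {p | p.1 ∈ G} ∩ {p | y p ∈ momentBadSet n T
    (fun r => ∑ j, w j * z p.1 j ^ (r + 1)) (C₁ * ε)} with hW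
  set B : Set (Fin n → E d) := {x | ¬ (‖sampleMean x - a‖ ≤ C₂ * ε ∧
    ∀ y, ‖Matrix.toEuclideanLin (sampleCov x) y - rankOne (w 0 * w 1) (μ 0 - μ 1) y‖ ≤
      C₂ * ε * ‖y‖)} with hB
  have hmsm := measurable_sampleMean (d := d) (n := n)
  have hGm : MeasurableSet G := measurableSet_le ((hmsm.sub_const a).norm) measurable_const
  have hWm : MeasurableSet W := by
    refine (measurable_fst hGm).inter (measurableSet_momentBadSet T ?_ (fun r => ?_) _)
    · refine measurable_pi_lambda _ fun i => ?_
      exact (hum.comp measurable_fst).inner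
        (((measurable_pi_apply i).comp measurable_snd).sub (hmsm.comp measurable_fst))
    · refine Finset.measurable_sum _ fun j _ => (Measurable.pow_const ?_ _).const_mul _
      exact (hum.comp measurable_fst).inner (measurable_const.sub (hmsm.comp measurable_fst))
  have hhalf : Measurable fun X : Fin (n + n) → E d => (firstHalf X, secondHalf X) := by
    unfold firstHalf secondHalf; fun_prop
  have hproj : ∀ b c : E d, Measurable fun (x : Fin n → E d) i => (inner ℝ b (x i - c) : ℝ) := by
    intro b c; fun_prop
  have hmap := map_halves (n := n) (atomic w μ)
  have hpW : (sampleLaw n (atomic w μ)).prod (sampleLaw n (atomic w μ)) W ≤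
      ENNReal.ofReal (δ / 2) := by
    rw [Measure.prod_apply hWm]
    -- Fubini: with the first half fixed, the direction and the centre are constants, and the
    -- projected second half is a sample from a one-dimensional mixture.
    calc _ ≤ ∫⁻ _x, ENNReal.ofReal (δ / 2) ∂sampleLaw n (atomic w μ) := by
          refine lintegral_mono fun x => ?_
          by_cases hx : x ∈ G
          · have hux := (hu x).1
            have hzB : ∀ j, |z x j| ≤ 2 * R + 1 := by
              intro j
              refine (abs_real_inner_le_norm _ _).trans ?_
              rw [hux, one_mul]
              have e : μ j - sampleMean x = μ j - a - (sampleMean x - a) := by abel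
              rw [e]
              refine (norm_sub_le _ _).trans (add_le_add ((norm_sub_le _ _).trans ?_)
                (le_trans hx hCε))
              linarith [hμ j, norm_mean_le hw h1 hμ]
            have h2 := hmom w (z x) hw h1 hzB d n T δ hd hn hδ hδ1 hSn hT
            rw [← map_sampleLaw_inner hw h1 n hux (sampleMean x)] at h2
            refine (measure_mono ?_).trans ((Measure.le_map_apply (hproj _ _).aemeasurable _).trans h2)
            exact fun x' hx' => hx'.2
          · have : Prod.mk x ⁻¹' W = ∅ := Set.eq_empty_of_forall_notMem fun x' hx' => hx hx'.1
            rw [this, measure_empty]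
            exact zero_le
      _ ≤ _ := by simp [sampleLaw]
  have hpB : (sampleLaw n (atomic w μ)).prod (sampleLaw n (atomic w μ)) (B ×ˢ Set.univ) ≤
      ENNReal.ofReal (δ / 2) := by
    rw [Measure.prod_prod]
    have h2 := hfirst d n w μ δ hw h1 hμ hd hn hδ hδ1 hSn
    have h3 : sampleLaw n (atomic w μ) Set.univ = 1 := by simp [sampleLaw]
    rw [h3, mul_one]
    exact h2
  rw [← hmap] at hpW hpB
  have hpW' := (Measure.le_map_apply hhalf.aemeasurable _).trans hpW
  have hpB' := (Measure.le_map_apply hhalf.aemeasurable _).trans hpB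
  refine (measure_mono ?_).trans ((measure_union_le _ _).trans ((add_le_add hpB' hpW').trans ?_))
  · intro X hX
    by_contra hcon
    rw [Set.mem_union, not_or] at hcon
    obtain ⟨hXB, hXW⟩ := hcon
    have hgood : firstHalf X ∉ B := fun h => hXB ⟨h, trivial⟩
    obtain ⟨hmean, hcov⟩ := not_not.1 hgood
    have hyX : y (firstHalf X, secondHalf X) ∉ momentBadSet n T
        (fun r => ∑ j, w j * z (firstHalf X) j ^ (r + 1)) (C₁ * ε) := fun h => hXW ⟨hmean, h⟩
    obtain ⟨ŵ, θ, hD, he⟩ := hΓ X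
    refine hX ?_
    rw [he]
    refine (hell d n T ε τ w μ (firstHalf X) (u (firstHalf X)) _ ŵ θ hε0 hε1 hCε hτ hτε hw h1 hμ
      (hu _) hD hmean hcov hyX).trans ?_
    gcongr
    linarith
  · rw [← ENNReal.ofReal_add (by positivity) (by positivity)]
    exact ENNReal.ofReal_le_ofReal (by linarith)

/-! ### Medians and two-point quadrature -/

/-- Take the smallest entry that has at least half of the entries below or equal to it. The largest
entry strictly below it fails this test, so more than half of the entries are at least the chosen
one. -/
theorem exists_isMedian {T : ℕ} (hT : 1 ≤ T) (x : Fin T → ℝ) : ∃ j, IsMedian x (x j) := by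
  classical
  have : Nonempty (Fin T) := ⟨⟨0, hT⟩⟩
  set s := Finset.univ.filter fun j : Fin T => T ≤ 2 * (Finset.univ.filter fun i => x i ≤ x j).card
    with hs
  have hne : s.Nonempty := by
    obtain ⟨j, hj⟩ := Finite.exists_max x
    refine ⟨j, Finset.mem_filter.2 ⟨Finset.mem_univ _, ?_⟩⟩
    rw [Finset.filter_true_of_mem fun i _ => hj i, Finset.card_univ, Fintype.card_fin]
    omega
  obtain ⟨j, hj, hmin⟩ := s.exists_min_image x hne
  refine ⟨j, (Finset.mem_filter.1 hj).2, ?_⟩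
  have hsplit := Finset.card_filter_add_card_filter_not (s := Finset.univ) fun i => x j ≤ x i
  rw [Finset.card_univ, Fintype.card_fin] at hsplit
  rcases (Finset.univ.filter fun i => ¬ x j ≤ x i).eq_empty_or_nonempty with h0 | h0
  · rw [h0, Finset.card_empty] at hsplit
    omega
  · obtain ⟨i, hi, hmax⟩ := Finset.exists_max_image _ x h0
    have hij : x i < x j := not_le.1 (Finset.mem_filter.1 hi).2
    have hnot : i ∉ s := fun h => absurd (hmin i h) (not_le.2 hij)
    have hle : (Finset.univ.filter fun i => ¬ x j ≤ x i) ⊆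
        Finset.univ.filter fun i' => x i' ≤ x i := fun i' hi' =>
      Finset.mem_filter.2 ⟨Finset.mem_univ _, hmax i' hi'⟩
    have hcard := Finset.card_le_card hle
    have : ¬ T ≤ 2 * (Finset.univ.filter fun i' => x i' ≤ x i).card := fun h =>
      hnot (Finset.mem_filter.2 ⟨Finset.mem_univ _, h⟩)
    omega

/-- A moment vector on which nonnegative cubic polynomials are nonnegative is the moment vector of
a two-atomic distribution. -/
theorem exists_two_atomic {L m₁ m₂ m₃ : ℝ}
    (h : ∀ c₀ c₁ c₂ c₃ : ℝ, (∀ x ∈ Set.Icc (-L) L, 0 ≤ c₀ + c₁ * x + c₂ * x ^ 2 + c₃ * x ^ 3) →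
      0 ≤ c₀ + c₁ * m₁ + c₂ * m₂ + c₃ * m₃) :
    ∃ a θ₀ θ₁ : ℝ, a ∈ Set.Icc (0 : ℝ) 1 ∧ θ₀ ∈ Set.Icc (-L) L ∧ θ₁ ∈ Set.Icc (-L) L ∧
      m₁ = a * θ₀ + (1 - a) * θ₁ ∧ m₂ = a * θ₀ ^ 2 + (1 - a) * θ₁ ^ 2 ∧
      m₃ = a * θ₀ ^ 3 + (1 - a) * θ₁ ^ 3 := by
  have hup : m₁ ≤ L := by
    have := h L (-1) 0 0 fun x hx => by linarith [hx.2]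
    linarith
  have hlo : -L ≤ m₁ := by
    have := h L 1 0 0 fun x hx => by linarith [hx.1]
    linarith
  have hs0 : 0 ≤ m₂ - m₁ ^ 2 := by
    have := h (m₁ ^ 2) (-2 * m₁) 1 0 fun x _ => by nlinarith [sq_nonneg (x - m₁)]
    linarith
  -- The test polynomials (L - x)(x - b)² here and (x + L)(x - b)² in the next step are nonnegative
  -- on the interval for every b.
  have hA : ∀ b, 0 ≤ (L * b ^ 2) + (-b ^ 2 - 2 * L * b) * m₁ + (L + 2 * b) * m₂ + (-1) * m₃ :=
    fun b => h _ _ _ _ fun x hx => by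
      have := mul_nonneg (sq_nonneg (x - b)) (sub_nonneg.2 hx.2)
      linarith
  have hB : ∀ b, 0 ≤ (L * b ^ 2) + (b ^ 2 - 2 * L * b) * m₁ + (L - 2 * b) * m₂ + 1 * m₃ :=
    fun b => h _ _ _ _ fun x hx => by
      have := mul_nonneg (sq_nonneg (x - b)) (by linarith [hx.1] : 0 ≤ x + L)
      linarith
  rcases hs0.eq_or_lt with hs | hs
  · refine ⟨1, m₁, m₁, by norm_num, ⟨hlo, hup⟩, ⟨hlo, hup⟩, by ring, by linarith, ?_⟩
    have h2 : m₂ = m₁ ^ 2 := by linarith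
    have e1 := hA m₁
    have e2 := hB m₁
    rw [h2] at e1 e2
    have : m₁ ^ 3 = m₁ ^ 3 := rfl
    linarith
  · set s := m₂ - m₁ ^ 2 with hsd
    set κ := m₃ - 3 * m₁ * m₂ + 2 * m₁ ^ 3 with hκ
    set q := √((κ / s) ^ 2 + 4 * s) with hq
    have hq2 : q ^ 2 = (κ / s) ^ 2 + 4 * s := Real.sq_sqrt (by positivity)
    have hq0 : 0 < q := Real.sqrt_pos.2 (by positivity)
    -- The nodes of two-point Gauss quadrature relative to the mean: the roots of y² - (κ/s)y - s,
    -- with s the variance and κ the third central moment. Their product -s < 0 puts them on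
    -- opposite sides of 0.
    set y₁ := (κ / s - q) / 2 with hy1
    set y₂ := (κ / s + q) / 2 with hy2
    have hprod : y₁ * y₂ = -s := by rw [hy1, hy2]; linarith
    have hsum : s * (y₁ + y₂) = κ := by rw [hy1, hy2]; field_simp; ring
    have hdiff : y₂ - y₁ = q := by rw [hy1, hy2]; ring
    have hlt : y₁ < y₂ := by linarith
    have hy1n : y₁ < 0 := by
      by_contra hcon
      nlinarith [mul_nonneg (not_lt.1 hcon) ((not_lt.1 hcon).trans hlt.le)]
    have hy2p : 0 < y₂ := by
      by_contra hcon
      nlinarith [mul_nonneg (neg_nonneg.2 hy1n.le) (neg_nonneg.2 (not_lt.1 hcon))]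
    have hm2 : m₂ = m₁ ^ 2 - y₁ * y₂ := by linarith
    have hm3 : m₃ = m₁ ^ 3 - 3 * m₁ * (y₁ * y₂) - y₁ * y₂ * (y₁ + y₂) := by
      have : κ = -(y₁ * y₂) * (y₁ + y₂) := by rw [hprod, ← hsum]; ring
      rw [hκ, hm2] at this
      linarith
    -- Placing the double root b at one node leaves a positive multiple of the linear factor at the
    -- other node, whose sign puts that node in the interval.
    have hin2 : m₁ + y₂ ≤ L := by
      have e := hA (m₁ + y₁)
      rw [hm2, hm3] at e
      have e' : 0 ≤ -y₁ * (y₂ - y₁) * (L - (m₁ + y₂)) := by linarith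
      have : 0 < -y₁ * (y₂ - y₁) := mul_pos (by linarith) (by linarith)
      linarith [(mul_nonneg_iff_of_pos_left this).1 e']
    have hin1 : -L ≤ m₁ + y₁ := by
      have e := hB (m₁ + y₂)
      rw [hm2, hm3] at e
      have e' : 0 ≤ y₂ * (y₂ - y₁) * (L + (m₁ + y₁)) := by linarith
      have : 0 < y₂ * (y₂ - y₁) := mul_pos (by linarith) (by linarith)
      linarith [(mul_nonneg_iff_of_pos_left this).1 e']
    have hd : 0 < y₂ - y₁ := by linarith
    refine ⟨y₂ / (y₂ - y₁), m₁ + y₁, m₁ + y₂, ⟨by positivity, ?_⟩, ⟨hin1, by linarith⟩,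
      ⟨by linarith, hin2⟩, ?_, ?_, ?_⟩
    · rw [div_le_one hd]; linarith
    · field_simp; ring
    · rw [hm2]; field_simp; ring
    · rw [hm3]; field_simp; ring

theorem exists_atomic_of_moments {L : ℝ} (π : Measure ℝ) [IsProbabilityMeasure π]
    (hπ : π (Set.Icc (-L) L)ᶜ = 0) : ∃ a θ₀ θ₁ : ℝ, a ∈ Set.Icc (0 : ℝ) 1 ∧ θ₀ ∈ Set.Icc (-L) L ∧
      θ₁ ∈ Set.Icc (-L) L ∧ ∀ r < 3, ∫ x, x ^ (r + 1) ∂π = a * θ₀ ^ (r + 1) + (1 - a) * θ₁ ^ (r + 1) := by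
  have hae : ∀ᵐ x ∂π, x ∈ Set.Icc (-L) L := hπ
  have hi : ∀ k : ℕ, Integrable (fun x : ℝ => x ^ k) π := fun k => by
    refine Integrable.of_bound (by fun_prop) (L ^ k) (hae.mono fun x hx => ?_)
    rw [norm_pow]
    exact pow_le_pow_left₀ (norm_nonneg _) (abs_le.2 ⟨hx.1, hx.2⟩) k
  obtain ⟨a, θ₀, θ₁, ha, h0, h1, e1, e2, e3⟩ := exists_two_atomic (L := L) (m₁ := ∫ x, x ∂π)
    (m₂ := ∫ x, x ^ 2 ∂π) (m₃ := ∫ x, x ^ 3 ∂π) (fun c₀ c₁ c₂ c₃ hc => by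
      have hx : Integrable (fun x : ℝ => x) π := by simpa using hi 1
      have h0 : 0 ≤ ∫ x, (c₀ + c₁ * x + c₂ * x ^ 2 + c₃ * x ^ 3) ∂π :=
        integral_nonneg_of_ae (hae.mono fun x hx => hc x hx)
      have i1 : Integrable (fun x : ℝ => c₀ + c₁ * x) π := (integrable_const _).add (hx.const_mul _)
      have i2 : Integrable (fun x : ℝ => c₀ + c₁ * x + c₂ * x ^ 2) π := i1.add ((hi 2).const_mul _)
      rw [integral_add i2 ((hi 3).const_mul _), integral_add i1 ((hi 2).const_mul _),
        integral_add (integrable_const _) (hx.const_mul _), integral_const_mul, integral_const_mul,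
        integral_const_mul] at h0
      simpa using h0)
  refine ⟨a, θ₀, θ₁, ha, h0, h1, fun r hr => ?_⟩
  interval_cases r
  · simpa using e1
  · exact e2
  · exact e3

/-- The squared distance between a vector and the vector of the first three moments of the
distribution with weights `a`, `1 - a` and atoms `b`, `c`. -/
def sqMomentGap (m : Fin 3 → ℝ) (a b c : ℝ) : ℝ :=
  ∑ r : Fin 3, (m r - (a * b ^ ((r : ℕ) + 1) + (1 - a) * c ^ ((r : ℕ) + 1))) ^ 2

theorem momentDist_two_atomic (m : Fin 3 → ℝ) {a : ℝ} (ha : a ∈ Set.Icc (0 : ℝ) 1) (b c : ℝ) :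
    momentDist m (atomic ![a, 1 - a] ![b, c]) = √(sqMomentGap m a b c) := by
  have hw : ∀ j : Fin 2, 0 ≤ (![a, 1 - a] : Fin 2 → ℝ) j := by
    intro j
    fin_cases j
    · exact ha.1
    · exact sub_nonneg.2 ha.2
  unfold momentDist sqMomentGap
  congr 1
  refine Finset.sum_congr rfl fun r _ => ?_
  rw [integral_atomic hw _ fun x => x ^ ((r : ℕ) + 1)]
  simp

theorem exists_sqMomentGap_eq {L : ℝ} (m : Fin 3 → ℝ) (π : Measure ℝ) [IsProbabilityMeasure π]
    (hπ : π (Set.Icc (-L) L)ᶜ = 0) : ∃ a b c : ℝ, a ∈ Set.Icc (0 : ℝ) 1 ∧ b ∈ Set.Icc (-L) L ∧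
      c ∈ Set.Icc (-L) L ∧ momentDist m π = √(sqMomentGap m a b c) := by
  obtain ⟨a, b, c, ha, hb, hc, h⟩ := exists_atomic_of_moments π hπ
  refine ⟨a, b, c, ha, hb, hc, ?_⟩
  unfold momentDist sqMomentGap
  congr 1
  exact Finset.sum_congr rfl fun r _ => by rw [h r r.2]

/-- A two-atomic distribution that nearly minimizes the distance to the estimated moments among the
two-atomic distributions is an output of the denoised method of moments. -/
theorem isDMM_of_forall_le {L τ : ℝ} {n T : ℕ} {y : Fin n → ℝ} {m : Fin 3 → ℝ} {w θ : Fin 2 → ℝ}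
    (hw : w 0 ∈ Set.Icc (0 : ℝ) 1) (hw1 : w 1 = 1 - w 0) (hθ : ∀ j, θ j ∈ Set.Icc (-L) L)
    (hm : ∀ r : Fin 3, IsMedian (batchMoment T y ((r : ℕ) + 1)) (m r))
    (hmin : ∀ a ∈ Set.Icc (0 : ℝ) 1, ∀ b ∈ Set.Icc (-L) L, ∀ c ∈ Set.Icc (-L) L,
      √(sqMomentGap m (w 0) (θ 0) (θ 1)) ≤ √(sqMomentGap m a b c) + τ) : IsDMM 2 L T τ y w θ := by
  have ew : w = ![w 0, 1 - w 0] := by ext j; fin_cases j <;> simp [hw1]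
  have eθ : θ = ![θ 0, θ 1] := by ext j; fin_cases j <;> simp
  refine ⟨fun j => ?_, ?_, hθ, m, hm, fun π hπ hπL => ?_⟩
  · fin_cases j
    · exact hw.1
    · simpa [hw1] using hw.2
  · rw [Fin.sum_univ_two, hw1]; ring
  · obtain ⟨a, b, c, ha, hb, hc, h⟩ := exists_sqMomentGap_eq m π hπL
    have e : momentDist m (atomic w θ) = √(sqMomentGap m (w 0) (θ 0) (θ 1)) := by
      rw [← momentDist_two_atomic m hw, ← ew, ← eθ]
    have := hmin a ha b hb c hc
    rw [← h, ← e] at this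
    exact this

/-- By `exists_two_atomic` only two-atomic competitors matter; they are parametrized by a compact
box on which the moment distance is continuous. -/
theorem exists_isDMM {L : ℝ} (hL : 0 ≤ L) {n T : ℕ} (hT : 1 ≤ T) (y : Fin n → ℝ) :
    ∃ w θ : Fin 2 → ℝ, IsDMM 2 L T 0 y w θ := by
  choose j hj using fun r : Fin 3 => exists_isMedian hT (batchMoment T y ((r : ℕ) + 1))
  set m : Fin 3 → ℝ := fun r => batchMoment T y ((r : ℕ) + 1) (j r) with hm
  have hK : IsCompact (Set.Icc (0 : ℝ) 1 ×ˢ Set.Icc (-L) L ×ˢ Set.Icc (-L) L) :=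
    isCompact_Icc.prod (isCompact_Icc.prod isCompact_Icc)
  have hne : (Set.Icc (0 : ℝ) 1 ×ˢ Set.Icc (-L) L ×ˢ Set.Icc (-L) L).Nonempty :=
    ⟨(0, 0, 0), by simp, by simp [hL], by simp [hL]⟩
  have hcont : Continuous fun p : ℝ × ℝ × ℝ => √(sqMomentGap m p.1 p.2.1 p.2.2) := by
    unfold sqMomentGap; fun_prop
  obtain ⟨p, ⟨hp1, hp2, hp3⟩, hmin⟩ := hK.exists_isMinOn hne hcont.continuousOn
  refine ⟨![p.1, 1 - p.1], ![p.2.1, p.2.2], isDMM_of_forall_le hp1 rfl ?_ hj ?_⟩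
  · intro i; fin_cases i
    · exact hp2
    · exact hp3
  · intro a ha b hb c hc
    rw [add_zero]
    exact hmin (show (a, b, c) ∈ _ from ⟨ha, hb, hc⟩)

/-! ### Power iteration -/

section

variable {d : ℕ} {A : E d →ₗ[ℝ] E d} {b : OrthonormalBasis (Fin d) ℝ (E d)} {ρ : Fin d → ℝ} {ℓ : ℝ}

theorem inner_pow_apply (hA : ∀ j y, inner ℝ (b j) (A y) = ρ j * inner ℝ (b j) y) (k : ℕ)
    (j : Fin d) (y : E d) : inner ℝ (b j) ((A ^ k) y) = ρ j ^ k * inner ℝ (b j) y := by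
  induction k with
  | zero => simp
  | succ k ih => rw [pow_succ', Module.End.mul_apply, hA, ih]; ring

theorem norm_sq_eq_sum_basis (b : OrthonormalBasis (Fin d) ℝ (E d)) (y : E d) :
    ‖y‖ ^ 2 = ∑ j, (inner ℝ (b j) y : ℝ) ^ 2 := by
  rw [← b.sum_sq_norm_inner_right y]
  simp

/-- The difference ℓ^{k+1} - t^{k+1} is ℓ - t times a sum of k + 1 terms, each at least t^k. This is
uniform in t: an eigenvalue close to ℓ causes a small residual, any other one decays. -/
theorem sub_mul_pow_le {t : ℝ} (ht : 0 ≤ t) (htℓ : t ≤ ℓ) (k : ℕ) :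
    (ℓ - t) * t ^ k * (k + 1) ≤ ℓ ^ (k + 1) := by
  have h := (Commute.all ℓ t).mul_geom_sum₂ (k + 1)
  have h2 : t ^ k * (k + 1) ≤ ∑ i ∈ Finset.range (k + 1), ℓ ^ i * t ^ (k + 1 - 1 - i) := by
    calc t ^ k * (k + 1) = ∑ i ∈ Finset.range (k + 1), t ^ k := by simp [mul_comm]
      _ ≤ _ := Finset.sum_le_sum fun i hi => by
          have hik : i + (k - i) = k := by have := Finset.mem_range.1 hi; omega
          rw [Nat.add_sub_cancel]
          calc t ^ k = t ^ i * t ^ (k - i) := by rw [← pow_add, hik]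
            _ ≤ _ := by gcongr
  have h3 := mul_le_mul_of_nonneg_left h2 (sub_nonneg.2 htℓ)
  have h4 : 0 ≤ t ^ (k + 1) := by positivity
  linarith

/-- The scalar bound `sub_mul_pow_le` applied in each eigencoordinate. The residual decays like 1/(k
+ 1) relative to ℓ^{k+1}, whatever the spectral gap. -/
theorem norm_power_residual_le (hA : ∀ j y, inner ℝ (b j) (A y) = ρ j * inner ℝ (b j) y)
    (h0 : ∀ j, 0 ≤ ρ j) (hℓ : ∀ j, ρ j ≤ ℓ) (k : ℕ) (y : E d) :
    ‖A ((A ^ k) y) - ℓ • (A ^ k) y‖ * (k + 1) ≤ ℓ ^ (k + 1) * ‖y‖ := by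
  by_cases hy : ℓ < 0
  · have hd : d = 0 := by
      by_contra hd
      have j : Fin d := ⟨0, Nat.pos_of_ne_zero hd⟩
      linarith [h0 j, hℓ j]
    subst hd
    have : ∀ z : E 0, ‖z‖ = 0 := fun z => by rw [Subsingleton.elim z 0, norm_zero]
    rw [this, this]; simp
  have hℓ0 : 0 ≤ ℓ := not_lt.1 hy
  refine abs_le_of_sq_le_sq' ?_ (by positivity) |>.2
  rw [mul_pow, mul_pow, norm_sq_eq_sum_basis b, norm_sq_eq_sum_basis b y, Finset.sum_mul,
    Finset.mul_sum]
  refine Finset.sum_le_sum fun j _ => ?_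
  rw [inner_sub_right, inner_smul_right, hA, inner_pow_apply hA]
  have h1 := sub_mul_pow_le (h0 j) (hℓ j) k
  have h2 : 0 ≤ (ℓ - ρ j) * ρ j ^ k * (k + 1) :=
    mul_nonneg (mul_nonneg (sub_nonneg.2 (hℓ j)) (pow_nonneg (h0 j) _)) (by positivity)
  have h3 := mul_le_mul_of_nonneg_right (pow_le_pow_left₀ h2 h1 2)
    (sq_nonneg (inner ℝ (b j) y : ℝ))
  calc _ = ((ℓ - ρ j) * ρ j ^ k * (k + 1)) ^ 2 * (inner ℝ (b j) y : ℝ) ^ 2 := by ring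
    _ ≤ _ := h3

/-- Some power iterate of a vector of the standard basis is large. -/
theorem exists_le_norm_power (hd : 1 ≤ d)
    (hA : ∀ j y, inner ℝ (b j) (A y) = ρ j * inner ℝ (b j) y) (j₀ : Fin d) (k : ℕ) :
    ∃ i : Fin d, ρ j₀ ^ (2 * k) ≤ d * ‖(A ^ k) (EuclideanSpace.single i 1)‖ ^ 2 := by
  by_contra hcon
  push Not at hcon
  have : Nonempty (Fin d) := ⟨⟨0, hd⟩⟩
  have h1 : ∑ i : Fin d, d * ‖(A ^ k) (EuclideanSpace.single i (1 : ℝ))‖ ^ 2 <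
      ∑ _i : Fin d, ρ j₀ ^ (2 * k) :=
    Finset.sum_lt_sum_of_nonempty Finset.univ_nonempty fun i _ => hcon i
  -- The squared coordinates of the unit eigenvector b j₀ sum to 1, so the squared components of the
  -- d iterates along it sum to ρ^{2k}.
  have h2 : ρ j₀ ^ (2 * k) ≤ ∑ i : Fin d, ‖(A ^ k) (EuclideanSpace.single i (1 : ℝ))‖ ^ 2 := by
    calc ρ j₀ ^ (2 * k) = ∑ i : Fin d, (ρ j₀ ^ k * inner ℝ (b j₀) (EuclideanSpace.single i 1)) ^ 2 := by
          simp only [mul_pow]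
          rw [← Finset.mul_sum, ← pow_mul, mul_comm k 2]
          have e : ‖b j₀‖ ^ 2 = ∑ i, (b j₀ i) ^ 2 := EuclideanSpace.real_norm_sq_eq _
          rw [b.norm_eq_one, one_pow] at e
          simp [EuclideanSpace.inner_single_right, ← e]
      _ ≤ _ := Finset.sum_le_sum fun i _ => by
          rw [← inner_pow_apply hA, norm_sq_eq_sum_basis b]
          exact Finset.single_le_sum (f := fun j => (inner ℝ (b j) ((A ^ k) (EuclideanSpace.single i 1)) : ℝ) ^ 2)
            (fun j _ => sq_nonneg _) (Finset.mem_univ j₀)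
  rw [← Finset.mul_sum, Finset.sum_const, Finset.card_univ, Fintype.card_fin, nsmul_eq_mul] at h1
  have hd0 : (0 : ℝ) < d := by exact_mod_cast hd
  nlinarith

/-- Normalized power iterates converge to an eigenvector of the top eigenvalue. -/
theorem exists_tendsto_power (hA : ∀ j y, inner ℝ (b j) (A y) = ρ j * inner ℝ (b j) y)
    (h0 : ∀ j, 0 ≤ ρ j) (hℓ : ∀ j, ρ j ≤ ℓ) (y : E d) :
    ∃ v, Filter.Tendsto (fun k => (ℓ⁻¹) ^ (k + 1) • (A ^ (k + 1)) y) Filter.atTop (nhds v) ∧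
      A v = ℓ • v ∧ (ℓ ≠ 0 → ∀ j, ρ j = ℓ → inner ℝ (b j) v = inner ℝ (b j) y) := by
  classical
  by_cases hz : ℓ = 0
  · exact ⟨0, by simp [hz], by simp, fun h => absurd hz h⟩
  set v : E d := ∑ j, (if ρ j = ℓ then (inner ℝ (b j) y : ℝ) else 0) • b j with hv
  have hbv : ∀ j, inner ℝ (b j) v = if ρ j = ℓ then (inner ℝ (b j) y : ℝ) else 0 := by
    intro j
    rw [hv, inner_sum]
    simp only [inner_smul_right, b.inner_eq_ite, mul_ite, mul_one, mul_zero, Finset.sum_ite_eq,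
      Finset.mem_univ, if_true]
  have hext : ∀ z z' : E d, (∀ j, inner ℝ (b j) z = (inner ℝ (b j) z' : ℝ)) → z = z' := by
    intro z z' h
    rw [← b.sum_repr' z, ← b.sum_repr' z']
    exact Finset.sum_congr rfl fun j _ => by rw [h]
  refine ⟨v, ?_, hext _ _ fun j => ?_, fun _ j hj => by rw [hbv, if_pos hj]⟩
  · have e : ∀ k, (ℓ⁻¹) ^ (k + 1) • (A ^ (k + 1)) y =
        ∑ j, ((ρ j / ℓ) ^ (k + 1) * inner ℝ (b j) y) • b j := by
      intro k
      rw [← b.sum_repr' ((ℓ⁻¹) ^ (k + 1) • (A ^ (k + 1)) y)]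
      refine Finset.sum_congr rfl fun j _ => ?_
      rw [inner_smul_right, inner_pow_apply hA, div_eq_mul_inv, mul_pow]
      congr 1; ring
    simp only [e]
    refine tendsto_finsetSum _ fun j _ => Filter.Tendsto.smul_const ?_ _
    split_ifs with hj
    · simp [hj, hz]
    · have hℓp : 0 < ℓ := lt_of_le_of_ne ((h0 j).trans (hℓ j)) (Ne.symm hz)
      have h1 := (tendsto_pow_atTop_nhds_zero_of_lt_one (div_nonneg (h0 j) hℓp.le)
        ((div_lt_one hℓp).2 (lt_of_le_of_ne (hℓ j) hj))).comp (Filter.tendsto_add_atTop_nat 1)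
      simpa using h1.mul_const (inner ℝ (b j) y : ℝ)
  · rw [hA, inner_smul_right, hbv]
    split_ifs with hj
    · rw [hj]
    · simp

end

/-- The operator `(1/n) ∑ (X_i - μ̂)(X_i - μ̂)ᵀ`. -/
def covOp {d n : ℕ} (X : Fin n → E d) : E d →ₗ[ℝ] E d :=
  Matrix.toEuclideanLin (sampleCov X) + 1

theorem covOp_apply {d n : ℕ} (X : Fin n → E d) (y : E d) : covOp X y =
    (n : ℝ)⁻¹ • ∑ i, (inner ℝ (X i - sampleMean X) y : ℝ) • (X i - sampleMean X) := by
  rw [covOp, LinearMap.add_apply, toEuclideanLin_sampleCov, Module.End.one_apply, sub_add_cancel]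

/-- Adding the identity makes the operator positive semidefinite, as power iteration requires. Its
top eigenvalue ℓ + 1 is also the scale of the tolerance in `IsTopEigenvector`. -/
theorem exists_spectral_covOp {d n : ℕ} (hd : 1 ≤ d) (X : Fin n → E d) :
    ∃ (ℓ : ℝ) (b : OrthonormalBasis (Fin d) ℝ (E d)) (ρ : Fin d → ℝ) (j₀ : Fin d),
      IsGreatest {a : ℝ | Module.End.HasEigenvalue (Matrix.toEuclideanLin (sampleCov X)) a} ℓ ∧
      (∀ j y, inner ℝ (b j) (covOp X y) = ρ j * inner ℝ (b j) y) ∧ (∀ j, 0 ≤ ρ j) ∧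
      (∀ j, ρ j ≤ ℓ + 1) ∧ ρ j₀ = ℓ + 1 := by
  have hS := isSymmetric_sampleCov X
  obtain ⟨ℓ, hℓ⟩ := exists_isGreatest_eigenvalue hd hS
  set b := hS.eigenvectorBasis finrank_euclideanSpace_fin with hb
  set σ := hS.eigenvalues finrank_euclideanSpace_fin with hσ
  have hA : ∀ j y, inner ℝ (b j) (covOp X y) = (σ j + 1) * inner ℝ (b j) y := by
    intro j y
    rw [covOp, LinearMap.add_apply, inner_add_right, ← hS (b j) y, hb, hS.apply_eigenvectorBasis,
      inner_smul_left, Module.End.one_apply]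
    simp only [RCLike.ofReal_real_eq_id, id_eq, conj_trivial]
    ring
  have hle : ∀ j, σ j ≤ ℓ := fun j => hℓ.2 (hS.hasEigenvalue_eigenvalues _ j)
  have hmax : ∃ j₀, σ j₀ = ℓ := by
    by_contra hcon
    push Not at hcon
    have : Nonempty (Fin d) := ⟨⟨0, hd⟩⟩
    obtain ⟨j₁, hj₁⟩ := Finite.exists_max σ
    obtain ⟨x, hx⟩ := Module.End.HasEigenvalue.exists_hasEigenvector hℓ.1
    have hx0 : 0 < ‖x‖ ^ 2 := by
      have := norm_pos_iff.2 hx.2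
      positivity
    have h1 := inner_le_of_eigenvalues_le hS hj₁ x
    rw [hx.apply_eq_smul, inner_smul_right, real_inner_self_eq_norm_sq] at h1
    exact hcon j₁ (le_antisymm (hle j₁) (le_of_mul_le_mul_right h1 hx0))
  obtain ⟨j₀, hj₀⟩ := hmax
  refine ⟨ℓ, b, fun j => σ j + 1, j₀, hℓ, hA, fun j => ?_, fun j => by linarith [hle j],
    by simp only [hj₀]⟩
  change 0 ≤ σ j + 1
  have h1 := hA j (b j)
  rw [real_inner_self_eq_norm_sq, b.norm_eq_one, one_pow, mul_one] at h1
  rw [← h1, covOp_apply, inner_smul_right, inner_sum]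
  refine mul_nonneg (by positivity) (Finset.sum_nonneg fun i _ => ?_)
  rw [inner_smul_right, real_inner_comm]
  exact mul_self_nonneg _

theorem measurable_covOp_apply {α : Type*} [MeasurableSpace α] {d n : ℕ} {X : α → Fin n → E d}
    {f : α → E d} (hX : Measurable X) (hf : Measurable f) : Measurable fun a => covOp (X a) (f a) := by
  simp only [covOp_apply]
  have hs := measurable_sampleMean.comp hX
  have hi : ∀ i, Measurable fun a => X a i - sampleMean (X a) := fun i =>
    ((measurable_pi_apply i).comp hX).sub hs
  have h2 : Measurable fun a => ∑ i, (inner ℝ (X a i - sampleMean (X a)) (f a) : ℝ) •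
      (X a i - sampleMean (X a)) :=
    Finset.measurable_sum _ fun i _ => (Measurable.inner (𝕜 := ℝ) (hi i) hf).smul (hi i)
  exact h2.const_smul (n : ℝ)⁻¹

theorem measurable_covOp_pow_apply {d n : ℕ} (k : ℕ) (y : E d) :
    Measurable fun X : Fin n → E d => (covOp X ^ k) y := by
  induction k with
  | zero => simp
  | succ k ih =>
    simp only [pow_succ', Module.End.mul_apply]
    exact measurable_covOp_apply measurable_id ih

theorem isTopEigenvector_of_covOp {d n : ℕ} {X : Fin n → E d} {ℓ τ : ℝ} {v : E d} (hv : v ≠ 0)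
    (hℓ : IsGreatest {a : ℝ | Module.End.HasEigenvalue (Matrix.toEuclideanLin (sampleCov X)) a} ℓ)
    (h : ‖covOp X v - (ℓ + 1) • v‖ ≤ τ * (ℓ + 1) * ‖v‖) :
    IsTopEigenvector (sampleCov X) τ (‖v‖⁻¹ • v) := by
  have hn : 0 < ‖v‖ := norm_pos_iff.2 hv
  refine ⟨by simp [norm_smul, hn.ne'], ℓ, hℓ, ?_⟩
  have e : Matrix.toEuclideanLin (sampleCov X) (‖v‖⁻¹ • v) - ℓ • ‖v‖⁻¹ • v =
      ‖v‖⁻¹ • (covOp X v - (ℓ + 1) • v) := by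
    rw [covOp, LinearMap.add_apply, map_smul, Module.End.one_apply]
    module
  rw [e, norm_smul, norm_inv, norm_norm, inv_mul_le_iff₀ hn]
  linarith

/-- The limits of the rescaled power iterates of the basis vectors are measurable in the data and
lie in the top eigenspace if ℓ + 1 ≠ 0. The first nonzero limit is selected. -/
theorem exists_measurable_top_eigenvector {d n : ℕ} (hd : 1 ≤ d) :
    ∃ u : (Fin n → E d) → E d, Measurable u ∧ ∀ X, IsTopEigenvector (sampleCov X) 0 (u X) := by
  classical
  choose ℓ b ρ j₀ hℓ hA h0 hle hj₀ using fun X : Fin n → E d => exists_spectral_covOp hd X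
  have hℓm : Measurable ℓ := by
    refine measurable_of_Iic fun a => ?_
    -- The largest eigenvalue is a supremum of Rayleigh quotients, each continuous in the data; its
    -- sublevel sets are therefore closed.
    have e : ℓ ⁻¹' Set.Iic a = ⋂ y : E d, {X | inner ℝ y (covOp X y) ≤ (a + 1) * ‖y‖ ^ 2} := by
      ext X
      simp only [Set.mem_preimage, Set.mem_Iic, Set.mem_iInter, Set.mem_ofPred_eq, covOp,
        LinearMap.add_apply, inner_add_right, Module.End.one_apply, real_inner_self_eq_norm_sq]
      constructor
      · intro h y
        have := inner_le_of_isGreatest_eigenvalue (isSymmetric_sampleCov X) (hℓ X).2 y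
        nlinarith [mul_le_mul_of_nonneg_right h (sq_nonneg ‖y‖)]
      · intro h
        obtain ⟨x, hx⟩ := Module.End.HasEigenvalue.exists_hasEigenvector (hℓ X).1
        have hx0 : 0 < ‖x‖ ^ 2 := by
          have := norm_pos_iff.2 hx.2
          positivity
        have h1 := h x
        rw [hx.apply_eq_smul, inner_smul_right, real_inner_self_eq_norm_sq] at h1
        exact le_of_mul_le_mul_right (by linarith) hx0
    rw [e]
    refine (isClosed_iInter fun y => isClosed_le ?_ continuous_const).measurableSet
    simp only [covOp_apply, sampleMean]
    fun_prop
  choose v hvt hAv hvb using fun (X : Fin n → E d) (i : Fin d) =>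
    exists_tendsto_power (hA X) (h0 X) (hle X) (EuclideanSpace.single i 1)
  have hvm : ∀ i, Measurable fun X => v X i := fun i => by
    refine measurable_of_tendsto_metrizable (f := fun k X => ((ℓ X + 1)⁻¹) ^ (k + 1) •
      (covOp X ^ (k + 1)) (EuclideanSpace.single i 1)) (fun k => ?_)
      (tendsto_pi_nhds.2 fun X => hvt X i)
    exact ((hℓm.add_const 1).inv.pow_const _).smul (measurable_covOp_pow_apply _ _)
  -- The value at indices beyond d is a nonzero basis vector, so the search for a nonzero value
  -- always succeeds.
  set f : ℕ → (Fin n → E d) → E d := fun i X =>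
    if h : i < d then v X ⟨i, h⟩ else EuclideanSpace.single ⟨0, hd⟩ 1 with hf
  have hfm : ∀ i, Measurable (f i) := by
    intro i
    by_cases h : i < d
    · simp only [hf, h, dite_true]; exact hvm _
    · simp only [hf, h, dite_false]; exact measurable_const
  have hex : ∀ X, ∃ i, f i X ≠ 0 := fun X => ⟨d, by simp [hf]⟩
  have hfind : Measurable fun X => Nat.find (hex X) :=
    measurable_find hex fun k => (measurableSet_eq_fun (hfm k) measurable_const).compl
  set g : (Fin n → E d) → E d := fun X => f (Nat.find (hex X)) X with hg
  have hgm : Measurable g := by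
    have h2 : Measurable fun p : ℕ × (Fin n → E d) => f p.1 p.2 :=
      measurable_from_prod_countable_right hfm
    exact h2.comp (hfind.prodMk measurable_id)
  refine ⟨fun X => ‖g X‖⁻¹ • g X, hgm.norm.inv.smul hgm, fun X => ?_⟩
  refine isTopEigenvector_of_covOp (Nat.find_spec (hex X)) (hℓ X) ?_
  rw [zero_mul, zero_mul, norm_le_zero_iff, sub_eq_zero]
  by_cases h : Nat.find (hex X) < d
  · simp only [hg, hf, h, dite_true]
    exact hAv X _
  · have hz : ∀ i, v X i = 0 := fun i => by
      have := Nat.find_min (hex X) (i.2.trans_le (not_lt.1 h))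
      simpa [hf] using this
    -- If all limits vanish, a top eigenvector would be orthogonal to every basis vector unless ℓ +
    -- 1 = 0. Then the covariance operator is zero and the fallback vector is an eigenvector.
    have hl0 : ℓ X + 1 = 0 := by
      by_contra hne
      have hb0 : ∀ i, inner ℝ (b X (j₀ X)) (EuclideanSpace.single i (1 : ℝ)) = (0 : ℝ) := fun i => by
        rw [← hvb X i hne _ (hj₀ X), hz, inner_zero_right]
      have hb1 : b X (j₀ X) = 0 := by
        ext i
        simpa [EuclideanSpace.inner_single_right] using hb0 i
      have := (b X).norm_eq_one (j₀ X)
      rw [hb1, norm_zero] at this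
      exact zero_ne_one this
    rw [hl0, zero_smul]
    have hρ : ∀ j, ρ X j = 0 := fun j => le_antisymm (hl0 ▸ hle X j) (h0 X j)
    rw [← norm_eq_zero, ← sq_eq_zero_iff, norm_sq_eq_sum_basis (b X)]
    simp [hA, hρ]

/-- The exact estimator exists. -/
theorem exists_centered_estimator {L : ℝ} (hL : 0 ≤ L) {d n T : ℕ} (hd : 1 ≤ d) (hT : 1 ≤ T) :
    ∃ Γhat : (Fin (n + n) → E d) → Measure (E d), IsCenteredEstimator L T 0 Γhat := by
  obtain ⟨u, hum, hu⟩ := exists_measurable_top_eigenvector (n := n) hd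
  choose w θ h using fun X : Fin (n + n) → E d => exists_isDMM hL hT fun i : Fin n =>
    (inner ℝ (u (firstHalf X)) (secondHalf X i - sampleMean (firstHalf X)) : ℝ)
  exact ⟨fun X => atomic (w X) fun j => θ X j • u (firstHalf X) + sampleMean (firstHalf X), u, hum,
    hu, fun X => ⟨w X, θ X, h X, rfl⟩⟩

/-! ### Reasoning about programs -/

/-- The final memory of a run. -/
def Prog.exec (p : Prog) (ρ : ℕ → ℕ) (M : Memory) : Memory := (p.run ρ M).1

theorem exec_seq (p q : Prog) (ρ : ℕ → ℕ) (M : Memory) :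
    (Prog.seq p q).exec ρ M = q.exec ρ (p.exec ρ M) := rfl

theorem exec_assign (a : ℕ) (i : IdxExpr) (x : RealExpr) (ρ : ℕ → ℕ) (M : Memory) :
    (Prog.assign a i x).exec ρ M =
      Function.update M a (Function.update (M a) (i.eval ρ) (x.eval ρ M)) := rfl

theorem exec_ifLe_skip (x y : RealExpr) (p : Prog) (ρ : ℕ → ℕ) (M : Memory) :
    (Prog.ifLe x y p .skip).exec ρ M = if x.eval ρ M ≤ y.eval ρ M then p.exec ρ M else M := by
  unfold Prog.exec
  rw [Prog.run]
  split_ifs <;> rfl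

/-- The invariant rule for loops. It speaks of the memory only; the number of steps is bounded
separately. -/
theorem exec_loop_induct {v : ℕ} {N : IdxExpr} {body : Prog} {ρ : ℕ → ℕ} {M : Memory}
    (I : ℕ → Memory → Prop) (h0 : I 0 M)
    (hs : ∀ j < N.eval ρ, ∀ M', I j M' → I (j + 1) (body.exec (Function.update ρ v j) M')) :
    I (N.eval ρ) ((Prog.loop v N body).exec ρ M) := by
  have h : ∀ m ≤ N.eval ρ, I m ((List.range m).foldl
      (fun (s : Memory × ℕ) j => ((body.run (Function.update ρ v j) s.1).1,
          s.2 + (body.run (Function.update ρ v j) s.1).2 + 1)) (M, N.cost + 1)).1 := by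
    intro m
    induction m with
    | zero => exact fun _ => h0
    | succ m ih =>
      intro hm
      rw [List.range_succ, List.foldl_append]
      exact hs m hm _ (ih (Nat.le_of_succ_le hm))
  exact h _ le_rfl

/-- The variables `0, 1, 2` hold the input sizes. -/
def SizeEnv (d n T : ℕ) (ρ : ℕ → ℕ) : Prop := ρ 0 = d ∧ ρ 1 = n ∧ ρ 2 = T

theorem SizeEnv.update {d n T : ℕ} {ρ : ℕ → ℕ} (h : SizeEnv d n T ρ) {v : ℕ} (hv : 3 ≤ v) (j : ℕ) :
    SizeEnv d n T (Function.update ρ v j) := by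
  obtain ⟨h0, h1, h2⟩ := h
  refine ⟨?_, ?_, ?_⟩ <;> rw [Function.update_of_ne (by omega)] <;> assumption

theorem sizeEnv_sizes (d n T : ℕ) : SizeEnv d n T (sizes d n T) := ⟨rfl, rfl, rfl⟩

/-! ### Running time -/

/-- The value of an index expression is bounded by a polynomial in the number of data. -/
def IdxExpr.Poly (N : IdxExpr) : Prop :=
  ∃ K : ℕ, ∀ d n T : ℕ, 1 ≤ d → 1 ≤ n → 1 ≤ T → T ≤ n → ∀ ρ, SizeEnv d n T ρ →
    N.eval ρ ≤ K * (n * d) ^ K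

theorem IdxExpr.poly_const (c : ℕ) : (IdxExpr.const c).Poly :=
  ⟨c, fun _ _ _ hd hn _ _ _ _ => Nat.le_mul_of_pos_right c (Nat.pow_pos (Nat.mul_pos hn hd))⟩

theorem IdxExpr.poly_var {v : ℕ} (hv : v < 3) : (IdxExpr.var v).Poly := by
  refine ⟨1, fun d n T hd hn hT hTn ρ ⟨h0, h1, h2⟩ => ?_⟩
  have e1 : d ≤ n * d := Nat.le_mul_of_pos_left d hn
  have e2 : n ≤ n * d := Nat.le_mul_of_pos_right n hd
  simp only [IdxExpr.eval, pow_one, one_mul]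
  interval_cases v <;> omega

theorem IdxExpr.Poly.add {M N : IdxExpr} (hM : M.Poly) (hN : N.Poly) : (M.add N).Poly := by
  obtain ⟨K, hK⟩ := hM
  obtain ⟨K', hK'⟩ := hN
  refine ⟨K + K', fun d n T hd hn hT hTn ρ hρ => ?_⟩
  have hx : 1 ≤ n * d := Nat.mul_pos hn hd
  calc _ ≤ K * (n * d) ^ K + K' * (n * d) ^ K' :=
        Nat.add_le_add (hK d n T hd hn hT hTn ρ hρ) (hK' d n T hd hn hT hTn ρ hρ)
    _ ≤ K * (n * d) ^ (K + K') + K' * (n * d) ^ (K + K') := by gcongr <;> omega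
    _ = _ := by ring

theorem IdxExpr.Poly.mul {M N : IdxExpr} (hM : M.Poly) (hN : N.Poly) : (M.mul N).Poly := by
  obtain ⟨K, hK⟩ := hM
  obtain ⟨K', hK'⟩ := hN
  refine ⟨K * K' + K + K', fun d n T hd hn hT hTn ρ hρ => ?_⟩
  have hx : 1 ≤ n * d := Nat.mul_pos hn hd
  calc _ ≤ (K * (n * d) ^ K) * (K' * (n * d) ^ K') :=
        Nat.mul_le_mul (hK d n T hd hn hT hTn ρ hρ) (hK' d n T hd hn hT hTn ρ hρ)
    _ = K * K' * (n * d) ^ (K + K') := by ring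
    _ ≤ _ := by gcongr <;> omega

theorem IdxExpr.Poly.div {M : IdxExpr} (hM : M.Poly) (N : IdxExpr) : (M.div N).Poly := by
  obtain ⟨K, hK⟩ := hM
  exact ⟨K, fun d n T hd hn hT hTn ρ hρ =>
    (Nat.div_le_self _ _).trans (hK d n T hd hn hT hTn ρ hρ)⟩

/-- The number of steps is polynomially bounded. -/
def Prog.PolyCost (p : Prog) : Prop :=
  ∃ K : ℕ, ∀ d n T : ℕ, 1 ≤ d → 1 ≤ n → 1 ≤ T → T ≤ n → ∀ ρ, SizeEnv d n T ρ → ∀ M,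
    (p.run ρ M).2 ≤ K * (n * d) ^ K

theorem polyCost_skip : Prog.skip.PolyCost :=
  ⟨1, fun _ _ _ hd hn _ _ _ _ _ => by
    simp only [Prog.run, pow_one, one_mul]
    exact Nat.mul_pos hn hd⟩

theorem polyCost_assign (a : ℕ) (i : IdxExpr) (x : RealExpr) : (Prog.assign a i x).PolyCost :=
  ⟨i.cost + x.cost + 1, fun _ _ _ hd hn _ _ _ _ _ =>
    Nat.le_mul_of_pos_right _ (Nat.pow_pos (Nat.mul_pos hn hd))⟩

theorem Prog.PolyCost.seq {p q : Prog} (hp : p.PolyCost) (hq : q.PolyCost) :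
    (Prog.seq p q).PolyCost := by
  obtain ⟨K, hK⟩ := hp
  obtain ⟨K', hK'⟩ := hq
  refine ⟨K + K', fun d n T hd hn hT hTn ρ hρ M => ?_⟩
  have hx : 1 ≤ n * d := Nat.mul_pos hn hd
  calc _ ≤ K * (n * d) ^ K + K' * (n * d) ^ K' :=
        Nat.add_le_add (hK d n T hd hn hT hTn ρ hρ M) (hK' d n T hd hn hT hTn ρ hρ _)
    _ ≤ K * (n * d) ^ (K + K') + K' * (n * d) ^ (K + K') := by gcongr <;> omega
    _ = _ := by ring

theorem Prog.PolyCost.ifLe_skip {p : Prog} (hp : p.PolyCost) (x y : RealExpr) :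
    (Prog.ifLe x y p .skip).PolyCost := by
  obtain ⟨K, hK⟩ := hp
  refine ⟨x.cost + y.cost + 2 + K, fun d n T hd hn hT hTn ρ hρ M => ?_⟩
  have hx : 1 ≤ n * d := Nat.mul_pos hn hd
  have h1 : (1 : ℕ) ≤ (n * d) ^ K := Nat.pow_pos hx
  have h2 : ((Prog.ifLe x y p .skip).run ρ M).2 ≤ x.cost + y.cost + 2 + K * (n * d) ^ K := by
    have := hK d n T hd hn hT hTn ρ hρ M
    rw [Prog.run]
    split_ifs
    · omega
    · simp only [Prog.run]; omega
  refine h2.trans ?_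
  calc _ ≤ (x.cost + y.cost + 2) * (n * d) ^ K + K * (n * d) ^ K := by
        gcongr; exact Nat.le_mul_of_pos_right _ h1
    _ = (x.cost + y.cost + 2 + K) * (n * d) ^ K := by ring
    _ ≤ _ := by gcongr; omega

/-- The counter must not be one of the variables 0, 1, 2: the body would otherwise run with changed
input sizes and its bound would not apply. -/
theorem Prog.PolyCost.loop {body : Prog} (hb : body.PolyCost) {N : IdxExpr} (hN : N.Poly) {v : ℕ}
    (hv : 3 ≤ v) : (Prog.loop v N body).PolyCost := by
  obtain ⟨K, hK⟩ := hb
  obtain ⟨K', hK'⟩ := hN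
  refine ⟨N.cost + 1 + K' * (K + 1) + K + K', fun d n T hd hn hT hTn ρ hρ M => ?_⟩
  have hx : 1 ≤ n * d := Nat.mul_pos hn hd
  have h1 : (1 : ℕ) ≤ (n * d) ^ K := Nat.pow_pos hx
  have h : ∀ m, ((List.range m).foldl
      (fun (s : Memory × ℕ) j => ((body.run (Function.update ρ v j) s.1).1,
          s.2 + (body.run (Function.update ρ v j) s.1).2 + 1)) (M, N.cost + 1)).2 ≤
      N.cost + 1 + m * (K * (n * d) ^ K + 1) := by
    intro m
    induction m with
    | zero => simp
    | succ m ih =>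
      rw [List.range_succ, List.foldl_append]
      simp only [List.foldl_cons, List.foldl_nil]
      have := hK d n T hd hn hT hTn _ (hρ.update hv m) ((List.range m).foldl
        (fun (s : Memory × ℕ) j => ((body.run (Function.update ρ v j) s.1).1,
          s.2 + (body.run (Function.update ρ v j) s.1).2 + 1)) (M, N.cost + 1)).1
      rw [Nat.succ_mul]
      omega
  calc _ ≤ N.cost + 1 + N.eval ρ * (K * (n * d) ^ K + 1) := h _
    _ ≤ (N.cost + 1) * (n * d) ^ (K + K') +
        K' * (n * d) ^ K' * (K * (n * d) ^ K + (n * d) ^ K) := by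
        gcongr
        · exact Nat.le_mul_of_pos_right _ (Nat.pow_pos hx)
        · exact hK' d n T hd hn hT hTn ρ hρ
    _ = (N.cost + 1 + K' * (K + 1)) * (n * d) ^ (K + K') := by ring
    _ ≤ _ := Nat.mul_le_mul (by omega) (Nat.pow_le_pow_right hx (by omega))

/-! ### Tabulation of guarded sums -/

/-- The expression does not read the array `a`. -/
def RealExpr.Avoids (a : ℕ) : RealExpr → Prop
  | .const _ => True
  | .read b _ => b ≠ a
  | .cast _ => True
  | .add x y => x.Avoids a ∧ y.Avoids a
  | .sub x y => x.Avoids a ∧ y.Avoids a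
  | .mul x y => x.Avoids a ∧ y.Avoids a
  | .div x y => x.Avoids a ∧ y.Avoids a
  | .sqrt x => x.Avoids a

theorem RealExpr.Avoids.eval_eq {a : ℕ} {x : RealExpr} (h : x.Avoids a) (ρ : ℕ → ℕ) {M M' : Memory}
    (hM : ∀ b, b ≠ a → M b = M' b) : x.eval ρ M = x.eval ρ M' := by
  induction x with
  | const c => rfl
  | read b i => simp only [RealExpr.eval, hM b h]
  | cast i => rfl
  | add x y hx hy => simp only [RealExpr.eval, hx h.1, hy h.2]
  | sub x y hx hy => simp only [RealExpr.eval, hx h.1, hy h.2]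
  | mul x y hx hy => simp only [RealExpr.eval, hx h.1, hy h.2]
  | div x y hx hy => simp only [RealExpr.eval, hx h.1, hy h.2]
  | sqrt x hx => simp only [RealExpr.eval, hx h]

/-- The environment of the three nested loops of `tab`. -/
def env3 (ρ : ℕ → ℕ) (i j k : ℕ) : ℕ → ℕ :=
  Function.update (Function.update (Function.update ρ 3 i) 4 j) 5 k

/-- `a[i * N₂ + j] := ∑ k < N₃, if x ≤ y then e else 0` for all `i < N₁`, `j < N₂`; the expressions
refer to `i, j, k` as the variables `3, 4, 5`. -/
def tab (a : ℕ) (N₁ N₂ N₃ : IdxExpr) (x y e : RealExpr) : Prog :=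
  .loop 3 N₁ (.loop 4 N₂ (.seq (.assign a (.add (.mul (.var 3) N₂) (.var 4)) (.const 0))
    (.loop 5 N₃ (.ifLe x y (.assign a (.add (.mul (.var 3) N₂) (.var 4))
      (.add (.read a (.add (.mul (.var 3) N₂) (.var 4))) e)) .skip))))

theorem polyCost_tab {N₁ N₂ N₃ : IdxExpr} (h₁ : N₁.Poly) (h₂ : N₂.Poly) (h₃ : N₃.Poly) (a : ℕ)
    (x y e : RealExpr) : (tab a N₁ N₂ N₃ x y e).PolyCost :=
  (((polyCost_assign _ _ _).seq (((polyCost_assign _ _ _).ifLe_skip _ _).loop h₃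
    (by norm_num))).loop h₂ (by norm_num)).loop h₁ (by norm_num)

open Classical in
/-- The value of an entry of a table. -/
def tabValue (x y e : RealExpr) (m : ℕ) (ρ : ℕ → ℕ) (M : Memory) (i j : ℕ) : ℝ :=
  ∑ k ∈ Finset.range m, if x.eval (env3 ρ i j k) M ≤ y.eval (env3 ρ i j k) M then
    e.eval (env3 ρ i j k) M else 0

theorem tabValue_congr {x y e : RealExpr} {a : ℕ} (hx : x.Avoids a) (hy : y.Avoids a)
    (he : e.Avoids a) (m : ℕ) (ρ : ℕ → ℕ) {M M' : Memory} (h : ∀ b, b ≠ a → M b = M' b) (i j : ℕ) :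
    tabValue x y e m ρ M i j = tabValue x y e m ρ M' i j := by
  unfold tabValue
  refine Finset.sum_congr rfl fun k _ => ?_
  rw [hx.eval_eq _ h, hy.eval_eq _ h, he.eval_eq _ h]

theorem add_mul_inj {m i j i' j' : ℕ} (hj : j < m) (hj' : j' < m) (h : i * m + j = i' * m + j') :
    i = i' ∧ j = j' := by
  have h1 : (i * m + j) / m = i := by
    rw [mul_comm, Nat.mul_add_div (by omega), Nat.div_eq_of_lt hj, add_zero]
  have h2 : (i' * m + j') / m = i' := by
    rw [mul_comm, Nat.mul_add_div (by omega), Nat.div_eq_of_lt hj', add_zero]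
  have hi : i = i' := by rw [← h1, h, h2]
  subst hi
  exact ⟨rfl, by omega⟩

/-- The effect of a tabulation. -/
theorem exec_tab {d n T a n₁ n₂ n₃ : ℕ} {N₁ N₂ N₃ : IdxExpr} {x y e : RealExpr} {ρ : ℕ → ℕ}
    (hρ : SizeEnv d n T ρ) (h₁ : ∀ ρ, SizeEnv d n T ρ → N₁.eval ρ = n₁)
    (h₂ : ∀ ρ, SizeEnv d n T ρ → N₂.eval ρ = n₂) (h₃ : ∀ ρ, SizeEnv d n T ρ → N₃.eval ρ = n₃)
    (hx : x.Avoids a) (hy : y.Avoids a) (he : e.Avoids a) (M : Memory) :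
    (∀ b, b ≠ a → (tab a N₁ N₂ N₃ x y e).exec ρ M b = M b) ∧
    ∀ i < n₁, ∀ j < n₂, (tab a N₁ N₂ N₃ x y e).exec ρ M a (i * n₂ + j) =
      tabValue x y e n₃ ρ M i j := by
  classical
  set g : ℕ → ℕ → ℕ → ℝ := fun i j k =>
    if x.eval (env3 ρ i j k) M ≤ y.eval (env3 ρ i j k) M then e.eval (env3 ρ i j k) M else 0 with hg
  have hin : ∀ i j : ℕ, ∀ M' : Memory, (∀ b, b ≠ a → M' b = M b) →
      (Prog.seq (.assign a (.add (.mul (.var 3) N₂) (.var 4)) (.const 0))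
        (.loop 5 N₃ (.ifLe x y (.assign a (.add (.mul (.var 3) N₂) (.var 4))
        (.add (.read a (.add (.mul (.var 3) N₂) (.var 4))) e)) .skip))).exec
        (Function.update (Function.update ρ 3 i) 4 j) M' =
      Function.update M' a (Function.update (M' a) (i * n₂ + j) (tabValue x y e n₃ ρ M i j)) := by
    intro i j M' hM'
    have hρ' : SizeEnv d n T (Function.update (Function.update ρ 3 i) 4 j) :=
      (hρ.update (by norm_num) i).update (by norm_num) j
    rw [exec_seq, exec_assign]
    have hidx : (IdxExpr.add (.mul (.var 3) N₂) (.var 4)).eval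
        (Function.update (Function.update ρ 3 i) 4 j) = i * n₂ + j := by
      simp [IdxExpr.eval, h₂ _ hρ', Function.update]
    rw [hidx]
    -- The invariant: the entry holds the partial sum, and every expression evaluates as in the
    -- original memory because only the array a has changed.
    have := exec_loop_induct (v := 5) (N := N₃) (body := .ifLe x y (.assign a
        (.add (.mul (.var 3) N₂) (.var 4)) (.add (.read a (.add (.mul (.var 3) N₂) (.var 4))) e))
        .skip) (ρ := Function.update (Function.update ρ 3 i) 4 j)
      (M := Function.update M' a (Function.update (M' a) (i * n₂ + j) 0))
      (fun k M'' => M'' = Function.update M' a (Function.update (M' a) (i * n₂ + j)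
        (∑ k' ∈ Finset.range k, g i j k'))) (by simp) ?_
    · rw [h₃ _ hρ'] at this
      exact this
    · rintro k - M'' rfl
      set s : ℝ := ∑ k' ∈ Finset.range k, g i j k' with hs
      set M'' := Function.update M' a (Function.update (M' a) (i * n₂ + j) s) with hM''
      have hag : ∀ b, b ≠ a → M'' b = M b := fun b hb => by
        rw [hM'', Function.update_of_ne hb, hM' b hb]
      have hρ'' := hρ'.update (v := 5) (by norm_num) k
      have hidx' : (IdxExpr.add (.mul (.var 3) N₂) (.var 4)).eval
          (Function.update (Function.update (Function.update ρ 3 i) 4 j) 5 k) = i * n₂ + j := by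
        simp [IdxExpr.eval, h₂ _ hρ'', Function.update]
      rw [exec_ifLe_skip, exec_assign, RealExpr.eval, RealExpr.eval, hidx', hx.eval_eq _ hag,
        hy.eval_eq _ hag, he.eval_eq _ hag]
      have hr : M'' a (i * n₂ + j) = s := by simp [hM'']
      rw [hr, Finset.sum_range_succ, ← hs]
      simp only [hg, env3]
      by_cases hc : x.eval (Function.update (Function.update (Function.update ρ 3 i) 4 j) 5 k) M ≤
          y.eval (Function.update (Function.update (Function.update ρ 3 i) 4 j) 5 k) M
      · simp [hc, hM'']
      · simp [hc, hM'']
  have hmain := exec_loop_induct (v := 3) (N := N₁) (ρ := ρ) (M := M)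
    (body := .loop 4 N₂ (.seq (.assign a (.add (.mul (.var 3) N₂) (.var 4)) (.const 0))
      (.loop 5 N₃ (.ifLe x y (.assign a (.add (.mul (.var 3) N₂) (.var 4))
      (.add (.read a (.add (.mul (.var 3) N₂) (.var 4))) e)) .skip))))
    (fun i M' => (∀ b, b ≠ a → M' b = M b) ∧ ∀ i' < i, ∀ j' < n₂, M' a (i' * n₂ + j') =
      tabValue x y e n₃ ρ M i' j') ⟨fun _ _ => rfl, by simp⟩ ?_
  · rw [h₁ ρ hρ] at hmain
    exact hmain
  · rintro i - M' ⟨hfr, hval⟩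
    have hρ' := hρ.update (v := 3) (by norm_num) i
    have hloop := exec_loop_induct (v := 4) (N := N₂) (ρ := Function.update ρ 3 i) (M := M')
      (body := .seq (.assign a (.add (.mul (.var 3) N₂) (.var 4)) (.const 0))
      (.loop 5 N₃ (.ifLe x y (.assign a (.add (.mul (.var 3) N₂) (.var 4))
      (.add (.read a (.add (.mul (.var 3) N₂) (.var 4))) e)) .skip)))
      (fun j M' => (∀ b, b ≠ a → M' b = M b) ∧ (∀ i' < i, ∀ j' < n₂, M' a (i' * n₂ + j') =
        tabValue x y e n₃ ρ M i' j') ∧ ∀ j' < j, M' a (i * n₂ + j') = tabValue x y e n₃ ρ M i j')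
      ⟨hfr, hval, by simp⟩ ?_
    · rw [h₂ _ hρ'] at hloop
      obtain ⟨h1, h2, h3⟩ := hloop
      refine ⟨h1, fun i' hi' j' hj' => ?_⟩
      rcases Nat.lt_succ_iff_lt_or_eq.1 hi' with h | rfl
      · exact h2 i' h j' hj'
      · exact h3 j' hj'
    · rw [h₂ _ hρ']
      rintro j hj M'' ⟨h1, h2, h3⟩
      rw [hin i j M'' h1]
      refine ⟨fun b hb => by rw [Function.update_of_ne hb, h1 b hb], fun i' hi' j' hj' => ?_,
        fun j' hj' => ?_⟩
      · rw [Function.update_self, Function.update_of_ne, h2 i' hi' j' hj']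
        intro h
        have := (add_mul_inj hj' hj h).1
        omega
      · rw [Function.update_self]
        rcases Nat.lt_succ_iff_lt_or_eq.1 hj' with h | rfl
        · rw [Function.update_of_ne (by omega), h3 j' h]
        · rw [Function.update_self]

/-! ### Sequential composition -/

/-- In the environment `ρ`, the program `p` only writes arrays with numbers in `[lo, hi)`, and its
final memory has the property `Φ`, which only depends on arrays with numbers less than `hi`. -/
structure Ensures (ρ : ℕ → ℕ) (p : Prog) (lo hi : ℕ) (Φ : Memory → Prop) : Prop where
  frame : ∀ M b, b < lo ∨ hi ≤ b → p.exec ρ M b = M b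
  holds : ∀ M, Φ (p.exec ρ M)
  local' : ∀ M M', (∀ b < hi, M b = M' b) → Φ M → Φ M'

/-- The second program writes only arrays numbered from mid on, and the first property depends only
on arrays before mid, so it survives. Arrays are numbered in order of computation for this reason.
-/
theorem Ensures.seq {ρ : ℕ → ℕ} {p q : Prog} {lo mid hi : ℕ} {Φ Ψ : Memory → Prop}
    (hp : Ensures ρ p lo mid Φ) (hq : Ensures ρ q mid hi Ψ) (h1 : lo ≤ mid) (h2 : mid ≤ hi) :
    Ensures ρ (.seq p q) lo hi fun M => Φ M ∧ Ψ M where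
  frame M b hb := by
    rw [exec_seq, hq.frame _ b (by omega), hp.frame _ b (by omega)]
  holds M := by
    refine ⟨?_, hq.holds _⟩
    rw [exec_seq]
    exact hp.local' _ _ (fun b hb => (hq.frame _ b (Or.inl hb)).symm) (hp.holds M)
  local' M M' h := fun ⟨h3, h4⟩ =>
    ⟨hp.local' M M' (fun b hb => h b (by omega)) h3, hq.local' M M' h h4⟩

/-- The expression only reads arrays with numbers less than `a`. -/
def RealExpr.Below (a : ℕ) : RealExpr → Prop
  | .const _ => True
  | .read b _ => b < a
  | .cast _ => True
  | .add x y => x.Below a ∧ y.Below a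
  | .sub x y => x.Below a ∧ y.Below a
  | .mul x y => x.Below a ∧ y.Below a
  | .div x y => x.Below a ∧ y.Below a
  | .sqrt x => x.Below a

theorem RealExpr.Below.eval_eq {a : ℕ} {x : RealExpr} (h : x.Below a) (ρ : ℕ → ℕ) {M M' : Memory}
    (hM : ∀ b < a, M b = M' b) : x.eval ρ M = x.eval ρ M' := by
  induction x with
  | const c => rfl
  | read b i => simp only [RealExpr.eval, hM b h]
  | cast i => rfl
  | add x y hx hy => simp only [RealExpr.eval, hx h.1, hy h.2]
  | sub x y hx hy => simp only [RealExpr.eval, hx h.1, hy h.2]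
  | mul x y hx hy => simp only [RealExpr.eval, hx h.1, hy h.2]
  | div x y hx hy => simp only [RealExpr.eval, hx h.1, hy h.2]
  | sqrt x hx => simp only [RealExpr.eval, hx h]

theorem RealExpr.Below.avoids {a : ℕ} {x : RealExpr} (h : x.Below a) : x.Avoids a := by
  induction x with
  | const c => trivial
  | read b i => exact Nat.ne_of_lt h
  | cast i => trivial
  | add x y hx hy => exact ⟨hx h.1, hy h.2⟩
  | sub x y hx hy => exact ⟨hx h.1, hy h.2⟩
  | mul x y hx hy => exact ⟨hx h.1, hy h.2⟩
  | div x y hx hy => exact ⟨hx h.1, hy h.2⟩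
  | sqrt x hx => exact hx h

theorem ensures_tab {d n T a n₁ n₂ n₃ : ℕ} {N₁ N₂ N₃ : IdxExpr} {x y e : RealExpr} {ρ : ℕ → ℕ}
    (hρ : SizeEnv d n T ρ) (h₁ : ∀ ρ, SizeEnv d n T ρ → N₁.eval ρ = n₁)
    (h₂ : ∀ ρ, SizeEnv d n T ρ → N₂.eval ρ = n₂) (h₃ : ∀ ρ, SizeEnv d n T ρ → N₃.eval ρ = n₃)
    (hx : x.Below a) (hy : y.Below a) (he : e.Below a) :
    Ensures ρ (tab a N₁ N₂ N₃ x y e) a (a + 1) fun M => ∀ i < n₁, ∀ j < n₂,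
      M a (i * n₂ + j) = tabValue x y e n₃ ρ M i j where
  frame M b hb := (exec_tab hρ h₁ h₂ h₃ hx.avoids hy.avoids he.avoids M).1 b (by omega)
  holds M i hi j hj := by
    obtain ⟨hf, hv⟩ := exec_tab hρ h₁ h₂ h₃ hx.avoids hy.avoids he.avoids M
    rw [hv i hi j hj]
    exact tabValue_congr hx.avoids hy.avoids he.avoids _ _ (fun b hb => (hf b hb).symm) _ _
  local' M M' h hM i hi j hj := by
    rw [← h a (by omega), hM i hi j hj]
    unfold tabValue
    have h' : ∀ b < a, M b = M' b := fun b hb => h b (by omega)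
    refine Finset.sum_congr rfl fun k _ => ?_
    rw [hx.eval_eq _ h', hy.eval_eq _ h', he.eval_eq _ h']

/-! ### Lists of tabulations -/

/-- The expression only refers to the input sizes. -/
def IdxExpr.SizeOnly : IdxExpr → Prop
  | .const _ => True
  | .var i => i < 3
  | .add a b => a.SizeOnly ∧ b.SizeOnly
  | .mul a b => a.SizeOnly ∧ b.SizeOnly
  | .div a b => a.SizeOnly ∧ b.SizeOnly

theorem IdxExpr.SizeOnly.poly {N : IdxExpr} (h : N.SizeOnly) : N.Poly := by
  induction N with
  | const c => exact poly_const c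
  | var i => exact poly_var h
  | add a b ha hb => exact (ha h.1).add (hb h.2)
  | mul a b ha hb => exact (ha h.1).mul (hb h.2)
  | div a b ha hb => exact (ha h.1).div b

theorem IdxExpr.SizeOnly.eval_eq {N : IdxExpr} (h : N.SizeOnly) {d n T : ℕ} {ρ ρ' : ℕ → ℕ}
    (hρ : SizeEnv d n T ρ) (hρ' : SizeEnv d n T ρ') : N.eval ρ = N.eval ρ' := by
  induction N with
  | const c => rfl
  | var i =>
    have hi : i < 3 := h
    obtain ⟨h0, h1, h2⟩ := hρ
    obtain ⟨h0', h1', h2'⟩ := hρ'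
    simp only [IdxExpr.eval]
    interval_cases i <;> simp_all
  | add a b ha hb => simp only [IdxExpr.eval, ha h.1, hb h.2]
  | mul a b ha hb => simp only [IdxExpr.eval, ha h.1, hb h.2]
  | div a b ha hb => simp only [IdxExpr.eval, ha h.1, hb h.2]

/-- The data of a tabulation: the three loop bounds, the guard `x ≤ y` and the summand. -/
structure Tab where
  N₁ : IdxExpr
  N₂ : IdxExpr
  N₃ : IdxExpr
  x : RealExpr
  y : RealExpr
  e : RealExpr

/-- The loop bounds only depend on the input sizes, and only arrays below `a` are read. -/
def Tab.WF (t : Tab) (a : ℕ) : Prop :=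
  (t.N₁.SizeOnly ∧ t.N₂.SizeOnly ∧ t.N₃.SizeOnly) ∧ t.x.Below a ∧ t.y.Below a ∧ t.e.Below a

/-- The array `a` holds the table `t`. -/
def Tab.Holds (t : Tab) (ρ : ℕ → ℕ) (a : ℕ) (M : Memory) : Prop :=
  ∀ i < t.N₁.eval ρ, ∀ j < t.N₂.eval ρ,
    M a (i * t.N₂.eval ρ + j) = tabValue t.x t.y t.e (t.N₃.eval ρ) ρ M i j

/-- Tabulations into consecutive arrays, starting with the array `a`. -/
def tabs : ℕ → List Tab → Prog
  | _, [] => .skip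
  | a, t :: ts => .seq (tab a t.N₁ t.N₂ t.N₃ t.x t.y t.e) (tabs (a + 1) ts)

def TabsWF : ℕ → List Tab → Prop
  | _, [] => True
  | a, t :: ts => t.WF a ∧ TabsWF (a + 1) ts

def TabsHold (ρ : ℕ → ℕ) : ℕ → List Tab → Memory → Prop
  | _, [], _ => True
  | a, t :: ts, M => t.Holds ρ a M ∧ TabsHold ρ (a + 1) ts M

theorem polyCost_tabs : ∀ (ts : List Tab) (a : ℕ), TabsWF a ts → (tabs a ts).PolyCost
  | [], _, _ => polyCost_skip
  | _ :: ts, a, ⟨⟨⟨h₁, h₂, h₃⟩, _⟩, h⟩ =>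
    (polyCost_tab h₁.poly h₂.poly h₃.poly _ _ _ _).seq (polyCost_tabs ts (a + 1) h)

theorem ensures_tabs {d n T : ℕ} {ρ : ℕ → ℕ} (hρ : SizeEnv d n T ρ) :
    ∀ (ts : List Tab) (a : ℕ), TabsWF a ts →
      Ensures ρ (tabs a ts) a (a + ts.length) (TabsHold ρ a ts)
  | [], _, _ => ⟨fun _ _ _ => rfl, fun _ => trivial, fun _ _ _ _ => trivial⟩
  | t :: ts, a, ⟨⟨⟨h₁, h₂, h₃⟩, hx, hy, he⟩, h⟩ => by
    have h' := (ensures_tab hρ (fun _ hρ' => h₁.eval_eq hρ' hρ) (fun _ hρ' => h₂.eval_eq hρ' hρ)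
      (fun _ hρ' => h₃.eval_eq hρ' hρ) hx hy he).seq (ensures_tabs hρ ts (a + 1) h) (by omega)
      (by omega)
    rw [List.length_cons, show a + (ts.length + 1) = a + 1 + ts.length by ring]
    exact h'

theorem tabsHold_append {ρ : ℕ → ℕ} {M : Memory} : ∀ (ts ts' : List Tab) (a : ℕ),
    TabsHold ρ a (ts ++ ts') M ↔ TabsHold ρ a ts M ∧ TabsHold ρ (a + ts.length) ts' M
  | [], _, _ => by simp [TabsHold]
  | t :: ts, ts', a => by
    simp only [List.cons_append, TabsHold, tabsHold_append ts ts' (a + 1), List.length_cons,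
      and_assoc, show a + (ts.length + 1) = a + 1 + ts.length by ring]

theorem tabsWF_append : ∀ (ts ts' : List Tab) (a : ℕ),
    TabsWF a (ts ++ ts') ↔ TabsWF a ts ∧ TabsWF (a + ts.length) ts'
  | [], _, _ => by simp [TabsWF]
  | t :: ts, ts', a => by
    simp only [List.cons_append, TabsWF, tabsWF_append ts ts' (a + 1), List.length_cons,
      and_assoc, show a + (ts.length + 1) = a + 1 + ts.length by ring]

@[simp] theorem env3_three (ρ : ℕ → ℕ) (i j k : ℕ) : env3 ρ i j k 3 = i := by simp [env3]

@[simp] theorem env3_four (ρ : ℕ → ℕ) (i j k : ℕ) : env3 ρ i j k 4 = j := by simp [env3]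

@[simp] theorem env3_five (ρ : ℕ → ℕ) (i j k : ℕ) : env3 ρ i j k 5 = k := by simp [env3]

theorem SizeEnv.env3 {d n T : ℕ} {ρ : ℕ → ℕ} (h : SizeEnv d n T ρ) (i j k : ℕ) :
    SizeEnv d n T (env3 ρ i j k) :=
  ((h.update (by norm_num) i).update (by norm_num) j).update (by norm_num) k

/-- A sum without guard. -/
def sumTab (N₁ N₂ N₃ : IdxExpr) (e : RealExpr) : Tab := ⟨N₁, N₂, N₃, .const 0, .const 0, e⟩

theorem sumTab_holds {N₁ N₂ N₃ : IdxExpr} {e : RealExpr} {ρ : ℕ → ℕ} {a : ℕ} {M : Memory}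
    (h : (sumTab N₁ N₂ N₃ e).Holds ρ a M) : ∀ i < N₁.eval ρ, ∀ j < N₂.eval ρ,
      M a (i * N₂.eval ρ + j) = ∑ k ∈ Finset.range (N₃.eval ρ), e.eval (env3 ρ i j k) M := by
  intro i hi j hj
  refine (h i hi j hj).trans ?_
  simp [tabValue, sumTab]

theorem sumTab_holds_one {N₁ N₃ : IdxExpr} {e : RealExpr} {ρ : ℕ → ℕ} {a : ℕ} {M : Memory}
    (h : (sumTab N₁ (.const 1) N₃ e).Holds ρ a M) : ∀ i < N₁.eval ρ,
      M a i = ∑ k ∈ Finset.range (N₃.eval ρ), e.eval (env3 ρ i 0 k) M := by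
  intro i hi
  have := sumTab_holds h i hi 0 (by simp [IdxExpr.eval])
  simpa [IdxExpr.eval] using this

open Classical in
theorem guardTab_holds_one {N₁ N₃ : IdxExpr} {x y e : RealExpr} {ρ : ℕ → ℕ} {a : ℕ} {M : Memory}
    (h : (Tab.mk N₁ (.const 1) N₃ x y e).Holds ρ a M) : ∀ i < N₁.eval ρ,
      M a i = ∑ k ∈ Finset.range (N₃.eval ρ), if x.eval (env3 ρ i 0 k) M ≤ y.eval (env3 ρ i 0 k) M
        then e.eval (env3 ρ i 0 k) M else 0 := by
  intro i hi
  have := h i hi 0 (by simp [IdxExpr.eval])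
  simpa [IdxExpr.eval, tabValue] using this

/-! ### Selection of an index, minimum and median -/

/-- Given flags `0` and `1` in the array `s`, marks the first index with flag `1`. -/
def selectTabs (s lo : ℕ) (N : IdxExpr) : List Tab :=
  [⟨N, .const 1, N, .add (.cast (.var 5)) (.const 1), .cast (.var 3), .read s (.var 5)⟩,
   ⟨N, .const 1, .const 1, .read lo (.var 3), .const 0, .read s (.var 3)⟩]

open Classical in
-- The first index with a flag is the flagged one with no flags before it, a condition expressed by
-- a guarded count.
theorem selectTabs_spec {s lo : ℕ} {N : IdxExpr} {ρ : ℕ → ℕ} {M : Memory} {m : ℕ}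
    (hm : N.eval ρ = m) (h : TabsHold ρ lo (selectTabs s lo N) M) {P : ℕ → Prop}
    [DecidablePred P]
    (hP : ∀ j < m, M s j = if P j then 1 else 0) (hex : ∃ j < m, P j) :
    ∃ j₀ < m, P j₀ ∧ (∀ k < j₀, ¬ P k) ∧ ∀ j < m, M (lo + 1) j = if j = j₀ then 1 else 0 := by
  obtain ⟨h1, h2, -⟩ := h
  have h1 := guardTab_holds_one h1
  have h2 := guardTab_holds_one h2
  simp only [RealExpr.eval, IdxExpr.eval, env3_three, env3_five, hm, Finset.range_one,
    Finset.sum_singleton] at h1 h2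
  set j₀ := Nat.find hex with hj₀
  obtain ⟨hlt, hPj⟩ := Nat.find_spec hex
  have hmin : ∀ k < j₀, ¬ P k := fun k hk hPk =>
    Nat.find_min hex hk ⟨hk.trans hlt, hPk⟩
  refine ⟨j₀, hlt, hPj, hmin, fun j hj => ?_⟩
  rw [h2 j hj, hP j hj]
  have hearly : M lo j = (((Finset.range m).filter fun k => k < j ∧ P k).card : ℝ) := by
    rw [h1 j hj, ← Finset.sum_boole]
    refine Finset.sum_congr rfl fun k hk => ?_
    rw [hP k (Finset.mem_range.1 hk)]
    -- Guards only test ≤, so the strict inequality of indices is written with a shift by one.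
    have e : ((k : ℝ) + 1 ≤ j) ↔ k < j := by
      rw [← Nat.cast_add_one, Nat.cast_le, Nat.succ_le_iff]
    by_cases hkj : k < j <;> by_cases hPk : P k <;> simp [e, hkj, hPk]
  rw [hearly]
  have hz : (((Finset.range m).filter fun k => k < j ∧ P k).card : ℝ) ≤ 0 ↔ ∀ k < j, ¬ P k := by
    rw [← Nat.cast_zero, Nat.cast_le, Nat.le_zero, Finset.card_eq_zero, Finset.filter_eq_empty_iff]
    constructor
    · intro h k hk hPk
      exact h (Finset.mem_range.2 (hk.trans hj)) ⟨hk, hPk⟩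
    · rintro h k - ⟨hk, hPk⟩
      exact h k hk hPk
  by_cases hjj : j = j₀
  · rw [if_pos (hz.2 (hjj ▸ hmin)), if_pos (hjj ▸ hPj), if_pos hjj]
  · rw [if_neg hjj]
    rcases lt_or_gt_of_ne hjj with h | h
    · rw [if_neg (hmin j h), ite_self]
    · rw [if_neg]
      intro h'
      exact hz.1 h' j₀ h hPj

theorem sum_select {m j₀ : ℕ} (hj₀ : j₀ < m) {f : ℕ → ℝ}
    (hf : ∀ j < m, f j = if j = j₀ then 1 else 0) (g : ℕ → ℝ) :
    ∑ k ∈ Finset.range m, f k * g k = g j₀ := by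
  have : ∑ k ∈ Finset.range m, f k * g k =
      ∑ k ∈ Finset.range m, (if k = j₀ then 1 else 0) * g k :=
    Finset.sum_congr rfl fun k hk => by rw [hf k (Finset.mem_range.1 hk)]
  rw [this]
  simp [hj₀]

/-- Marks the first index of a minimal entry of the array `s`. -/
def argminTabs (s lo : ℕ) (N : IdxExpr) : List Tab :=
  [⟨N, .const 1, N, .read s (.var 3), .read s (.var 5), .const 1⟩,
   ⟨N, .const 1, .const 1, .cast N, .read lo (.var 3), .const 1⟩] ++
  selectTabs (lo + 1) (lo + 2) N

open Classical in
-- An entry is minimal if and only if all m entries are at least as large, which is tested by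
-- counting. That earlier entries are not minimal is needed to match the program with the measurable
-- choice of direction.
theorem argminTabs_spec {s lo d n T : ℕ} {N : IdxExpr} {ρ : ℕ → ℕ} {M : Memory} {m : ℕ}
    (hρ : SizeEnv d n T ρ) (hN : N.SizeOnly) (hm : N.eval ρ = m) (hm1 : 1 ≤ m)
    (h : TabsHold ρ lo (argminTabs s lo N) M) :
    ∃ j₀ < m, (∀ k < m, M s j₀ ≤ M s k) ∧ (∀ k < j₀, ∃ l < m, M s l < M s k) ∧
      ∀ j < m, M (lo + 3) j = if j = j₀ then 1 else 0 := by
  obtain ⟨⟨h1, h2, -⟩, h3⟩ := (tabsHold_append _ _ _).1 h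
  have h1 := guardTab_holds_one h1
  have h2 := guardTab_holds_one h2
  have hmN : ∀ i j k, N.eval (env3 ρ i j k) = m := fun i j k => by
    rw [← hm]; exact hN.eval_eq (hρ.env3 i j k) hρ
  simp only [RealExpr.eval, IdxExpr.eval, env3_three, env3_five, hm, hmN, Finset.range_one,
    Finset.sum_singleton] at h1 h2
  set P : ℕ → Prop := fun j => ∀ k < m, M s j ≤ M s k with hP
  have hflag : ∀ j < m, M (lo + 1) j = if P j then 1 else 0 := by
    intro j hj
    rw [h2 j hj, h1 j hj, Finset.sum_boole]
    have e : (m : ℝ) ≤ (((Finset.range m).filter fun k => M s j ≤ M s k).card : ℝ) ↔ P j := by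
      rw [Nat.cast_le]
      constructor
      · intro hc k hk
        have := Finset.eq_of_subset_of_card_le (Finset.filter_subset (fun k => M s j ≤ M s k)
          (Finset.range m)) (by rwa [Finset.card_range])
        have hk' := Finset.mem_range.2 hk
        rw [← this] at hk'
        exact (Finset.mem_filter.1 hk').2
      · intro hp
        rw [Finset.filter_true_of_mem fun k hk => hp k (Finset.mem_range.1 hk), Finset.card_range]
    exact if_congr e rfl rfl
  have hex : ∃ j < m, P j := by
    obtain ⟨j, hj, hmin⟩ := Finset.exists_min_image (Finset.range m) (M s) ⟨0, Finset.mem_range.2 hm1⟩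
    exact ⟨j, Finset.mem_range.1 hj, fun k hk => hmin k (Finset.mem_range.2 hk)⟩
  obtain ⟨j₀, hj₀, hPj, hmin, hsel⟩ := selectTabs_spec hm h3 hflag hex
  refine ⟨j₀, hj₀, hPj, fun k hk => ?_, hsel⟩
  have := hmin k hk
  simp only [hP] at this
  push Not at this
  exact this

theorem argminTabs_wf {s lo : ℕ} {N : IdxExpr} (hs : s < lo) (hN : N.SizeOnly) :
    TabsWF lo (argminTabs s lo N) := by
  simp [TabsWF, Tab.WF, argminTabs, selectTabs, RealExpr.Below, IdxExpr.SizeOnly, hN]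
  omega

/-- The median of the first `N` entries of the array `s`. -/
def medianTabs (s lo : ℕ) (N : IdxExpr) : List Tab :=
  [⟨N, .const 1, N, .read s (.var 5), .read s (.var 3), .const 1⟩,
   ⟨N, .const 1, N, .read s (.var 3), .read s (.var 5), .const 1⟩,
   ⟨N, .const 1, .const 1, .cast N, .mul (.const 2) (.read lo (.var 3)), .const 1⟩,
   ⟨N, .const 1, .const 1, .cast N, .mul (.const 2) (.read (lo + 1) (.var 3)),
    .read (lo + 2) (.var 3)⟩] ++
  (selectTabs (lo + 3) (lo + 4) N ++
  [sumTab (.const 1) (.const 1) N (.mul (.read (lo + 5) (.var 5)) (.read s (.var 5)))])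

open Classical in
-- Both counting conditions of a median are tested for every entry, and the first entry that passes
-- is read off by summation against its indicator; `exists_isMedian` says that some entry passes.
theorem medianTabs_spec {s lo d n T : ℕ} {N : IdxExpr} {ρ : ℕ → ℕ} {M : Memory} {m : ℕ}
    (hρ : SizeEnv d n T ρ) (hN : N.SizeOnly) (hm : N.eval ρ = m) (hm1 : 1 ≤ m)
    (h : TabsHold ρ lo (medianTabs s lo N) M) :
    IsMedian (fun j : Fin m => M s j) (M (lo + 6) 0) := by
  obtain ⟨⟨h1, h2, h3, h4, -⟩, h56⟩ := (tabsHold_append _ _ _).1 h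
  obtain ⟨h5, h6, -⟩ := (tabsHold_append _ _ _).1 h56
  have h1 := guardTab_holds_one h1
  have h2 := guardTab_holds_one h2
  have h3 := guardTab_holds_one h3
  have h4 := guardTab_holds_one h4
  have h6 := sumTab_holds_one h6 0 (by simp [IdxExpr.eval])
  have hmN : ∀ i j k, N.eval (env3 ρ i j k) = m := fun i j k => by
    rw [← hm]; exact hN.eval_eq (hρ.env3 i j k) hρ
  simp only [RealExpr.eval, IdxExpr.eval, env3_three, env3_five, hm, hmN, Finset.range_one,
    Finset.sum_singleton] at h1 h2 h3 h4 h6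
  set c₁ : ℕ → ℕ := fun j => (Finset.univ.filter fun k : Fin m => M s k ≤ M s j).card with hc₁
  set c₂ : ℕ → ℕ := fun j => (Finset.univ.filter fun k : Fin m => M s j ≤ M s k).card with hc₂
  have h1' : ∀ j < m, M lo j = c₁ j := fun j hj => by
    rw [h1 j hj, Finset.sum_range, Finset.sum_boole]
  have h2' : ∀ j < m, M (lo + 1) j = c₂ j := fun j hj => by
    rw [h2 j hj, Finset.sum_range, Finset.sum_boole]
  have hflag : ∀ j < m, M (lo + 3) j = if m ≤ 2 * c₁ j ∧ m ≤ 2 * c₂ j then 1 else 0 := by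
    intro j hj
    rw [h4 j hj, h2' j hj, show lo + 1 + 1 = lo + 2 from rfl] at *
    rw [h3 j hj, h1' j hj]
    have e : ∀ c : ℕ, ((m : ℝ) ≤ 2 * (c : ℝ)) ↔ m ≤ 2 * c := fun c => by
      rw [← Nat.cast_ofNat (n := 2), ← Nat.cast_mul, Nat.cast_le]
    simp only [e]
    by_cases ha : m ≤ 2 * c₁ j <;> by_cases hb : m ≤ 2 * c₂ j <;> simp [ha, hb]
  have hex : ∃ j < m, m ≤ 2 * c₁ j ∧ m ≤ 2 * c₂ j := by
    obtain ⟨j, hj⟩ := exists_isMedian hm1 fun j : Fin m => M s j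
    exact ⟨j, j.2, hj⟩
  obtain ⟨j₀, hj₀, hPj, -, hsel⟩ := selectTabs_spec hm h5 hflag hex
  have hv : M (lo + 6) 0 = M s j₀ := by
    refine h6.trans ?_
    exact sum_select hj₀ hsel _
  rw [hv]
  exact hPj

theorem medianTabs_wf {s lo : ℕ} {N : IdxExpr} (hs : s < lo) (hN : N.SizeOnly) :
    TabsWF lo (medianTabs s lo N) := by
  simp [TabsWF, Tab.WF, medianTabs, selectTabs, sumTab, RealExpr.Below, IdxExpr.SizeOnly, hN]
  omega

/-! ### The direction found by power iteration -/

/-- The `i`-th column of a power of the covariance matrix. -/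
def powerVec {d n : ℕ} (X : Fin n → E d) (i : Fin d) : E d :=
  (covOp X ^ (n * d + 1)) (EuclideanSpace.single i 1)

/-- With k = n d + 1, the largest column has norm at least (ℓ + 1)^k / √d by `exists_le_norm_power`,
and its residual is at most (ℓ + 1)^{k+1} / (k + 1). The ratio is at most (ℓ + 1)√d / (n d + 2),
hence at most (ℓ + 1)/√n. -/
theorem isTopEigenvector_powerVec {d n : ℕ} (hd : 1 ≤ d) (hn : 1 ≤ n) (X : Fin n → E d) (i : Fin d)
    (hi : ∀ j, ‖powerVec X j‖ ≤ ‖powerVec X i‖) (h0 : powerVec X i ≠ 0) :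
    IsTopEigenvector (sampleCov X) (1 / √(n : ℝ)) (‖powerVec X i‖⁻¹ • powerVec X i) := by
  obtain ⟨ℓ, b, ρ, j₀, hℓ, hA, hρ0, hle, hj₀⟩ := exists_spectral_covOp hd X
  refine isTopEigenvector_of_covOp h0 hℓ ?_
  have hl0 : 0 ≤ ℓ + 1 := hj₀ ▸ hρ0 j₀
  have hd0 : (0 : ℝ) < d := by exact_mod_cast hd
  have hn0 : (0 : ℝ) < n := by exact_mod_cast hn
  obtain ⟨i₀, hi₀⟩ := exists_le_norm_power hd hA j₀ (n * d + 1)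
  have h1 : (ℓ + 1) ^ (n * d + 1) ≤ √(d : ℝ) * ‖powerVec X i‖ := by
    refine abs_le_of_sq_le_sq' ?_ (by positivity) |>.2
    rw [mul_pow, Real.sq_sqrt hd0.le, ← pow_mul, mul_comm _ 2, ← hj₀]
    refine hi₀.trans ?_
    gcongr
    exact hi i₀
  have h2 := norm_power_residual_le hA hρ0 hle (n * d + 1) (EuclideanSpace.single i 1)
  rw [PiLp.norm_single, norm_one, mul_one] at h2
  change ‖covOp X (powerVec X i) - (ℓ + 1) • powerVec X i‖ * ((n * d + 1 : ℕ) + 1) ≤ _ at h2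
  have h3 : √(n : ℝ) * √(d : ℝ) ≤ (n * d + 1 : ℕ) + 1 := by
    have h4 : (1 : ℝ) ≤ n * d := by exact_mod_cast Nat.mul_pos hn hd
    rw [← Real.sqrt_mul hn0.le]
    calc √((n : ℝ) * d) ≤ n * d := Real.sqrt_le_iff.2 ⟨by linarith, by nlinarith⟩
      _ ≤ _ := by push_cast; linarith
  set res := ‖covOp X (powerVec X i) - (ℓ + 1) • powerVec X i‖ with hres
  have hsn : 0 < √(n : ℝ) := Real.sqrt_pos.2 hn0
  have hsd : 0 < √(d : ℝ) := Real.sqrt_pos.2 hd0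
  have hr0 : 0 ≤ res := norm_nonneg _
  have h5 : res * (√(n : ℝ) * √(d : ℝ)) ≤ (ℓ + 1) * (√(d : ℝ) * ‖powerVec X i‖) := by
    calc _ ≤ res * ((n * d + 1 : ℕ) + 1) := by gcongr
      _ ≤ (ℓ + 1) ^ (n * d + 1 + 1) := h2
      _ = (ℓ + 1) * (ℓ + 1) ^ (n * d + 1) := by ring
      _ ≤ _ := by gcongr
  have h6 : res * √(n : ℝ) ≤ (ℓ + 1) * ‖powerVec X i‖ := by
    refine le_of_mul_le_mul_right ?_ hsd
    linarith
  rw [one_div, mul_assoc, ← div_eq_inv_mul, le_div_iff₀ hsn]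
  exact h6

/-- If every column vanishes, the covariance operator is zero and every unit vector is an exact
eigenvector. -/
theorem isTopEigenvector_single {d n : ℕ} (hd : 1 ≤ d) {τ : ℝ} (X : Fin n → E d)
    (h : ∀ j, powerVec X j = 0) (i : Fin d) :
    IsTopEigenvector (sampleCov X) τ (EuclideanSpace.single i 1) := by
  obtain ⟨ℓ, b, ρ, j₀, hℓ, hA, hρ0, hle, hj₀⟩ := exists_spectral_covOp hd X
  obtain ⟨i₀, hi₀⟩ := exists_le_norm_power hd hA j₀ (n * d + 1)
  have hl0 : ℓ + 1 = 0 := by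
    have h1 : (covOp X ^ (n * d + 1)) (EuclideanSpace.single i₀ 1) = 0 := h i₀
    rw [h1, norm_zero, hj₀] at hi₀
    have h2 : (ℓ + 1) ^ (2 * (n * d + 1)) = 0 := by
      refine le_antisymm (by simpa using hi₀) ?_
      exact pow_nonneg (hj₀ ▸ hρ0 j₀) _
    exact pow_eq_zero_iff (by omega) |>.1 h2
  have hρ : ∀ j, ρ j = 0 := fun j => le_antisymm (hl0 ▸ hle j) (hρ0 j)
  have hz : covOp X (EuclideanSpace.single i 1) = 0 := by
    rw [← norm_eq_zero, ← sq_eq_zero_iff, norm_sq_eq_sum_basis b]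
    simp [hA, hρ]
  have h1 : (EuclideanSpace.single i 1 : E d) ≠ 0 := by
    rw [← norm_ne_zero_iff]; simp
  have := isTopEigenvector_of_covOp (τ := τ) h1 hℓ (by rw [hz, hl0]; simp)
  simpa using this

/-- The direction found by power iteration is a measurable function of the data. -/
theorem exists_measurable_power_direction {d n : ℕ} (hd : 1 ≤ d) (hn : 1 ≤ n) :
    ∃ u : (Fin n → E d) → E d, Measurable u ∧
      (∀ X, IsTopEigenvector (sampleCov X) (1 / √(n : ℝ)) (u X)) ∧
      ∀ X i, (∀ j, ‖powerVec X j‖ ≤ ‖powerVec X i‖) →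
        (∀ j < i, ∃ l, ‖powerVec X j‖ < ‖powerVec X l‖) →
        (powerVec X i = 0 → u X = EuclideanSpace.single ⟨0, hd⟩ 1) ∧
        (powerVec X i ≠ 0 → u X = ‖powerVec X i‖⁻¹ • powerVec X i) := by
  classical
  set f : ℕ → (Fin n → E d) → E d := fun i X => if h : i < d then powerVec X ⟨i, h⟩ else 0 with hf
  have hpm : ∀ i, Measurable fun X : Fin n → E d => powerVec X i := fun i =>
    measurable_covOp_pow_apply _ _
  have hfm : ∀ i, Measurable (f i) := by
    intro i
    by_cases h : i < d
    · simp only [hf, h, dite_true]; exact hpm _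
    · simp only [hf, h, dite_false]; exact measurable_const
  set p : (Fin n → E d) → ℕ → Prop := fun X i => i < d ∧ ∀ j, ‖powerVec X j‖ ≤ ‖f i X‖ with hp
  have : Nonempty (Fin d) := ⟨⟨0, hd⟩⟩
  have hex : ∀ X, ∃ i, p X i := fun X => by
    obtain ⟨i, hi⟩ := Finite.exists_max fun j => ‖powerVec X j‖
    exact ⟨i, i.2, fun j => by simpa [hf] using hi j⟩
  have hfind : Measurable fun X => Nat.find (hex X) := by
    refine measurable_find hex fun k => ?_
    by_cases hk : k < d
    · simp only [hp, hk, true_and, Set.ofPred_forall]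
      exact MeasurableSet.iInter fun j => measurableSet_le (hpm j).norm (hfm k).norm
    · simp [hp, hk]
  set g : (Fin n → E d) → E d := fun X => f (Nat.find (hex X)) X with hg
  have hgm : Measurable g := by
    have h2 : Measurable fun p : ℕ × (Fin n → E d) => f p.1 p.2 :=
      measurable_from_prod_countable_right hfm
    exact h2.comp (hfind.prodMk measurable_id)
  set u : (Fin n → E d) → E d := fun X =>
    if g X = 0 then EuclideanSpace.single ⟨0, hd⟩ 1 else ‖g X‖⁻¹ • g X with hu
  have hgi : ∀ X, ∃ i, g X = powerVec X i ∧ (∀ j, ‖powerVec X j‖ ≤ ‖powerVec X i‖) ∧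
      (i : ℕ) = Nat.find (hex X) := fun X => by
    obtain ⟨h1, h2⟩ := Nat.find_spec (hex X)
    have e : f (Nat.find (hex X)) X = powerVec X ⟨Nat.find (hex X), h1⟩ := by simp only [hf, h1, dite_true]
    exact ⟨⟨_, h1⟩, e, fun j => e ▸ h2 j, rfl⟩
  refine ⟨u, Measurable.ite (measurableSet_eq_fun hgm measurable_const) measurable_const
    (hgm.norm.inv.smul hgm), fun X => ?_, fun X i hi hfirst => ?_⟩
  · obtain ⟨i, he, hi, -⟩ := hgi X
    simp only [hu, he]
    split_ifs with h0
    · refine isTopEigenvector_single hd X (fun j => ?_) _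
      have := hi j
      rw [h0, norm_zero] at this
      exact norm_le_zero_iff.1 this
    · exact isTopEigenvector_powerVec hd hn X i hi h0
  · obtain ⟨i', he, hi', hfi'⟩ := hgi X
    -- The first maximizing column is unique, so any rule that selects it agrees with the measurable
    -- one.
    have hii : i' = i := by
      rcases lt_trichotomy i' i with h | h | h
      · obtain ⟨l, hl⟩ := hfirst i' h
        exact absurd (hi' l) (not_le.2 hl)
      · exact h
      · have h1 : (i : ℕ) < Nat.find (hex X) := by rw [← hfi']; exact h
        exact absurd ⟨i.2, fun j => by simpa [hf] using hi j⟩ (Nat.find_min (hex X) h1)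
    rw [hii] at he
    constructor
    · intro h0; simp only [hu, he, h0, if_true]
    · intro h0; simp only [hu, he, h0, if_false]

/-! ### Grid search -/

/-- Perturbing the two atoms costs 3M²s each, perturbing the weight M³s for each atom; the total is
at most 8M³s as M ≥ 1. -/
theorem abs_moment_diff_grid {M a a' b b' c c' s : ℝ} (hM : 1 ≤ M) (ha : a ∈ Set.Icc (0 : ℝ) 1)
    (hb : |b| ≤ M) (hb' : |b'| ≤ M) (hc : |c| ≤ M) (hc' : |c'| ≤ M)
    (hs : 0 ≤ s) (haa : |a - a'| ≤ s) (hbb : |b - b'| ≤ s) (hcc : |c - c'| ≤ s) {r : ℕ}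
    (hr : r < 3) :
    |(a * b ^ (r + 1) + (1 - a) * c ^ (r + 1)) - (a' * b' ^ (r + 1) + (1 - a') * c' ^ (r + 1))| ≤
      8 * M ^ 3 * s := by
  have h1 := abs_pow_sub_pow_le hM hs hb hb' hbb (l := r + 1) (by omega)
  have h2 := abs_pow_sub_pow_le hM hs hc hc' hcc (l := r + 1) (by omega)
  have hpow : ∀ t : ℝ, |t| ≤ M → |t ^ (r + 1)| ≤ M ^ 3 := fun t ht => by
    rw [abs_pow]
    exact (pow_le_pow_left₀ (abs_nonneg _) ht _).trans (pow_le_pow_right₀ hM (by omega))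
  have h3 := hpow b' hb'
  have h4 := hpow c' hc'
  have h5 : M ^ 2 ≤ M ^ 3 := pow_le_pow_right₀ hM (by norm_num)
  have e : (a * b ^ (r + 1) + (1 - a) * c ^ (r + 1)) - (a' * b' ^ (r + 1) + (1 - a') * c' ^ (r + 1)) =
      a * (b ^ (r + 1) - b' ^ (r + 1)) + (1 - a) * (c ^ (r + 1) - c' ^ (r + 1)) +
        (a - a') * b' ^ (r + 1) - (a - a') * c' ^ (r + 1) := by ring
  rw [e]
  have k1 : |a * (b ^ (r + 1) - b' ^ (r + 1))| ≤ 1 * (3 * M ^ 2 * s) := by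
    rw [abs_mul, abs_of_nonneg ha.1]
    exact mul_le_mul ha.2 h1 (abs_nonneg _) zero_le_one
  have k2 : |(1 - a) * (c ^ (r + 1) - c' ^ (r + 1))| ≤ 1 * (3 * M ^ 2 * s) := by
    rw [abs_mul, abs_of_nonneg (sub_nonneg.2 ha.2)]
    exact mul_le_mul (by linarith [ha.1]) h2 (abs_nonneg _) zero_le_one
  have k3 : |(a - a') * b' ^ (r + 1)| ≤ s * M ^ 3 := by
    rw [abs_mul]; exact mul_le_mul haa h3 (abs_nonneg _) hs
  have k4 : |(a - a') * c' ^ (r + 1)| ≤ s * M ^ 3 := by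
    rw [abs_mul]; exact mul_le_mul haa h4 (abs_nonneg _) hs
  have k5 : M ^ 2 * s ≤ M ^ 3 * s := mul_le_mul_of_nonneg_right h5 hs
  rw [abs_le] at k1 k2 k3 k4 ⊢
  constructor <;> linarith

theorem sqrt_sqMomentGap_eq (m : Fin 3 → ℝ) (a b c : ℝ) : √(sqMomentGap m a b c) =
    ‖(WithLp.toLp 2 m : E 3) -
      WithLp.toLp 2 fun r : Fin 3 => a * b ^ ((r : ℕ) + 1) + (1 - a) * c ^ ((r : ℕ) + 1)‖ := by
  rw [EuclideanSpace.norm_eq, sqMomentGap]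
  simp

theorem sqrt_sqMomentGap_le {M a a' b b' c c' s : ℝ} (m : Fin 3 → ℝ) (hM : 1 ≤ M)
    (ha : a ∈ Set.Icc (0 : ℝ) 1) (hb : |b| ≤ M) (hb' : |b'| ≤ M)
    (hc : |c| ≤ M) (hc' : |c'| ≤ M) (hs : 0 ≤ s) (haa : |a - a'| ≤ s) (hbb : |b - b'| ≤ s)
    (hcc : |c - c'| ≤ s) :
    √(sqMomentGap m a' b' c') ≤ √(sqMomentGap m a b c) + 16 * M ^ 3 * s := by
  rw [sqrt_sqMomentGap_eq, sqrt_sqMomentGap_eq]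
  set v : E 3 := WithLp.toLp 2 fun r : Fin 3 => a * b ^ ((r : ℕ) + 1) + (1 - a) * c ^ ((r : ℕ) + 1)
  set v' : E 3 := WithLp.toLp 2 fun r : Fin 3 =>
    a' * b' ^ ((r : ℕ) + 1) + (1 - a') * c' ^ ((r : ℕ) + 1)
  have h : ‖v - v'‖ ≤ 16 * M ^ 3 * s := by
    rw [EuclideanSpace.norm_eq]
    refine Real.sqrt_le_iff.2 ⟨by positivity, ?_⟩
    calc _ ≤ ∑ _r : Fin 3, (8 * M ^ 3 * s) ^ 2 := Finset.sum_le_sum fun r _ => by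
          refine pow_le_pow_left₀ (norm_nonneg _) ?_ 2
          exact abs_moment_diff_grid hM ha hb hb' hc hc' hs haa hbb hcc r.2
      -- Three coordinates: √3 · 8 < 16.
      _ ≤ _ := by simp; nlinarith [sq_nonneg (M ^ 3 * s)]
  have h2 : (WithLp.toLp 2 m : E 3) - v' = (WithLp.toLp 2 m - v) + (v - v') := by abel
  rw [h2]
  exact (norm_add_le _ _).trans (add_le_add le_rfl h)

theorem exists_grid_point {G : ℕ} (hG : 1 ≤ G) {t : ℝ} (ht : t ∈ Set.Icc (0 : ℝ) 1) :
    ∃ i ≤ G, |t - i / G| ≤ 1 / G := by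
  have hG0 : (0 : ℝ) < G := by exact_mod_cast hG
  have h0 : 0 ≤ t * G := mul_nonneg ht.1 hG0.le
  refine ⟨⌊t * G⌋₊, ?_, ?_⟩
  · refine Nat.floor_le_of_le ?_
    nlinarith [ht.2]
  · have h1 := Nat.floor_le h0
    have h2 := Nat.lt_floor_add_one (t * G)
    have e : t - ⌊t * G⌋₊ / G = (t * G - ⌊t * G⌋₊) / G := by field_simp
    rw [e, abs_div, abs_of_pos hG0]
    gcongr
    rw [abs_le]
    constructor <;> linarith

/-- The minimum over a fine grid nearly attains the minimum. -/
theorem exists_grid_near {L : ℝ} (hL : 0 ≤ L) {g n : ℕ} (hn : 1 ≤ n) (hg : 32 * (L + 1) ^ 4 ≤ g)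
    (m : Fin 3 → ℝ) {a b c : ℝ} (ha : a ∈ Set.Icc (0 : ℝ) 1) (hb : b ∈ Set.Icc (-L) L)
    (hc : c ∈ Set.Icc (-L) L) : ∃ i ≤ g * n, ∃ j ≤ g * n, ∃ k ≤ g * n,
      √(sqMomentGap m (i / (g * n : ℕ)) (2 * L * j / (g * n : ℕ) - L) (2 * L * k / (g * n : ℕ) - L)) ≤
        √(sqMomentGap m a b c) + 1 / √(n : ℝ) := by
  have hL1 : 1 ≤ L + 1 := by linarith
  have hg1 : (1 : ℝ) ≤ g := by
    have : 1 ≤ (L + 1) ^ 4 := one_le_pow₀ hL1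
    linarith
  have hg1' : 1 ≤ g := by exact_mod_cast hg1
  have hn1 : (1 : ℝ) ≤ n := by exact_mod_cast hn
  set G : ℕ := g * n with hG
  have hG1 : 1 ≤ G := Nat.mul_pos hg1' hn
  have hG0 : (0 : ℝ) < G := by exact_mod_cast hG1
  have key : ∀ x ∈ Set.Icc (-L) L, ∃ j ≤ G, |x - (2 * L * j / G - L)| ≤ 2 * (L + 1) / G ∧
      2 * L * j / G - L ∈ Set.Icc (-L) L := by
    intro x hx
    have hin : ∀ j ≤ G, 2 * L * j / G - L ∈ Set.Icc (-L) L := by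
      intro j hj
      have hj' : (j : ℝ) / G ≤ 1 := by rw [div_le_one hG0]; exact_mod_cast hj
      have hj0 : (0 : ℝ) ≤ (j : ℝ) / G := by positivity
      have e : 2 * L * (j : ℝ) / G = 2 * L * (j / G) := by ring
      rw [e]
      constructor <;> nlinarith
    rcases hL.eq_or_lt with h0 | h0
    -- For L = 0 the rescaling by 2L is not invertible, but the interval is a point.
    · refine ⟨0, by omega, ?_, hin 0 (by omega)⟩
      subst h0
      have : x = 0 := le_antisymm hx.2 (by linarith [hx.1])
      simp [this]
      positivity
    · have ht : (x + L) / (2 * L) ∈ Set.Icc (0 : ℝ) 1 :=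
        ⟨div_nonneg (by linarith [hx.1]) (by linarith), by
          rw [div_le_one (by linarith)]; linarith [hx.2]⟩
      obtain ⟨j, hj, h⟩ := exists_grid_point hG1 ht
      refine ⟨j, hj, ?_, hin j hj⟩
      have e : x - (2 * L * j / G - L) = 2 * L * ((x + L) / (2 * L) - j / G) := by
        field_simp; ring
      rw [e, abs_mul, abs_of_pos (by linarith : (0 : ℝ) < 2 * L)]
      calc 2 * L * |(x + L) / (2 * L) - j / G| ≤ 2 * (L + 1) * (1 / G) := by gcongr; linarith
        _ = _ := by ring
  obtain ⟨i, hi, hia⟩ := exists_grid_point hG1 ha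
  obtain ⟨j, hj, hjb, hj'⟩ := key b hb
  obtain ⟨k, hk, hkc, hk'⟩ := key c hc
  refine ⟨i, hi, j, hj, k, hk, ?_⟩
  have hbd : ∀ x ∈ Set.Icc (-L) L, |x| ≤ L + 1 := fun x hx =>
    abs_le.2 ⟨by linarith [hx.1], by linarith [hx.2]⟩
  have h1 : |a - (i : ℝ) / G| ≤ 2 * (L + 1) / G := by
    refine hia.trans ?_
    gcongr
    linarith
  refine (sqrt_sqMomentGap_le m hL1 ha (hbd b hb) (hbd _ hj') (hbd c hc) (hbd _ hk')
    (by positivity) h1 hjb hkc).trans ?_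
  gcongr
  -- The loss 16(L + 1)³ times the spacing 2(L + 1)/(g n) is at most 1/n by the choice of g, hence
  -- at most n^{-1/2}. The bound L + 1 in place of L for the atoms is there to be at least 1.
  have hs : √(n : ℝ) ≤ n := Real.sqrt_le_iff.2 ⟨by linarith, by nlinarith⟩
  have hs0 : 0 < √(n : ℝ) := Real.sqrt_pos.2 (by linarith)
  calc 16 * (L + 1) ^ 3 * (2 * (L + 1) / (G : ℝ)) = 32 * (L + 1) ^ 4 / (G : ℝ) := by ring
    _ ≤ (g : ℝ) / (G : ℝ) := by gcongr
    _ = 1 / (n : ℝ) := by rw [hG]; push_cast; field_simp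
    _ ≤ _ := by gcongr

/-! ### The program: covariance matrix and power iteration -/

@[simp] theorem env3_zero (ρ : ℕ → ℕ) (i j k : ℕ) : env3 ρ i j k 0 = ρ 0 := by simp [env3]

@[simp] theorem env3_one (ρ : ℕ → ℕ) (i j k : ℕ) : env3 ρ i j k 1 = ρ 1 := by simp [env3]

@[simp] theorem env3_two (ρ : ℕ → ℕ) (i j k : ℕ) : env3 ρ i j k 2 = ρ 2 := by simp [env3]

@[simp] theorem sizes_zero (d n T : ℕ) : sizes d n T 0 = d := rfl

@[simp] theorem sizes_one (d n T : ℕ) : sizes d n T 1 = n := rfl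

@[simp] theorem sizes_two (d n T : ℕ) : sizes d n T 2 = T := rfl

theorem inputMemory_apply {d m : ℕ} (X : Fin m → E d) (i : Fin m) (c : Fin d) :
    inputMemory X 0 (i * d + c) = X i c := by
  have hlt : (i : ℕ) * d + c < m * d := by
    calc (i : ℕ) * d + c < i * d + d := by have := c.2; omega
      _ = (i + 1) * d := by ring
      _ ≤ m * d := Nat.mul_le_mul_right _ i.2
  have h1 : ((i : ℕ) * d + c) / d = i := by
    rw [mul_comm, Nat.mul_add_div (by have := c.2; omega), Nat.div_eq_of_lt c.2, add_zero]
  have h2 : ((i : ℕ) * d + c) % d = c := by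
    rw [mul_comm, Nat.mul_add_mod, Nat.mod_eq_of_lt c.2]
  unfold inputMemory
  rw [dif_pos ⟨rfl, hlt⟩]
  exact congrArg₂ (fun (a : Fin m) (b : Fin d) => X a b) (Fin.ext h1) (Fin.ext h2)

/-- The entry `i` of the array `a`, where `i` is the value of a loop counter. -/
abbrev entry (a i : ℕ) : RealExpr := .read a (.var i)

/-- The entry in row `i` and column `j` of the array `a` with rows of length `N`. -/
abbrev entry₂ (a i : ℕ) (N : IdxExpr) (j : ℕ) : RealExpr :=
  .read a (.add (.mul (.var i) N) (.var j))

/-- The mean, the centered first half, and the matrix of second moments. -/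
def covTabs : List Tab :=
  [sumTab (.var 0) (.const 1) (.var 1) (.div (entry₂ 0 5 (.var 0) 3) (.cast (.var 1))),
   sumTab (.var 1) (.var 0) (.const 1) (.sub (entry₂ 0 3 (.var 0) 4) (entry 3 4)),
   sumTab (.var 0) (.var 0) (.var 1)
    (.div (.mul (entry₂ 4 5 (.var 0) 3) (entry₂ 4 5 (.var 0) 4)) (.cast (.var 1)))]

theorem covTabs_wf : TabsWF 3 covTabs := by
  simp [TabsWF, Tab.WF, covTabs, sumTab, RealExpr.Below, IdxExpr.SizeOnly]

theorem covTabs_spec {d n T : ℕ} {X : Fin (n + n) → E d} {M : Memory}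
    (h0 : M 0 = inputMemory X 0) (h : TabsHold (sizes d n T) 3 covTabs M) :
    (∀ c : Fin d, M 3 c = sampleMean (firstHalf X) c) ∧
    ∀ a b : Fin d, M 5 (a * d + b) = covOp (firstHalf X) (EuclideanSpace.single b 1) a := by
  obtain ⟨h1, h2, h3, -⟩ := h
  have h1 := sumTab_holds_one h1
  have h2 := sumTab_holds h2
  have h3 := sumTab_holds h3
  simp only [RealExpr.eval, IdxExpr.eval, env3_zero, env3_one, env3_three, env3_four, env3_five,
    sizes_zero, sizes_one, Finset.range_one, Finset.sum_singleton] at h1 h2 h3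
  have hX : ∀ (i : Fin n) (c : Fin d), M 0 (i * d + c) = firstHalf X i c := fun i c => by
    rw [h0]
    exact inputMemory_apply X (Fin.castAdd n i) c
  have hmean : ∀ c : Fin d, M 3 c = sampleMean (firstHalf X) c := by
    intro c
    rw [h1 c c.2, Finset.sum_range, ← Finset.sum_div]
    simp only [hX]
    simp [sampleMean, div_eq_inv_mul]
  refine ⟨hmean, fun a b => ?_⟩
  have hcen : ∀ (i : Fin n) (c : Fin d),
      M (3 + 1) (i * d + c) = (firstHalf X i - sampleMean (firstHalf X)) c := by
    intro i c
    rw [h2 i i.2 c c.2, hX, hmean]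
    rfl
  refine (h3 a a.2 b b.2).trans ?_
  rw [Finset.sum_range, ← Finset.sum_div, covOp_apply]
  have e : ∀ i : Fin n, M 4 (i * d + a) * M 4 (i * d + b) =
      (firstHalf X i - sampleMean (firstHalf X)) a * (firstHalf X i - sampleMean (firstHalf X)) b :=
    fun i => by rw [← hcen i a, ← hcen i b]
  simp only [e]
  rw [PiLp.smul_apply, WithLp.ofLp_sum, Finset.sum_apply, smul_eq_mul, div_eq_inv_mul]
  congr 1
  refine Finset.sum_congr rfl fun i _ => ?_
  rw [EuclideanSpace.inner_single_right]
  simp [mul_comm]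

/-- `n d + 1`-th power of the matrix in the array `5`, computed in the array `7`. -/
def powerProg : Prog :=
  .seq (tab 7 (.var 0) (.var 0) (.const 1) (.const 0) (.const 0) (entry₂ 5 3 (.var 0) 4))
    (.loop 6 (.mul (.var 1) (.var 0))
      (.seq (tab 6 (.var 0) (.var 0) (.var 0) (.const 0) (.const 0)
          (.mul (entry₂ 5 3 (.var 0) 5) (entry₂ 7 5 (.var 0) 4)))
        (tab 7 (.var 0) (.var 0) (.const 1) (.const 0) (.const 0) (entry₂ 6 3 (.var 0) 4))))

theorem polyCost_powerProg : powerProg.PolyCost := by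
  have h0 := IdxExpr.poly_var (v := 0) (by norm_num)
  have h1 := IdxExpr.poly_var (v := 1) (by norm_num)
  have hc := IdxExpr.poly_const 1
  exact (polyCost_tab h0 h0 hc _ _ _ _).seq (((polyCost_tab h0 h0 h0 _ _ _ _).seq
    (polyCost_tab h0 h0 hc _ _ _ _)).loop (h1.mul h0) (by norm_num))

theorem apply_eq_sum_single {d : ℕ} (A : E d →ₗ[ℝ] E d) (y : E d) (a : Fin d) :
    A y a = ∑ c : Fin d, A (EuclideanSpace.single c 1) a * y c := by
  have hy : y = ∑ c : Fin d, y c • (EuclideanSpace.single c (1 : ℝ) : E d) := by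
    ext a
    simp [Finset.sum_apply, Pi.single_apply]
  conv_lhs => rw [hy]
  rw [map_sum, WithLp.ofLp_sum, Finset.sum_apply]
  refine Finset.sum_congr rfl fun c _ => ?_
  rw [map_smul, PiLp.smul_apply, smul_eq_mul, mul_comm]

/-- A table may not read the array that it fills, so each product goes to array 6 and is copied back
to array 7. The initial copy is the first power, and n d multiplications give the exponent n d + 1.
-/
theorem ensures_powerProg (d n T : ℕ) :
    Ensures (sizes d n T) powerProg 6 8 fun M => ∀ A : E d →ₗ[ℝ] E d,
      (∀ a b : Fin d, M 5 (a * d + b) = A (EuclideanSpace.single b 1) a) →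
      ∀ a b : Fin d, M 7 (a * d + b) = (A ^ (n * d + 1)) (EuclideanSpace.single b 1) a := by
  have hcopy : ∀ (s : ℕ) (_ : s ≠ 7) (ρ : ℕ → ℕ) (_ : SizeEnv d n T ρ) (M : Memory),
      (∀ b, b ≠ 7 → (tab 7 (.var 0) (.var 0) (.const 1) (.const 0) (.const 0)
        (entry₂ s 3 (.var 0) 4)).exec ρ M b = M b) ∧ ∀ i j : Fin d,
      (tab 7 (.var 0) (.var 0) (.const 1) (.const 0) (.const 0)
        (entry₂ s 3 (.var 0) 4)).exec ρ M 7 (i * d + j) = M s (i * d + j) := by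
    intro s hs ρ hρ M
    obtain ⟨h1, h2⟩ := exec_tab (a := 7) (N₁ := .var 0) (N₂ := .var 0) (N₃ := .const 1)
      (x := .const 0) (y := .const 0) (e := entry₂ s 3 (.var 0) 4) hρ (fun _ h => h.1)
      (fun _ h => h.1) (fun _ _ => rfl) trivial trivial hs M
    refine ⟨h1, fun i j => ?_⟩
    rw [h2 i i.2 j j.2]
    simp [tabValue, RealExpr.eval, IdxExpr.eval, hρ.1]
  have hmul : ∀ (ρ : ℕ → ℕ) (_ : SizeEnv d n T ρ) (M : Memory),
      (∀ b, b ≠ 6 → (tab 6 (.var 0) (.var 0) (.var 0) (.const 0) (.const 0)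
        (.mul (entry₂ 5 3 (.var 0) 5) (entry₂ 7 5 (.var 0) 4))).exec ρ M b = M b) ∧
      ∀ i j : Fin d, (tab 6 (.var 0) (.var 0) (.var 0) (.const 0) (.const 0)
        (.mul (entry₂ 5 3 (.var 0) 5) (entry₂ 7 5 (.var 0) 4))).exec ρ M 6 (i * d + j) =
        ∑ k : Fin d, M 5 (i * d + k) * M 7 (k * d + j) := by
    intro ρ hρ M
    obtain ⟨h1, h2⟩ := exec_tab (a := 6) (N₁ := .var 0) (N₂ := .var 0) (N₃ := .var 0)
      (x := .const 0) (y := .const 0) (e := .mul (entry₂ 5 3 (.var 0) 5) (entry₂ 7 5 (.var 0) 4)) hρ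
      (fun _ h => h.1) (fun _ h => h.1) (fun _ h => h.1) trivial trivial
      ⟨by norm_num [RealExpr.Avoids], by norm_num [RealExpr.Avoids]⟩ M
    refine ⟨h1, fun i j => ?_⟩
    rw [h2 i i.2 j j.2, tabValue, Finset.sum_range]
    simp [RealExpr.eval, IdxExpr.eval, hρ.1]
  have key : ∀ M : Memory, (∀ b, b ≠ 6 → b ≠ 7 → powerProg.exec (sizes d n T) M b = M b) ∧
      ∀ A : E d →ₗ[ℝ] E d, (∀ a b : Fin d, M 5 (a * d + b) = A (EuclideanSpace.single b 1) a) →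
      ∀ a b : Fin d, powerProg.exec (sizes d n T) M 7 (a * d + b) =
        (A ^ (n * d + 1)) (EuclideanSpace.single b 1) a := by
    intro M
    unfold powerProg
    rw [exec_seq]
    obtain ⟨c1, c2⟩ := hcopy 5 (by norm_num) _ (sizeEnv_sizes d n T) M
    exact exec_loop_induct (v := 6) (N := .mul (.var 1) (.var 0)) (fun t M' =>
      (∀ b, b ≠ 6 → b ≠ 7 → M' b = M b) ∧ ∀ A : E d →ₗ[ℝ] E d,
      (∀ a b : Fin d, M 5 (a * d + b) = A (EuclideanSpace.single b 1) a) →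
      ∀ a b : Fin d, M' 7 (a * d + b) = (A ^ (t + 1)) (EuclideanSpace.single b 1) a)
      ⟨fun b _ hb => c1 b hb, fun A hA a b => by rw [c2, hA, zero_add, pow_one]⟩ (by
        rintro t - M' ⟨hfr, hval⟩
        have hρ := (sizeEnv_sizes d n T).update (v := 6) (by norm_num) t
        rw [exec_seq]
        obtain ⟨m1, m2⟩ := hmul _ hρ M'
        obtain ⟨k1, k2⟩ := hcopy 6 (by norm_num) _ hρ ((tab 6 (.var 0) (.var 0) (.var 0) (.const 0)
          (.const 0) (.mul (entry₂ 5 3 (.var 0) 5) (entry₂ 7 5 (.var 0) 4))).exec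
          (Function.update (sizes d n T) 6 t) M')
        refine ⟨fun b hb6 hb7 => by rw [k1 b hb7, m1 b hb6, hfr b hb6 hb7], fun A hA a b => ?_⟩
        rw [k2, m2, pow_succ', Module.End.mul_apply, apply_eq_sum_single]
        refine Finset.sum_congr rfl fun c _ => ?_
        rw [hval A hA, hfr 5 (by norm_num) (by norm_num), hA])
  refine ⟨fun M b hb => (key M).1 b (by omega) (by omega), fun M A hA => ?_, fun M M' h hM A hA => ?_⟩
  · rw [(key M).1 5 (by norm_num) (by norm_num)] at hA
    exact (key M).2 A hA
  · rw [← h 7 (by norm_num)]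
    rw [← h 5 (by norm_num)] at hA
    exact hM A hA

/-! ### The program: direction -/

/-- The direction, computed from the array `7`. -/
def directionTabs : List Tab :=
  [sumTab (.var 0) (.const 1) (.var 0)
    (.sub (.const 0) (.mul (entry₂ 7 5 (.var 0) 3) (entry₂ 7 5 (.var 0) 3)))] ++
  (argminTabs 8 9 (.var 0) ++
  [sumTab (.var 0) (.const 1) (.var 0) (.mul (entry 12 5) (entry₂ 7 3 (.var 0) 5)),
   sumTab (.const 1) (.const 1) (.var 0) (.mul (entry 13 5) (entry 13 5)),
   ⟨.var 0, .const 1, .const 1, .cast (.var 3), .const 0, .const 1⟩,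
   ⟨.var 0, .const 1, .const 1, .read 14 (.const 0), .const 0, entry 15 3⟩,
   ⟨.const 1, .const 1, .const 1, .read 14 (.const 0), .const 0, .const 1⟩,
   sumTab (.var 0) (.const 1) (.const 1) (.add (entry 16 3)
    (.div (entry 13 3) (.add (.sqrt (.read 14 (.const 0))) (.read 17 (.const 0)))))])

theorem directionTabs_wf : TabsWF 8 directionTabs := by
  refine (tabsWF_append _ _ _).2 ⟨?_, (tabsWF_append _ _ _).2
    ⟨argminTabs_wf (by norm_num) (by norm_num [IdxExpr.SizeOnly]), ?_⟩⟩ <;>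
  simp [TabsWF, Tab.WF, sumTab, RealExpr.Below, IdxExpr.SizeOnly, argminTabs, selectTabs]

/-- Array 8 holds the negative squared norms, so its first minimum is the first largest column. If
that column is zero, array 16 supplies the first basis vector and array 17 puts 1 into the
denominator; otherwise both vanish and the column is normalized. -/
theorem directionTabs_spec {d n T : ℕ} (hd : 1 ≤ d) {x : Fin n → E d} {M : Memory} {u : E d}
    (h7 : ∀ a b : Fin d, M 7 (a * d + b) = powerVec x b a)
    (hu : ∀ i, (∀ j, ‖powerVec x j‖ ≤ ‖powerVec x i‖) →
        (∀ j < i, ∃ l, ‖powerVec x j‖ < ‖powerVec x l‖) →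
        (powerVec x i = 0 → u = EuclideanSpace.single ⟨0, hd⟩ 1) ∧
        (powerVec x i ≠ 0 → u = ‖powerVec x i‖⁻¹ • powerVec x i))
    (h : TabsHold (sizes d n T) 8 directionTabs M) (c : Fin d) : M 18 c = u c := by
  classical
  obtain ⟨⟨h8, -⟩, h'⟩ := (tabsHold_append _ _ _).1 h
  obtain ⟨hsel, h13, h14, h15, h16, h17, h18, -⟩ := (tabsHold_append _ _ _).1 h'
  have h8 := sumTab_holds_one h8
  have h13 := sumTab_holds_one h13
  have h14 := sumTab_holds_one h14 0 (by simp [IdxExpr.eval])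
  have h15 := guardTab_holds_one h15
  have h16 := guardTab_holds_one h16
  have h17 := guardTab_holds_one h17 0 (by simp [IdxExpr.eval])
  have h18 := sumTab_holds_one h18
  simp only [RealExpr.eval, IdxExpr.eval, env3_zero, env3_three, env3_five,
    sizes_zero, Finset.range_one, Finset.sum_singleton] at h8 h13 h14 h15 h16 h17 h18
  obtain ⟨j₀, hj₀, hmin, hfirst, hsel⟩ := argminTabs_spec (sizeEnv_sizes d n T)
    (show (IdxExpr.var 0).SizeOnly by norm_num [IdxExpr.SizeOnly]) (rfl : (IdxExpr.var 0).eval (sizes d n T) = d) hd hsel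
  have hsel : ∀ j < d, M 12 j = if j = j₀ then 1 else 0 := fun j hj => by
    exact (hsel j hj).trans (by congr)
  set i : Fin d := ⟨j₀, hj₀⟩ with hi
  have hnorm : ∀ b : Fin d, M 8 b = -‖powerVec x b‖ ^ 2 := by
    intro b
    rw [h8 b b.2, Finset.sum_range, EuclideanSpace.real_norm_sq_eq, ← Finset.sum_neg_distrib]
    refine Finset.sum_congr rfl fun a _ => ?_
    rw [h7]; ring
  have hmax : ∀ j, ‖powerVec x j‖ ≤ ‖powerVec x i‖ := by
    intro j
    have := hmin j j.2
    rw [hnorm j, show M 8 j₀ = M 8 (i : ℕ) from rfl, hnorm i] at this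
    exact le_of_sq_le_sq (by linarith) (norm_nonneg _)
  have hlt : ∀ j < i, ∃ l, ‖powerVec x j‖ < ‖powerVec x l‖ := by
    intro j hj
    obtain ⟨l, hl, hlt⟩ := hfirst j hj
    refine ⟨⟨l, hl⟩, ?_⟩
    rw [hnorm j, show M 8 l = M 8 ((⟨l, hl⟩ : Fin d) : ℕ) from rfl, hnorm ⟨l, hl⟩] at hlt
    exact lt_of_pow_lt_pow_left₀ 2 (norm_nonneg _) (by linarith)
  obtain ⟨hu0, hu1⟩ := hu i hmax hlt
  have h13' : ∀ a : Fin d, M 13 a = powerVec x i a := by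
    intro a
    refine (h13 a a.2).trans ?_
    exact (sum_select hj₀ hsel fun k => M 7 (a * d + k)).trans (h7 a i)
  have h14' : M 14 0 = ‖powerVec x i‖ ^ 2 := by
    refine h14.trans ?_
    rw [Finset.sum_range, EuclideanSpace.real_norm_sq_eq]
    refine Finset.sum_congr rfl fun a _ => ?_
    rw [h13']; ring
  have e18 : M 18 c = _ := h18 c c.2
  have e16 : M 16 c = if M 14 0 ≤ 0 then M 15 c else 0 := by
    exact (h16 c c.2).trans (by congr)
  have e15 : M 15 c = if ((c : ℕ) : ℝ) ≤ 0 then 1 else 0 := by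
    exact (h15 c c.2).trans (by congr)
  have h17 : M 17 0 = if M 14 0 ≤ 0 then 1 else 0 := by
    exact h17.trans (by congr)
  rw [e18, e16, e15, h17, h13', h14']
  by_cases hz : powerVec x i = 0
  · rw [hu0 hz, hz]
    have : ((c : ℕ) : ℝ) ≤ 0 ↔ c = ⟨0, hd⟩ := by
      rw [← Nat.cast_zero, Nat.cast_le, Nat.le_zero, Fin.ext_iff]
    by_cases hc : c = ⟨0, hd⟩
    · simp [hc]
    · simp [this, hc]
  · have hpos : 0 < ‖powerVec x i‖ ^ 2 := by
      have := norm_pos_iff.2 hz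
      positivity
    rw [hu1 hz, if_neg (not_le.2 hpos), if_neg (not_le.2 hpos), Real.sqrt_sq (norm_nonneg _),
      PiLp.smul_apply, smul_eq_mul, zero_add, add_zero, div_eq_inv_mul]

/-! ### The program: moments and grid search -/

/-- The projected observation `v₃ ⌊n / T⌋ + v₅`. -/
abbrev batchEntry : RealExpr := .read 19 (.add (.mul (.var 3) (.div (.var 1) (.var 2))) (.var 5))

/-- The average of an expression over the `T` batches. -/
abbrev batchTab (e : RealExpr) : Tab :=
  sumTab (.var 2) (.const 1) (.div (.var 1) (.var 2)) (.div e (.cast (.div (.var 1) (.var 2))))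

/-- The projected second half, the batch moments, and their medians. -/
def momentTabs : List Tab :=
  [sumTab (.var 1) (.const 1) (.var 0) (.mul (entry 18 5)
      (.sub (.read 0 (.add (.mul (.add (.var 1) (.var 3)) (.var 0)) (.var 5))) (entry 3 5))),
   batchTab batchEntry,
   batchTab (.sub (.mul batchEntry batchEntry) (.const 1)),
   batchTab (.sub (.mul batchEntry (.mul batchEntry batchEntry)) (.mul (.const 3) batchEntry))] ++
  (medianTabs 20 23 (.var 2) ++ (medianTabs 21 30 (.var 2) ++ medianTabs 22 37 (.var 2)))

theorem momentTabs_wf : TabsWF 19 momentTabs := by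
  have h2 : (IdxExpr.var 2).SizeOnly := by norm_num [IdxExpr.SizeOnly]
  refine (tabsWF_append _ _ _).2 ⟨?_, (tabsWF_append _ _ _).2 ⟨medianTabs_wf (by norm_num) h2,
    (tabsWF_append _ _ _).2 ⟨medianTabs_wf (lo := 30) (by norm_num) h2,
      medianTabs_wf (lo := 37) (by norm_num) h2⟩⟩⟩
  simp [TabsWF, Tab.WF, sumTab, RealExpr.Below, IdxExpr.SizeOnly]

/-- The three blocks of median tables start at arrays 23, 30 and 37 and leave their results six
arrays later. -/
theorem momentTabs_spec {d n T : ℕ} (hT : 1 ≤ T) {X : Fin (n + n) → E d} {M : Memory} {u ν : E d}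
    (h0 : M 0 = inputMemory X 0) (hν : ∀ c : Fin d, M 3 c = ν c) (hu : ∀ c : Fin d, M 18 c = u c)
    (h : TabsHold (sizes d n T) 19 momentTabs M) (r : Fin 3) :
    IsMedian (batchMoment T (fun i => inner ℝ u (secondHalf X i - ν)) ((r : ℕ) + 1))
      (![M 29 0, M 36 0, M 43 0] r) := by
  obtain ⟨⟨hy, h1, h2, h3, -⟩, h'⟩ := (tabsHold_append _ _ _).1 h
  obtain ⟨hm1, h'⟩ := (tabsHold_append _ _ _).1 h'
  obtain ⟨hm2, hm3⟩ := (tabsHold_append _ _ _).1 h'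
  have hT2 : (IdxExpr.var 2).SizeOnly := by norm_num [IdxExpr.SizeOnly]
  have hm1 := medianTabs_spec (sizeEnv_sizes d n T) hT2 (rfl : _ = T) hT hm1
  have hm2 := medianTabs_spec (sizeEnv_sizes d n T) hT2 (rfl : _ = T) hT hm2
  have hm3 := medianTabs_spec (sizeEnv_sizes d n T) hT2 (rfl : _ = T) hT hm3
  have hy := sumTab_holds_one hy
  have h1 := sumTab_holds_one h1
  have h2 := sumTab_holds_one h2
  have h3 := sumTab_holds_one h3
  simp only [RealExpr.eval, IdxExpr.eval, env3_zero, env3_one, env3_two, env3_three, env3_five,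
    sizes_zero, sizes_one, sizes_two] at hy h1 h2 h3
  set y : Fin n → ℝ := fun i => inner ℝ u (secondHalf X i - ν) with hydef
  have hM : ∀ i : Fin n, M 19 i = y i := by
    intro i
    rw [hy i i.2, Finset.sum_range]
    change _ = inner ℝ u (secondHalf X i - ν)
    rw [PiLp.inner_apply]
    refine Finset.sum_congr rfl fun c _ => ?_
    have hX : M 0 ((n + i) * d + c) = secondHalf X i c := by
      rw [h0]
      exact inputMemory_apply X (Fin.natAdd n i) c
    rw [hu, hν, hX]
    simp [mul_comm]
  have hb : ∀ (j : Fin T) (p : Fin (n / T)), M 19 (j * (n / T) + p) = y (batchIndex n T (j, p)) :=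
    fun j p => hM (batchIndex n T (j, p))
  have e1 : ∀ j : Fin T, M 20 j = batchMoment T y 1 j := by
    intro j
    refine (h1 j j.2).trans ?_
    rw [batchMoment_eq, Finset.sum_range, Finset.sum_div]
    refine Finset.sum_congr rfl fun p _ => ?_
    rw [aeval_hermite_one, hb]
  have e2 : ∀ j : Fin T, M 21 j = batchMoment T y 2 j := by
    intro j
    refine (h2 j j.2).trans ?_
    rw [batchMoment_eq, Finset.sum_range, Finset.sum_div]
    refine Finset.sum_congr rfl fun p _ => ?_
    rw [aeval_hermite_two, hb, sq]
  have e3 : ∀ j : Fin T, M 22 j = batchMoment T y 3 j := by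
    intro j
    refine (h3 j j.2).trans ?_
    rw [batchMoment_eq, Finset.sum_range, Finset.sum_div]
    refine Finset.sum_congr rfl fun p _ => ?_
    rw [aeval_hermite_three, hb]
    ring
  rw [funext e1] at hm1
  rw [funext e2] at hm2
  rw [funext e3] at hm3
  fin_cases r
  · exact hm1
  · exact hm2
  · exact hm3

/-- The number `g n` of steps of the grid in each coordinate. -/
abbrev gridSteps (g : ℕ) : IdxExpr := .mul (.const g) (.var 1)

/-- The number of grid points in each coordinate. -/
abbrev gridSize (g : ℕ) : IdxExpr := .add (gridSteps g) (.const 1)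

/-- The total number of grid points. -/
abbrev gridCard (g : ℕ) : IdxExpr := .mul (.mul (gridSize g) (gridSize g)) (gridSize g)

/-- The squared deviation of `m` from `a s + (1 - a) t`. -/
abbrev sqGap (m a s t : RealExpr) : RealExpr :=
  .mul (.sub m (.add (.mul a s) (.mul (.sub (.const 1) a) t)))
    (.sub m (.add (.mul a s) (.mul (.sub (.const 1) a) t)))

/-- The three coordinates of the grid points, the distance of their moments from the estimated
moments, and the coordinates of the closest grid point. -/
def gridTabs (g : ℕ) (L : ℝ) : List Tab :=
  [sumTab (gridCard g) (.const 1) (.const 1)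
    (.div (.cast (.div (.var 3) (.mul (gridSize g) (gridSize g)))) (.cast (gridSteps g))),
   sumTab (gridCard g) (.const 1) (.const 1)
    (.sub (.div (.mul (.const (2 * L)) (.sub (.cast (.div (.var 3) (gridSize g)))
      (.cast (.mul (gridSize g) (.div (.var 3) (.mul (gridSize g) (gridSize g)))))))
      (.cast (gridSteps g))) (.const L)),
   sumTab (gridCard g) (.const 1) (.const 1)
    (.sub (.div (.mul (.const (2 * L)) (.sub (.cast (.var 3))
      (.cast (.mul (gridSize g) (.div (.var 3) (gridSize g)))))) (.cast (gridSteps g))) (.const L)),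
   sumTab (gridCard g) (.const 1) (.const 1)
    (.add (.add (sqGap (.read 29 (.const 0)) (entry 44 3) (entry 45 3) (entry 46 3))
      (sqGap (.read 36 (.const 0)) (entry 44 3) (.mul (entry 45 3) (entry 45 3))
        (.mul (entry 46 3) (entry 46 3))))
      (sqGap (.read 43 (.const 0)) (entry 44 3) (.mul (entry 45 3) (.mul (entry 45 3) (entry 45 3)))
        (.mul (entry 46 3) (.mul (entry 46 3) (entry 46 3)))))] ++
  (argminTabs 47 48 (gridCard g) ++
  [sumTab (.const 1) (.const 1) (gridCard g) (.mul (entry 51 5) (entry 44 5)),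
   sumTab (.const 1) (.const 1) (gridCard g) (.mul (entry 51 5) (entry 45 5)),
   sumTab (.const 1) (.const 1) (gridCard g) (.mul (entry 51 5) (entry 46 5))])

theorem gridTabs_wf (g : ℕ) (L : ℝ) : TabsWF 44 (gridTabs g L) := by
  refine (tabsWF_append _ _ _).2 ⟨?_, (tabsWF_append _ _ _).2
    ⟨argminTabs_wf (by norm_num) (by norm_num [IdxExpr.SizeOnly]), ?_⟩⟩ <;>
  simp [TabsWF, Tab.WF, sumTab, RealExpr.Below, IdxExpr.SizeOnly, argminTabs, selectTabs]

/-- A single index runs over the grid; its three digits in base H = g n + 1 are the grid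
coordinates. Index arithmetic has neither subtraction nor remainder, so the lower digits are
computed as real differences l - H⌊l/H⌋. -/
theorem gridTabs_spec {d n T g : ℕ} {L : ℝ} {M : Memory}
    (h : TabsHold (sizes d n T) 44 (gridTabs g L) M) :
    (∃ i ≤ g * n, ∃ j ≤ g * n, ∃ k ≤ g * n, M 52 0 = i / (g * n : ℕ) ∧
      M 53 0 = 2 * L * j / (g * n : ℕ) - L ∧ M 54 0 = 2 * L * k / (g * n : ℕ) - L) ∧
    ∀ i ≤ g * n, ∀ j ≤ g * n, ∀ k ≤ g * n,
      sqMomentGap ![M 29 0, M 36 0, M 43 0] (M 52 0) (M 53 0) (M 54 0) ≤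
        sqMomentGap ![M 29 0, M 36 0, M 43 0] (i / (g * n : ℕ)) (2 * L * j / (g * n : ℕ) - L)
          (2 * L * k / (g * n : ℕ) - L) := by
  obtain ⟨⟨ha, hb, hc, hv, -⟩, h'⟩ := (tabsHold_append _ _ _).1 h
  obtain ⟨hsel, h52, h53, h54, -⟩ := (tabsHold_append _ _ _).1 h'
  set H : ℕ := g * n + 1 with hH
  have hHpos : 0 < H := Nat.succ_pos _
  have hpos : 0 < H * H * H := by positivity
  obtain ⟨l₀, hl₀, hmin, -, hsel⟩ := argminTabs_spec (sizeEnv_sizes d n T)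
    (show (gridCard g).SizeOnly by norm_num [IdxExpr.SizeOnly])
    (rfl : (gridCard g).eval (sizes d n T) = H * H * H) (Nat.succ_le_of_lt hpos) hsel
  have hsel : ∀ j < H * H * H, M 51 j = if j = l₀ then 1 else 0 := fun j hj =>
    (hsel j hj).trans (by congr)
  have ha := sumTab_holds_one ha
  have hb := sumTab_holds_one hb
  have hc := sumTab_holds_one hc
  have hv := sumTab_holds_one hv
  have h52 := sumTab_holds_one h52 0 (by simp [IdxExpr.eval])
  have h53 := sumTab_holds_one h53 0 (by simp [IdxExpr.eval])
  have h54 := sumTab_holds_one h54 0 (by simp [IdxExpr.eval])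
  simp only [RealExpr.eval, IdxExpr.eval, env3_one, env3_three, env3_five,
    sizes_one, Finset.range_one, Finset.sum_singleton, ← hH] at ha hb hc hv h52 h53 h54
  have hdiv1 : ∀ l : ℕ, ((l / H : ℕ) : ℝ) - (H * (l / (H * H)) : ℕ) = (l / H % H : ℕ) := by
    intro l
    rw [← Nat.div_div_eq_div_mul, sub_eq_iff_eq_add, ← Nat.cast_add, Nat.mod_add_div]
  have hdiv2 : ∀ l : ℕ, (l : ℝ) - (H * (l / H) : ℕ) = (l % H : ℕ) := by
    intro l
    rw [sub_eq_iff_eq_add, ← Nat.cast_add, Nat.mod_add_div]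
  have ea : ∀ l < H * H * H, M 44 l = (l / H / H : ℕ) / (g * n : ℕ) := fun l hl => by
    rw [ha l hl, Nat.div_div_eq_div_mul]
  have eb : ∀ l < H * H * H, M 45 l = 2 * L * (l / H % H : ℕ) / (g * n : ℕ) - L := fun l hl => by
    refine (hb l hl).trans ?_
    rw [hdiv1]
  have ec : ∀ l < H * H * H, M 46 l = 2 * L * (l % H : ℕ) / (g * n : ℕ) - L := fun l hl => by
    refine (hc l hl).trans ?_
    rw [hdiv2]
  have ev : ∀ l < H * H * H, M 47 l =
      sqMomentGap ![M 29 0, M 36 0, M 43 0] (M 44 l) (M 45 l) (M 46 l) := fun l hl => by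
    refine (hv l hl).trans ?_
    simp only [sqMomentGap, Fin.sum_univ_three]
    simp
    ring
  have f52 : M 52 0 = M 44 l₀ := h52.trans (sum_select hl₀ hsel (M 44))
  have f53 : M 53 0 = M 45 l₀ := h53.trans (sum_select hl₀ hsel (M 45))
  have f54 : M 54 0 = M 46 l₀ := h54.trans (sum_select hl₀ hsel (M 46))
  constructor
  · refine ⟨l₀ / H / H, ?_, l₀ / H % H, ?_, l₀ % H, ?_, f52.trans (ea _ hl₀),
      f53.trans (eb _ hl₀), f54.trans (ec _ hl₀)⟩
    · refine Nat.lt_succ_iff.1 (Nat.div_lt_of_lt_mul (Nat.div_lt_of_lt_mul ?_))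
      calc l₀ < H * H * H := hl₀
        _ = H * (H * H) := by ring
    · exact Nat.lt_succ_iff.1 (Nat.mod_lt _ hHpos)
    · exact Nat.lt_succ_iff.1 (Nat.mod_lt _ hHpos)
  · intro i hi j hj k hk
    -- The index with digits i, j, k: every grid point is compared with the selected one.
    set l : ℕ := (i * H + j) * H + k with hl
    have hkm : l % H = k := by
      rw [hl, mul_comm, Nat.mul_add_mod, Nat.mod_eq_of_lt (by omega)]
    have hlH : l / H = i * H + j := by
      rw [hl, mul_comm, Nat.mul_add_div hHpos, Nat.div_eq_of_lt (by omega), add_zero]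
    have hji : (i * H + j) / H = i := by
      rw [mul_comm, Nat.mul_add_div hHpos, Nat.div_eq_of_lt (by omega), add_zero]
    have hjm : (i * H + j) % H = j := by
      rw [mul_comm, Nat.mul_add_mod, Nat.mod_eq_of_lt (by omega)]
    have hlt : l < H * H * H := by
      calc l < (i * H + j) * H + H := by omega
        _ = (i * H + j + 1) * H := by ring
        _ ≤ (i * H + H) * H := Nat.mul_le_mul_right _ (by omega)
        _ = (i + 1) * H * H := by ring
        _ ≤ H * H * H := Nat.mul_le_mul_right _ (Nat.mul_le_mul_right _ (by omega))
    have := hmin l hlt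
    rw [ev _ hl₀, ev l hlt, ea l hlt, eb l hlt, ec l hlt, hkm, hlH, hji, hjm] at this
    rw [f52, f53, f54]
    exact this

/-! ### The program: output -/

/-- The direction and the estimated one-dimensional distribution, computed from the data. -/
def projectionProg (g : ℕ) (L : ℝ) : Prog :=
  .seq (tabs 3 covTabs) (.seq powerProg (.seq (tabs 8 directionTabs)
    (.seq (tabs 19 momentTabs) (tabs 44 (gridTabs g L)))))

/-- The two weights. -/
def weightProg : Prog :=
  tab 1 (.const 2) (.const 1) (.const 1) (.const 0) (.const 0)
    (.add (.mul (.sub (.const 1) (.cast (.var 3))) (.read 52 (.const 0)))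
      (.mul (.cast (.var 3)) (.sub (.const 1) (.read 52 (.const 0)))))

/-- The coordinates of the two atoms. -/
def atomProg : Prog :=
  tab 2 (.const 2) (.var 0) (.const 1) (.const 0) (.const 0)
    (.add (.mul (.add (.mul (.sub (.const 1) (.cast (.var 3))) (.read 53 (.const 0)))
      (.mul (.cast (.var 3)) (.read 54 (.const 0)))) (entry 18 4)) (entry 3 4))

/-- The whole estimator. -/
def estimatorProg (g : ℕ) (L : ℝ) : Prog :=
  .seq (projectionProg g L) (.seq weightProg atomProg)

theorem polyCost_estimatorProg (g : ℕ) (L : ℝ) : (estimatorProg g L).PolyCost := by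
  have h0 := IdxExpr.poly_var (v := 0) (by norm_num)
  have hc := IdxExpr.poly_const
  exact ((polyCost_tabs _ _ covTabs_wf).seq (polyCost_powerProg.seq
    ((polyCost_tabs _ _ directionTabs_wf).seq ((polyCost_tabs _ _ momentTabs_wf).seq
      (polyCost_tabs _ _ (gridTabs_wf g L)))))).seq
    ((polyCost_tab (hc 2) (hc 1) (hc 1) _ _ _ _).seq (polyCost_tab (hc 2) h0 (hc 1) _ _ _ _))

theorem ensures_projectionProg (d n T g : ℕ) (L : ℝ) :
    Ensures (sizes d n T) (projectionProg g L) 3 55 fun M =>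
      TabsHold (sizes d n T) 3 covTabs M ∧
      (∀ A : E d →ₗ[ℝ] E d, (∀ a b : Fin d, M 5 (a * d + b) = A (EuclideanSpace.single b 1) a) →
        ∀ a b : Fin d, M 7 (a * d + b) = (A ^ (n * d + 1)) (EuclideanSpace.single b 1) a) ∧
      TabsHold (sizes d n T) 8 directionTabs M ∧ TabsHold (sizes d n T) 19 momentTabs M ∧
      TabsHold (sizes d n T) 44 (gridTabs g L) M := by
  have hρ := sizeEnv_sizes d n T
  have h1 : Ensures _ _ 3 6 _ := ensures_tabs hρ covTabs 3 covTabs_wf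
  have h2 : Ensures _ _ 8 19 _ := ensures_tabs hρ directionTabs 8 directionTabs_wf
  have h3 : Ensures _ _ 19 44 _ := ensures_tabs hρ momentTabs 19 momentTabs_wf
  have h4 : Ensures _ _ 44 55 _ := ensures_tabs hρ (gridTabs g L) 44 (gridTabs_wf g L)
  exact h1.seq ((ensures_powerProg d n T).seq (h2.seq (h3.seq h4 (by norm_num) (by norm_num))
    (by norm_num) (by norm_num)) (by norm_num) (by norm_num)) (by norm_num) (by norm_num)

/-- With the loop index i equal to 0 or 1, the combination (1 - i)x + iy selects between the two
weights or the two atoms without a branch. -/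
theorem outputMeasure_estimatorProg {d n T g : ℕ} {L : ℝ} (M : Memory) {u ν : E d}
    (hu : ∀ c : Fin d, (projectionProg g L).exec (sizes d n T) M 18 c = u c)
    (hν : ∀ c : Fin d, (projectionProg g L).exec (sizes d n T) M 3 c = ν c) :
    outputMeasure d ((estimatorProg g L).exec (sizes d n T) M) =
      atomic ![(projectionProg g L).exec (sizes d n T) M 52 0,
        1 - (projectionProg g L).exec (sizes d n T) M 52 0] fun j =>
        (![(projectionProg g L).exec (sizes d n T) M 53 0,
          (projectionProg g L).exec (sizes d n T) M 54 0] : Fin 2 → ℝ) j • u + ν := by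
  have hρ := sizeEnv_sizes d n T
  rw [estimatorProg, exec_seq, exec_seq]
  set M₁ := (projectionProg g L).exec (sizes d n T) M
  obtain ⟨f1, v1⟩ := exec_tab (a := 1) (N₁ := .const 2) (N₂ := .const 1) (N₃ := .const 1)
    (x := .const 0) (y := .const 0)
    (e := (.add (.mul (.sub (.const 1) (.cast (.var 3))) (.read 52 (.const 0)))
      (.mul (.cast (.var 3)) (.sub (.const 1) (.read 52 (.const 0)))))) hρ (fun _ _ => rfl)
    (fun _ _ => rfl) (fun _ _ => rfl) trivial trivial (by norm_num [RealExpr.Avoids]) M₁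
  change (∀ b, b ≠ 1 → weightProg.exec (sizes d n T) M₁ b = M₁ b) at f1
  change ∀ i < 2, ∀ j < 1, weightProg.exec (sizes d n T) M₁ 1 (i * 1 + j) = _ at v1
  set M₂ := weightProg.exec (sizes d n T) M₁
  obtain ⟨f2, v2⟩ := exec_tab (a := 2) (N₁ := .const 2) (N₂ := .var 0) (N₃ := .const 1)
    (x := .const 0) (y := .const 0)
    (e := (.add (.mul (.add (.mul (.sub (.const 1) (.cast (.var 3))) (.read 53 (.const 0)))
      (.mul (.cast (.var 3)) (.read 54 (.const 0)))) (entry 18 4)) (entry 3 4))) hρ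
    (fun _ _ => rfl) (fun _ h => h.1) (fun _ _ => rfl) trivial trivial
    (by norm_num [RealExpr.Avoids]) M₂
  change (∀ b, b ≠ 2 → atomProg.exec (sizes d n T) M₂ b = M₂ b) at f2
  change ∀ i < 2, ∀ j < d, atomProg.exec (sizes d n T) M₂ 2 (i * d + j) = _ at v2
  have w : ∀ j : Fin 2, atomProg.exec (sizes d n T) M₂ 1 (j : ℕ) = ![M₁ 52 0, 1 - M₁ 52 0] j := by
    intro j
    have h := v1 j j.2 0 one_pos
    rw [mul_one, add_zero] at h
    rw [f2 1 (by norm_num), h]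
    fin_cases j <;> simp [tabValue, RealExpr.eval, IdxExpr.eval]
  have θ : ∀ j : Fin 2, WithLp.toLp 2 (fun c : Fin d =>
      atomProg.exec (sizes d n T) M₂ 2 ((j : ℕ) * d + (c : ℕ))) =
      (![M₁ 53 0, M₁ 54 0] : Fin 2 → ℝ) j • u + ν := by
    intro j
    ext c
    refine (v2 j j.2 c c.2).trans ?_
    fin_cases j <;> simp [tabValue, RealExpr.eval, IdxExpr.eval, f1, hu, hν]
  simp only [outputMeasure, w, θ]

/-- The estimator is computed in polynomial time, with tolerance `n^{-1/2}`. -/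
theorem exists_polynomial_time_estimator {L : ℝ} (hL : 0 ≤ L) :
    ∃ (p : Prog) (K : ℕ), ∀ d n T : ℕ, 1 ≤ d → 1 ≤ n → 1 ≤ T → T ≤ n →
      (∀ X : Fin (n + n) → E d, (p.run (sizes d n T) (inputMemory X)).2 ≤ K * (n * d) ^ K) ∧
      IsCenteredEstimator L T (1 / √(n : ℝ)) fun X : Fin (n + n) → E d =>
        outputMeasure d (p.run (sizes d n T) (inputMemory X)).1 := by
  -- The fineness of the grid enters the program as a constant; it depends on L alone, so one
  -- program serves all d, n and T.
  set g : ℕ := ⌈32 * (L + 1) ^ 4⌉₊ with hg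
  have hg' : 32 * (L + 1) ^ 4 ≤ g := Nat.le_ceil _
  have hg0 : 0 < g := Nat.ceil_pos.2 (by positivity)
  obtain ⟨K, hK⟩ := polyCost_estimatorProg g L
  refine ⟨estimatorProg g L, K, fun d n T hd hn hT hTn =>
    ⟨fun X => hK d n T hd hn hT hTn _ (sizeEnv_sizes d n T) _, ?_⟩⟩
  obtain ⟨u, hum, hutop, hu⟩ := exists_measurable_power_direction hd hn
  refine ⟨u, hum, hutop, fun X => ?_⟩
  set M := (projectionProg g L).exec (sizes d n T) (inputMemory X) with hM
  have hens := ensures_projectionProg d n T g L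
  have hM0 : M 0 = inputMemory X 0 := hens.frame _ 0 (by norm_num)
  obtain ⟨hcov, hpow, hdir, hmom, hgrid⟩ := hens.holds (inputMemory X)
  obtain ⟨hmean, hcov⟩ := covTabs_spec hM0 hcov
  have h18 : ∀ c : Fin d, M 18 c = u (firstHalf X) c := directionTabs_spec hd
    (hpow (covOp (firstHalf X)) hcov) (hu (firstHalf X)) hdir
  have hmed := momentTabs_spec hT hM0 hmean h18 hmom
  obtain ⟨⟨i, hi, j, hj, k, hk, h52, h53, h54⟩, hmin⟩ := gridTabs_spec hgrid
  change M 52 0 = _ at h52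
  change M 53 0 = _ at h53
  change M 54 0 = _ at h54
  refine ⟨_, _, ?_, outputMeasure_estimatorProg (inputMemory X) h18 hmean⟩
  have hG : (0 : ℝ) < (g * n : ℕ) := by exact_mod_cast Nat.mul_pos hg0 hn
  have hfrac : ∀ i ≤ g * n, (i : ℝ) / (g * n : ℕ) ∈ Set.Icc (0 : ℝ) 1 := fun i hi =>
    ⟨by positivity, (div_le_one hG).2 (by exact_mod_cast hi)⟩
  have hbox : ∀ i ≤ g * n, 2 * L * i / (g * n : ℕ) - L ∈ Set.Icc (-L) L := fun i hi => by
    have h1 := hfrac i hi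
    rw [mul_div_assoc]
    constructor <;> nlinarith [h1.1, h1.2]
  refine isDMM_of_forall_le (m := ![M 29 0, M 36 0, M 43 0]) ?_ rfl ?_ hmed ?_
  · change M 52 0 ∈ _
    rw [h52]
    exact hfrac i hi
  · intro l
    fin_cases l
    · change M 53 0 ∈ _
      rw [h53]
      exact hbox j hj
    · change M 54 0 ∈ _
      rw [h54]
      exact hbox k hk
  · intro a ha b hb c hc
    obtain ⟨i', hi', j', hj', k', hk', hle⟩ :=
      exists_grid_near hL hn hg' ![M 29 0, M 36 0, M 43 0] ha hb hc
    exact (Real.sqrt_le_sqrt (hmin i' hi' j' hj' k' hk')).trans hle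

end GaussianMixture

end

theorem mainTheorem6 (R L : ℝ) (hR : 0 < R) (hL : 2 * R ≤ L) :
    -- the estimator exists, with exact eigenvector and exact moment projection
    (∀ d n T : ℕ, 1 ≤ d → 1 ≤ n → 1 ≤ T →
      ∃ Γhat : (Fin (n + n) → GaussianMixture.E d) → MeasureTheory.Measure (GaussianMixture.E d),
        GaussianMixture.IsCenteredEstimator L T 0 Γhat) ∧
    -- the rate
    (∃ C : ℝ, 0 < C ∧
      ∀ (d n T : ℕ) (δ τ : ℝ), 1 ≤ d → 1 ≤ n → 0 < δ → δ < 1 → 0 ≤ τ → τ ≤ 1 / √(n : ℝ) →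
      (T = min n ⌈Real.log (1 / δ)⌉₊ ∨ (T = 1 ∧ Real.exp (-√(n : ℝ)) ≤ δ)) →
      ∀ Γhat : (Fin (n + n) → GaussianMixture.E d) → MeasureTheory.Measure (GaussianMixture.E d),
        GaussianMixture.IsCenteredEstimator L T τ Γhat →
      ∀ Γ ∈ GaussianMixture.mixingClass 2 d R,
        GaussianMixture.sampleLaw (n + n) Γ
          {X | ¬ GaussianMixture.hellinger (GaussianMixture.mixture Γ)
              (GaussianMixture.mixture (Γhat X)) ≤ C * √((d + Real.log (1 / δ)) / n)} ≤
          ENNReal.ofReal δ) ∧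
    -- the rate is optimal among all density estimators
    (∃ c : ℝ, 0 < c ∧
      ∀ d n : ℕ, 1 ≤ d → 1 ≤ n →
      ∀ Phat : (Fin (n + n) → GaussianMixture.E d) → MeasureTheory.Measure (GaussianMixture.E d),
        (∀ X, MeasureTheory.IsProbabilityMeasure (Phat X)) →
        ∃ Γ ∈ GaussianMixture.mixingClass 2 d R,
          ENNReal.ofReal (1 / 4) ≤ GaussianMixture.sampleLaw (n + n) Γ
            {X | c * min (√((d : ℝ) / n)) 1 ≤
              GaussianMixture.hellinger (GaussianMixture.mixture Γ) (Phat X)}) ∧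
    -- polynomial running time
    (∃ (p : GaussianMixture.Prog) (K : ℕ),
      ∀ d n T : ℕ, 1 ≤ d → 1 ≤ n → 1 ≤ T → T ≤ n →
        (∀ X : Fin (n + n) → GaussianMixture.E d,
          (p.run (GaussianMixture.sizes d n T) (GaussianMixture.inputMemory X)).2 ≤
            K * (n * d) ^ K) ∧
        GaussianMixture.IsCenteredEstimator L T (1 / √(n : ℝ))
          fun X : Fin (n + n) → GaussianMixture.E d => GaussianMixture.outputMeasure d
            (p.run (GaussianMixture.sizes d n T) (GaussianMixture.inputMemory X)).1) := by
  have hL0 : 0 ≤ L := by linarith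
  exact ⟨fun d n T hd _ hT => GaussianMixture.exists_centered_estimator hL0 hd hT,
    GaussianMixture.centered_estimator_rate R L hR hL, GaussianMixture.minimax_lower_bound R hR,
    GaussianMixture.exists_polynomial_time_estimator hL0⟩
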